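/- All graphs are finite and simple. The circumference of a graph is the length of a longest (simple) cycle, where a graph without cycles is given circumference $0$. Let $P$ be a finite set of points in the plane $\mathbb{R}^2$ in general position (no three on a line), and let $C\subset\mathbb{R}^2\setminus P$ be a topologically open, non-self-intersecting polygon (the bounded open region enclosed by a simple closed polygonal curve). The visibility graph $G_C(P)$ has vertex set $P$, and two distinct points $p,q\in P$ are adjacent if and only if $\overline{pq}\cap C=\emptyset$. The visibility drawing is its straight-line drawing, that is, the union of the points of $P$ and of the segments $\overline{pq}$ over all edges $pq$ of $G_C(P)$. A graph $G$ has an outside-obstacle representation if there are such $P$ and $C$ for which $G=G_C(P)$ (under a bijection between the vertices of $G$ and $P$) and $C$ is contained in the unbounded connected component of the complement of the visibility drawing. Theorem. If the circumference of a graph $G$ is at most $6$, then $G$ has an outside-obstacle representation. -/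

import Mathlib

/-- The circumference of a graph: the length of a longest cycle, and `0` if there is no cycle. -/
noncomputable def SimpleGraph.circumference {V : Type*} (G : SimpleGraph V) : ℕ∞ :=
  ⨆ (a : V) (w : G.Walk a a) (_ : w.IsCycle), (w.length : ℕ∞)

/-- A polygon is simple (non-self-intersecting) if it has at least three vertices and its closed
boundary curve, run through edge by edge, visits every point at most once. -/
def Polygon.IsSimple {n : ℕ} (poly : Polygon (EuclideanSpace ℝ (Fin 2)) n) : Prop :=
  3 ≤ n ∧ ∀ (i j : Fin n), ∀ s ∈ Set.Ico (0 : ℝ) 1, ∀ t ∈ Set.Ico (0 : ℝ) 1,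
    poly.edgePath ℝ i s = poly.edgePath ℝ j t → i = j ∧ s = t

/-- `C` is a (topologically open) non-self-intersecting polygon, that is, the open region enclosed
by a simple closed polygonal curve. A bounded connected open set whose frontier is the curve is
the bounded connected component of the complement of the curve. -/
def IsOpenSimplePolygon (C : Set (EuclideanSpace ℝ (Fin 2))) : Prop :=
  IsOpen C ∧ IsConnected C ∧ Bornology.IsBounded C ∧
    ∃ (n : ℕ) (poly : Polygon (EuclideanSpace ℝ (Fin 2)) n),
      poly.IsSimple ∧ frontier C = poly.boundary ℝ

/-- The points `p v` are pairwise distinct, and no three of them lie on a line. -/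
def InGeneralPosition {V : Type*} (p : V → EuclideanSpace ℝ (Fin 2)) : Prop :=
  Function.Injective p ∧
    ∀ u v w : V, u ≠ v → u ≠ w → v ≠ w → ¬ Collinear ℝ {p u, p v, p w}

/-- The visibility graph of the points `p v` with respect to the obstacle `C`: two points are
adjacent if the closed line segment between them does not meet `C`. -/
def visibilityGraph {V : Type*} (C : Set (EuclideanSpace ℝ (Fin 2)))
    (p : V → EuclideanSpace ℝ (Fin 2)) : SimpleGraph V where
  Adj u v := u ≠ v ∧ segment ℝ (p u) (p v) ∩ C = ∅
  symm := ⟨fun u v h => ⟨h.1.symm, by rw [segment_symm]; exact h.2⟩⟩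
  loopless := ⟨fun _ h => h.1 rfl⟩

/-- The straight-line drawing of `G` with the vertices at the points `p v`: the union of the
points and of the closed segments that represent the edges. -/
def straightLineDrawing {V : Type*} (G : SimpleGraph V)
    (p : V → EuclideanSpace ℝ (Fin 2)) : Set (EuclideanSpace ℝ (Fin 2)) :=
  Set.range p ∪ ⋃ (u : V) (v : V) (_ : G.Adj u v), segment ℝ (p u) (p v)

/-- The union of the unbounded connected components of the complement of `D`. For a bounded set
`D` in the plane there is exactly one such component. -/
def unboundedComponent (D : Set (EuclideanSpace ℝ (Fin 2))) :
    Set (EuclideanSpace ℝ (Fin 2)) :=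
  {x | x ∈ Dᶜ ∧ ¬ Bornology.IsBounded (connectedComponentIn Dᶜ x)}

/-- The points `p v` and the single obstacle `C` form an outside-obstacle representation of `G`. -/
structure IsOutsideObstacleRepresentation {V : Type*} (G : SimpleGraph V)
    (p : V → EuclideanSpace ℝ (Fin 2)) (C : Set (EuclideanSpace ℝ (Fin 2))) : Prop where
  isOpenSimplePolygon : IsOpenSimplePolygon C
  inGeneralPosition : InGeneralPosition p
  notMem_obstacle : ∀ v : V, p v ∉ C
  eq_visibilityGraph : G = visibilityGraph C p
  outside : C ⊆ unboundedComponent (straightLineDrawing (visibilityGraph C p) p)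

/-- `G` has an outside-obstacle representation. -/
def HasOutsideObstacleRepresentation {V : Type*} (G : SimpleGraph V) : Prop :=
  ∃ (p : V → EuclideanSpace ℝ (Fin 2)) (C : Set (EuclideanSpace ℝ (Fin 2))),
    IsOutsideObstacleRepresentation G p C

/-! ### Polygonal regions: cyclic shifts and inserted vertices. -/

open Set Topology

/-! The obstacle is constructed last. If every nonedge of a straight-line drawing contains a point
that can be joined to infinity without meeting the drawing, then these finitely many points lie in
the unbounded component of the complement. That component is open and connected, and finitely many
points of an open connected set lie in a simple polygon inside it (`exists_isOpenSimplePolygon`).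
Such a polygon meets every nonedge and no edge. Joining to infinity is an open condition, so general
position can be reached by a small perturbation. It remains to find an `IsEscapeDrawing`, which also
asks for an empty sector at every vertex (`IsEscapeDrawing.hasOutsideObstacleRepresentation`).

Escape drawings are assembled from blocks. An end block, drawn with its cut vertex as a root on the
convex hull, is squeezed affinely into a very thin and small cone and placed in the empty sector of
the cut vertex in a drawing of the remaining graph (`IsEscapeDrawing.exists_glue`). Disconnected
graphs are first made connected by a new vertex that creates no cycle, and the drawing is restricted
afterwards.

For a block, every nonedge must be visible from outside the convex hull. The basic criterion is
`visible_of_side`: a nonedge at a hull vertex `u` is visible if all neighbours of `u` lie strictly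
on one side of its line. Visibility is stable, so a hull vertex may be replaced by two nearby
vertices displaced along a supporting direction. In this way a drawing survives the duplication of a
vertex (twins) and the undoing of certain edge contractions (splits); see `Drawable.of_twin` and
`Drawable.of_split`. The induction hypothesis `Drawable` therefore asks for a drawing for every
choice of root, with all vertices that may have to be doubled on the convex hull.

The combinatorial part concerns a biconnected graph whose longest cycle has at most six vertices.
Either this cycle is Hamiltonian, and the graph is one of finitely many, or some vertex is missed.
Exchange arguments on a longest cycle then produce removable twins, a contractible edge, or one of
two families of graphs on seven vertices (`IsBiconnected.hasTwin_of_short`,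
`IsBiconnected.reduces_of_six`). The finitely many remaining graphs are drawn on a parabola in a
suitable order, apart from the wheel with five spokes and one member of each family on seven
vertices, for which integral coordinates are given and checked. -/

abbrev Plane := EuclideanSpace ℝ (Fin 2)

/-- `C` is the open region bounded by the simple closed polygon with vertices `v`. -/
structure IsPolygonRegion {n : ℕ} (C : Set Plane) (v : Fin n → Plane) : Prop where
  isOpen : IsOpen C
  isConnected : IsConnected C
  isBounded : Bornology.IsBounded C
  isSimple : (⟨v⟩ : Polygon Plane n).IsSimple
  frontier_eq : frontier C = (⟨v⟩ : Polygon Plane n).boundary ℝ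

theorem IsPolygonRegion.isOpenSimplePolygon {n : ℕ} {C : Set Plane} {v : Fin n → Plane}
    (h : IsPolygonRegion C v) : IsOpenSimplePolygon C :=
  ⟨h.isOpen, h.isConnected, h.isBounded, n, ⟨v⟩, h.isSimple, h.frontier_eq⟩

theorem mem_polygon_boundary {n : ℕ} {v : Fin n → Plane} {x : Plane} :
    x ∈ (⟨v⟩ : Polygon Plane n).boundary ℝ ↔
      ∃ i, x ∈ segment ℝ (v i) (v (finRotate n i)) := by
  simp [Polygon.boundary, Polygon.edgeSet, affineSegment_eq_segment]

theorem polygon_isSimple_iff {n : ℕ} {v : Fin n → Plane} :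
    (⟨v⟩ : Polygon Plane n).IsSimple ↔
      3 ≤ n ∧ ∀ (i j : Fin n), ∀ s ∈ Ico (0 : ℝ) 1, ∀ t ∈ Ico (0 : ℝ) 1,
        AffineMap.lineMap (v i) (v (finRotate n i)) s
          = AffineMap.lineMap (v j) (v (finRotate n j)) t → i = j ∧ s = t := Iff.rfl

theorem isPolygonRegion_rotate {n : ℕ} {C : Set Plane} {v : Fin n → Plane}
    (h : IsPolygonRegion C v) (k : ℕ) :
    IsPolygonRegion C (fun i => v (((finRotate n) ^ k) i)) := by
  have hc : ∀ i, ((finRotate n) ^ k) (finRotate n i) = finRotate n (((finRotate n) ^ k) i) := by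
    intro i
    rw [← Equiv.Perm.mul_apply, ← Equiv.Perm.mul_apply, ← pow_succ, ← pow_succ']
  refine ⟨h.isOpen, h.isConnected, h.isBounded, ?_, ?_⟩
  · have hs := polygon_isSimple_iff.1 h.isSimple
    refine polygon_isSimple_iff.2 ⟨hs.1, fun i j s hs' t ht he => ?_⟩
    simp only [hc] at he
    obtain ⟨h1, h2⟩ := hs.2 _ _ s hs' t ht he
    exact ⟨(Equiv.injective _) h1, h2⟩
  · rw [h.frontier_eq]
    ext x
    simp only [mem_polygon_boundary, hc]
    constructor
    · rintro ⟨i, hi⟩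
      exact ⟨((finRotate n) ^ k).symm i, by simpa using hi⟩
    · rintro ⟨i, hi⟩
      exact ⟨_, hi⟩

/-- Any edge can be made the closing one, so local modifications of a polygon need only be carried
out on the edge from `v (Fin.last m)` to `v 0`. -/
theorem exists_finRotate_pow_last {m : ℕ} (i : Fin (m + 1)) :
    ∃ k : ℕ, ((finRotate (m + 1)) ^ k) (Fin.last m) = i := by
  have key : ∀ k : ℕ, (((finRotate (m + 1)) ^ k) (Fin.last m)).val = (m + k) % (m + 1) := by
    intro k
    induction k with
    | zero => simp
    | succ k ih =>
      rw [pow_succ', Equiv.Perm.mul_apply, finRotate_apply, Fin.val_add, ih]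
      simp [Nat.add_assoc]
  refine ⟨i.val + 1, ?_⟩
  ext
  rw [key, show m + (i.val + 1) = i.val + (m + 1) by omega, Nat.add_mod_right,
    Nat.mod_eq_of_lt i.isLt]

section Snoc
variable {m : ℕ} (v : Fin (m + 1) → Plane) (z : Plane)

abbrev snocVertex : Fin (m + 2) → Plane := Fin.snoc (α := fun _ => Plane) v z

theorem snoc_edge_castSucc (j : Fin m) :
    snocVertex v z (j.castSucc.castSucc) = v j.castSucc ∧
    snocVertex v z (finRotate (m + 2) j.castSucc.castSucc) = v (finRotate (m + 1) j.castSucc) := by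
  have h1 : finRotate (m + 2) j.castSucc.castSucc = j.succ.castSucc := by
    rw [finRotate_apply]; ext; simp
  have h2 : finRotate (m + 1) j.castSucc = j.succ := by
    rw [finRotate_apply]; ext; simp
  rw [h1, h2]
  exact ⟨Fin.snoc_castSucc (α := fun _ => Plane) _ _ _, Fin.snoc_castSucc (α := fun _ => Plane) _ _ _⟩

theorem snoc_edge_prelast :
    snocVertex v z (Fin.last m).castSucc = v (Fin.last m) ∧
    snocVertex v z (finRotate (m + 2) (Fin.last m).castSucc) = z := by
  have h1 : finRotate (m + 2) (Fin.last m).castSucc = Fin.last (m + 1) := by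
    rw [finRotate_apply]; ext; simp 
  rw [h1]
  exact ⟨Fin.snoc_castSucc (α := fun _ => Plane) _ _ _, Fin.snoc_last (α := fun _ => Plane) _ _⟩

theorem snoc_edge_last :
    snocVertex v z (Fin.last (m + 1)) = z ∧
    snocVertex v z (finRotate (m + 2) (Fin.last (m + 1))) = v 0 := by
  rw [finRotate_last]
  exact ⟨Fin.snoc_last (α := fun _ => Plane) _ _, Fin.snoc_castSucc (α := fun _ => Plane) _ _ 0⟩

end Snoc

/-- The edges of the extended polygon are the old edges other than the closing one, and the two
edges at the new vertex. -/
theorem forall_fin_castSucc_last {m : ℕ} {P : Fin (m + 2) → Prop} :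
    (∀ i, P i) ↔ (∀ j : Fin m, P j.castSucc.castSucc) ∧ P (Fin.last m).castSucc ∧ P (Fin.last (m + 1)) := by
  rw [Fin.forall_fin_succ', Fin.forall_fin_succ', and_assoc]

theorem exists_fin_castSucc_last {m : ℕ} {P : Fin (m + 2) → Prop} :
    (∃ i, P i) ↔ (∃ j : Fin m, P j.castSucc.castSucc) ∨ P (Fin.last m).castSucc ∨ P (Fin.last (m + 1)) := by
  rw [Fin.exists_fin_succ', Fin.exists_fin_succ', or_assoc]

-- Only pairs that involve a new edge have to be checked. Edges are parametrised over half-open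
-- intervals, so a common endpoint of consecutive edges belongs to one of them only.
open AffineMap in
theorem polygon_isSimple_snoc {m : ℕ} {v : Fin (m + 1) → Plane} {z : Plane}
    (h : (⟨v⟩ : Polygon Plane (m + 1)).IsSimple)
    (h1 : v (Fin.last m) ≠ z) (h2 : z ≠ v 0)
    (h12 : ∀ s ∈ Ico (0 : ℝ) 1, ∀ t ∈ Ico (0 : ℝ) 1,
      lineMap (v (Fin.last m)) z s ≠ lineMap z (v 0) t)
    (hd1 : ∀ j : Fin m, ∀ s ∈ Ico (0 : ℝ) 1, ∀ t ∈ Ico (0 : ℝ) 1,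
      lineMap (v j.castSucc) (v (finRotate (m + 1) j.castSucc)) s ≠ lineMap (v (Fin.last m)) z t)
    (hd2 : ∀ j : Fin m, ∀ s ∈ Ico (0 : ℝ) 1, ∀ t ∈ Ico (0 : ℝ) 1,
      lineMap (v j.castSucc) (v (finRotate (m + 1) j.castSucc)) s ≠ lineMap z (v 0) t) :
    (⟨snocVertex v z⟩ : Polygon Plane (m + 2)).IsSimple := by
  rw [polygon_isSimple_iff] at h ⊢
  refine ⟨by omega, ?_⟩
  rw [forall_fin_castSucc_last]
  simp only [forall_fin_castSucc_last, snoc_edge_castSucc, snoc_edge_prelast, snoc_edge_last]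
  refine ⟨fun j => ⟨fun j' s hs t ht he => ?_, fun s hs t ht he => ?_, fun s hs t ht he => ?_⟩,
    ⟨fun j s hs t ht he => ?_, fun s hs t ht he => ?_, fun s hs t ht he => ?_⟩,
    ⟨fun j s hs t ht he => ?_, fun s hs t ht he => ?_, fun s hs t ht he => ?_⟩⟩
  · obtain ⟨a, b⟩ := h.2 _ _ s hs t ht he
    exact ⟨by rw [a], b⟩
  · exact absurd he (hd1 j s hs t ht)
  · exact absurd he (hd2 j s hs t ht)
  · exact absurd he.symm (hd1 j t ht s hs)
  · exact ⟨by trivial, AffineMap.lineMap_injective ℝ h1 he⟩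
  · exact absurd he (h12 s hs t ht)
  · exact absurd he.symm (hd2 j t ht s hs)
  · exact absurd he.symm (h12 t ht s hs)
  · exact ⟨by trivial, AffineMap.lineMap_injective ℝ h2 he⟩

theorem mem_boundary_snoc {m : ℕ} {v : Fin (m + 1) → Plane} {z x : Plane} :
    x ∈ (⟨snocVertex v z⟩ : Polygon Plane (m + 2)).boundary ℝ ↔
      (∃ j : Fin m, x ∈ segment ℝ (v j.castSucc) (v (finRotate (m + 1) j.castSucc))) ∨
        x ∈ segment ℝ (v (Fin.last m)) z ∨ x ∈ segment ℝ z (v 0) := by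
  rw [mem_polygon_boundary, exists_fin_castSucc_last]
  simp only [snoc_edge_castSucc, snoc_edge_prelast, snoc_edge_last]

theorem mem_boundary_last {m : ℕ} {v : Fin (m + 1) → Plane} {x : Plane} :
    x ∈ (⟨v⟩ : Polygon Plane (m + 1)).boundary ℝ ↔
      (∃ j : Fin m, x ∈ segment ℝ (v j.castSucc) (v (finRotate (m + 1) j.castSucc))) ∨
        x ∈ segment ℝ (v (Fin.last m)) (v 0) := by
  rw [mem_polygon_boundary, Fin.exists_fin_succ', finRotate_last]

open AffineMap in
/-- A vertex can be inserted in the interior of the last edge. -/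
theorem isPolygonRegion_subdivide {m : ℕ} {C : Set Plane} {v : Fin (m + 1) → Plane}
    (h : IsPolygonRegion C v) {c : ℝ} (hc : c ∈ Ioo (0 : ℝ) 1) :
    IsPolygonRegion C (snocVertex v (lineMap (v (Fin.last m)) (v 0) c)) := by
  have hs := polygon_isSimple_iff.1 h.isSimple
  have hl : finRotate (m + 1) (Fin.last m) = 0 := finRotate_last
  have hm : 1 ≤ m := by omega
  have hne : v (Fin.last m) ≠ v 0 := by
    intro he
    have := hs.2 (Fin.last m) 0 0 (by simp) 0 (by simp) (by simpa using he)
    have h3 := congrArg Fin.val this.1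
    simp at h3; omega
  -- Both new edges are reparametrised pieces of the old closing edge, through `c * s` and `c + (1 -
  -- c) * s`; both maps preserve the half-open unit interval.
  have e1 : ∀ s, lineMap (v (Fin.last m)) (lineMap (v (Fin.last m)) (v 0) c) s
      = (lineMap (v (Fin.last m)) (v 0) (c * s) : Plane) := by
    intro s; simp [lineMap_apply, smul_smul, mul_comm]
  have e2 : ∀ s, lineMap (lineMap (v (Fin.last m)) (v 0) c) (v 0) s
      = (lineMap (v (Fin.last m)) (v 0) (c + (1 - c) * s) : Plane) := by
    intro s; simp only [lineMap_apply, vsub_eq_sub, vadd_eq_add]; module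
  have r1 : ∀ s ∈ Ico (0 : ℝ) 1, c * s ∈ Ico (0 : ℝ) 1 := fun s h => by
    constructor <;> nlinarith [h.1, h.2, hc.1, hc.2]
  have r2 : ∀ s ∈ Ico (0 : ℝ) 1, c + (1 - c) * s ∈ Ico (0 : ℝ) 1 := fun s h => by
    constructor <;> nlinarith [h.1, h.2, hc.1, hc.2]
  have hjl : ∀ j : Fin m, j.castSucc ≠ Fin.last m := fun j => Fin.castSucc_ne_last j
  have hinj := AffineMap.lineMap_injective ℝ hne
  refine ⟨h.isOpen, h.isConnected, h.isBounded, ?_, ?_⟩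
  · refine polygon_isSimple_snoc h.isSimple ?_ ?_ ?_ ?_ ?_
    · intro he
      have : (0 : ℝ) = c := hinj (by simpa using he)
      linarith [hc.1]
    · intro he
      have : c = (1 : ℝ) := hinj (by simpa using he)
      linarith [hc.2]
    · intro s hs t ht he
      rw [e1, e2] at he
      have := hinj he
      nlinarith [hs.1, hs.2, ht.1, ht.2, hc.1, hc.2]
    · intro j s hs' t ht he
      rw [e1] at he
      exact hjl j (hs.2 _ (Fin.last m) s hs' _ (r1 t ht) (by rw [hl]; exact he)).1
    · intro j s hs' t ht he
      rw [e2] at he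
      exact hjl j (hs.2 _ (Fin.last m) s hs' _ (r2 t ht) (by rw [hl]; exact he)).1
  · rw [h.frontier_eq]
    ext x
    rw [mem_boundary_snoc, mem_boundary_last]
    refine or_congr_right ?_
    simp only [segment_eq_image_lineMap]
    constructor
    · rintro ⟨s, hs, rfl⟩
      rcases le_total s c with hsc | hsc
      · left
        refine ⟨s / c, ⟨div_nonneg hs.1 hc.1.le, by rw [div_le_one hc.1]; exact hsc⟩, ?_⟩
        rw [e1, mul_div_cancel₀ _ hc.1.ne']
      · right
        have : 0 < 1 - c := by linarith [hc.2]
        refine ⟨(s - c) / (1 - c), ⟨div_nonneg (by linarith) this.le, by rw [div_le_one this]; linarith [hs.2]⟩, ?_⟩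
        rw [e2, mul_div_cancel₀ _ this.ne']; congr 1; ring
    · rintro (⟨s, hs, rfl⟩ | ⟨s, hs, rfl⟩)
      · exact ⟨c * s, by constructor <;> nlinarith [hs.1, hs.2, hc.1, hc.2], (e1 s).symm⟩
      · exact ⟨c + (1 - c) * s, by constructor <;> nlinarith [hs.1, hs.2, hc.1, hc.2], (e2 s).symm⟩

/-! ### Determinants and barycentric coordinates. -/

/-- The signed area of the parallelogram spanned by two vectors of the plane. -/
def det₂ (u v : Plane) : ℝ := u 0 * v 1 - u 1 * v 0

theorem Plane.ext' {u v : Plane} (h0 : u 0 = v 0) (h1 : u 1 = v 1) : u = v := by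
  ext i; fin_cases i <;> assumption

@[fun_prop]
theorem continuous_det₂ {X : Type*} [TopologicalSpace X] {f g : X → Plane} (hf : Continuous f)
    (hg : Continuous g) : Continuous fun x => det₂ (f x) (g x) := by
  unfold det₂; fun_prop

@[simp] theorem det₂_self (u : Plane) : det₂ u u = 0 := by unfold det₂; ring
@[simp] theorem det₂_zero_left (u : Plane) : det₂ 0 u = 0 := by simp [det₂]
@[simp] theorem det₂_zero_right (u : Plane) : det₂ u 0 = 0 := by simp [det₂]
theorem det₂_add_left (u v w : Plane) : det₂ (u + v) w = det₂ u w + det₂ v w := by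
  simp [det₂]; ring
theorem det₂_add_right (u v w : Plane) : det₂ u (v + w) = det₂ u v + det₂ u w := by
  simp [det₂]; ring
theorem det₂_sub_left (u v w : Plane) : det₂ (u - v) w = det₂ u w - det₂ v w := by
  simp [det₂]; ring
theorem det₂_sub_right (u v w : Plane) : det₂ u (v - w) = det₂ u v - det₂ u w := by
  simp [det₂]; ring
theorem det₂_smul_left (c : ℝ) (u v : Plane) : det₂ (c • u) v = c * det₂ u v := by
  simp [det₂]; ring
theorem det₂_smul_right (c : ℝ) (u v : Plane) : det₂ u (c • v) = c * det₂ u v := by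
  simp [det₂]; ring
theorem det₂_swap (u v : Plane) : det₂ u v = -det₂ v u := by
  simp [det₂]; ring

/-- The barycentric coordinate at `z` with respect to the triangle `A z B`. -/
noncomputable def baryTip (A z B p : Plane) : ℝ := det₂ (p - A) (B - A) / det₂ (z - A) (B - A)
/-- The barycentric coordinate at `B` with respect to the triangle `A z B`. -/
noncomputable def baryEnd (A z B p : Plane) : ℝ := det₂ (z - A) (p - A) / det₂ (z - A) (B - A)

@[fun_prop]
theorem continuous_baryTip (A z B : Plane) : Continuous (baryTip A z B) := by
  unfold baryTip; fun_prop
@[fun_prop]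
theorem continuous_baryEnd (A z B : Plane) : Continuous (baryEnd A z B) := by
  unfold baryEnd; fun_prop

def openTriangle (A z B : Plane) : Set Plane :=
  {p | 0 < baryTip A z B p ∧ 0 < baryEnd A z B p ∧ baryTip A z B p + baryEnd A z B p < 1}
def closedTriangle (A z B : Plane) : Set Plane :=
  {p | 0 ≤ baryTip A z B p ∧ 0 ≤ baryEnd A z B p ∧ baryTip A z B p + baryEnd A z B p ≤ 1}

section Triangle
variable {A z B : Plane} (hΔ : det₂ (z - A) (B - A) ≠ 0)
include hΔ

/-- Cramer's rule for the basis `z - A`, `B - A`. -/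
theorem bary_expand (p : Plane) :
    p = A + baryTip A z B p • (z - A) + baryEnd A z B p • (B - A) := by
  unfold baryTip baryEnd
  have h : ∀ x y w : ℝ, x * det₂ (z - A) (B - A) = y → w + y / det₂ (z - A) (B - A) = w + x := by
    rintro x y w rfl; field_simp
  apply Plane.ext' <;> simp only [PiLp.add_apply, PiLp.smul_apply, PiLp.sub_apply, smul_eq_mul]
  · rw [div_mul_eq_mul_div, div_mul_eq_mul_div, add_assoc, ← add_div, h (p 0 - A 0)]
    · ring
    · simp only [det₂, PiLp.sub_apply]; ring
  · rw [div_mul_eq_mul_div, div_mul_eq_mul_div, add_assoc, ← add_div, h (p 1 - A 1)]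
    · ring
    · simp only [det₂, PiLp.sub_apply]; ring

theorem baryTip_comb (b c : ℝ) : baryTip A z B (A + b • (z - A) + c • (B - A)) = b := by
  have : A + b • (z - A) + c • (B - A) - A = b • (z - A) + c • (B - A) := by abel
  rw [baryTip, this, det₂_add_left, det₂_smul_left, det₂_smul_left, det₂_self]
  field_simp; ring

theorem baryEnd_comb (b c : ℝ) : baryEnd A z B (A + b • (z - A) + c • (B - A)) = c := by
  have : A + b • (z - A) + c • (B - A) - A = b • (z - A) + c • (B - A) := by abel
  rw [baryEnd, this, det₂_add_right, det₂_smul_right, det₂_smul_right, det₂_self]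
  field_simp; ring

theorem mem_segment_start_tip {p : Plane} :
    p ∈ segment ℝ A z ↔ 0 ≤ baryTip A z B p ∧ baryTip A z B p ≤ 1 ∧ baryEnd A z B p = 0 := by
  rw [segment_eq_image']
  constructor
  · rintro ⟨t, ht, rfl⟩
    have h1 := baryTip_comb hΔ t 0
    have h2 := baryEnd_comb hΔ t 0
    simp only [zero_smul, add_zero] at h1 h2
    simp only [h1, h2]; exact ⟨ht.1, ht.2, trivial⟩
  · rintro ⟨h1, h2, h3⟩
    exact ⟨_, ⟨h1, h2⟩, by have := bary_expand hΔ p; rw [h3] at this; simpa using this.symm⟩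

theorem mem_segment_start_end {p : Plane} :
    p ∈ segment ℝ A B ↔ 0 ≤ baryEnd A z B p ∧ baryEnd A z B p ≤ 1 ∧ baryTip A z B p = 0 := by
  rw [segment_eq_image']
  constructor
  · rintro ⟨t, ht, rfl⟩
    have h1 := baryTip_comb hΔ 0 t
    have h2 := baryEnd_comb hΔ 0 t
    simp only [zero_smul, add_zero] at h1 h2
    simp only [h1, h2]; exact ⟨ht.1, ht.2, trivial⟩
  · rintro ⟨h1, h2, h3⟩
    exact ⟨_, ⟨h1, h2⟩, by have := bary_expand hΔ p; rw [h3] at this; simpa using this.symm⟩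

theorem mem_openSegment_start_end {p : Plane} :
    p ∈ openSegment ℝ A B ↔ 0 < baryEnd A z B p ∧ baryEnd A z B p < 1 ∧ baryTip A z B p = 0 := by
  rw [openSegment_eq_image']
  constructor
  · rintro ⟨t, ht, rfl⟩
    have h1 := baryTip_comb hΔ 0 t
    have h2 := baryEnd_comb hΔ 0 t
    simp only [zero_smul, add_zero] at h1 h2
    simp only [h1, h2]; exact ⟨ht.1, ht.2, trivial⟩
  · rintro ⟨h1, h2, h3⟩
    exact ⟨_, ⟨h1, h2⟩, by have := bary_expand hΔ p; rw [h3] at this; simpa using this.symm⟩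

theorem mem_segment_tip_end {p : Plane} :
    p ∈ segment ℝ z B ↔ 0 ≤ baryTip A z B p ∧ 0 ≤ baryEnd A z B p ∧
      baryTip A z B p + baryEnd A z B p = 1 := by
  rw [segment_eq_image']
  constructor
  · rintro ⟨t, ht, rfl⟩
    have e : z + t • (B - z) = A + (1 - t) • (z - A) + t • (B - A) := by module
    simp only [e, baryTip_comb hΔ, baryEnd_comb hΔ]
    exact ⟨by linarith [ht.2], ht.1, by ring⟩
  · rintro ⟨h1, h2, h3⟩
    refine ⟨baryEnd A z B p, ⟨h2, by linarith⟩, ?_⟩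
    have e := bary_expand hΔ p
    have : baryTip A z B p = 1 - baryEnd A z B p := by linarith
    rw [this] at e
    conv_rhs => rw [e]
    module

omit hΔ in
theorem isOpen_openTriangle : IsOpen (openTriangle A z B) := by
  simp only [openTriangle, ofPred_and]
  exact (isOpen_lt continuous_const (by fun_prop)).inter
    ((isOpen_lt continuous_const (by fun_prop)).inter (isOpen_lt (by fun_prop) continuous_const))

omit hΔ in
theorem isClosed_closedTriangle : IsClosed (closedTriangle A z B) := by
  simp only [closedTriangle, ofPred_and]
  exact (isClosed_le continuous_const (by fun_prop)).inter
    ((isClosed_le continuous_const (by fun_prop)).inter (isClosed_le (by fun_prop) continuous_const))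

theorem closedTriangle_eq_image : closedTriangle A z B =
    (fun q : ℝ × ℝ => A + q.1 • (z - A) + q.2 • (B - A)) ''
      {q | 0 ≤ q.1 ∧ 0 ≤ q.2 ∧ q.1 + q.2 ≤ 1} := by
  ext p
  constructor
  · intro h
    exact ⟨(_, _), h, (bary_expand hΔ p).symm⟩
  · rintro ⟨⟨b, c⟩, h, rfl⟩
    simpa only [closedTriangle, mem_ofPred_eq, baryTip_comb hΔ, baryEnd_comb hΔ] using h

theorem openTriangle_eq_image : openTriangle A z B =
    (fun q : ℝ × ℝ => A + q.1 • (z - A) + q.2 • (B - A)) ''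
      {q | 0 < q.1 ∧ 0 < q.2 ∧ q.1 + q.2 < 1} := by
  ext p
  constructor
  · intro h
    exact ⟨(_, _), h, (bary_expand hΔ p).symm⟩
  · rintro ⟨⟨b, c⟩, h, rfl⟩
    simpa only [openTriangle, mem_ofPred_eq, baryTip_comb hΔ, baryEnd_comb hΔ] using h

theorem isBounded_closedTriangle : Bornology.IsBounded (closedTriangle A z B) := by
  rw [closedTriangle_eq_image hΔ]
  have hc : IsCompact (Icc (0 : ℝ) 1 ×ˢ Icc (0 : ℝ) 1) := isCompact_Icc.prod isCompact_Icc
  refine ((hc.image (f := fun q : ℝ × ℝ => A + q.1 • (z - A) + q.2 • (B - A))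
    (by fun_prop)).isBounded).subset (image_mono ?_)
  rintro ⟨b, c⟩ ⟨h1, h2, h3⟩
  simp only at h1 h2 h3
  exact ⟨⟨h1, by simp only; linarith⟩, ⟨h2, by simp only; linarith⟩⟩

theorem isConnected_openTriangle : IsConnected (openTriangle A z B) := by
  rw [openTriangle_eq_image hΔ]
  refine IsConnected.image ⟨⟨(1 / 3, 1 / 3), by norm_num⟩, Convex.isPreconnected ?_⟩ _ (by fun_prop)
  rintro ⟨a, b⟩ ⟨h1, h2, h3⟩ ⟨c, d⟩ ⟨h4, h5, h6⟩ s t hs ht hst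
  simp only at h1 h2 h3 h4 h5 h6
  simp only [mem_ofPred_eq, Prod.smul_mk, Prod.mk_add_mk, smul_eq_mul]
  rcases hs.eq_or_lt with h | h
  · have : t = 1 := by linarith
    subst this; subst h; simp; exact ⟨h4, h5, h6⟩
  · exact ⟨by nlinarith, by nlinarith, by nlinarith⟩

theorem closure_openTriangle : closure (openTriangle A z B) = closedTriangle A z B := by
  apply Subset.antisymm
  · exact closure_minimal (fun p h => ⟨h.1.le, h.2.1.le, h.2.2.le⟩) isClosed_closedTriangle
  · intro p hp
    -- The point is moved towards the interior point with both coordinates `1 / 3`; all intermediate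
    -- points are interior.
    have hlim : Filter.Tendsto (fun s : ℝ => A + ((1 - s) * baryTip A z B p + s * (1 / 3)) • (z - A)
        + ((1 - s) * baryEnd A z B p + s * (1 / 3)) • (B - A)) (𝓝[>] 0) (𝓝 p) := by
      have : Continuous (fun s : ℝ => A + ((1 - s) * baryTip A z B p + s * (1 / 3)) • (z - A)
        + ((1 - s) * baryEnd A z B p + s * (1 / 3)) • (B - A)) := by fun_prop
      have h0 := this.tendsto 0
      simp only [sub_zero, one_mul, zero_mul, add_zero] at h0
      rw [← bary_expand hΔ p] at h0
      exact h0.mono_left nhdsWithin_le_nhds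
    refine mem_closure_of_tendsto hlim ?_
    filter_upwards [Ioo_mem_nhdsGT (show (0 : ℝ) < 1 by norm_num)] with s hs
    obtain ⟨h1, h2, h3⟩ := hp
    simp only [openTriangle, mem_ofPred_eq, baryTip_comb hΔ, baryEnd_comb hΔ]
    exact ⟨by nlinarith [hs.1, hs.2], by nlinarith [hs.1, hs.2], by nlinarith [hs.1, hs.2]⟩

theorem mem_closedTriangle_iff {p : Plane} : p ∈ closedTriangle A z B ↔
    p ∈ openTriangle A z B ∨ p ∈ segment ℝ A z ∨ p ∈ segment ℝ z B ∨ p ∈ openSegment ℝ A B := by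
  rw [mem_segment_start_tip hΔ, mem_segment_tip_end hΔ, mem_openSegment_start_end hΔ]
  simp only [closedTriangle, openTriangle, mem_ofPred_eq]
  constructor
  · rintro ⟨h1, h2, h3⟩
    rcases h1.eq_or_lt with h | h <;> rcases h2.eq_or_lt with h' | h' <;>
      rcases h3.eq_or_lt with h'' | h'' <;> grind
  · rintro (h | h | h | h) <;> grind

end Triangle

/-! ### Attaching a triangle to an edge. -/

/-- Off the frontier, the plane splits into the disjoint open sets `C` and the complement of
`closure C`. -/
theorem IsPreconnected.subset_of_disjoint_frontier {X : Type*} [TopologicalSpace X] {S C : Set X}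
    (hS : IsPreconnected S) (hC : IsOpen C) (hd : Disjoint S (frontier C))
    (hne : (S ∩ C).Nonempty) : S ⊆ C := by
  refine hS.subset_left_of_subset_union hC isClosed_closure.isOpen_compl
    (disjoint_compl_right.mono_left subset_closure) (fun x hx => ?_) hne
  by_cases h : x ∈ closure C
  · left
    by_contra hxC
    exact (disjoint_left.1 hd hx) (by rw [hC.frontier_eq]; exact ⟨h, hxC⟩)
  · exact Or.inr h

theorem openSegment_disjoint_edge {m : ℕ} {v : Fin (m + 1) → Plane}
    (h : (⟨v⟩ : Polygon Plane (m + 1)).IsSimple) {x : Plane}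
    (hx : x ∈ openSegment ℝ (v (Fin.last m)) (v 0)) (j : Fin m) :
    x ∉ segment ℝ (v j.castSucc) (v (finRotate (m + 1) j.castSucc)) := by
  have hs := polygon_isSimple_iff.1 h
  rw [openSegment_eq_image_lineMap] at hx
  obtain ⟨t, ht, rfl⟩ := hx
  rw [segment_eq_image_lineMap]
  rintro ⟨s, hs', he⟩
  have hl : finRotate (m + 1) (Fin.last m) = 0 := finRotate_last
  -- The endpoint `s = 1` is not covered by the half-open parametrisation; it is treated as the
  -- start of the next edge.
  rcases hs'.2.eq_or_lt with rfl | hlt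
  · have := hs.2 (finRotate (m + 1) j.castSucc) (Fin.last m) 0 (by simp) t ⟨ht.1.le, ht.2⟩
      (by rw [hl, ← he]; simp)
    linarith [ht.1, this.2]
  · exact (Fin.castSucc_ne_last j) (hs.2 _ (Fin.last m) s ⟨hs'.1, hlt⟩ t ⟨ht.1.le, ht.2⟩
      (by rw [hl, ← he])).1

theorem isClosed_otherEdges {m : ℕ} (v : Fin (m + 1) → Plane) :
    IsClosed (⋃ j : Fin m, segment ℝ (v j.castSucc) (v (finRotate (m + 1) j.castSucc))) :=
  isClosed_iUnion_of_finite fun _ => (by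
    rw [segment_eq_image_lineMap]
    exact (isCompact_Icc.image (by fun_prop)).isClosed)

-- The closing edge `A B` is replaced by the path `A z B`. Openness is delicate only at points of
-- the base. There the line `A B` cuts a small disc into a half inside the triangle, a piece of the
-- base, and a half that is connected and avoids the frontier; the last half meets `C` and so lies
-- in `C`.
open AffineMap in
theorem isPolygonRegion_bump {m : ℕ} {C : Set Plane} {v : Fin (m + 1) → Plane}
    (h : IsPolygonRegion C v) {A z B : Plane} (hA : v (Fin.last m) = A) (hB : v 0 = B)
    (hΔ : det₂ (z - A) (B - A) ≠ 0)
    (hT : ∀ x ∈ closedTriangle A z B, x ∈ closure C → x ∈ segment ℝ A B) :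
    IsPolygonRegion (C ∪ openSegment ℝ A B ∪ openTriangle A z B) (snocVertex v z) := by
  have hmemb : ∀ x, x ∈ frontier C ↔ (∃ j : Fin m, x ∈ segment ℝ (v j.castSucc)
      (v (finRotate (m + 1) j.castSucc))) ∨ x ∈ segment ℝ A B := by
    intro x; rw [h.frontier_eq, mem_boundary_last, hA, hB]
  have hseg : ∀ {x}, x ∈ openSegment ℝ A B → ∀ j : Fin m,
      x ∉ segment ℝ (v j.castSucc) (v (finRotate (m + 1) j.castSucc)) := by
    intro x hx; rw [← hA, ← hB] at hx; exact openSegment_disjoint_edge h.isSimple hx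
  have hfc : frontier C ⊆ closure C := frontier_subset_closure
  have hfC : ∀ x ∈ frontier C, x ∉ C := fun x hx hxC => by
    rw [h.isOpen.frontier_eq] at hx; exact hx.2 hxC
  have hO : ∀ x ∈ openTriangle A z B, x ∉ closure C := by
    intro x hx hxc
    have := (mem_segment_start_end hΔ).1 (hT x ⟨hx.1.le, hx.2.1.le, hx.2.2.le⟩ hxc)
    linarith [hx.1, this.2.2]
  have hside : ∀ x, (x ∈ segment ℝ A z ∨ x ∈ segment ℝ z B) → x ∈ closedTriangle A z B := by
    intro x hx; rw [mem_closedTriangle_iff hΔ]; tauto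
  have hzA : A ≠ z := by rintro rfl; simp at hΔ
  have hzB : z ≠ B := by rintro rfl; simp at hΔ
  have eA : ∀ t : ℝ, (lineMap A z t : Plane) = A + t • (z - A) + (0 : ℝ) • (B - A) := by
    intro t; simp only [lineMap_apply, vsub_eq_sub, vadd_eq_add]; module
  have eB : ∀ t : ℝ, (lineMap z B t : Plane) = A + (1 - t) • (z - A) + t • (B - A) := by
    intro t; simp only [lineMap_apply, vsub_eq_sub, vadd_eq_add]; module
  have key : ∀ x, (x ∈ segment ℝ A z ∨ x ∈ segment ℝ z B) → x ∈ frontier C → x = A ∨ x = B := by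
    intro x hx hxf
    have h1 := (mem_segment_start_end hΔ).1 (hT x (hside x hx) (hfc hxf))
    have hxx := bary_expand hΔ x
    rcases hx with hx | hx
    · have h2 := (mem_segment_start_tip hΔ).1 hx
      rw [h1.2.2, h2.2.2] at hxx; left; simpa using hxx
    · have h2 := (mem_segment_tip_end hΔ).1 hx
      rw [h1.2.2, show baryEnd A z B x = 1 by linarith [h2.2.2, h1.2.2]] at hxx
      right; simpa using hxx
  have hs := polygon_isSimple_iff.1 h.isSimple
  have hl : finRotate (m + 1) (Fin.last m) = 0 := finRotate_last
  have hmemj : ∀ (j : Fin m) (s : ℝ), s ∈ Ico (0 : ℝ) 1 →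
      lineMap (v j.castSucc) (v (finRotate (m + 1) j.castSucc)) s ∈ frontier C := by
    intro j s hs'
    rw [hmemb]
    exact Or.inl ⟨j, by rw [segment_eq_image_lineMap]; exact ⟨s, ⟨hs'.1, hs'.2.le⟩, rfl⟩⟩
  have hnA : ∀ (j : Fin m) (s : ℝ), s ∈ Ico (0 : ℝ) 1 →
      lineMap (v j.castSucc) (v (finRotate (m + 1) j.castSucc)) s ≠ A := by
    intro j s hs' he
    exact (Fin.castSucc_ne_last j) (hs.2 _ (Fin.last m) s hs' 0 (by simp) (by rw [he, hA]; simp)).1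
  have hopen : IsOpen (C ∪ openSegment ℝ A B ∪ openTriangle A z B) := by
    rw [isOpen_iff_mem_nhds]
    rintro x ((hx | hx) | hx)
    · exact Filter.mem_of_superset (h.isOpen.mem_nhds hx) fun y hy => Or.inl (Or.inl hy)
    · have hxb := (mem_openSegment_start_end hΔ).1 hx
      have hN : {y | 0 < baryEnd A z B y} ∩ {y | baryTip A z B y + baryEnd A z B y < 1} ∩
          (⋃ j : Fin m, segment ℝ (v j.castSucc) (v (finRotate (m + 1) j.castSucc)))ᶜ ∈ 𝓝 x := by
        refine Filter.inter_mem (Filter.inter_mem ?_ ?_) ?_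
        · exact (isOpen_lt continuous_const (by fun_prop)).mem_nhds hxb.1
        · refine (isOpen_lt (by fun_prop) continuous_const).mem_nhds ?_
          simp only [mem_ofPred_eq]; rw [hxb.2.2]; linarith [hxb.2.1]
        · refine (isClosed_otherEdges v).isOpen_compl.mem_nhds ?_
          simp only [mem_compl_iff, mem_iUnion, not_exists]
          exact hseg hx
      obtain ⟨r, hr, hball⟩ := Metric.mem_nhds_iff.1 hN
      refine Filter.mem_of_superset (Metric.ball_mem_nhds x hr) ?_
      have hxf : x ∈ frontier C := by rw [hmemb]; exact Or.inr (openSegment_subset_segment _ _ _ hx)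
      have hin : ∀ y ∈ Metric.ball x r, baryTip A z B y = 0 → y ∈ openSegment ℝ A B := by
        intro y hy h0
        have hyb := hball hy
        rw [mem_openSegment_start_end hΔ]
        refine ⟨hyb.1.1, ?_, h0⟩
        have := hyb.1.2
        simp only [mem_ofPred_eq] at this; linarith
      have hpos : ∀ y ∈ Metric.ball x r, 0 < baryTip A z B y → y ∈ openTriangle A z B :=
        fun y hy h0 => ⟨h0, (hball hy).1.1, (hball hy).1.2⟩
      have hconv : Convex ℝ (Metric.ball x r ∩ {y | baryTip A z B y < 0}) := by
        refine (convex_ball x r).inter ?_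
        intro a ha b hb s t hs ht hst
        have : baryTip A z B (s • a + t • b) = s * baryTip A z B a + t * baryTip A z B b := by
          have : s • a + t • b - A = s • (a - A) + t • (b - A) := by
            have : A = s • A + t • A := by rw [← add_smul, hst, one_smul]
            nth_rewrite 1 [this]; module
          simp only [baryTip, this, det₂_add_left, det₂_smul_left]; ring
        simp only [mem_ofPred_eq] at ha hb ⊢
        rw [this]
        rcases hs.eq_or_lt with h | h
        · have : t = 1 := by linarith
          subst this; subst h; linarith
        · nlinarith
      have hneg : Metric.ball x r ∩ {y | baryTip A z B y < 0} ⊆ C := by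
        refine hconv.isPreconnected.subset_of_disjoint_frontier h.isOpen ?_ ?_
        · rw [disjoint_left]
          rintro y ⟨hy, hy0⟩ hyf
          rcases (hmemb y).1 hyf with hj | hj
          · exact (hball hy).2 (mem_iUnion.2 hj)
          · have := ((mem_segment_start_end hΔ).1 hj).2.2
            simp only [mem_ofPred_eq] at hy0; linarith
        -- The centre lies in `closure C`, and neither the base nor the triangle contains points of
        -- `C`, so a nearby point of `C` must be in the lower half disc.
        · obtain ⟨y, hyC, hyb⟩ := (Metric.mem_closure_iff.1 (hfc hxf) r hr)
          rw [dist_comm] at hyb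
          refine ⟨y, ⟨hyb, ?_⟩, hyC⟩
          rcases lt_trichotomy (baryTip A z B y) 0 with h0 | h0 | h0
          · exact h0
          · exact absurd hyC (hfC y (by
              rw [hmemb]; exact Or.inr (openSegment_subset_segment _ _ _ (hin y hyb h0))))
          · exact absurd (subset_closure hyC) (hO y (hpos y hyb h0))
      intro y hy
      rcases lt_trichotomy (baryTip A z B y) 0 with h0 | h0 | h0
      · exact Or.inl (Or.inl (hneg ⟨hy, h0⟩))
      · exact Or.inl (Or.inr (hin y hy h0))
      · exact Or.inr (hpos y hy h0)
    · exact Filter.mem_of_superset (isOpen_openTriangle.mem_nhds hx) fun y hy => Or.inr hy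
  refine ⟨hopen, ?_, ?_, ?_, ?_⟩
  · have hmid : lineMap A B (1 / 2 : ℝ) ∈ openSegment ℝ A B := by
      rw [openSegment_eq_image_lineMap]; exact ⟨_, by norm_num, rfl⟩
    have c1 : IsPreconnected (C ∪ openSegment ℝ A B) := by
      refine h.isConnected.isPreconnected.subset_closure subset_union_left ?_
      refine union_subset subset_closure fun x hx => hfc ?_
      rw [hmemb]; exact Or.inr (openSegment_subset_segment _ _ _ hx)
    have c2 : IsPreconnected (openSegment ℝ A B ∪ openTriangle A z B) := by
      refine (isConnected_openTriangle hΔ).isPreconnected.subset_closure subset_union_right ?_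
      rw [closure_openTriangle hΔ]
      intro x hx
      rw [mem_closedTriangle_iff hΔ]
      rcases hx with hx | hx
      · exact Or.inr (Or.inr (Or.inr hx))
      · exact Or.inl hx
    have := c1.union (lineMap A B (1 / 2 : ℝ)) (Or.inr hmid) (Or.inl hmid) c2
    have he : C ∪ openSegment ℝ A B ∪ (openSegment ℝ A B ∪ openTriangle A z B) =
        C ∪ openSegment ℝ A B ∪ openTriangle A z B := by
      rw [← union_assoc, union_assoc C, union_self]
    rw [he] at this
    exact ⟨h.isConnected.nonempty.mono fun x hx => Or.inl (Or.inl hx), this⟩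
  · refine (h.isBounded.union ?_).union ((isBounded_closedTriangle hΔ).subset ?_)
    · exact (h.isBounded.closure).subset fun x hx => hfc (by
        rw [hmemb]; exact Or.inr (openSegment_subset_segment _ _ _ hx))
    · intro x hx; exact ⟨hx.1.le, hx.2.1.le, hx.2.2.le⟩
  · refine polygon_isSimple_snoc h.isSimple (by rwa [hA]) (by rwa [hB]) ?_ ?_ ?_
    · rw [hA, hB]
      intro s hs t ht he
      rw [eA, eB] at he
      have h1 := congrArg (baryEnd A z B) he
      have h2 := congrArg (baryTip A z B) he
      rw [baryEnd_comb hΔ, baryEnd_comb hΔ] at h1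
      rw [baryTip_comb hΔ, baryTip_comb hΔ] at h2
      linarith [hs.2]
    · intro j s hs' t ht he
      rw [hA] at he
      rcases key _ (Or.inl (by rw [segment_eq_image_lineMap]; exact ⟨t, ⟨ht.1, ht.2.le⟩, rfl⟩))
        (he ▸ hmemj j s hs') with h1 | h1
      · exact hnA j s hs' (he.trans h1)
      · have e : A + (0 : ℝ) • (z - A) + (1 : ℝ) • (B - A) = B := by module
        have h1 := congrArg (baryEnd A z B) ((eA t).symm.trans (h1.trans e.symm))
        rw [baryEnd_comb hΔ, baryEnd_comb hΔ] at h1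
        linarith
    · intro j s hs' t ht he
      rw [hB] at he
      rcases key _ (Or.inr (by rw [segment_eq_image_lineMap]; exact ⟨t, ⟨ht.1, ht.2.le⟩, rfl⟩))
        (he ▸ hmemj j s hs') with h1 | h1
      · exact hnA j s hs' (he.trans h1)
      · have := AffineMap.lineMap_injective ℝ hzB (h1.trans (lineMap_apply_one z B).symm)
        linarith [ht.2]
  · have hcl : closure (C ∪ openSegment ℝ A B ∪ openTriangle A z B)
        = closure C ∪ closedTriangle A z B := by
      rw [closure_union, closure_openTriangle hΔ]
      apply Subset.antisymm
      · refine union_subset_union_left _ (closure_minimal ?_ isClosed_closure)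
        refine union_subset subset_closure fun x hx => hfc ?_
        rw [hmemb]; exact Or.inr (openSegment_subset_segment _ _ _ hx)
      · exact union_subset_union_left _ (closure_mono subset_union_left)
    rw [hopen.frontier_eq, hcl]
    ext x
    rw [mem_boundary_snoc, hA, hB]
    constructor
    · rintro ⟨hx, hxn⟩
      simp only [mem_union, not_or] at hx hxn
      rcases hx with hx | hx
      · rcases (hmemb x).1 (by rw [h.isOpen.frontier_eq]; exact ⟨hx, hxn.1.1⟩) with h1 | h1
        · exact Or.inl h1
        · right
          rw [← insert_endpoints_openSegment] at h1
          rcases h1 with rfl | rfl | h1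
          · exact Or.inl (left_mem_segment _ _ _)
          · exact Or.inr (right_mem_segment _ _ _)
          · exact absurd h1 hxn.1.2
      · rw [mem_closedTriangle_iff hΔ] at hx
        tauto
    · rintro (hx | hx)
      · have hxf := (hmemb x).2 (Or.inl hx)
        refine ⟨Or.inl (hfc hxf), ?_⟩
        rintro ((h1 | h1) | h1)
        · exact hfC x hxf h1
        · obtain ⟨j, hj⟩ := hx
          exact hseg h1 j hj
        · exact hO x h1 (hfc hxf)
      · have hxT := hside x hx
        refine ⟨Or.inr hxT, ?_⟩
        rintro ((h1 | h1) | h1)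
        · exact hfC x ((hmemb x).2 (Or.inr (hT x hxT (subset_closure h1)))) h1
        · rw [mem_openSegment_start_end hΔ] at h1
          rw [mem_segment_start_tip hΔ, mem_segment_tip_end hΔ] at hx
          rcases hx with hx | hx <;> linarith [hx.2.2, h1.1, h1.2.1, h1.2.2]
        · rw [mem_segment_start_tip hΔ, mem_segment_tip_end hΔ] at hx
          rcases hx with hx | hx <;> linarith [hx.2.2, h1.1, h1.2.1, h1.2.2]

/-- The inside of a triangle is a polygon region. -/
theorem isPolygonRegion_triangle {A z B : Plane} (hΔ : det₂ (z - A) (B - A) ≠ 0) :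
    IsPolygonRegion (openTriangle A z B) ![A, z, B] := by
  have hzA : A ≠ z := by rintro rfl; simp at hΔ
  have hzB : z ≠ B := by rintro rfl; simp at hΔ
  have hAB : B ≠ A := by rintro rfl; simp at hΔ
  have eA : ∀ t : ℝ, (AffineMap.lineMap A z t : Plane) = A + t • (z - A) + (0 : ℝ) • (B - A) := by
    intro t; simp only [AffineMap.lineMap_apply, vsub_eq_sub, vadd_eq_add]; module
  have eB : ∀ t : ℝ, (AffineMap.lineMap z B t : Plane) = A + (1 - t) • (z - A) + t • (B - A) := by
    intro t; simp only [AffineMap.lineMap_apply, vsub_eq_sub, vadd_eq_add]; module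
  have eC : ∀ t : ℝ, (AffineMap.lineMap B A t : Plane) = A + (0 : ℝ) • (z - A) + (1 - t) • (B - A) := by
    intro t; simp only [AffineMap.lineMap_apply, vsub_eq_sub, vadd_eq_add]; module
  have inj : ∀ a b c d : ℝ, A + a • (z - A) + b • (B - A) = A + c • (z - A) + d • (B - A) →
      a = c ∧ b = d := by
    intro a b c d he
    have h1 := congrArg (baryTip A z B) he
    have h2 := congrArg (baryEnd A z B) he
    rw [baryTip_comb hΔ, baryTip_comb hΔ] at h1
    rw [baryEnd_comb hΔ, baryEnd_comb hΔ] at h2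
    exact ⟨h1, h2⟩
  have f0 : finRotate 3 0 = 1 := by decide
  have f1 : finRotate 3 1 = 2 := by decide
  have f2 : finRotate 3 2 = 0 := by decide
  refine ⟨isOpen_openTriangle, isConnected_openTriangle hΔ,
    (isBounded_closedTriangle hΔ).subset fun x hx => ⟨hx.1.le, hx.2.1.le, hx.2.2.le⟩, ?_, ?_⟩
  · rw [polygon_isSimple_iff]
    refine ⟨le_rfl, ?_⟩
    simp only [Fin.forall_fin_succ, IsEmpty.forall_iff, and_true, Fin.isValue, Fin.succ_zero_eq_one,
      Fin.succ_one_eq_two, f0, f1, f2, Matrix.cons_val_zero, Matrix.cons_val_one, Matrix.cons_val,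
      eA, eB, eC]
    refine ⟨⟨?_, ?_, ?_⟩, ⟨?_, ?_, ?_⟩, ?_, ?_, ?_⟩ <;> intro s hs t ht he <;>
      obtain ⟨h1, h2⟩ := inj _ _ _ _ he <;>
      first
      | exact ⟨by trivial, by linarith⟩
      | (exfalso; linarith [hs.1, hs.2, ht.1, ht.2])
  · rw [isOpen_openTriangle.frontier_eq, closure_openTriangle hΔ]
    ext x
    rw [mem_polygon_boundary, mem_sdiff, mem_closedTriangle_iff hΔ]
    simp only [Fin.exists_fin_succ, IsEmpty.exists_iff, or_false, Fin.isValue, Fin.succ_zero_eq_one,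
      Fin.succ_one_eq_two, f0, f1, f2, Matrix.cons_val_zero, Matrix.cons_val_one, Matrix.cons_val]
    rw [segment_symm ℝ B A, mem_segment_start_tip hΔ, mem_segment_tip_end hΔ,
      mem_openSegment_start_end hΔ, mem_segment_start_end hΔ]
    simp only [openTriangle, mem_ofPred_eq]
    grind

theorem isPolygonRegion_translate {n : ℕ} {C : Set Plane} {v : Fin n → Plane}
    (h : IsPolygonRegion C v) (τ : Plane) :
    IsPolygonRegion ((fun x => x + τ) '' C) (fun i => v i + τ) := by
  have hl : ∀ (a b : Plane) (s : ℝ), AffineMap.lineMap (a + τ) (b + τ) s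
      = AffineMap.lineMap a b s + τ := by
    intro a b s; simp only [AffineMap.lineMap_apply, vsub_eq_sub, vadd_eq_add]; module
  refine ⟨(Homeomorph.addRight τ).isOpenMap _ h.isOpen, h.isConnected.image _ (by fun_prop), ?_, ?_, ?_⟩
  · exact (IsometryEquiv.addRight τ).isometry.lipschitz.isBounded_image h.isBounded
  · have hs := polygon_isSimple_iff.1 h.isSimple
    refine polygon_isSimple_iff.2 ⟨hs.1, fun i j s hs' t ht he => ?_⟩
    rw [hl, hl] at he
    exact hs.2 i j s hs' t ht (add_right_cancel he)
  · have := (Homeomorph.addRight τ).image_frontier C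
    simp only [Homeomorph.coe_addRight] at this
    rw [← this, h.frontier_eq]
    ext x
    simp only [mem_image, mem_polygon_boundary, segment_eq_image_lineMap, hl]
    constructor
    · rintro ⟨_, ⟨i, s, hs, rfl⟩, rfl⟩; exact ⟨i, s, hs, rfl⟩
    · rintro ⟨i, s, hs, rfl⟩; exact ⟨_, ⟨i, s, hs, rfl⟩, rfl⟩

/-! ### Growing a polygonal region inside an open set. -/

/-- The start is moved in a direction `w` transversal to `y - z`. For each `p` in `F` the
determinant is an affine function of the displacement that does not vanish identically, hence it is
nonzero for all small positive displacements. -/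
theorem exists_generic_start {y z : Plane} (hyz : y ≠ z) (F : Set Plane) (hF : F.Finite) (hz : z ∉ F)
    {W : Set Plane} (hW : W ∈ 𝓝 y) :
    ∃ y' ∈ W, y' ≠ z ∧ ∀ p ∈ F, det₂ (y' - z) (p - z) ≠ 0 := by
  obtain ⟨w, hw⟩ : ∃ w : Plane, det₂ (y - z) w ≠ 0 := by
    by_contra! h
    apply hyz
    have h0 := h (EuclideanSpace.single 0 1)
    have h1 := h (EuclideanSpace.single 1 1)
    simp [det₂] at h0 h1
    exact Plane.ext' (by linarith) (by linarith)
  have hev : ∀ p ∈ F, ∀ᶠ s : ℝ in 𝓝[>] 0, det₂ (y + s • w - z) (p - z) ≠ 0 := by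
    intro p hp
    have hlin : ∀ s : ℝ, det₂ (y + s • w - z) (p - z) = det₂ (y - z) (p - z) + s * det₂ w (p - z) := by
      intro s; simp [det₂]; ring
    simp only [hlin]
    by_cases h0 : det₂ (y - z) (p - z) = 0
    · have h1 : det₂ w (p - z) ≠ 0 := by
        intro h1
        apply hz
        have hp' : p - z = 0 := by
          simp only [det₂, PiLp.sub_apply] at h0 h1 hw
          have ha : p 0 - z 0 = 0 := by
            have : (p 0 - z 0) * ((y 0 - z 0) * w 1 - (y 1 - z 1) * w 0) = 0 := by linear_combination w 0 * h0 - (y 0 - z 0) * h1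
            exact (mul_eq_zero.1 this).resolve_right hw
          have hb : p 1 - z 1 = 0 := by
            have : (p 1 - z 1) * ((y 0 - z 0) * w 1 - (y 1 - z 1) * w 0) = 0 := by linear_combination w 1 * h0 - (y 1 - z 1) * h1
            exact (mul_eq_zero.1 this).resolve_right hw
          exact Plane.ext' (by simpa using ha) (by simpa using hb)
        rw [sub_eq_zero] at hp'
        exact hp' ▸ hp
      filter_upwards [self_mem_nhdsWithin] with s hs
      rw [h0, zero_add]
      exact mul_ne_zero (ne_of_gt hs) h1
    · have : Filter.Tendsto (fun s : ℝ => det₂ (y - z) (p - z) + s * det₂ w (p - z)) (𝓝[>] 0)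
          (𝓝 (det₂ (y - z) (p - z))) := by
        have : Continuous (fun s : ℝ => det₂ (y - z) (p - z) + s * det₂ w (p - z)) := by fun_prop
        have := this.tendsto 0
        simp only [zero_mul, add_zero] at this
        exact this.mono_left nhdsWithin_le_nhds
      exact this.eventually_ne h0
  have hcont : Filter.Tendsto (fun s : ℝ => y + s • w) (𝓝[>] 0) (𝓝 y) := by
    have : Continuous (fun s : ℝ => y + s • w) := by fun_prop
    have := this.tendsto 0
    simp only [zero_smul, add_zero] at this
    exact this.mono_left nhdsWithin_le_nhds
  obtain ⟨s, h1, h2, h3⟩ := ((hcont.eventually hW).and ((hcont.eventually_ne hyz).and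
    ((Filter.eventually_all_finite hF).2 hev))).exists
  exact ⟨_, h1, h2, h3⟩

theorem exists_last_mem_of_isClosed {y z : Plane} {K : Set Plane} (hK : IsClosed K) (hy : y ∈ K)
    (hz : z ∉ K) : ∃ s ∈ Ico (0 : ℝ) 1, y + s • (z - y) ∈ K ∧
      ∀ t ∈ Ioc s 1, y + t • (z - y) ∉ K := by
  have hcont : Continuous (fun s : ℝ => y + s • (z - y)) := by fun_prop
  have hc : IsCompact (Icc (0 : ℝ) 1 ∩ (fun s : ℝ => y + s • (z - y)) ⁻¹' K) :=
    isCompact_Icc.inter_right (hK.preimage hcont)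
  obtain ⟨s, ⟨hs, hsK⟩, hmax⟩ := hc.exists_isGreatest ⟨0, by simp, by simpa using hy⟩
  refine ⟨s, ⟨hs.1, hs.2.lt_of_ne ?_⟩, hsK, fun t ht htK => ?_⟩
  · rintro rfl
    apply hz
    simpa using hsK
  · exact absurd (hmax ⟨⟨hs.1.trans ht.1.le, ht.2⟩, htK⟩) (not_le.2 ht.1)

/-- A thin triangle over a point of an edge of a polygon region, whose tip is visible from this
point, meets the region only in its base. -/
theorem exists_thin_triangle {m : ℕ} {C : Set Plane} {v : Fin (m + 1) → Plane}
    (h : IsPolygonRegion C v) {q z : Plane} (hq : q ∈ openSegment ℝ (v (Fin.last m)) (v 0))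
    (hdet : det₂ (z - q) (v 0 - v (Fin.last m)) ≠ 0)
    (hz : ∀ t ∈ Ioc (0 : ℝ) 1, q + t • (z - q) ∉ closure C) {ρ : ℝ} (hρ : 0 < ρ) :
    ∀ᶠ δ : ℝ in 𝓝[>] 0, ∀ b ∈ Icc (0 : ℝ) 1, ∀ μ ∈ Icc (-δ) δ,
      ‖μ • (v 0 - v (Fin.last m))‖ < ρ ∧
      (b ≠ 0 → q + b • (z - q) + μ • (v 0 - v (Fin.last m)) ∉ closure C) := by
  set A := v (Fin.last m) with hA
  set B := v 0 with hB
  set e := B - A with he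
  have hfc : frontier C ⊆ closure C := frontier_subset_closure
  -- local structure near `q`
  have hN : (⋃ j : Fin m, segment ℝ (v j.castSucc) (v (finRotate (m + 1) j.castSucc)))ᶜ ∈ 𝓝 q := by
    refine (isClosed_otherEdges v).isOpen_compl.mem_nhds ?_
    simp only [mem_compl_iff, mem_iUnion, not_exists]
    exact openSegment_disjoint_edge h.isSimple hq
  obtain ⟨r, hr, hball⟩ := Metric.mem_nhds_iff.1 hN
  have hqA : det₂ (q - A) e = 0 := by
    rw [openSegment_eq_image'] at hq
    obtain ⟨s, -, rfl⟩ := hq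
    simp only [add_sub_cancel_left, ← he]
    rw [det₂_smul_left, det₂_self, mul_zero]
  -- The half disc at `q` on the side of `z`. It misses the frontier, so it lies inside `C` or
  -- outside `closure C`; a point of the visible segment excludes the first case.
  set S : Set Plane := Metric.ball q r ∩ {y | 0 < det₂ (y - q) e * det₂ (z - q) e} with hS
  have hSconv : Convex ℝ S := by
    refine (convex_ball q r).inter ?_
    intro a ha b hb s t hs ht hst
    simp only [mem_ofPred_eq] at ha hb ⊢
    have e1 : det₂ (s • a + t • b - q) e = s * det₂ (a - q) e + t * det₂ (b - q) e := by
      have : s • a + t • b - q = s • (a - q) + t • (b - q) := by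
        have : q = s • q + t • q := by rw [← add_smul, hst, one_smul]
        nth_rewrite 1 [this]; module
      rw [this, det₂_add_left, det₂_smul_left, det₂_smul_left]
    rw [e1]
    rcases hs.eq_or_lt with h | h
    · have : t = 1 := by linarith
      subst this; subst h; linarith
    · nlinarith
  have hSC : Disjoint S (frontier C) := by
    rw [disjoint_left]
    rintro y ⟨hy, hy0⟩ hyf
    rw [h.frontier_eq, mem_boundary_last] at hyf
    rcases hyf with hj | hj
    · exact hball hy (mem_iUnion.2 hj)
    · rw [segment_eq_image'] at hj
      obtain ⟨s, -, rfl⟩ := hj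
      simp only [mem_ofPred_eq, ← hA, ← hB, ← he] at hy0
      have : det₂ (A + s • e - q) e = 0 := by
        have : A + s • e - q = s • e - (q - A) := by abel
        rw [this, det₂_sub_left, det₂_smul_left, det₂_self, hqA]; ring
      rw [this] at hy0; linarith
  have hline : ∀ b μ : ℝ, det₂ (q + b • (z - q) + μ • e - q) e = b * det₂ (z - q) e := by
    intro b μ
    have : q + b • (z - q) + μ • e - q = b • (z - q) + μ • e := by abel
    rw [this, det₂_add_left, det₂_smul_left, det₂_smul_left, det₂_self]; ring
  have hpos : 0 < det₂ (z - q) e * det₂ (z - q) e := mul_self_pos.2 hdet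
  -- choose the depth `b₀` of the local part
  obtain ⟨b₀, hb₀, hb₀1, hb₀r⟩ : ∃ b₀ : ℝ, 0 < b₀ ∧ b₀ ≤ 1 ∧ b₀ * ‖z - q‖ < r / 2 := by
    have hn : 0 ≤ ‖z - q‖ := norm_nonneg _
    refine ⟨min 1 (r / (4 * (‖z - q‖ + 1))), by positivity, min_le_left _ _, ?_⟩
    calc min 1 (r / (4 * (‖z - q‖ + 1))) * ‖z - q‖ ≤ r / (4 * (‖z - q‖ + 1)) * ‖z - q‖ := by
          gcongr; exact min_le_right _ _
      _ = r / 4 * (‖z - q‖ / (‖z - q‖ + 1)) := by field_simp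
      _ ≤ r / 4 * 1 := by gcongr; rw [div_le_one (by positivity)]; linarith
      _ < r / 2 := by linarith
  have hSout : ∀ y ∈ S, y ∉ closure C := by
    have hnot : ¬ (S ∩ C).Nonempty := by
      intro hne
      have hsub := hSconv.isPreconnected.subset_of_disjoint_frontier h.isOpen hSC hne
      have hmem : q + b₀ • (z - q) ∈ S := by
        refine ⟨?_, ?_⟩
        · rw [Metric.mem_ball, dist_eq_norm, add_sub_cancel_left, norm_smul, Real.norm_of_nonneg hb₀.le]
          linarith
        · have := hline b₀ 0
          simp only [zero_smul, add_zero] at this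
          simp only [mem_ofPred_eq, this]; nlinarith
      exact hz b₀ ⟨hb₀, hb₀1⟩ (subset_closure (hsub hmem))
    intro y hy hyc
    by_cases hyC : y ∈ C
    · exact hnot ⟨y, hy, hyC⟩
    · exact disjoint_left.1 hSC hy (by rw [h.isOpen.frontier_eq]; exact ⟨hyc, hyC⟩)
  -- distance of the far part
  obtain ⟨σ, hσ, hfar⟩ : ∃ σ : ℝ, 0 < σ ∧ ∀ b ∈ Icc b₀ 1, ∀ y, dist y (q + b • (z - q)) < σ →
      y ∉ closure C := by
    have hcomp : IsCompact ((fun b : ℝ => q + b • (z - q)) '' Icc b₀ 1) :=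
      isCompact_Icc.image (by fun_prop)
    have hdis : Disjoint ((fun b : ℝ => q + b • (z - q)) '' Icc b₀ 1) (closure C) := by
      rw [disjoint_left]
      rintro _ ⟨b, hb, rfl⟩
      exact hz b ⟨hb₀.trans_le hb.1, hb.2⟩
    obtain ⟨σ, hσ, hd⟩ := hdis.exists_thickenings hcomp isClosed_closure
    refine ⟨σ, hσ, fun b hb y hy hyc => ?_⟩
    exact disjoint_left.1 hd (Metric.mem_thickening_iff.2 ⟨_, ⟨b, hb, rfl⟩, hy⟩)
      (Metric.self_subset_thickening hσ _ hyc)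
  have hev : ∀ᶠ δ : ℝ in 𝓝[>] 0, δ * ‖e‖ < min ρ (min σ (r / 2)) := by
    have : Continuous (fun δ : ℝ => δ * ‖e‖) := by fun_prop
    have := this.tendsto 0
    simp only [zero_mul] at this
    exact (this.mono_left nhdsWithin_le_nhds).eventually_lt_const (by positivity)
  filter_upwards [hev] with δ hδ b hb μ hμ
  have hμe : ‖μ • e‖ ≤ δ * ‖e‖ := by
    rw [norm_smul]; gcongr; exact abs_le.2 hμ
  have h1 := lt_min_iff.1 hδ
  have h2 := lt_min_iff.1 h1.2
  refine ⟨by linarith, fun hb0 => ?_⟩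
  rcases le_total b b₀ with hbb | hbb
  · apply hSout
    refine ⟨?_, ?_⟩
    · rw [Metric.mem_ball, dist_eq_norm]
      calc ‖q + b • (z - q) + μ • e - q‖ = ‖b • (z - q) + μ • e‖ := by congr 1; abel
        _ ≤ ‖b • (z - q)‖ + ‖μ • e‖ := norm_add_le _ _
        _ ≤ b₀ * ‖z - q‖ + δ * ‖e‖ := by
            gcongr
            rw [norm_smul, Real.norm_of_nonneg hb.1]; gcongr
        _ < r := by linarith
    · simp only [mem_ofPred_eq, hline]
      have : 0 < b := lt_of_le_of_ne hb.1 (Ne.symm hb0)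
      nlinarith
  · apply hfar b ⟨hbb, hb.2⟩
    rw [dist_eq_norm, add_sub_cancel_left]
    linarith

theorem eventually_gt_nhdsGT (a : ℝ) : ∀ᶠ t : ℝ in 𝓝[>] a, a < t := self_mem_nhdsWithin

/-- The inside of a simple closed polygonal curve with vertices in some cyclic order. -/
def IsRegion (C : Set Plane) : Prop := ∃ (m : ℕ) (v : Fin (m + 1) → Plane), IsPolygonRegion C v

theorem exists_thickening_segment {q z : Plane} {U : Set Plane} (hU : IsOpen U)
    (h : segment ℝ q z ⊆ U) : ∃ ρ > 0, ∀ t ∈ Icc (0 : ℝ) 1, ∀ w : Plane, ‖w‖ < ρ →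
      q + t • (z - q) + w ∈ U := by
  have hc : IsCompact (segment ℝ q z) := by
    rw [segment_eq_image']; exact isCompact_Icc.image (by fun_prop)
  obtain ⟨ρ, hρ, hs⟩ := hc.exists_thickening_subset_open hU h
  refine ⟨ρ, hρ, fun t ht w hw => hs (Metric.mem_thickening_iff.2 ⟨q + t • (z - q), ?_, ?_⟩)⟩
  · rw [segment_eq_image']; exact ⟨t, ht, rfl⟩
  · rwa [dist_eq_norm, add_sub_cancel_left]

/-- The base of the attached triangle must be a complete edge. With `e` the vector of the closing
edge, subdividing at `c + δ`, rotating, and subdividing again at ratio `(c - δ) / (c + δ)` isolates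
the edge from `q - δ • e` to `q + δ • e`, over which a thin triangle with tip `z` is glued. -/
theorem IsPolygonRegion.exists_bump {m : ℕ} {C : Set Plane} {v : Fin (m + 1) → Plane}
    (h : IsPolygonRegion C v) {U : Set Plane} (hU : IsOpen U) (hCU : closure C ⊆ U) {q z : Plane}
    (hq : q ∈ openSegment ℝ (v (Fin.last m)) (v 0))
    (hdet : det₂ (z - q) (v 0 - v (Fin.last m)) ≠ 0) (hqz : segment ℝ q z ⊆ U)
    (hz : ∀ t ∈ Ioc (0 : ℝ) 1, q + t • (z - q) ∉ closure C) :
    ∃ C', IsRegion C' ∧ C ⊆ C' ∧ closure C' ⊆ U ∧ ∀ t ∈ Ioo (0 : ℝ) 1, q + t • (z - q) ∈ C' := by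
  obtain ⟨ρ, hρ, hρU⟩ := exists_thickening_segment hU hqz
  set A := v (Fin.last m) with hA
  set B := v 0 with hB
  have hev := exists_thin_triangle h hq hdet hz hρ
  rw [openSegment_eq_image'] at hq
  obtain ⟨c, hc, hqc⟩ := hq
  obtain ⟨δ, hδt, hδ, hδc, hδ1⟩ := (hev.and ((eventually_gt_nhdsGT 0).and
    ((eventually_nhdsWithin_of_eventually_nhds (eventually_lt_nhds hc.1)).and
      (eventually_nhdsWithin_of_eventually_nhds (eventually_lt_nhds
        (show (0 : ℝ) < 1 - c by linarith [hc.2])))))).exists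
  -- subdivide twice
  have hB0 : 0 < c + δ := by linarith [hc.1]
  have h1 := isPolygonRegion_subdivide h (c := c + δ) ⟨hB0, by linarith⟩
  obtain ⟨k, hk⟩ := exists_finRotate_pow_last (m := m + 1) (Fin.last m).castSucc
  have h2 := isPolygonRegion_rotate h1 k
  set w := fun i => snocVertex v (AffineMap.lineMap (v (Fin.last m)) (v 0) (c + δ))
    ((finRotate (m + 1 + 1) ^ k) i) with hw
  have hwl : w (Fin.last (m + 1)) = A := by
    rw [hw]; simp only [hk]; simp [snocVertex, hA]
  have hw0 : w 0 = A + (c + δ) • (B - A) := by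
    have e0 : (0 : Fin (m + 1 + 1)) = finRotate (m + 1 + 1) (Fin.last (m + 1)) := by simp
    have : (finRotate (m + 1 + 1) ^ k) 0 = Fin.last (m + 1) := by
      rw [e0, ← Equiv.Perm.mul_apply, ← pow_succ, pow_succ', Equiv.Perm.mul_apply, hk]
      simp
    rw [hw]
    simp only [this]
    simp [snocVertex, AffineMap.lineMap_apply, hA, hB, add_comm]
  have h3 := isPolygonRegion_subdivide h2 (c := (c - δ) / (c + δ))
    ⟨by apply div_pos <;> linarith, by rw [div_lt_one hB0]; linarith⟩
  set u := snocVertex w (AffineMap.lineMap (w (Fin.last (m + 1))) (w 0) ((c - δ) / (c + δ))) with hu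
  have hul : u (Fin.last _) = q - δ • (B - A) := by
    have : u (Fin.last _) = AffineMap.lineMap (w (Fin.last (m + 1))) (w 0) ((c - δ) / (c + δ)) := by
      simp [hu, snocVertex]
    rw [this, hwl, hw0, AffineMap.lineMap_apply, ← hqc]
    simp only [vsub_eq_sub, vadd_eq_add, add_sub_cancel_left, smul_smul, div_mul_cancel₀ _ hB0.ne']
    module
  have hu0 : u 0 = q + δ • (B - A) := by
    have : u 0 = w 0 := by simp [hu, snocVertex]
    rw [this, hw0, ← hqc]; module
  have hlin : ∀ a b : ℝ, (q - δ • (B - A)) + a • (z - (q - δ • (B - A)))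
      + b • ((q + δ • (B - A)) - (q - δ • (B - A)))
      = q + a • (z - q) + (-δ + a * δ + 2 * δ * b) • (B - A) := by
    intro a b; module
  have hΔ : det₂ (z - (q - δ • (B - A))) ((q + δ • (B - A)) - (q - δ • (B - A))) ≠ 0 := by
    have e1 : (q + δ • (B - A)) - (q - δ • (B - A)) = (2 * δ) • (B - A) := by module
    have e2 : z - (q - δ • (B - A)) = (z - q) + δ • (B - A) := by module
    rw [e1, e2, det₂_smul_right, det₂_add_left, det₂_smul_left, det₂_self]
    have : 2 * δ ≠ 0 := by positivity
    simpa using ⟨hδ.ne', hdet⟩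
  have hmemT : ∀ x ∈ closedTriangle (q - δ • (B - A)) z (q + δ • (B - A)), ∃ a ∈ Icc (0 : ℝ) 1,
      ∃ μ ∈ Icc (-δ) δ, x = q + a • (z - q) + μ • (B - A) := by
    intro x hx
    rw [closedTriangle_eq_image hΔ] at hx
    obtain ⟨⟨a, b⟩, ⟨ha, hb, hab⟩, rfl⟩ := hx
    simp only at ha hb hab ⊢
    refine ⟨a, ⟨ha, by linarith⟩, _, ⟨?_, ?_⟩, hlin a b⟩ <;> nlinarith
  have hbump := isPolygonRegion_bump h3 hul hu0 hΔ (by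
    intro x hx hxC
    obtain ⟨a, ha, μ, hμ, rfl⟩ := hmemT x hx
    have ha0 : a = 0 := by
      by_contra ha0
      exact (hδt a ha μ hμ).2 ha0 hxC
    subst ha0
    rw [segment_eq_image']
    refine ⟨(μ + δ) / (2 * δ), ⟨by apply div_nonneg <;> linarith [hμ.1],
      by rw [div_le_one (by linarith)]; linarith [hμ.2]⟩, ?_⟩
    have e1 : (q + δ • (B - A)) - (q - δ • (B - A)) = (2 * δ) • (B - A) := by module
    simp only [e1, smul_smul, div_mul_cancel₀ _ (show 2 * δ ≠ 0 by positivity)]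
    module)
  refine ⟨_, ⟨_, _, hbump⟩, fun x hx => Or.inl (Or.inl hx), ?_, ?_⟩
  · have hcl : closure (C ∪ openSegment ℝ (q - δ • (B - A)) (q + δ • (B - A)) ∪
        openTriangle (q - δ • (B - A)) z (q + δ • (B - A))) ⊆
        closure C ∪ closedTriangle (q - δ • (B - A)) z (q + δ • (B - A)) := by
      refine closure_minimal ?_ (isClosed_closure.union isClosed_closedTriangle)
      rintro x ((hx | hx) | hx)
      · exact Or.inl (subset_closure hx)
      · refine Or.inr ?_
        rw [mem_openSegment_start_end hΔ] at hx
        exact ⟨by linarith [hx.1], by linarith [hx.2.1], by linarith [hx.1, hx.2.2]⟩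
      · exact Or.inr ⟨hx.1.le, hx.2.1.le, hx.2.2.le⟩
    refine hcl.trans (union_subset hCU fun x hx => ?_)
    obtain ⟨a, ha, μ, hμ, rfl⟩ := hmemT x hx
    exact hρU a ha _ (hδt a ha μ hμ).1
  · intro t ht
    refine Or.inr ?_
    rw [openTriangle_eq_image hΔ]
    refine ⟨(t, (1 - t) / 2), ⟨ht.1, by simp only; linarith [ht.2], by simp only; linarith [ht.2]⟩, ?_⟩
    simp only
    rw [hlin]
    have : -δ + t * δ + 2 * δ * ((1 - t) / 2) = 0 := by ring
    rw [this]; simp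

/-- After a small move of `y`, the line to `z` contains no vertex of the polygon. The last point `q`
of `closure C` on the way to `z` is then interior to an edge that is crossed transversally, and a
thin triangle can be glued there. Its tip is put slightly beyond `z`, so that `z` becomes an
interior point. -/
theorem IsRegion.exists_extension {C : Set Plane} (h : IsRegion C) {U : Set Plane} (hU : IsOpen U)
    (hCU : closure C ⊆ U) {y z : Plane} (hy : y ∈ C) (hz : z ∉ closure C)
    (hyz : segment ℝ y z ⊆ U) : ∃ C', IsRegion C' ∧ C ⊆ C' ∧ closure C' ⊆ U ∧ z ∈ C' := by
  obtain ⟨m, v, h⟩ := h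
  have hfc : frontier C ⊆ closure C := frontier_subset_closure
  have hne : y ≠ z := by rintro rfl; exact hz (subset_closure hy)
  have hvF : ∀ i, v i ∈ frontier C := by
    intro i; rw [h.frontier_eq, mem_polygon_boundary]; exact ⟨i, left_mem_segment _ _ _⟩
  obtain ⟨ρ, hρ, hρU⟩ := exists_thickening_segment hU hyz
  obtain ⟨y', ⟨hy'C, hy'ρ⟩, hy'z, hgen⟩ := exists_generic_start hne (range v) (finite_range v)
    (by rintro ⟨i, rfl⟩; exact hz (hfc (hvF i)))
    (Filter.inter_mem (h.isOpen.mem_nhds hy) (Metric.ball_mem_nhds y hρ))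
  have hy'U : ∀ t ∈ Icc (0 : ℝ) 1, y' + t • (z - y') ∈ U := by
    intro t ht
    have : y' + t • (z - y') = y + t • (z - y) + (1 - t) • (y' - y) := by module
    rw [this]
    refine hρU t ht _ ?_
    rw [norm_smul, Real.norm_of_nonneg (by linarith [ht.2])]
    have : ‖y' - y‖ < ρ := by rwa [← dist_eq_norm]
    nlinarith [ht.1, norm_nonneg (y' - y)]
  obtain ⟨s, hs, hsC, hst⟩ := exists_last_mem_of_isClosed isClosed_closure (subset_closure hy'C) hz
  set q := y' + s • (z - y') with hq
  -- Since `C` is open, a point of `C` would be followed by further points of `C` on the segment,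
  -- against the choice of `q` as the last one.
  have hqC : q ∉ C := by
    intro hqC
    have hc : Continuous (fun t : ℝ => y' + t • (z - y')) := by fun_prop
    have := (hc.tendsto s).eventually (h.isOpen.mem_nhds hqC)
    obtain ⟨t, h1, h2, h3⟩ := ((eventually_nhdsWithin_of_eventually_nhds this).and
      ((eventually_gt_nhdsGT s).and
        (eventually_nhdsWithin_of_eventually_nhds (eventually_lt_nhds hs.2)))).exists
    exact hst t ⟨h2, h3.le⟩ (subset_closure h1)
  have hqf : q ∈ frontier C := by rw [h.isOpen.frontier_eq]; exact ⟨hsC, hqC⟩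
  rw [h.frontier_eq, mem_polygon_boundary] at hqf
  obtain ⟨i, hi⟩ := hqf
  obtain ⟨k, hk⟩ := exists_finRotate_pow_last i
  have h2 := isPolygonRegion_rotate h k
  set w := fun j => v ((finRotate (m + 1) ^ k) j) with hw
  have hwl : w (Fin.last m) = v i := by simp [hw, hk]
  have hw0 : w 0 = v (finRotate (m + 1) i) := by
    have e0 : (0 : Fin (m + 1)) = finRotate (m + 1) (Fin.last m) := by simp
    simp only [hw]
    rw [e0, ← Equiv.Perm.mul_apply, ← pow_succ, pow_succ', Equiv.Perm.mul_apply, hk]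
  rw [← hwl, ← hw0] at hi
  have hgw : ∀ j, det₂ (y' - z) (w j - z) ≠ 0 := fun j => hgen _ ⟨_, rfl⟩
  have hqz : q - z = (1 - s) • (y' - z) := by rw [hq]; module
  have hqdet : det₂ (y' - z) (q - z) = 0 := by rw [hqz, det₂_smul_right, det₂_self, mul_zero]
  have hqo : q ∈ openSegment ℝ (w (Fin.last m)) (w 0) := by
    rw [← insert_endpoints_openSegment] at hi
    rcases hi with hi | hi | hi
    · exact absurd (hi ▸ hqdet) (hgw _)
    · exact absurd (hi ▸ hqdet) (hgw _)
    · exact hi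
  have hdet : det₂ (z - q) (w 0 - w (Fin.last m)) ≠ 0 := by
    intro h0
    have h1 : det₂ (y' - z) (w 0 - w (Fin.last m)) = 0 := by
      have : z - q = (-(1 - s)) • (y' - z) := by rw [neg_smul, ← hqz]; abel
      rw [this, det₂_smul_left] at h0
      exact (mul_eq_zero.1 h0).resolve_left (by linarith [hs.2])
    rw [openSegment_eq_image'] at hqo
    obtain ⟨c, hc, hqc⟩ := hqo
    apply hgw (Fin.last m)
    have : w (Fin.last m) - z = (q - z) - c • (w 0 - w (Fin.last m)) := by rw [← hqc]; module
    rw [this, det₂_sub_right, det₂_smul_right, hqdet, h1]; ring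
  -- extend slightly beyond `z`
  have hopen : IsOpen (U \ closure C) := hU.sdiff isClosed_closure
  have hzU : z ∈ U := hyz (right_mem_segment _ _ _)
  obtain ⟨r, hr, hball⟩ := Metric.isOpen_iff.1 hopen z ⟨hzU, hz⟩
  obtain ⟨κ, hκ, hκr⟩ : ∃ κ > 0, κ * ‖z - q‖ < r := by
    refine ⟨r / (‖z - q‖ + 1), by positivity, ?_⟩
    rw [div_mul_eq_mul_div, div_lt_iff₀ (by positivity)]
    nlinarith [norm_nonneg (z - q)]
  have key : ∀ t ∈ Icc (0 : ℝ) (1 + κ), q + t • (z - q) ∈ U ∧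
      (t ≠ 0 → q + t • (z - q) ∉ closure C) := by
    intro t ht
    rcases le_total t 1 with ht1 | ht1
    · have : q + t • (z - q) = y' + (s + t * (1 - s)) • (z - y') := by rw [hq]; module
      rw [this]
      have h1s : 0 < 1 - s := by linarith [hs.2]
      refine ⟨hy'U _ ⟨by nlinarith [hs.1, ht.1], by nlinarith⟩, fun ht0 => hst _ ⟨?_, by nlinarith⟩⟩
      have : 0 < t := lt_of_le_of_ne ht.1 (Ne.symm ht0)
      nlinarith
    · have : q + t • (z - q) ∈ U \ closure C := by
        apply hball
        have e : q + t • (z - q) - z = (t - 1) • (z - q) := by module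
        rw [Metric.mem_ball, dist_eq_norm, e, norm_smul, Real.norm_of_nonneg (by linarith)]
        calc (t - 1) * ‖z - q‖ ≤ κ * ‖z - q‖ := by gcongr; linarith [ht.2]
          _ < r := hκr
      exact ⟨this.1, fun _ => this.2⟩
  set zp := q + (1 + κ) • (z - q) with hzp
  have hlin : ∀ t : ℝ, q + t • (zp - q) = q + (t * (1 + κ)) • (z - q) := by
    intro t; rw [hzp]; module
  obtain ⟨C', hC', hCC', hC'U, hC't⟩ := h2.exists_bump (z := zp) hU hCU hqo (by
      have : zp - q = (1 + κ) • (z - q) := by rw [hzp]; module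
      rw [this, det₂_smul_left]
      exact mul_ne_zero (by positivity) hdet)
    (by
      rw [segment_eq_image']
      rintro _ ⟨t, ht, rfl⟩
      simp only [hlin]
      exact (key _ ⟨by have := ht.1; positivity, by nlinarith [ht.2]⟩).1)
    (by
      intro t ht
      rw [hlin]
      have := ht.1
      exact (key _ ⟨by positivity, by nlinarith [ht.2]⟩).2 (by positivity))
  refine ⟨C', hC', hCC', hC'U, ?_⟩
  have := hC't (1 / (1 + κ)) ⟨by positivity, by rw [div_lt_one (by positivity)]; linarith⟩
  rw [hlin, one_div_mul_cancel (by positivity), one_smul, add_sub_cancel] at this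
  exact this

theorem IsRegion.isOpen {C : Set Plane} (h : IsRegion C) : IsOpen C := by
  obtain ⟨_, _, h⟩ := h; exact h.isOpen

/-- A point of the closure is approximated by some `c` in `C`, and the region is translated by `z -
c`. A small translation keeps the finite set inside and the closure within `U`. -/
theorem IsRegion.exists_translate {C : Set Plane} (h : IsRegion C) {U : Set Plane} (hU : IsOpen U)
    (hCU : closure C ⊆ U) {F : Set Plane} (hF : F.Finite) (hFC : F ⊆ C) {z : Plane}
    (hz : z ∈ closure C) : ∃ C', IsRegion C' ∧ insert z F ⊆ C' ∧ closure C' ⊆ U := by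
  obtain ⟨m, v, h⟩ := h
  have hcomp : IsCompact (closure C) := h.isBounded.isCompact_closure
  obtain ⟨ρ, hρ, hρU⟩ := hcomp.exists_thickening_subset_open hU hCU
  obtain ⟨ρ', hρ', hρC⟩ := hF.isCompact.exists_thickening_subset_open h.isOpen hFC
  obtain ⟨c, hc, hcd⟩ := Metric.mem_closure_iff.1 hz (min ρ ρ') (by positivity)
  have hc1 := lt_min_iff.1 hcd
  refine ⟨_, ⟨m, _, isPolygonRegion_translate h (z - c)⟩, insert_subset ⟨c, hc, by simp⟩ ?_, ?_⟩
  · intro x hx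
    refine ⟨x - (z - c), hρC (Metric.mem_thickening_iff.2 ⟨x, hx, ?_⟩), by simp⟩
    rw [dist_eq_norm, sub_sub_cancel_left, norm_neg, ← dist_eq_norm]; exact hc1.2
  · have := (Homeomorph.addRight (z - c)).image_closure C
    simp only [Homeomorph.coe_addRight] at this
    rw [← this]
    rintro _ ⟨x, hx, rfl⟩
    refine hρU (Metric.mem_thickening_iff.2 ⟨x, hx, ?_⟩)
    rw [dist_eq_norm, add_sub_cancel_left, ← dist_eq_norm]; exact hc1.1

theorem exists_isRegion_ball (x : Plane) {r : ℝ} (hr : 0 < r) :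
    ∃ C, IsRegion C ∧ closure C ⊆ Metric.ball x r := by
  set A : Plane := x with hA
  set z : Plane := x + EuclideanSpace.single 0 (r / 2) with hzd
  set B : Plane := x + EuclideanSpace.single 1 (r / 2) with hBd
  have hΔ : det₂ (z - A) (B - A) ≠ 0 := by
    simp [det₂, hzd, hBd, hA]; positivity
  refine ⟨openTriangle A z B, ⟨2, _, isPolygonRegion_triangle hΔ⟩, ?_⟩
  rw [closure_openTriangle hΔ, closedTriangle_eq_image hΔ]
  rintro _ ⟨⟨a, b⟩, ⟨ha, hb, hab⟩, rfl⟩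
  simp only at ha hb hab ⊢
  have e : A + a • (z - A) + b • (B - A) - x
      = a • EuclideanSpace.single 0 (r / 2) + b • EuclideanSpace.single 1 (r / 2) := by
    rw [hzd, hBd, hA]; module
  rw [Metric.mem_ball, dist_eq_norm, e]
  refine (norm_add_le _ _).trans_lt ?_
  rw [norm_smul, norm_smul, PiLp.norm_single, PiLp.norm_single,
    Real.norm_of_nonneg ha, Real.norm_of_nonneg hb, Real.norm_of_nonneg (by positivity)]
  nlinarith

/-- Finitely many points of a connected open set of the plane lie in a simple polygon inside it. -/
theorem exists_isOpenSimplePolygon {U : Set Plane} (hU : IsOpen U) (hconn : IsPreconnected U)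
    (hne : U.Nonempty) {F : Set Plane} (hF : F.Finite) (hFU : F ⊆ U) :
    ∃ C, IsOpenSimplePolygon C ∧ F ⊆ C ∧ C ⊆ U := by
  suffices H : ∃ C, IsRegion C ∧ F ⊆ C ∧ closure C ⊆ U by
    obtain ⟨C, ⟨m, v, h⟩, hFC, hCU⟩ := H
    exact ⟨C, h.isOpenSimplePolygon, hFC, subset_closure.trans hCU⟩
  induction F, hF using Set.Finite.induction_on with
  | empty =>
    obtain ⟨x, hx⟩ := hne
    obtain ⟨r, hr, hball⟩ := Metric.isOpen_iff.1 hU x hx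
    obtain ⟨C, hC, hCr⟩ := exists_isRegion_ball x hr
    exact ⟨C, hC, empty_subset _, hCr.trans hball⟩
  | @insert z F _ hF ih =>
    obtain ⟨C, hC, hFC, hCU⟩ := ih ((subset_insert _ _).trans hFU)
    -- The points that can be added to `F`. This set is open and relatively closed in the connected
    -- set `U`: a limit point is reached by a translation if it lies in the closure of a nearby
    -- region, and by an extension otherwise.
    set S : Set Plane := {w | ∃ C, IsRegion C ∧ insert w F ⊆ C ∧ closure C ⊆ U} with hS
    have hSopen : IsOpen S := by
      rw [isOpen_iff_mem_nhds]
      rintro w ⟨C', hC', hw, hC'U⟩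
      filter_upwards [hC'.isOpen.mem_nhds (hw (mem_insert _ _))] with y hy
      exact ⟨C', hC', insert_subset hy ((subset_insert _ _).trans hw), hC'U⟩
    refine hconn.subset_of_closure_inter_subset hSopen ?_ ?_ (hFU (mem_insert _ _))
    · obtain ⟨m, v, h⟩ := hC
      obtain ⟨x, hx⟩ := h.isConnected.nonempty
      exact ⟨x, hCU (subset_closure hx), C, ⟨m, v, h⟩, insert_subset hx hFC, hCU⟩
    · rintro w ⟨hwS, hwU⟩
      obtain ⟨r, hr, hball⟩ := Metric.isOpen_iff.1 hU w hwU
      obtain ⟨y, ⟨C', hC', hy, hC'U⟩, hyd⟩ := Metric.mem_closure_iff.1 hwS r hr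
      have hFC' := (subset_insert _ _).trans hy
      by_cases hwc : w ∈ closure C'
      · exact hC'.exists_translate hU hC'U hF hFC' hwc
      · obtain ⟨C'', h1, h2, h3, h4⟩ := hC'.exists_extension hU hC'U (hy (mem_insert _ _)) hwc
          (((convex_ball w r).segment_subset (by rwa [Metric.mem_ball, dist_comm])
            (Metric.mem_ball_self hr)).trans hball)
        exact ⟨C'', h1, insert_subset h4 (hFC'.trans h2), h3⟩

/-! ### Escape to infinity and the unbounded component. -/

/-- The image of the punctured plane under the radial map that adds `R` to the norm. -/
theorem isConnected_norm_gt (R : ℝ) (hR : 0 ≤ R) : IsConnected {x : Plane | R < ‖x‖} := by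
  have h : IsConnected ({0}ᶜ : Set Plane) :=
    isConnected_compl_singleton_of_one_lt_rank (by
      rw [← Module.finrank_eq_rank]; simp) 0
  have := h.image (fun x => (R / ‖x‖ + 1) • x) (by
    refine ContinuousOn.smul ((ContinuousOn.div continuousOn_const continuous_norm.continuousOn ?_).add
      continuousOn_const) continuousOn_id
    intro x hx; simpa using hx)
  convert this using 1
  ext y
  simp only [mem_ofPred_eq, mem_image, mem_compl_iff, mem_singleton_iff]
  constructor
  · intro hy
    have hy0 : 0 < ‖y‖ := hR.trans_lt hy
    refine ⟨((‖y‖ - R) / ‖y‖) • y, ?_, ?_⟩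
    · rw [smul_eq_zero, not_or]
      exact ⟨by apply ne_of_gt; apply div_pos <;> linarith, by simpa using hy0.ne'⟩
    · have : ‖((‖y‖ - R) / ‖y‖) • y‖ = ‖y‖ - R := by
        rw [norm_smul, Real.norm_of_nonneg (by apply div_nonneg <;> linarith),
          div_mul_cancel₀ _ hy0.ne']
      rw [this, smul_smul]
      have h2 : ‖y‖ - R ≠ 0 := by linarith
      have : (R / (‖y‖ - R) + 1) * ((‖y‖ - R) / ‖y‖) = 1 := by field_simp; ring
      rw [this, one_smul]
  · rintro ⟨x, hx, rfl⟩
    have hx0 : 0 < ‖x‖ := by simpa using hx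
    rw [norm_smul, Real.norm_of_nonneg (by positivity), add_mul, div_mul_cancel₀ _ hx0.ne']
    linarith

/-- The point `z` can be joined to infinity by a closed set that avoids `D`. -/
def Escapes (D : Set Plane) (z : Plane) : Prop :=
  ∃ E : Set Plane, IsPreconnected E ∧ IsClosed E ∧ ¬ Bornology.IsBounded E ∧ z ∈ E ∧ Disjoint E D

/-- The closed escape set has positive distance from the compact set `D`. Translating it by `z' - z`
therefore still avoids everything close to `D`. -/
theorem Escapes.exists_stable {D : Set Plane} (hD : IsCompact D) {z : Plane} (h : Escapes D z) :
    ∃ δ > 0, ∀ (D' : Set Plane) (z' : Plane), D' ⊆ Metric.thickening δ D → dist z z' < δ →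
      Escapes D' z' := by
  obtain ⟨E, hE, hcl, hb, hz, hdis⟩ := h
  obtain ⟨δ, hδ, hd⟩ := hdis.symm.exists_thickenings hD hcl
  refine ⟨δ, hδ, fun D' z' hD' hz' => ⟨(fun x => x + (z' - z)) '' E, hE.image _ (by fun_prop),
    (Homeomorph.addRight (z' - z)).isClosedMap _ hcl, fun hb' => hb ?_, ⟨z, hz, by simp⟩, ?_⟩⟩
  · have := (IsometryEquiv.addRight (-(z' - z))).isometry.lipschitz.isBounded_image hb'
    refine this.subset fun x hx => ⟨_, ⟨x, hx, rfl⟩, ?_⟩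
    simp only [IsometryEquiv.addRight_apply]
    abel
  · rw [disjoint_left]
    rintro _ ⟨x, hx, rfl⟩ hxD
    refine disjoint_left.1 hd (hD' hxD) (Metric.mem_thickening_iff.2 ⟨x, hx, ?_⟩)
    simp only
    rw [dist_eq_norm, add_sub_cancel_left, ← dist_eq_norm, dist_comm]; exact hz'

theorem Escapes.mem_unboundedComponent {D : Set Plane} {z : Plane} (h : Escapes D z) :
    z ∈ unboundedComponent D := by
  obtain ⟨E, hE, hcl, hb, hz, hdis⟩ := h
  have hED : E ⊆ Dᶜ := fun x hx hxD => disjoint_left.1 hdis hx hxD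
  exact ⟨hED hz, fun hb' => hb (hb'.subset (hE.subset_connectedComponentIn hz hED))⟩

/-- Every unbounded component meets the exterior of a large disc that contains `D`, and this
exterior is connected. -/
theorem unboundedComponent_isOpen_isConnected {D : Set Plane} (hD : IsCompact D) :
    IsOpen (unboundedComponent D) ∧ IsConnected (unboundedComponent D) := by
  obtain ⟨R, hR0, hR⟩ : ∃ R, 0 ≤ R ∧ ∀ x ∈ D, ‖x‖ ≤ R := by
    obtain ⟨R, hR⟩ := hD.isBounded.exists_norm_le
    exact ⟨max R 0, le_max_right _ _, fun x hx => (hR x hx).trans (le_max_left _ _)⟩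
  set B : Set Plane := {x | R < ‖x‖} with hB
  have hBc := isConnected_norm_gt R hR0
  have hBD : B ⊆ Dᶜ := fun x hx hxD => (hR x hxD).not_gt hx
  have hBu : ¬ Bornology.IsBounded B := by
    intro hb
    obtain ⟨M, hM⟩ := hb.exists_norm_le
    have hn : ‖(EuclideanSpace.single 0 (max R M + 1) : Plane)‖ = max R M + 1 := by
      rw [PiLp.norm_single, Real.norm_of_nonneg]
      have := le_max_left R M; linarith
    have h1 : (EuclideanSpace.single 0 (max R M + 1) : Plane) ∈ B := by
      simp only [hB, mem_ofPred_eq, hn]; have := le_max_left R M; linarith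
    have h2 := hM _ h1
    rw [hn] at h2
    have := le_max_right R M; linarith
  obtain ⟨b, hb⟩ := hBc.nonempty
  have hcomp : ∀ x ∈ unboundedComponent D, connectedComponentIn Dᶜ x = connectedComponentIn Dᶜ b := by
    rintro x ⟨hxD, hx⟩
    obtain ⟨y, hy, hyB⟩ : ∃ y ∈ connectedComponentIn Dᶜ x, y ∈ B := by
      by_contra! hcon
      apply hx
      refine (Metric.isBounded_closedBall (x := (0 : Plane)) (r := R)).subset fun y hy => ?_
      have := hcon y hy
      simpa [hB] using this
    rw [connectedComponentIn_eq hy]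
    exact (connectedComponentIn_eq (hBc.isPreconnected.subset_connectedComponentIn hyB hBD hb))
  have hbU : ¬ Bornology.IsBounded (connectedComponentIn Dᶜ b) := fun h =>
    hBu (h.subset (hBc.isPreconnected.subset_connectedComponentIn hb hBD))
  have heq : unboundedComponent D = connectedComponentIn Dᶜ b := by
    ext x
    constructor
    · intro hx
      rw [← hcomp x hx]
      exact mem_connectedComponentIn hx.1
    · intro hx
      refine ⟨connectedComponentIn_subset _ _ hx, ?_⟩
      rwa [← connectedComponentIn_eq hx]
  rw [heq]
  exact ⟨hD.isClosed.isOpen_compl.connectedComponentIn,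
    ⟨b, mem_connectedComponentIn (hBD hb)⟩, isPreconnected_connectedComponentIn⟩

/-! ### Escape drawings yield outside-obstacle representations. -/

section Drawing
variable {V : Type*}

theorem mem_straightLineDrawing {G : SimpleGraph V} {p : V → Plane} {x : Plane} :
    x ∈ straightLineDrawing G p ↔ (∃ v, p v = x) ∨ ∃ u v, G.Adj u v ∧ x ∈ segment ℝ (p u) (p v) := by
  simp [straightLineDrawing]

theorem vertex_mem_straightLineDrawing (G : SimpleGraph V) (p : V → Plane) (v : V) :
    p v ∈ straightLineDrawing G p := mem_straightLineDrawing.2 (Or.inl ⟨v, rfl⟩)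

theorem isCompact_straightLineDrawing [Finite V] (G : SimpleGraph V) (p : V → Plane) :
    IsCompact (straightLineDrawing G p) := by
  refine (finite_range p).isCompact.union (isCompact_iUnion fun u => isCompact_iUnion fun v =>
    isCompact_iUnion fun _ => ?_)
  rw [segment_eq_image']; exact isCompact_Icc.image (by fun_prop)

theorem dist_segment_lt {a b a' b' : Plane} {δ : ℝ} (ha : dist a a' < δ) (hb : dist b b' < δ)
    {t : ℝ} (ht : t ∈ Icc (0 : ℝ) 1) : dist (a + t • (b - a)) (a' + t • (b' - a')) < δ := by
  rw [dist_eq_norm] at *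
  have : a + t • (b - a) - (a' + t • (b' - a')) = (1 - t) • (a - a') + t • (b - b') := by module
  rw [this]
  refine (norm_add_le _ _).trans_lt ?_
  rw [norm_smul, norm_smul, Real.norm_of_nonneg ht.1, Real.norm_of_nonneg (by linarith [ht.2])]
  rcases ht.1.eq_or_lt with h | h
  · subst h; simpa using ha
  · nlinarith [ht.2, norm_nonneg (a - a')]

theorem straightLineDrawing_subset_thickening (G : SimpleGraph V) {p p' : V → Plane} {δ : ℝ}
    (h : ∀ v, dist (p v) (p' v) < δ) :
    straightLineDrawing G p' ⊆ Metric.thickening δ (straightLineDrawing G p) := by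
  intro x hx
  rw [Metric.mem_thickening_iff]
  rcases mem_straightLineDrawing.1 hx with ⟨v, rfl⟩ | ⟨u, v, huv, hx⟩
  · exact ⟨p v, vertex_mem_straightLineDrawing G p v, by rw [dist_comm]; exact h v⟩
  · rw [segment_eq_image'] at hx
    obtain ⟨t, ht, rfl⟩ := hx
    refine ⟨p u + t • (p v - p u), mem_straightLineDrawing.2 (Or.inr ⟨u, v, huv, ?_⟩), ?_⟩
    · rw [segment_eq_image']; exact ⟨t, ht, rfl⟩
    · rw [dist_comm]; exact dist_segment_lt (h u) (h v) ht

/-- The closed cone at `x` spanned by `n₁` and `n₂` meets `D` at most in its apex. -/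
def FreeSector (D : Set Plane) (x n₁ n₂ : Plane) : Prop :=
  det₂ n₁ n₂ ≠ 0 ∧ ∀ α β : ℝ, 0 ≤ α → 0 ≤ β → 0 < α + β → x + α • n₁ + β • n₂ ∉ D

/-- A drawing in which every nonedge can be blocked from outside and every vertex lies on the
outer face. -/
structure IsEscapeDrawing (G : SimpleGraph V) (p : V → Plane) : Prop where
  injective : Function.Injective p
  escapes : ∀ u w, u ≠ w → ¬ G.Adj u w →
    ∃ z ∈ segment ℝ (p u) (p w), Escapes (straightLineDrawing G p) z
  sector : ∀ v, ∃ n₁ n₂, FreeSector (straightLineDrawing G p) (p v) n₁ n₂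

theorem Plane.not_collinear {a b c : Plane} (h : det₂ (b - a) (c - a) ≠ 0) :
    ¬ Collinear ℝ {a, b, c} := by
  intro hc
  rw [collinear_iff_of_mem (p₀ := a) (by simp)] at hc
  obtain ⟨v, hv⟩ := hc
  obtain ⟨r, rfl⟩ := hv b (by simp)
  obtain ⟨s, rfl⟩ := hv c (by simp)
  apply h
  simp only [vadd_eq_add, add_sub_cancel_right]
  rw [det₂_smul_left, det₂_smul_right, det₂_self]; ring

theorem eventually_quadratic_ne_zero (a b : ℝ) {c : ℝ} (hc : c ≠ 0) :
    ∀ᶠ t : ℝ in 𝓝[>] 0, a + b * t + c * t ^ 2 ≠ 0 := by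
  have key : ∀ d : ℝ, ∀ f : ℝ → ℝ, d ≠ 0 → Continuous f → f 0 = d → ∀ᶠ t in 𝓝[>] (0 : ℝ), f t ≠ 0 :=
    fun d f hd hf h0 => ((hf.tendsto 0).mono_left nhdsWithin_le_nhds).eventually_ne (h0 ▸ hd)
  by_cases ha : a = 0
  · by_cases hb : b = 0
    · filter_upwards [eventually_gt_nhdsGT 0] with t ht
      subst ha; subst hb; simpa using ⟨hc, ht.ne'⟩
    · filter_upwards [eventually_gt_nhdsGT 0, key b (fun t => b + c * t) hb (by fun_prop) (by simp)]
        with t ht h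
      have : a + b * t + c * t ^ 2 = t * (b + c * t) := by subst ha; ring
      rw [this]; exact mul_ne_zero ht.ne' h
  · exact key a (fun t => a + b * t + c * t ^ 2) ha (by fun_prop) (by simp)

/-- The vertices move with velocities on the parabola `(c, c ^ 2)`, for different values of `c`. The
determinant of a triple is quadratic in time, and its leading coefficient is a Vandermonde
determinant, hence nonzero; all determinants are nonzero for small positive times. -/
theorem exists_generalPosition_perturbation [Finite V] (p : V → Plane) (hp : Function.Injective p)
    {δ : ℝ} (hδ : 0 < δ) : ∃ p' : V → Plane, InGeneralPosition p' ∧ ∀ v, dist (p v) (p' v) < δ := by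
  obtain ⟨n, ⟨e⟩⟩ := Finite.exists_equiv_fin V
  set c : V → ℝ := fun v => ((e v : ℕ) : ℝ) with hcd
  have hc : Function.Injective c := fun u v h => by
    simp only [hcd, Nat.cast_inj] at h; exact e.injective (Fin.ext h)
  set w : V → Plane := fun v => !₂[c v, c v ^ 2] with hw
  have hcont : ∀ v, Filter.Tendsto (fun t : ℝ => p v + t • w v) (𝓝[>] 0) (𝓝 (p v)) := by
    intro v
    have : Continuous (fun t : ℝ => p v + t • w v) := by fun_prop
    have := this.tendsto 0
    simp only [zero_smul, add_zero] at this
    exact this.mono_left nhdsWithin_le_nhds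
  have h1 : ∀ᶠ t : ℝ in 𝓝[>] 0, ∀ v, dist (p v) (p v + t • w v) < δ := by
    rw [Filter.eventually_all]
    intro v
    filter_upwards [(hcont v).eventually (Metric.ball_mem_nhds _ hδ)] with t ht
    rwa [dist_comm]
  have h2 : ∀ᶠ t : ℝ in 𝓝[>] 0, ∀ u v, u ≠ v → p u + t • w u ≠ p v + t • w v := by
    rw [Filter.eventually_all]
    intro u
    rw [Filter.eventually_all]
    intro v
    by_cases huv : u = v
    · simp [huv]
    · filter_upwards [((hcont u).sub (hcont v)).eventually_ne (sub_ne_zero.2 (hp.ne huv))]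
        with t ht _
      exact sub_ne_zero.1 ht
  have h3 : ∀ᶠ t : ℝ in 𝓝[>] 0, ∀ u v x, u ≠ v → u ≠ x → v ≠ x →
      det₂ (p v + t • w v - (p u + t • w u)) (p x + t • w x - (p u + t • w u)) ≠ 0 := by
    simp only [Filter.eventually_all]
    intro u v x huv hux hvx
    have hne : (c v - c u) * (c x - c u) * (c x - c v) ≠ 0 :=
      mul_ne_zero (mul_ne_zero (sub_ne_zero.2 (hc.ne huv.symm)) (sub_ne_zero.2 (hc.ne hux.symm)))
        (sub_ne_zero.2 (hc.ne hvx.symm))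
    filter_upwards [eventually_quadratic_ne_zero (det₂ (p v - p u) (p x - p u))
      (det₂ (p v - p u) (w x - w u) + det₂ (w v - w u) (p x - p u)) hne] with t ht
    convert ht using 1
    simp [det₂, hw]; ring
  obtain ⟨t, h1, h2, h3⟩ := (h1.and (h2.and h3)).exists
  refine ⟨fun v => p v + t • w v, ⟨fun u v h => by_contra fun huv => h2 u v huv h, ?_⟩, h1⟩
  intro u v x huv hux hvx
  exact Plane.not_collinear (h3 u v x huv hux hvx)

/-- Finitely many positive thresholds have a common positive lower bound. -/
theorem exists_pos_forall_of_finite {ι : Type*} [Finite ι] (P : ι → ℝ → Prop)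
    (hmono : ∀ i δ δ', 0 < δ' → δ' ≤ δ → P i δ → P i δ') (h : ∀ i, ∃ δ > 0, P i δ) :
    ∃ δ > 0, ∀ i, P i δ := by
  choose δ hδ hP using h
  have : ∀ᶠ t : ℝ in 𝓝[>] 0, ∀ i, t < δ i := by
    rw [Filter.eventually_all]
    exact fun i => eventually_nhdsWithin_of_eventually_nhds (eventually_lt_nhds (hδ i))
  obtain ⟨t, h1, h2⟩ := ((eventually_gt_nhdsGT 0).and this).exists
  exact ⟨t, h1, fun i => hmono i _ _ h1 (h2 i).le (hP i)⟩

/-- Escaping points persist, at the same parameter of their nonedge, under the perturbation to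
general position. A polygon within the unbounded component that contains one such point for every
nonedge blocks exactly the nonedges. -/
theorem IsEscapeDrawing.hasOutsideObstacleRepresentation [Finite V] {G : SimpleGraph V}
    {p : V → Plane} (h : IsEscapeDrawing G p) : HasOutsideObstacleRepresentation G := by
  have hD := isCompact_straightLineDrawing G p
  obtain ⟨δ, hδ, hstab⟩ := exists_pos_forall_of_finite
    (fun (i : V × V) δ => i.1 ≠ i.2 → ¬ G.Adj i.1 i.2 → ∀ p' : V → Plane,
      (∀ v, dist (p v) (p' v) < δ) → ∃ z ∈ segment ℝ (p' i.1) (p' i.2),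
        Escapes (straightLineDrawing G p') z)
    (fun i δ δ' _ hle hP h1 h2 p' hp' => hP h1 h2 p' fun v => (hp' v).trans_le hle)
    (by
      rintro ⟨u, w⟩
      by_cases huw : u ≠ w ∧ ¬ G.Adj u w
      · obtain ⟨z, hz, hesc⟩ := h.escapes u w huw.1 huw.2
        obtain ⟨δ, hδ, hs⟩ := hesc.exists_stable hD
        rw [segment_eq_image'] at hz
        obtain ⟨t, ht, rfl⟩ := hz
        refine ⟨δ, hδ, fun _ _ p' hp' => ⟨p' u + t • (p' w - p' u), ?_, ?_⟩⟩
        · rw [segment_eq_image']; exact ⟨t, ht, rfl⟩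
        · exact hs _ _ (straightLineDrawing_subset_thickening G hp')
            (dist_segment_lt (hp' u) (hp' w) ht)
      · exact ⟨1, one_pos, fun h1 h2 => absurd ⟨h1, h2⟩ huw⟩)
  obtain ⟨p', hgp, hp'⟩ := exists_generalPosition_perturbation p h.injective hδ
  have hz : ∀ i : V × V, ∃ z : Plane, i.1 ≠ i.2 → ¬ G.Adj i.1 i.2 → z ∈ segment ℝ (p' i.1) (p' i.2) ∧
      Escapes (straightLineDrawing G p') z := by
    intro i
    by_cases hi : i.1 ≠ i.2 ∧ ¬ G.Adj i.1 i.2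
    · obtain ⟨z, h1, h2⟩ := hstab i hi.1 hi.2 p' hp'
      exact ⟨z, fun _ _ => ⟨h1, h2⟩⟩
    · exact ⟨0, fun h1 h2 => absurd ⟨h1, h2⟩ hi⟩
  choose z hz using hz
  obtain ⟨hUo, hUc⟩ := unboundedComponent_isOpen_isConnected (isCompact_straightLineDrawing G p')
  obtain ⟨C, hC, hFC, hCU⟩ := exists_isOpenSimplePolygon hUo hUc.isPreconnected hUc.nonempty
    (F := z '' {i | i.1 ≠ i.2 ∧ ¬ G.Adj i.1 i.2}) (toFinite _) (by
      rintro _ ⟨i, ⟨h1, h2⟩, rfl⟩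
      exact (hz i h1 h2).2.mem_unboundedComponent)
  have hCD : ∀ x ∈ C, x ∉ straightLineDrawing G p' := fun x hx => (hCU hx).1
  have hG : G = visibilityGraph C p' := by
    ext u v
    constructor
    · intro huv
      refine ⟨huv.ne, eq_empty_iff_forall_notMem.2 fun x hx => hCD x hx.2 ?_⟩
      exact mem_straightLineDrawing.2 (Or.inr ⟨u, v, huv, hx.1⟩)
    · rintro ⟨hne, hemp⟩
      by_contra hnadj
      have := hz (u, v) hne hnadj
      exact eq_empty_iff_forall_notMem.1 hemp _ ⟨this.1, hFC ⟨(u, v), ⟨hne, hnadj⟩, rfl⟩⟩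
  refine ⟨p', C, hC, hgp, fun v hv => hCD _ hv (vertex_mem_straightLineDrawing G p' v), hG, ?_⟩
  rwa [← hG]

end Drawing

/-! ### Rooted drawings and their cones. -/

theorem escapes_of_ray {D : Set Plane} {z h n : Plane} (hn : n ≠ 0)
    (hzh : Disjoint (segment ℝ z h) D) (hray : ∀ s : ℝ, 0 ≤ s → h + s • n ∉ D) : Escapes D z := by
  set R : Set Plane := (fun s : ℝ => h + s • n) '' Ici 0 with hR
  have hcl : IsClosed R := by
    have := ((Homeomorph.addLeft h).isClosedEmbedding.comp (isClosedEmbedding_smul_left hn)).isClosedMap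
      _ (isClosed_Ici (a := (0 : ℝ)))
    exact this
  have hhR : h ∈ R := ⟨0, self_mem_Ici, by simp⟩
  refine ⟨segment ℝ z h ∪ R, ?_, ?_, ?_, Or.inl (left_mem_segment _ _ _), ?_⟩
  · exact (convex_segment z h).isPreconnected.union h (right_mem_segment _ _ _) hhR
      (isPreconnected_Ici.image _ (by fun_prop))
  · refine IsClosed.union ?_ hcl
    rw [segment_eq_image']
    exact (isCompact_Icc.image (by fun_prop)).isClosed
  · intro hb
    obtain ⟨M, hM⟩ := (hb.subset subset_union_right).exists_norm_le
    have hn0 : 0 < ‖n‖ := norm_pos_iff.2 hn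
    have hM0 : 0 ≤ M := (norm_nonneg _).trans (hM h hhR)
    have := hM _ ⟨(M + ‖h‖ + 1) / ‖n‖, by rw [mem_Ici]; positivity, rfl⟩
    have h2 : ‖((M + ‖h‖ + 1) / ‖n‖) • n‖ = M + ‖h‖ + 1 := by
      rw [norm_smul, Real.norm_of_nonneg (by positivity), div_mul_cancel₀ _ hn0.ne']
    have h3 := norm_sub_le (h + ((M + ‖h‖ + 1) / ‖n‖) • n) h
    rw [add_sub_cancel_left, h2] at h3
    linarith
  · rw [disjoint_union_left]
    refine ⟨hzh, disjoint_left.2 ?_⟩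
    rintro _ ⟨s, hs, rfl⟩
    exact hray s hs

/-- A drawing with a root on its convex hull that can be squeezed into a thin cone. -/
structure IsRootedDrawing {W : Type*} (G : SimpleGraph W) (p : W → Plane) (r : W) : Prop where
  injective : Function.Injective p
  visible : ∀ u w, u ≠ w → ¬ G.Adj u w → ∃ z ∈ segment ℝ (p u) (p w),
    ∃ h ∉ convexHull ℝ (range p), Disjoint (segment ℝ z h) (straightLineDrawing G p)
  root : ∃ c : Plane, c ≠ 0 ∧ (∀ y ≠ r, 0 < det₂ c (p y - p r)) ∧
    ∀ y ≠ r, ∃ n₁ n₂, FreeSector (straightLineDrawing G p) (p y) n₁ n₂ ∧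
      0 < det₂ c n₁ ∧ 0 < det₂ c n₂

section
variable {W : Type*} {G : SimpleGraph W} {p : W → Plane} {r : W}

theorem straightLineDrawing_subset_of_convex {S : Set Plane} (hS : Convex ℝ S)
    (h : ∀ v, p v ∈ S) : straightLineDrawing G p ⊆ S := by
  intro x hx
  rcases mem_straightLineDrawing.1 hx with ⟨v, rfl⟩ | ⟨u, v, -, hx⟩
  · exact h v
  · exact hS.segment_subset (h u) (h v) hx

theorem convex_cone (c c' x : Plane) (M : ℝ) :
    Convex ℝ {y : Plane | |det₂ c' (y - x)| ≤ M * det₂ c (y - x)} := by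
  have e : {y : Plane | |det₂ c' (y - x)| ≤ M * det₂ c (y - x)} =
      {y | det₂ (M • c - c') x ≤ det₂ (M • c - c') y} ∩ {y | det₂ (M • c + c') x ≤ det₂ (M • c + c') y} := by
    ext y
    simp only [mem_ofPred_eq, mem_inter_iff, abs_le, det₂_sub_right, det₂_sub_left, det₂_add_left,
      det₂_smul_left]
    constructor
    · rintro ⟨h1, h2⟩; constructor <;> linarith
    · rintro ⟨h1, h2⟩; constructor <;> linarith
  rw [e]
  have hl : ∀ a : Plane, IsLinearMap ℝ (det₂ a) := fun a =>
    ⟨fun _ _ => det₂_add_right _ _ _, fun _ _ => det₂_smul_right _ _ _⟩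
  exact (convex_halfSpace_ge (hl _) _).inter (convex_halfSpace_ge (hl _) _)

theorem convex_halfplane (c x : Plane) (k : ℝ) : Convex ℝ {y : Plane | k < det₂ c (y - x)} := by
  have e : {y : Plane | k < det₂ c (y - x)} = {y | k + det₂ c x < det₂ c y} := by
    ext y
    simp only [mem_ofPred_eq, det₂_sub_right]
    constructor <;> intro h <;> linarith
  rw [e]
  exact convex_halfSpace_gt ⟨fun _ _ => det₂_add_right _ _ _, fun _ _ => det₂_smul_right _ _ _⟩ _

/-- In a rooted drawing the blocking points can be joined to infinity inside the half plane of the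
root. -/
theorem exists_ray_of_visible [Finite W] {c : Plane} (hc : ∀ y ≠ r, 0 < det₂ c (p y - p r))
    {z h : Plane} (hz : z ∈ convexHull ℝ (range p)) (hh : h ∉ convexHull ℝ (range p))
    (hzh : Disjoint (segment ℝ z h) (straightLineDrawing G p)) :
    ∃ h', h' ∈ segment ℝ z h ∧ 0 < det₂ c (z - p r) ∧ 0 < det₂ c (h' - p r) ∧
      ∀ s : ℝ, 0 ≤ s → h' + s • (h' - p r) ∉ convexHull ℝ (range p) := by
  have hpr : p r ∈ convexHull ℝ (range p) := subset_convexHull _ _ ⟨r, rfl⟩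
  have hrD := vertex_mem_straightLineDrawing G p r
  have hsegr : ∀ x ∈ segment ℝ z h, x ≠ p r := by
    rintro x hx rfl
    exact disjoint_left.1 hzh hx hrD
  -- The open half plane together with the single point `p r` of its boundary line is convex, so it
  -- contains the hull.
  have hpos : ∀ x ∈ convexHull ℝ (range p), x ≠ p r → 0 < det₂ c (x - p r) := by
    have hconv : Convex ℝ ({p r} ∪ {y | 0 < det₂ c (y - p r)}) := by
      rw [convex_iff_forall_pos]
      have hsc : ∀ (a b : ℝ) (x y : Plane), a + b = 1 → det₂ c (a • x + b • y - p r)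
          = a * det₂ c (x - p r) + b * det₂ c (y - p r) := by
        intro a b x y hab
        have : a • x + b • y - p r = a • (x - p r) + b • (y - p r) := by
          have : p r = a • p r + b • p r := by rw [← add_smul, hab, one_smul]
          nth_rewrite 1 [this]; module
        rw [this, det₂_add_right, det₂_smul_right, det₂_smul_right]
      have h0 : det₂ c (p r - p r) = 0 := by simp
      rintro x (hx | hx) y (hy | hy) a b ha hb hab
      · rw [mem_singleton_iff] at hx hy
        subst hx; subst hy
        left; rw [← add_smul, hab, one_smul]; rfl
      · rw [mem_singleton_iff] at hx
        subst hx
        right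
        simp only [mem_ofPred_eq] at hy ⊢
        rw [hsc _ _ _ _ hab, h0]; nlinarith [mul_pos hb hy]
      · rw [mem_singleton_iff] at hy
        subst hy
        right
        simp only [mem_ofPred_eq] at hx ⊢
        rw [hsc _ _ _ _ hab, h0]; nlinarith [mul_pos ha hx]
      · right
        simp only [mem_ofPred_eq] at hx hy ⊢
        rw [hsc _ _ _ _ hab]; nlinarith [mul_pos ha hx, mul_pos hb hy]
    intro x hx hxr
    have := convexHull_min (t := {p r} ∪ {y | 0 < det₂ c (y - p r)}) (by
      rintro _ ⟨y, rfl⟩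
      by_cases hy : y = r
      · exact Or.inl (by rw [hy]; rfl)
      · exact Or.inr (hc y hy)) hconv hx
    exact this.resolve_left hxr
  have hz0 := hpos z hz (hsegr z (left_mem_segment _ _ _))
  have hcl : IsClosed (convexHull ℝ (range p)) :=
    ((finite_range p).isCompact_convexHull ℝ).isClosed
  -- a point outside the hull on the positive side
  obtain ⟨h', hh'seg, hh', hh'0⟩ : ∃ h' ∈ segment ℝ z h, h' ∉ convexHull ℝ (range p) ∧
      0 < det₂ c (h' - p r) := by
    by_cases hh0 : 0 < det₂ c (h - p r)
    · exact ⟨h, right_mem_segment _ _ _, hh, hh0⟩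
    · rw [not_lt] at hh0
      set a := det₂ c (z - p r) with ha
      set b := det₂ c (h - p r) with hb
      set t₀ := a / (a - b) with ht₀
      have hab : 0 < a - b := by linarith
      have hval : ∀ t : ℝ, det₂ c (z + t • (h - z) - p r) = a - t * (a - b) := by
        intro t
        have : z + t • (h - z) - p r = (z - p r) + t • ((h - p r) - (z - p r)) := by module
        have e2 : det₂ c ((h - p r) - (z - p r)) = b - a := det₂_sub_right _ _ _
        rw [this, det₂_add_right, det₂_smul_right, e2, ← ha]; ring
      have ht0 : 0 < t₀ := div_pos hz0 hab
      have ht1 : t₀ ≤ 1 := by rw [ht₀, div_le_one hab]; linarith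
      have hseg : ∀ t, 0 ≤ t → t ≤ t₀ → z + t • (h - z) ∈ segment ℝ z h := by
        intro t h0 h1
        rw [segment_eq_image']; exact ⟨t, ⟨h0, h1.trans ht1⟩, rfl⟩
      -- At `t₀` the segment crosses the line through the root. The hull meets this line only in `p
      -- r`, which belongs to the drawing, so the crossing point is outside the hull; points
      -- slightly before it are still outside and on the positive side.
      have hq : z + t₀ • (h - z) ∉ convexHull ℝ (range p) := by
        intro hq
        have := hpos _ hq (hsegr _ (hseg _ ht0.le le_rfl))
        rw [hval, ht₀, div_mul_cancel₀ _ hab.ne', sub_self] at this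
        exact lt_irrefl _ this
      have hcont : Continuous (fun t : ℝ => z + t • (h - z)) := by fun_prop
      have hev := (hcont.tendsto t₀).eventually (hcl.isOpen_compl.mem_nhds hq)
      obtain ⟨t, h1, h2, h3⟩ := ((eventually_nhdsWithin_of_eventually_nhds (s := Iio t₀) hev).and
        ((eventually_nhdsWithin_of_eventually_nhds (eventually_gt_nhds ht0)).and
          (self_mem_nhdsWithin : Iio t₀ ∈ 𝓝[<] t₀))).exists
      refine ⟨_, hseg t h2.le (le_of_lt h3), h1, ?_⟩
      rw [hval]
      have : t * (a - b) < t₀ * (a - b) := mul_lt_mul_of_pos_right h3 hab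
      rw [ht₀, div_mul_cancel₀ _ hab.ne'] at this
      linarith
  -- If a point of the ray were in the hull, then so would be `h'`, which lies between it and `p r`.
  refine ⟨h', hh'seg, hz0, hh'0, fun s hs hcon => hh' ?_⟩
  have := (convex_convexHull ℝ (range p)).segment_subset hpr hcon
  apply this
  rw [segment_eq_image']
  refine ⟨1 / (1 + s), ⟨by positivity, by rw [div_le_one (by positivity)]; linarith⟩, ?_⟩
  have : h' + s • (h' - p r) - p r = (1 + s) • (h' - p r) := by module
  simp only [this, smul_smul]
  rw [one_div_mul_cancel (by positivity), one_smul]; abel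

/-- Here `c'` is `c` turned by a right angle, so `det₂ c` and `det₂ c'` serve as coordinates at the
root. Only finitely many vertices, exit points and sector directions occur, all with positive
`c`-coordinate except the root itself; one slope `M` works for all of them. -/
theorem IsRootedDrawing.exists_cone [Finite W] (h : IsRootedDrawing G p r) :
    ∃ c c' : Plane, det₂ c c' ≠ 0 ∧ (∀ y ≠ r, 0 < det₂ c (p y - p r)) ∧ ∃ M : ℝ, 0 < M ∧
      (∀ y, |det₂ c' (p y - p r)| ≤ M * det₂ c (p y - p r)) ∧
      (∀ u w, u ≠ w → ¬ G.Adj u w → ∃ z ∈ segment ℝ (p u) (p w), ∃ h,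
        Disjoint (segment ℝ z h) (straightLineDrawing G p) ∧ 0 < det₂ c (z - p r) ∧
        0 < det₂ c (h - p r) ∧ |det₂ c' (h - p r)| ≤ M * det₂ c (h - p r) ∧
        ∀ s : ℝ, 0 ≤ s → h + s • (h - p r) ∉ straightLineDrawing G p) ∧
      ∀ y ≠ r, ∃ n₁ n₂, FreeSector (straightLineDrawing G p) (p y) n₁ n₂ ∧
        0 < det₂ c n₁ ∧ 0 < det₂ c n₂ ∧ |det₂ c' n₁| ≤ M * det₂ c n₁ ∧ |det₂ c' n₂| ≤ M * det₂ c n₂ := by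
  obtain ⟨c, hc0, hc, hsec⟩ := h.root
  have hc' : det₂ c !₂[-c 1, c 0] ≠ 0 := by
    simp only [det₂]
    intro h0
    simp at h0
    apply hc0
    have h1 : c 0 = 0 := by nlinarith [sq_nonneg (c 0), sq_nonneg (c 1)]
    have h2 : c 1 = 0 := by nlinarith [sq_nonneg (c 0), sq_nonneg (c 1)]
    exact Plane.ext' (by simpa using h1) (by simpa using h2)
  set c' : Plane := !₂[-c 1, c 0]
  have hM : ∀ x : Plane, 0 < det₂ c x → ∀ᶠ M : ℝ in Filter.atTop, |det₂ c' x| ≤ M * det₂ c x := by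
    intro x hx
    filter_upwards [Filter.eventually_ge_atTop (|det₂ c' x| / det₂ c x)] with M hM
    rwa [div_le_iff₀ hx] at hM
  have h1 : ∀ᶠ M : ℝ in Filter.atTop, ∀ y, |det₂ c' (p y - p r)| ≤ M * det₂ c (p y - p r) := by
    rw [Filter.eventually_all]
    intro y
    by_cases hy : y = r
    · subst hy; simp
    · exact hM _ (hc y hy)
  have hhull : ∀ x ∈ straightLineDrawing G p, x ∈ convexHull ℝ (range p) := fun x hx =>
    straightLineDrawing_subset_of_convex (convex_convexHull ℝ _)
      (fun v => subset_convexHull _ _ (mem_range_self v)) hx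
  have h2 : ∀ᶠ M : ℝ in Filter.atTop, ∀ u w, u ≠ w → ¬ G.Adj u w → ∃ z ∈ segment ℝ (p u) (p w), ∃ h,
        Disjoint (segment ℝ z h) (straightLineDrawing G p) ∧ 0 < det₂ c (z - p r) ∧
        0 < det₂ c (h - p r) ∧ |det₂ c' (h - p r)| ≤ M * det₂ c (h - p r) ∧
        ∀ s : ℝ, 0 ≤ s → h + s • (h - p r) ∉ straightLineDrawing G p := by
    simp only [Filter.eventually_all]
    intro u w huw hadj
    obtain ⟨z, hz, k, hk, hzk⟩ := h.visible u w huw hadj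
    have hzc : z ∈ convexHull ℝ (range p) := (convex_convexHull ℝ (range p)).segment_subset
      (subset_convexHull _ _ (mem_range_self u)) (subset_convexHull _ _ (mem_range_self w)) hz
    obtain ⟨k', hk', hz0, hk0, hray⟩ := exists_ray_of_visible hc hzc hk hzk
    filter_upwards [hM _ hk0] with M hM
    exact ⟨z, hz, k', hzk.mono_left ((convex_segment z k).segment_subset (left_mem_segment _ _ _) hk'),
      hz0, hk0, hM, fun s hs hD => hray s hs (hhull _ hD)⟩
  have h3 : ∀ᶠ M : ℝ in Filter.atTop, ∀ y ≠ r, ∃ n₁ n₂, FreeSector (straightLineDrawing G p) (p y) n₁ n₂ ∧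
        0 < det₂ c n₁ ∧ 0 < det₂ c n₂ ∧ |det₂ c' n₁| ≤ M * det₂ c n₁ ∧ |det₂ c' n₂| ≤ M * det₂ c n₂ := by
    simp only [Filter.eventually_all]
    intro y hy
    obtain ⟨n₁, n₂, hf, hn₁, hn₂⟩ := hsec y hy
    filter_upwards [hM _ hn₁, hM _ hn₂] with M hM₁ hM₂
    exact ⟨n₁, n₂, hf, hn₁, hn₂, hM₁, hM₂⟩
  obtain ⟨M, hM0, h1, h2, h3⟩ := ((Filter.eventually_gt_atTop 0).and (h1.and (h2.and h3))).exists
  exact ⟨c, c', hc', hc, M, hM0, h1, h2, h3⟩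

/-- Inside a free sector there is a free sector with a generic axis. -/
theorem FreeSector.exists_generic {D : Set Plane} {x n₁ n₂ : Plane} (h : FreeSector D x n₁ n₂)
    {F : Set Plane} (hF : F.Finite) (hxF : x ∉ F) : ∃ d d' : Plane, det₂ d d' ≠ 0 ∧
      (∀ a b : ℝ, 0 < a → |b| ≤ a → x + a • d + b • d' ∉ D) ∧ ∀ q ∈ F, det₂ d (q - x) ≠ 0 := by
  have hev : ∀ᶠ t : ℝ in 𝓝[>] 0, ∀ q ∈ F, det₂ (n₁ + t • n₂) (q - x) ≠ 0 := by
    rw [Filter.eventually_all_finite hF]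
    intro q hq
    have hlin : ∀ t : ℝ, det₂ (n₁ + t • n₂) (q - x) = det₂ n₁ (q - x) + t * det₂ n₂ (q - x) := by
      intro t; rw [det₂_add_left, det₂_smul_left]
    by_cases h0 : det₂ n₁ (q - x) = 0
    · have h1 : det₂ n₂ (q - x) ≠ 0 := by
        intro h1
        apply hxF
        have hd := h.1
        simp only [det₂, PiLp.sub_apply] at h0 h1 hd
        have ha : q 0 - x 0 = 0 := by
          have : (q 0 - x 0) * (n₁ 0 * n₂ 1 - n₁ 1 * n₂ 0) = 0 := by
            linear_combination n₂ 0 * h0 - n₁ 0 * h1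
          exact (mul_eq_zero.1 this).resolve_right hd
        have hb : q 1 - x 1 = 0 := by
          have : (q 1 - x 1) * (n₁ 0 * n₂ 1 - n₁ 1 * n₂ 0) = 0 := by
            linear_combination n₂ 1 * h0 - n₁ 1 * h1
          exact (mul_eq_zero.1 this).resolve_right hd
        have : q = x := Plane.ext' (by linarith) (by linarith)
        exact this ▸ hq
      filter_upwards [eventually_gt_nhdsGT 0] with t ht
      rw [hlin, h0, zero_add]
      exact mul_ne_zero ht.ne' h1
    · have hc : Continuous (fun t : ℝ => det₂ (n₁ + t • n₂) (q - x)) := by fun_prop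
      have := (hc.tendsto 0).mono_left (nhdsWithin_le_nhds (s := Ioi 0))
      simp only [zero_smul, add_zero] at this
      exact this.eventually_ne h0
  obtain ⟨t, ht, hq⟩ := ((eventually_gt_nhdsGT 0).and hev).exists
  -- With this axis and width, the point with coordinates `a`, `b` is `a • n₁ + (t * (a + b)) • n₂`,
  -- which lies in the given cone as long as `|b| ≤ a`.
  refine ⟨n₁ + t • n₂, t • n₂, ?_, ?_, hq⟩
  · rw [det₂_smul_right, det₂_add_left, det₂_smul_left, det₂_self]
    simpa using ⟨ht.ne', h.1⟩
  · intro a b ha hb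
    have : x + a • (n₁ + t • n₂) + b • t • n₂ = x + a • n₁ + (t * (a + b)) • n₂ := by module
    rw [this]
    have : 0 ≤ a + b := by linarith [(abs_le.1 hb).1]
    exact h.2 _ _ ha.le (by positivity) (by positivity)

end

/-! ### Gluing a rooted drawing at a vertex. -/

section
variable {V V₁ V₂ : Type*} {G : SimpleGraph V} {G₁ : SimpleGraph V₁} {G₂ : SimpleGraph V₂}

theorem exists_common_extension {α : Type*} (i₁ : V₁ → V) (i₂ : V₂ → V) (hi₁ : Function.Injective i₁)
    (hi₂ : Function.Injective i₂) (p : V₁ → α) (q : V₂ → α) (h : ∀ a b, i₁ a = i₂ b → p a = q b)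
    [Nonempty α] : ∃ P : V → α, (∀ a, P (i₁ a) = p a) ∧ ∀ b, P (i₂ b) = q b := by
  classical
  refine ⟨fun x => if h : ∃ a, i₁ a = x then p h.choose else
    if h : ∃ b, i₂ b = x then q h.choose else Classical.arbitrary α, fun a => ?_, fun b => ?_⟩
  · have he : ∃ a', i₁ a' = i₁ a := ⟨a, rfl⟩
    simp only [he, dite_true]
    rw [hi₁ he.choose_spec]
  · by_cases he : ∃ a, i₁ a = i₂ b
    · simp only [he, dite_true]
      exact h _ _ he.choose_spec
    · have he' : ∃ b', i₂ b' = i₂ b := ⟨b, rfl⟩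
      simp only [he, dite_false, he', dite_true]
      rw [hi₂ he'.choose_spec]

theorem straightLineDrawing_eq_union (i₁ : G₁ ↪g G) (i₂ : G₂ ↪g G)
    (hcov : ∀ x, (∃ a, i₁ a = x) ∨ ∃ b, i₂ b = x)
    (hadj : ∀ a b, G.Adj (i₁ a) (i₂ b) → (∃ b', i₁ a = i₂ b') ∨ ∃ a', i₁ a' = i₂ b) (P : V → Plane) :
    straightLineDrawing G P =
      straightLineDrawing G₁ (fun a => P (i₁ a)) ∪ straightLineDrawing G₂ (fun b => P (i₂ b)) := by
  apply Subset.antisymm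
  · intro x hx
    rcases mem_straightLineDrawing.1 hx with ⟨u, rfl⟩ | ⟨u, w, huw, hx⟩
    · rcases hcov u with ⟨a, rfl⟩ | ⟨b, rfl⟩
      · exact Or.inl (mem_straightLineDrawing.2 (Or.inl ⟨a, rfl⟩))
      · exact Or.inr (mem_straightLineDrawing.2 (Or.inl ⟨b, rfl⟩))
    · have key : ∀ a b, G.Adj (i₁ a) (i₂ b) → x ∈ segment ℝ (P (i₁ a)) (P (i₂ b)) →
          x ∈ straightLineDrawing G₁ (fun a => P (i₁ a)) ∪ straightLineDrawing G₂ (fun b => P (i₂ b)) := by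
        intro a b hab hx
        rcases hadj a b hab with ⟨b', hb⟩ | ⟨a', ha⟩
        · rw [hb] at hab hx
          exact Or.inr (mem_straightLineDrawing.2 (Or.inr ⟨b', b, i₂.map_adj_iff.1 hab, hx⟩))
        · rw [← ha] at hab hx
          exact Or.inl (mem_straightLineDrawing.2 (Or.inr ⟨a, a', i₁.map_adj_iff.1 hab, hx⟩))
      rcases hcov u with ⟨a, rfl⟩ | ⟨a, rfl⟩ <;> rcases hcov w with ⟨b, rfl⟩ | ⟨b, rfl⟩
      · exact Or.inl (mem_straightLineDrawing.2 (Or.inr ⟨a, b, i₁.map_adj_iff.1 huw, hx⟩))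
      · exact key _ _ huw hx
      · exact key _ _ huw.symm (by rwa [segment_symm])
      · exact Or.inr (mem_straightLineDrawing.2 (Or.inr ⟨a, b, i₂.map_adj_iff.1 huw, hx⟩))
  · rintro x (hx | hx)
    · rcases mem_straightLineDrawing.1 hx with ⟨u, rfl⟩ | ⟨u, w, huw, hx⟩
      · exact mem_straightLineDrawing.2 (Or.inl ⟨_, rfl⟩)
      · exact mem_straightLineDrawing.2 (Or.inr ⟨_, _, i₁.map_adj_iff.2 huw, hx⟩)
    · rcases mem_straightLineDrawing.1 hx with ⟨u, rfl⟩ | ⟨u, w, huw, hx⟩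
      · exact mem_straightLineDrawing.2 (Or.inl ⟨_, rfl⟩)
      · exact mem_straightLineDrawing.2 (Or.inr ⟨_, _, i₂.map_adj_iff.2 huw, hx⟩)

theorem plane_basis_eq {d d' : Plane} (h : det₂ d d' ≠ 0) (u : Plane) :
    u = (det₂ u d' / det₂ d d') • d + (det₂ d u / det₂ d d') • d' := by
  apply Plane.ext' <;>
  · simp only [PiLp.add_apply, PiLp.smul_apply, smul_eq_mul]
    rw [div_mul_eq_mul_div, div_mul_eq_mul_div, ← add_div, eq_div_iff h]
    simp only [det₂]; ring

theorem isClosed_sector {x n₁ n₂ : Plane} (h : det₂ n₁ n₂ ≠ 0) :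
    IsClosed {y : Plane | ∃ α β : ℝ, 0 ≤ α ∧ 0 ≤ β ∧ y = x + α • n₁ + β • n₂} := by
  have e : {y : Plane | ∃ α β : ℝ, 0 ≤ α ∧ 0 ≤ β ∧ y = x + α • n₁ + β • n₂} =
      {y | 0 ≤ det₂ (y - x) n₂ / det₂ n₁ n₂} ∩ {y | 0 ≤ det₂ n₁ (y - x) / det₂ n₁ n₂} := by
    ext y
    constructor
    · rintro ⟨α, β, hα, hβ, rfl⟩
      have e1 : x + α • n₁ + β • n₂ - x = α • n₁ + β • n₂ := by abel
      constructor
      · simp only [mem_ofPred_eq, e1, det₂_add_left, det₂_smul_left, det₂_self, mul_zero, add_zero]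
        rwa [mul_div_cancel_right₀ _ h]
      · simp only [mem_ofPred_eq, e1, det₂_add_right, det₂_smul_right, det₂_self, mul_zero, zero_add]
        rwa [mul_div_cancel_right₀ _ h]
    · rintro ⟨h1, h2⟩
      refine ⟨_, _, h1, h2, ?_⟩
      rw [add_assoc, ← plane_basis_eq h (y - x)]; abel
  rw [e]
  exact (isClosed_le continuous_const (by fun_prop)).inter (isClosed_le continuous_const (by fun_prop))

/-- One radius `δ` such that adding anything within distance `δ` of `p₁ v` does no harm: the
blocking points of nonedges persist, even with slightly moved ends, and the closed empty sectors at
the other vertices do not contain `p₁ v`, hence miss a disc around it. -/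
theorem IsEscapeDrawing.exists_stable [Finite V₁] {p₁ : V₁ → Plane} (h₁ : IsEscapeDrawing G₁ p₁)
    (v : V₁) : ∃ δ > 0,
      (∀ a b, a ≠ b → ¬ G₁.Adj a b → ∃ t ∈ Icc (0 : ℝ) 1, ∀ (D' : Set Plane) (z' : Plane),
        D' ⊆ Metric.thickening δ (straightLineDrawing G₁ p₁) →
        dist (p₁ a + t • (p₁ b - p₁ a)) z' < δ → Escapes D' z') ∧
      ∀ a ≠ v, ∃ n₁ n₂, FreeSector (straightLineDrawing G₁ p₁) (p₁ a) n₁ n₂ ∧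
        ∀ α β : ℝ, 0 ≤ α → 0 ≤ β → p₁ a + α • n₁ + β • n₂ ∉ Metric.ball (p₁ v) δ := by
  have hD := isCompact_straightLineDrawing G₁ p₁
  have hthick : ∀ δ δ' : ℝ, δ' ≤ δ → Metric.thickening δ' (straightLineDrawing G₁ p₁) ⊆
      Metric.thickening δ (straightLineDrawing G₁ p₁) := fun _ _ h => Metric.thickening_mono h _
  obtain ⟨δ, hδ, hs⟩ := exists_pos_forall_of_finite
    (fun (i : V₁ × V₁) δ => i.1 ≠ i.2 → ¬ G₁.Adj i.1 i.2 → ∃ t ∈ Icc (0 : ℝ) 1, ∀ (D' : Set Plane) (z' : Plane),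
        D' ⊆ Metric.thickening δ (straightLineDrawing G₁ p₁) →
        dist (p₁ i.1 + t • (p₁ i.2 - p₁ i.1)) z' < δ → Escapes D' z')
    (fun i δ δ' _ hle hP h1 h2 => by
      obtain ⟨t, ht, h⟩ := hP h1 h2
      exact ⟨t, ht, fun D' z' hD' hz' => h D' z' (hD'.trans (hthick _ _ hle)) (hz'.trans_le hle)⟩)
    (by
      rintro ⟨u, w⟩
      by_cases huw : u ≠ w ∧ ¬ G₁.Adj u w
      · obtain ⟨z, hz, hesc⟩ := h₁.escapes u w huw.1 huw.2
        obtain ⟨δ, hδ, hs⟩ := hesc.exists_stable hD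
        rw [segment_eq_image'] at hz
        obtain ⟨t, ht, rfl⟩ := hz
        exact ⟨δ, hδ, fun _ _ => ⟨t, ht, hs⟩⟩
      · exact ⟨1, one_pos, fun h1 h2 => absurd ⟨h1, h2⟩ huw⟩)
  obtain ⟨δ', hδ', hs'⟩ := exists_pos_forall_of_finite
    (fun (a : V₁) δ => a ≠ v → ∃ n₁ n₂, FreeSector (straightLineDrawing G₁ p₁) (p₁ a) n₁ n₂ ∧
        ∀ α β : ℝ, 0 ≤ α → 0 ≤ β → p₁ a + α • n₁ + β • n₂ ∉ Metric.ball (p₁ v) δ)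
    (fun a δ δ' _ hle hP h1 => by
      obtain ⟨n₁, n₂, hf, h⟩ := hP h1
      exact ⟨n₁, n₂, hf, fun α β hα hβ hb => h α β hα hβ (Metric.ball_subset_ball hle hb)⟩)
    (by
      intro a
      by_cases hav : a = v
      · exact ⟨1, one_pos, fun h => absurd hav h⟩
      · obtain ⟨n₁, n₂, hf⟩ := h₁.sector a
        have hmem : p₁ v ∈ {y : Plane | ∃ α β : ℝ, 0 ≤ α ∧ 0 ≤ β ∧ y = p₁ a + α • n₁ + β • n₂}ᶜ := by
          rintro ⟨α, β, hα, hβ, he⟩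
          rcases (add_nonneg hα hβ).eq_or_lt with h0 | h0
          · have hα0 : α = 0 := by linarith
            have hβ0 : β = 0 := by linarith
            apply hav
            apply h₁.injective
            rw [he, hα0, hβ0, zero_smul, zero_smul, add_zero, add_zero]
          · exact hf.2 α β hα hβ h0 (he ▸ vertex_mem_straightLineDrawing G₁ p₁ v)
        obtain ⟨δ, hδ, hb⟩ := Metric.isOpen_iff.1 (isClosed_sector hf.1).isOpen_compl _ hmem
        exact ⟨δ, hδ, fun _ => ⟨n₁, n₂, hf, fun α β hα hβ hx => hb hx ⟨α, β, hα, hβ, rfl⟩⟩⟩)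
  refine ⟨min δ δ', lt_min hδ hδ', fun a b hab hadj => ?_, fun a ha => ?_⟩
  · obtain ⟨t, ht, h⟩ := hs (a, b) hab hadj
    exact ⟨t, ht, fun D' z' hD' hz' => h D' z' (hD'.trans (hthick _ _ (min_le_left _ _)))
      (hz'.trans_le (min_le_left _ _))⟩
  · obtain ⟨n₁, n₂, hf, h⟩ := hs' a ha
    exact ⟨n₁, n₂, hf, fun α β hα hβ hb => h α β hα hβ (Metric.ball_subset_ball (min_le_right _ _) hb)⟩

theorem eventually_mul_lt (a : ℝ) {b : ℝ} (hb : 0 < b) : ∀ᶠ t : ℝ in 𝓝[>] 0, t * a < b := by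
  have : Continuous (fun t : ℝ => t * a) := by fun_prop
  have := this.tendsto 0
  simp only [zero_mul] at this
  exact (this.mono_left nhdsWithin_le_nhds).eventually_lt_const hb

theorem plane_basis_inj {d d' : Plane} (h : det₂ d d' ≠ 0) {a b a' b' : ℝ}
    (he : a • d + b • d' = a' • d + b' • d') : a = a' ∧ b = b' := by
  have h1 := congrArg (fun u => det₂ u d') he
  have h2 := congrArg (fun u => det₂ d u) he
  simp only [det₂_add_left, det₂_add_right, det₂_smul_left, det₂_smul_right, det₂_self, mul_zero,
    add_zero, zero_add] at h1 h2
  exact ⟨mul_right_cancel₀ h h1, mul_right_cancel₀ h h2⟩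

/-- A rooted drawing can be glued into a free sector of an escape drawing. -/
theorem IsEscapeDrawing.exists_glue [Finite V₁] [Finite V₂] {p₁ : V₁ → Plane} {p₂ : V₂ → Plane}
    {v : V₁} {r : V₂} (h₁ : IsEscapeDrawing G₁ p₁) (h₂ : IsRootedDrawing G₂ p₂ r) (i₁ : G₁ ↪g G)
    (i₂ : G₂ ↪g G) (hvr : i₁ v = i₂ r) (hdisj : ∀ a b, i₁ a = i₂ b → b = r)
    (hcov : ∀ x, (∃ a, i₁ a = x) ∨ ∃ b, i₂ b = x)
    (hnadj : ∀ a b, a ≠ v → b ≠ r → ¬ G.Adj (i₁ a) (i₂ b)) : ∃ P, IsEscapeDrawing G P := by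
  obtain ⟨c, c', hcc', hf, M, hM, hcone, hvis, hsec⟩ := h₂.exists_cone
  obtain ⟨m₁, m₂, hm⟩ := h₁.sector v
  obtain ⟨d, d', hdd', hS, hgen⟩ := hm.exists_generic (F := p₁ '' {a | a ≠ v}) (toFinite _) (by
    rintro ⟨a, ha, he⟩; exact ha (h₁.injective he))
  obtain ⟨δ, hδ, hstab, hsec₁⟩ := h₁.exists_stable v
  obtain ⟨A, B, hAB⟩ : ∃ A B : V₁ → ℝ, ∀ a, p₁ a - p₁ v = A a • d + B a • d' :=
    ⟨_, _, fun a => plane_basis_eq hdd' _⟩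
  -- This is where the generic axis is used: no other vertex lies on the line through `p₁ v` in
  -- direction `d`.
  have hB : ∀ a, a ≠ v → 0 < |B a| := by
    intro a ha
    rw [abs_pos]
    intro h0
    apply hgen (p₁ a) ⟨a, ha, rfl⟩
    rw [hAB, h0, det₂_add_right, det₂_smul_right, det₂_smul_right, det₂_self]; ring
  obtain ⟨g, hg⟩ : ∃ g : ℝ, ∀ y, |det₂ c' (p₂ y - p₂ r)| ≤ g := by
    have : ∀ᶠ g : ℝ in Filter.atTop, ∀ y, |det₂ c' (p₂ y - p₂ r)| ≤ g := by
      rw [Filter.eventually_all]; exact fun y => Filter.eventually_ge_atTop _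
    exact this.exists
  have hg0 : 0 ≤ g := (abs_nonneg _).trans (hg r)
  -- The constants are chosen in the order `κ`, `η`, `ε`. `κ` fixes where the blocking points of
  -- mixed nonedges lie relative to the small copy; `η` flattens the copy until it fits well into
  -- the sector and these points lie beside it; `ε` shrinks the copy into the disc of radius `δ`.
  obtain ⟨κ, hκ, hκf⟩ : ∃ κ > 0, ∀ a y, y ≠ r →
      κ * (|A a| + |B a|) < det₂ c (p₂ y - p₂ r) / 8 := by
    have : ∀ᶠ κ : ℝ in 𝓝[>] 0, ∀ a y, y ≠ r →
        κ * (|A a| + |B a|) < det₂ c (p₂ y - p₂ r) / 8 := by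
      simp only [Filter.eventually_all]
      exact fun a y hy => eventually_mul_lt _ (by linarith [hf y hy])
    exact ((eventually_gt_nhdsGT 0).and this).exists
  obtain ⟨η, hη, hηM, hηf, hηB⟩ : ∃ η > 0, η * M < 1 / 4 ∧
      (∀ y, y ≠ r → η * g < det₂ c (p₂ y - p₂ r) / 8) ∧ ∀ a, a ≠ v → η * (2 * g) < κ * |B a| := by
    have h1 : ∀ᶠ η : ℝ in 𝓝[>] 0, ∀ y, y ≠ r → η * g < det₂ c (p₂ y - p₂ r) / 8 := by
      simp only [Filter.eventually_all]
      exact fun y hy => eventually_mul_lt _ (by linarith [hf y hy])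
    have h2 : ∀ᶠ η : ℝ in 𝓝[>] 0, ∀ a, a ≠ v → η * (2 * g) < κ * |B a| := by
      simp only [Filter.eventually_all]
      exact fun a ha => eventually_mul_lt _ (mul_pos hκ (hB a ha))
    exact ((eventually_gt_nhdsGT 0).and ((eventually_mul_lt M (by norm_num)).and (h1.and h2))).exists
  obtain ⟨ε, hε, hεκ, hεδ⟩ : ∃ ε > 0, ε * κ < 1 / 2 ∧ ∀ y,
      ε * ‖det₂ c (p₂ y - p₂ r) • d + (η * det₂ c' (p₂ y - p₂ r)) • d'‖ < δ := by
    have : ∀ᶠ ε : ℝ in 𝓝[>] 0, ∀ y,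
        ε * ‖det₂ c (p₂ y - p₂ r) • d + (η * det₂ c' (p₂ y - p₂ r)) • d'‖ < δ := by
      rw [Filter.eventually_all]; exact fun y => eventually_mul_lt _ hδ
    exact ((eventually_gt_nhdsGT 0).and ((eventually_mul_lt κ (by norm_num)).and this)).exists
  -- The `c`-coordinate at the root is sent along the axis `d` of the sector, the `c'`-coordinate,
  -- flattened by `η`, along `d'`.
  obtain ⟨Φ, hΦ⟩ : ∃ Φ : Plane → Plane, ∀ x, Φ x = p₁ v + (ε * det₂ c (x - p₂ r)) • d +
      (ε * η * det₂ c' (x - p₂ r)) • d' := ⟨_, fun _ => rfl⟩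
  have hΦr : Φ (p₂ r) = p₁ v := by simp [hΦ]
  have hΦinj : Function.Injective Φ := by
    intro x y hxy
    rw [hΦ, hΦ, add_assoc, add_assoc] at hxy
    obtain ⟨e1, e2⟩ := plane_basis_inj hdd' (add_left_cancel hxy)
    have e1 := mul_left_cancel₀ hε.ne' e1
    have e2 := mul_left_cancel₀ (mul_pos hε hη).ne' e2
    simp only [det₂, PiLp.sub_apply] at e1 e2 hcc'
    have ha : (x 0 - y 0) * (c 0 * c' 1 - c 1 * c' 0) = 0 := by
      linear_combination c' 0 * e1 - c 0 * e2
    have hb : (x 1 - y 1) * (c 0 * c' 1 - c 1 * c' 0) = 0 := by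
      linear_combination c' 1 * e1 - c 1 * e2
    exact Plane.ext' (by linarith [(mul_eq_zero.1 ha).resolve_right hcc'])
      (by linarith [(mul_eq_zero.1 hb).resolve_right hcc'])
  have hΦlin : ∀ x y n : Plane, ∀ t s : ℝ, Φ (x + t • y + s • n) = Φ x + t • (Φ (p₂ r + y) - p₁ v) +
      s • (Φ (p₂ r + n) - p₁ v) := by
    intro x y n t s
    have e1 : x + t • y + s • n - p₂ r = (x - p₂ r) + t • y + s • n := by abel
    simp only [hΦ, e1, det₂_add_right, det₂_smul_right, add_sub_cancel_left]
    module
  have hΦaff : ∀ x y : Plane, ∀ t : ℝ, Φ x + t • (Φ y - Φ x) = Φ (x + t • (y - x)) := by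
    intro x y t
    have e1 : x + t • (y - x) - p₂ r = (x - p₂ r) + t • ((y - p₂ r) - (x - p₂ r)) := by module
    have e2 : ∀ u : Plane, det₂ u ((y - p₂ r) - (x - p₂ r)) = det₂ u (y - p₂ r) - det₂ u (x - p₂ r) :=
      fun u => det₂_sub_right _ _ _
    simp only [hΦ, e1, det₂_add_right, det₂_smul_right, e2]
    module
  set q : V₂ → Plane := fun y => Φ (p₂ y) with hq
  set D₁ := straightLineDrawing G₁ p₁ with hD₁
  have hD₂ : ∀ x ∈ straightLineDrawing G₂ q, ∃ y ∈ straightLineDrawing G₂ p₂, x = Φ y := by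
    intro x hx
    rcases mem_straightLineDrawing.1 hx with ⟨y, rfl⟩ | ⟨u, w, huw, hx⟩
    · exact ⟨_, vertex_mem_straightLineDrawing G₂ p₂ y, rfl⟩
    · rw [segment_eq_image'] at hx
      obtain ⟨t, ht, rfl⟩ := hx
      refine ⟨_, mem_straightLineDrawing.2 (Or.inr ⟨u, w, huw, ?_⟩), hΦaff _ _ _⟩
      rw [segment_eq_image']; exact ⟨t, ht, rfl⟩
  have hcone₂ : ∀ y ∈ straightLineDrawing G₂ p₂,
      |det₂ c' (y - p₂ r)| ≤ M * det₂ c (y - p₂ r) :=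
    straightLineDrawing_subset_of_convex (convex_cone c c' (p₂ r) M) hcone
  have hg₂ : ∀ y ∈ straightLineDrawing G₂ p₂, |det₂ c' (y - p₂ r)| ≤ g := by
    have hlin : IsLinearMap ℝ (det₂ c') :=
      ⟨fun _ _ => det₂_add_right _ _ _, fun _ _ => det₂_smul_right _ _ _⟩
    have e : {y : Plane | |det₂ c' (y - p₂ r)| ≤ g} = {y | -g + det₂ c' (p₂ r) ≤ det₂ c' y} ∩
        {y | det₂ c' y ≤ g + det₂ c' (p₂ r)} := by
      ext y
      simp only [mem_ofPred_eq, mem_inter_iff, abs_le, det₂_sub_right]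
      constructor <;> rintro ⟨h1, h2⟩ <;> constructor <;> linarith
    have hconv : Convex ℝ {y : Plane | |det₂ c' (y - p₂ r)| ≤ g} := by
      rw [e]
      exact (convex_halfSpace_ge hlin _).inter (convex_halfSpace_le hlin _)
    exact straightLineDrawing_subset_of_convex hconv hg
  -- points of the thin cone avoid the first drawing
  have hΦD₁ : ∀ x, 0 < det₂ c (x - p₂ r) → |det₂ c' (x - p₂ r)| ≤ M * det₂ c (x - p₂ r) →
      Φ x ∉ D₁ := by
    intro x h1 h2
    rw [hΦ]
    refine hS _ _ (mul_pos hε h1) ?_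
    rw [abs_mul, abs_of_pos (mul_pos hε hη), mul_assoc]
    refine mul_le_mul_of_nonneg_left ?_ hε.le
    calc η * |det₂ c' (x - p₂ r)| ≤ η * (M * det₂ c (x - p₂ r)) := by gcongr
      _ = (η * M) * det₂ c (x - p₂ r) := by ring
      _ ≤ 1 * det₂ c (x - p₂ r) := by gcongr; linarith
      _ = _ := one_mul _
  have hΦD₂ : ∀ x, x ∉ straightLineDrawing G₂ p₂ → Φ x ∉ straightLineDrawing G₂ q := by
    intro x hx hx'
    obtain ⟨y, hy, he⟩ := hD₂ _ hx'
    exact hx (hΦinj he ▸ hy)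
  have hqball : ∀ y, dist (p₁ v) (q y) < δ := by
    intro y
    have : q y - p₁ v = ε • (det₂ c (p₂ y - p₂ r) • d + (η * det₂ c' (p₂ y - p₂ r)) • d') := by
      simp only [hq, hΦ]; module
    rw [dist_comm, dist_eq_norm, this, norm_smul, Real.norm_of_nonneg hε.le]
    exact hεδ y
  have hD₂ball : straightLineDrawing G₂ q ⊆ Metric.ball (p₁ v) δ :=
    straightLineDrawing_subset_of_convex (convex_ball _ _) fun y => by
      rw [Metric.mem_ball, dist_comm]; exact hqball y
  -- the combined drawing
  obtain ⟨P, hP₁, hP₂⟩ := exists_common_extension i₁ i₂ i₁.injective i₂.injective p₁ q (by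
    intro a b hab
    have hb := hdisj a b hab
    subst hb
    rw [← hvr] at hab
    rw [i₁.injective hab, hq]; exact hΦr.symm)
  have hD : straightLineDrawing G P = D₁ ∪ straightLineDrawing G₂ q := by
    rw [straightLineDrawing_eq_union i₁ i₂ hcov ?_ P]
    · simp only [hP₁, hP₂]; rfl
    · intro a b hab
      by_cases ha : a = v
      · exact Or.inl ⟨r, ha ▸ hvr⟩
      · by_cases hb : b = r
        · exact Or.inr ⟨v, hb ▸ hvr⟩
        · exact absurd hab (hnadj a b ha hb)
  have hDthick : straightLineDrawing G P ⊆ Metric.thickening δ D₁ := by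
    rw [hD]
    refine union_subset (Metric.self_subset_thickening hδ _) fun x hx => ?_
    exact Metric.mem_thickening_iff.2 ⟨_, vertex_mem_straightLineDrawing G₁ p₁ v, hD₂ball hx⟩
  have hqD₁ : ∀ y, y ≠ r → q y ∉ D₁ := fun y hy => hΦD₁ _ (hf y hy) (hcone y)
  have hcov' : ∀ x, (∃ a, i₁ a = x) ∨ ∃ b, b ≠ r ∧ i₂ b = x := by
    intro x
    rcases hcov x with h | ⟨b, rfl⟩
    · exact Or.inl h
    · by_cases hb : b = r
      · exact Or.inl ⟨v, hb ▸ hvr⟩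
      · exact Or.inr ⟨b, hb, rfl⟩
  refine ⟨P, ?_, ?_, ?_⟩
  · -- injectivity
    have key : ∀ a b, b ≠ r → P (i₁ a) ≠ P (i₂ b) := by
      intro a b hb he
      rw [hP₁, hP₂] at he
      exact hqD₁ b hb (he ▸ vertex_mem_straightLineDrawing G₁ p₁ a)
    intro x y hxy
    rcases hcov' x with ⟨a, rfl⟩ | ⟨a, ha, rfl⟩ <;> rcases hcov' y with ⟨b, rfl⟩ | ⟨b, hb, rfl⟩
    · rw [hP₁, hP₁] at hxy; rw [h₁.injective hxy]
    · exact absurd hxy (key _ _ hb)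
    · exact absurd hxy.symm (key _ _ ha)
    · rw [hP₂, hP₂] at hxy
      rw [h₂.injective (hΦinj hxy)]
  · -- nonedges
    have mixed : ∀ a b, a ≠ v → b ≠ r → ∃ z ∈ segment ℝ (P (i₁ a)) (P (i₂ b)),
        Escapes (straightLineDrawing G P) z := by
      intro a y hav hyr
      rw [hP₁, hP₂]
      -- If `a` and `v` are adjacent, the blocking point is taken at the fraction `τ = ε * κ` of the
      -- way from `q y` to `p₁ a`. Its `d'`-coordinate is larger in absolute value than any in the
      -- copy, because `η * (2 * g) < κ * |B a|`, and it still lies in the sector; so its ray in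
      -- direction `d` misses both drawings. If `a` and `v` are not adjacent, the blocking point of
      -- that nonedge is inherited.
      by_cases hadj : G₁.Adj a v
      · have hd0 : d ≠ 0 := by rintro rfl; simp at hdd'
        set f₀ := det₂ c (p₂ y - p₂ r) with hf₀
        set g₀ := det₂ c' (p₂ y - p₂ r) with hg₀
        have hfy : 0 < f₀ := hf y hyr
        have hgy : |g₀| ≤ g := hg y
        have hB0 := hB a hav
        have hκa := hκf a y hyr
        have hηy := hηf y hyr
        have hηa := hηB a hav
        set τ := ε * κ with hτ
        have hτ0 : 0 < τ := mul_pos hε hκ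
        set a₀ := ε * (f₀ * (1 - τ) + κ * A a) with ha₀
        set b₀ := ε * (η * g₀ * (1 - τ) + κ * B a) with hb₀
        have hpt : q y + τ • (p₁ a - q y) = p₁ v + a₀ • d + b₀ • d' := by
          have e1 : p₁ a = p₁ v + (A a • d + B a • d') := by rw [← hAB]; abel
          simp only [hq, hΦ, e1, ha₀, hb₀, hτ, ← hf₀, ← hg₀]
          module
        have hκA : κ * |A a| + κ * |B a| < f₀ / 8 := by linarith
        have hgη : η * |g₀| ≤ η * g := mul_le_mul_of_nonneg_left hgy hη.le
        have hbb : |η * g₀ * (1 - τ)| ≤ η * g := by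
          rw [abs_mul, abs_mul, abs_of_pos hη, abs_of_nonneg (by linarith : 0 ≤ 1 - τ)]
          have : 0 ≤ η * |g₀| := by positivity
          nlinarith
        have hκB : |κ * B a| = κ * |B a| := by rw [abs_mul, abs_of_pos hκ]
        have hκA' : |κ * A a| = κ * |A a| := by rw [abs_mul, abs_of_pos hκ]
        have ha1 : f₀ / 4 ≤ f₀ * (1 - τ) + κ * A a := by
          have := neg_abs_le (κ * A a)
          have : 0 ≤ κ * |B a| := by positivity
          nlinarith
        have hray : ∀ s : ℝ, 0 ≤ s → q y + τ • (p₁ a - q y) + s • d ∉ straightLineDrawing G P := by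
          intro s hs
          have e : q y + τ • (p₁ a - q y) + s • d = p₁ v + (a₀ + s) • d + b₀ • d' := by
            rw [hpt]; module
          rw [e, hD]
          rintro (hx | hx)
          · have h1 : 0 < a₀ := mul_pos hε (by linarith)
            refine hS _ _ (by linarith) ?_ hx
            have : |b₀| ≤ ε * (f₀ / 4) := by
              rw [hb₀, abs_mul, abs_of_pos hε]
              refine mul_le_mul_of_nonneg_left ?_ hε.le
              refine (abs_add_le _ _).trans ?_
              rw [hκB]
              have : 0 ≤ κ * |A a| := by positivity
              linarith
            have h3 : ε * (f₀ / 4) ≤ a₀ := mul_le_mul_of_nonneg_left ha1 hε.le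
            linarith
          · obtain ⟨w, hw, he⟩ := hD₂ _ hx
            rw [hΦ, add_assoc, add_assoc] at he
            obtain ⟨-, e2⟩ := plane_basis_inj hdd' (add_left_cancel he)
            have h1 := hg₂ w hw
            rw [hb₀, mul_assoc ε η] at e2
            have e3 := mul_left_cancel₀ hε.ne' e2
            have h2 : κ * |B a| ≤ η * g + η * g := by
              rw [← hκB]
              have : κ * B a = η * det₂ c' (w - p₂ r) - η * g₀ * (1 - τ) := by linarith
              rw [this]
              refine (abs_sub _ _).trans (add_le_add ?_ hbb)
              rw [abs_mul, abs_of_pos hη]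
              exact mul_le_mul_of_nonneg_left h1 hη.le
            linarith
        refine ⟨q y + τ • (p₁ a - q y), ?_, escapes_of_ray hd0 ?_ hray⟩
        · rw [segment_symm, segment_eq_image']
          exact ⟨τ, ⟨hτ0.le, by linarith⟩, rfl⟩
        · rw [segment_same, disjoint_singleton_left]
          simpa using hray 0 le_rfl
      · obtain ⟨t, ht, hst⟩ := hstab a v hav hadj
        refine ⟨p₁ a + t • (q y - p₁ a), ?_, hst _ _ hDthick ?_⟩
        · rw [segment_eq_image']; exact ⟨t, ht, rfl⟩
        · exact dist_segment_lt (by rwa [dist_self]) (hqball y) ht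
    -- The exit paths of the rooted drawing were chosen inside its cone, and so was their
    -- continuation away from the root; `Φ` maps the cone into the free sector.
    have inner : ∀ a b, a ≠ b → ¬ G₂.Adj a b → ∃ z ∈ segment ℝ (P (i₂ a)) (P (i₂ b)),
        Escapes (straightLineDrawing G P) z := by
      intro a b hab hadj
      rw [hP₂, hP₂]
      obtain ⟨z, hz, h, hzh, hz0, hh0, hhM, hray⟩ := hvis a b hab hadj
      have hzM : |det₂ c' (z - p₂ r)| ≤ M * det₂ c (z - p₂ r) :=
        (convex_cone c c' (p₂ r) M).segment_subset (hcone a) (hcone b) hz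
      refine ⟨Φ z, ?_, escapes_of_ray (h := Φ h) (n := Φ h - p₁ v) ?_ ?_ ?_⟩
      · rw [segment_eq_image'] at hz ⊢
        obtain ⟨t, ht, rfl⟩ := hz
        exact ⟨t, ht, hΦaff _ _ _⟩
      · rw [sub_ne_zero, ← hΦr]
        intro he
        rw [hΦinj he, sub_self, det₂_zero_right] at hh0
        exact lt_irrefl _ hh0
      · rw [disjoint_left, hD]
        intro x hx
        rw [segment_eq_image'] at hx
        obtain ⟨t, ht, rfl⟩ := hx
        simp only [hΦaff]
        have hxs : z + t • (h - z) ∈ segment ℝ z h := by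
          rw [segment_eq_image']; exact ⟨t, ht, rfl⟩
        rintro (hx | hx)
        · exact hΦD₁ _ ((convex_halfplane c (p₂ r) 0).segment_subset hz0 hh0 hxs)
            ((convex_cone c c' (p₂ r) M).segment_subset hzM hhM hxs) hx
        · exact hΦD₂ _ (disjoint_left.1 hzh hxs) hx
      · intro s hs
        have e : Φ h + s • (Φ h - p₁ v) = Φ (h + s • (h - p₂ r)) := by
          have := hΦlin h (h - p₂ r) 0 s 0
          simpa using this.symm
        have e2 : h + s • (h - p₂ r) - p₂ r = (1 + s) • (h - p₂ r) := by module
        rw [e, hD]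
        rintro (hx | hx)
        · refine hΦD₁ _ ?_ ?_ hx
          · rw [e2, det₂_smul_right]; positivity
          · rw [e2, det₂_smul_right, det₂_smul_right, abs_mul, abs_of_nonneg (by positivity)]
            nlinarith
        · exact hΦD₂ _ (hray s hs) hx
    intro u w huw hadj
    rcases hcov' u with ⟨a, rfl⟩ | ⟨a, ha, rfl⟩ <;> rcases hcov' w with ⟨b, rfl⟩ | ⟨b, hb, rfl⟩
    · obtain ⟨t, ht, hst⟩ := hstab a b (fun h => huw (by rw [h])) (fun h => hadj (i₁.map_adj_iff.2 h))
      refine ⟨p₁ a + t • (p₁ b - p₁ a), ?_, hst _ _ hDthick (by rwa [dist_self])⟩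
      rw [hP₁, hP₁, segment_eq_image']; exact ⟨t, ht, rfl⟩
    · by_cases hav : a = v
      · subst hav
        rw [hvr] at huw hadj ⊢
        exact inner r b (fun h => huw (by rw [h])) (fun h => hadj (i₂.map_adj_iff.2 h))
      · exact mixed a b hav hb
    · by_cases hbv : b = v
      · subst hbv
        rw [hvr] at huw hadj ⊢
        exact inner a r (fun h => huw (by rw [h])) (fun h => hadj (i₂.map_adj_iff.2 h))
      · rw [segment_symm]; exact mixed b a hbv ha
    · exact inner a b (fun h => huw (by rw [h])) (fun h => hadj (i₂.map_adj_iff.2 h))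
  · -- sectors
    intro x
    rw [hD]
    rcases hcov' x with ⟨a, rfl⟩ | ⟨y, hy, rfl⟩
    · rw [hP₁]
      by_cases hav : a = v
      · subst hav
        -- Slopes between `1 / 2` and `1` remain free: the copy only occupies slopes up to `η * M <
        -- 1 / 4`.
        refine ⟨d + d', d + (1 / 2 : ℝ) • d', ?_, ?_⟩
        · rw [det₂_add_left, det₂_add_right, det₂_add_right, det₂_smul_right, det₂_smul_right,
            det₂_self, det₂_self, det₂_swap d' d]
          intro h; apply hdd'; linarith
        · intro α β hα hβ hαβ
          have e : p₁ a + α • (d + d') + β • (d + (1 / 2 : ℝ) • d') =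
              p₁ a + (α + β) • d + (α + β / 2) • d' := by module
          rw [e]
          rintro (hx | hx)
          · refine hS _ _ hαβ ?_ hx
            rw [abs_of_nonneg (by positivity)]; linarith
          · obtain ⟨y, hy, he⟩ := hD₂ _ hx
            rw [hΦ, add_assoc, add_assoc] at he
            obtain ⟨e1, e2⟩ := plane_basis_inj hdd' (add_left_cancel he)
            have h1 := hcone₂ y hy
            have h2 : α + β / 2 ≤ (η * M) * (α + β) := by
              rw [e1, e2]
              calc ε * η * det₂ c' (y - p₂ r) ≤ ε * η * |det₂ c' (y - p₂ r)| := by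
                    gcongr; exact le_abs_self _
                _ ≤ ε * η * (M * det₂ c (y - p₂ r)) := by gcongr
                _ = _ := by ring
            nlinarith
      · obtain ⟨n₁, n₂, hfs, hn⟩ := hsec₁ a hav
        refine ⟨n₁, n₂, hfs.1, fun α β hα hβ hαβ => ?_⟩
        rintro (hx | hx)
        · exact hfs.2 α β hα hβ hαβ hx
        · exact hn α β hα hβ (hD₂ball hx)
    · rw [hP₂]
      obtain ⟨n₁, n₂, hfs, h1, h2, h3, h4⟩ := hsec y hy
      refine ⟨Φ (p₂ r + n₁) - p₁ v, Φ (p₂ r + n₂) - p₁ v, ?_, fun α β hα hβ hαβ => ?_⟩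
      · have e : ∀ n, Φ (p₂ r + n) - p₁ v = (ε * det₂ c n) • d + (ε * η * det₂ c' n) • d' := by
          intro n; rw [hΦ, add_sub_cancel_left]; module
        rw [e, e]
        have : det₂ ((ε * det₂ c n₁) • d + (ε * η * det₂ c' n₁) • d')
            ((ε * det₂ c n₂) • d + (ε * η * det₂ c' n₂) • d')
            = ε * ε * η * det₂ c c' * det₂ n₁ n₂ * det₂ d d' := by
          simp only [det₂, PiLp.add_apply, PiLp.smul_apply, smul_eq_mul]; ring
        rw [this]
        have := hfs.1
        positivity
      · rw [hq]
        simp only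
        rw [← hΦlin]
        rintro (hx | hx)
        · have e : p₂ y + α • n₁ + β • n₂ - p₂ r = (p₂ y - p₂ r) + α • n₁ + β • n₂ := by abel
          have h5 := hf y hy
          have h6 := hcone y
          refine hΦD₁ _ ?_ ?_ hx
          · rw [e, det₂_add_right, det₂_add_right, det₂_smul_right, det₂_smul_right]; positivity
          · rw [e, det₂_add_right, det₂_add_right, det₂_smul_right, det₂_smul_right,
              det₂_add_right, det₂_add_right, det₂_smul_right, det₂_smul_right]
            calc |det₂ c' (p₂ y - p₂ r) + α * det₂ c' n₁ + β * det₂ c' n₂|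
                ≤ |det₂ c' (p₂ y - p₂ r)| + |α * det₂ c' n₁| + |β * det₂ c' n₂| := by
                  refine (abs_add_le _ _).trans ?_
                  gcongr
                  exact abs_add_le _ _
              _ ≤ M * det₂ c (p₂ y - p₂ r) + α * (M * det₂ c n₁) + β * (M * det₂ c n₂) := by
                  rw [abs_mul, abs_mul, abs_of_nonneg hα, abs_of_nonneg hβ]
                  gcongr
              _ = _ := by ring
        · exact hΦD₂ _ (hfs.2 α β hα hβ hαβ) hx

end

/-! ### Visibility from outside the convex hull; block drawings. -/

section
variable {V : Type*} {G : SimpleGraph V} {p : V → Plane}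

/-- The point `p x` is a vertex of the convex hull. -/
def Extreme (p : V → Plane) (x : V) : Prop := ∃ c : Plane, ∀ y ≠ x, det₂ c (p y - p x) < 0

/-- A point of the segment between `p u` and `p w` can be joined by a segment to a point outside
the convex hull without meeting the drawing. -/
def Visible (G : SimpleGraph V) (p : V → Plane) (u w : V) : Prop :=
  ∃ z ∈ segment ℝ (p u) (p w), ∃ h ∉ convexHull ℝ (range p),
    Disjoint (segment ℝ z h) (straightLineDrawing G p)

theorem Visible.symm {u w : V} (h : Visible G p u w) : Visible G p w u := by
  unfold Visible at *; rwa [segment_symm]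

/-- The drawing of the graph without the vertex `y`. -/
def restDrawing (G : SimpleGraph V) (p : V → Plane) (y : V) : Set Plane :=
  straightLineDrawing (G.induce {k | k ≠ y}) (fun k => p k)

theorem mem_straightLineDrawing_iff_rest {y : V} {x : Plane} :
    x ∈ straightLineDrawing G p ↔ x ∈ restDrawing G p y ∨ x = p y ∨
      ∃ k, G.Adj y k ∧ x ∈ segment ℝ (p y) (p k) := by
  simp only [restDrawing, mem_straightLineDrawing]
  constructor
  · rintro (⟨k, rfl⟩ | ⟨a, b, hab, hx⟩)
    · by_cases hk : k = y
      · exact Or.inr (Or.inl (by rw [hk]))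
      · exact Or.inl (Or.inl ⟨⟨k, hk⟩, rfl⟩)
    · by_cases ha : a = y
      · subst ha; exact Or.inr (Or.inr ⟨b, hab, hx⟩)
      · by_cases hb : b = y
        · subst hb; exact Or.inr (Or.inr ⟨a, hab.symm, by rwa [segment_symm]⟩)
        · exact Or.inl (Or.inr ⟨⟨a, ha⟩, ⟨b, hb⟩, hab, hx⟩)
  · rintro ((⟨k, rfl⟩ | ⟨a, b, hab, hx⟩) | rfl | ⟨k, hk, hx⟩)
    · exact Or.inl ⟨_, rfl⟩
    · exact Or.inr ⟨_, _, hab, hx⟩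
    · exact Or.inl ⟨_, rfl⟩
    · exact Or.inr ⟨_, _, hk, hx⟩

theorem isCompact_restDrawing [Finite V] (y : V) : IsCompact (restDrawing G p y) :=
  isCompact_straightLineDrawing _ _

theorem vertex_mem_restDrawing {y k : V} (h : k ≠ y) : p k ∈ restDrawing G p y :=
  vertex_mem_straightLineDrawing (G.induce {k | k ≠ y}) (fun k => p k) ⟨k, h⟩

theorem det₂_neg_of_mem_restDrawing {y : V} {c : Plane} (hc : ∀ k ≠ y, det₂ c (p k - p y) < 0)
    {x : Plane} (hx : x ∈ restDrawing G p y) : det₂ c (x - p y) < 0 := by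
  have : restDrawing G p y ⊆ {x | 0 < det₂ (-c) (x - p y)} :=
    straightLineDrawing_subset_of_convex (convex_halfplane _ _ _) (by
      rintro ⟨k, hk⟩
      have := hc k hk
      simp only [mem_ofPred_eq, ← neg_one_smul ℝ c, det₂_smul_left]
      linarith)
  have := this hx
  simp only [mem_ofPred_eq, ← neg_one_smul ℝ c, det₂_smul_left] at this
  linarith

theorem det₂_nonpos_of_mem_convexHull {y : V} {c : Plane} (hc : ∀ k ≠ y, det₂ c (p k - p y) < 0)
    {x : Plane} (hx : x ∈ convexHull ℝ (range p)) : det₂ c (x - p y) ≤ 0 := by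
  have hconv : Convex ℝ {x : Plane | det₂ c x ≤ det₂ c (p y)} :=
    convex_halfSpace_le ⟨fun _ _ => det₂_add_right _ _ _, fun _ _ => det₂_smul_right _ _ _⟩ _
  have := convexHull_min (by
    rintro _ ⟨k, rfl⟩
    simp only [mem_ofPred_eq]
    by_cases hk : k = y
    · rw [hk]
    · have := hc k hk
      rw [det₂_sub_right] at this; linarith) hconv hx
  simp only [mem_ofPred_eq] at this
  rw [det₂_sub_right]; linarith

/-- The closed ray from `p y` in direction `t` meets the drawing only in `p y`. -/
def FreeRay (G : SimpleGraph V) (p : V → Plane) (y : V) (t : Plane) : Prop :=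
  t ≠ 0 ∧ ∀ s : ℝ, 0 ≤ s → p y + s • t ∉ restDrawing G p y

theorem Extreme.freeRay {y : V} {c t : Plane} (hc : ∀ k ≠ y, det₂ c (p k - p y) < 0)
    (ht : 0 ≤ det₂ c t) (ht0 : t ≠ 0) : FreeRay G p y t := by
  refine ⟨ht0, fun s hs hx => ?_⟩
  have := det₂_neg_of_mem_restDrawing hc hx
  rw [add_sub_cancel_left, det₂_smul_right] at this
  nlinarith

theorem isClosed_ray (x : Plane) {t : Plane} (ht : t ≠ 0) :
    IsClosed ((fun s : ℝ => x + s • t) '' Ici 0) :=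
  ((Homeomorph.addLeft x).isClosedEmbedding.comp (isClosedEmbedding_smul_left ht)).isClosedMap
      _ (isClosed_Ici (a := (0 : ℝ)))

/-- The ray has positive distance from the rest of the drawing, and far out a small tilt stays
outside a disc that contains this rest. An edge at `y` cannot enter the thin sector either, because
its other end would then lie in the sector, and that end belongs to the rest. -/
theorem FreeRay.exists_freeSector [Finite V] {y : V} {c t : Plane} (h : FreeRay G p y t)
    (hct : 0 < det₂ c t) : ∃ n₁ n₂, FreeSector (straightLineDrawing G p) (p y) n₁ n₂ ∧
      0 < det₂ c n₁ ∧ 0 < det₂ c n₂ := by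
  obtain ⟨ht, hray⟩ := h
  have hdis : Disjoint (restDrawing G p y) ((fun s : ℝ => p y + s • t) '' Ici 0) := by
    rw [disjoint_right]; rintro _ ⟨s, hs, rfl⟩; exact hray s hs
  obtain ⟨ρ, hρ, hd⟩ := hdis.exists_thickenings (isCompact_restDrawing y) (isClosed_ray _ ht)
  obtain ⟨R, hR⟩ := (isCompact_restDrawing (G := G) (p := p) y).isBounded.exists_norm_le
  have ht' : 0 < ‖t‖ := norm_pos_iff.2 ht
  -- Beyond the parameter `S` a slightly tilted point has norm larger than the bound `|R|` for the
  -- rest of the drawing.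
  set S : ℝ := 2 * (|R| + ‖p y‖ + 1) / ‖t‖ with hS
  have hS0 : 0 < S := by positivity
  obtain ⟨τ, hτ, h1, h2, h3⟩ := ((eventually_gt_nhdsGT 0).and ((eventually_mul_lt (S * ‖c‖) hρ).and
    ((eventually_mul_lt (‖c‖) (show 0 < ‖t‖ / 2 by positivity)).and
      (eventually_mul_lt 1 (one_pos))))).exists
  have key : ∀ s θ : ℝ, 0 < s → |θ| ≤ s → p y + s • t + (θ * τ) • c ∉ restDrawing G p y := by
    intro s θ hs hθ hx
    have hn : ‖(θ * τ) • c‖ ≤ s * (τ * ‖c‖) := by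
      rw [norm_smul, Real.norm_eq_abs, abs_mul, abs_of_pos hτ, mul_assoc]; gcongr
    rcases le_total s S with hsS | hsS
    · refine disjoint_left.1 hd (Metric.self_subset_thickening hρ _ hx)
        (Metric.mem_thickening_iff.2 ⟨_, ⟨s, hs.le, rfl⟩, ?_⟩)
      rw [dist_eq_norm, add_sub_cancel_left]
      calc ‖(θ * τ) • c‖ ≤ s * (τ * ‖c‖) := hn
        _ ≤ S * (τ * ‖c‖) := by gcongr
        _ = τ * (S * ‖c‖) := by ring
        _ < ρ := h1
    · have h4 := (hR _ hx).trans (le_abs_self R)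
      have h5 : ‖s • t‖ ≤ ‖p y + s • t + (θ * τ) • c‖ + ‖p y‖ + ‖(θ * τ) • c‖ := by
        have : s • t = (p y + s • t + (θ * τ) • c) - p y - (θ * τ) • c := by abel
        nth_rewrite 1 [this]
        exact (norm_sub_le _ _).trans (by gcongr; exact norm_sub_le _ _)
      rw [norm_smul, Real.norm_of_nonneg hs.le] at h5
      have h6 : S * ‖t‖ = 2 * (|R| + ‖p y‖ + 1) := by rw [hS]; field_simp
      have h7 : S * ‖t‖ ≤ s * ‖t‖ := by gcongr
      have h8 : s * (τ * ‖c‖) ≤ s * (‖t‖ / 2) := by gcongr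
      linarith
  have hlin : ∀ α β : ℝ, p y + α • (t + τ • c) + β • (t - τ • c) =
      p y + (α + β) • t + ((α - β) * τ) • c := by intro α β; module
  refine ⟨t + τ • c, t - τ • c, ⟨?_, fun α β hα hβ hαβ hx => ?_⟩, ?_, ?_⟩
  · have : det₂ (t + τ • c) (t - τ • c) = 2 * τ * det₂ c t := by
      simp only [det₂, PiLp.add_apply, PiLp.sub_apply, PiLp.smul_apply, smul_eq_mul]; ring
    rw [this]; positivity
  · rw [hlin] at hx
    have hab : |α - β| ≤ α + β := by rw [abs_le]; constructor <;> linarith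
    have hc0 : det₂ c ((α + β) • t + ((α - β) * τ) • c) ≠ 0 := by
      rw [det₂_add_right, det₂_smul_right, det₂_smul_right, det₂_self]
      have : 0 < (α + β) * det₂ c t := by positivity
      linarith
    rcases (mem_straightLineDrawing_iff_rest (y := y)).1 hx with hx | hx | ⟨k, hk, hx⟩
    · exact key _ _ hαβ hab hx
    · rw [add_assoc, add_eq_left] at hx
      rw [hx] at hc0; simp at hc0
    · rw [segment_eq_image'] at hx
      obtain ⟨s, hs, he⟩ := hx
      simp only [add_assoc, add_right_inj] at he
      have hs0 : 0 < s := by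
        refine lt_of_le_of_ne hs.1 ?_
        rintro rfl
        rw [zero_smul] at he
        rw [← he] at hc0; simp at hc0
      -- The sector is a cone with apex `p y`, so with a point of the edge it also contains the
      -- other end.
      have hpk : p k = p y + ((α + β) / s) • t + ((α - β) / s * τ) • c := by
        have e : p k = p y + s⁻¹ • (s • (p k - p y)) := by
          rw [smul_smul, inv_mul_cancel₀ hs0.ne', one_smul]; abel
        rw [e, he]
        have : ((α - β) / s * τ) = s⁻¹ * ((α - β) * τ) := by ring
        rw [this, div_eq_inv_mul]; module
      refine key ((α + β) / s) ((α - β) / s) (by positivity) ?_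
        (hpk ▸ vertex_mem_restDrawing hk.ne')
      rw [abs_div, abs_of_pos hs0]; gcongr
  · rw [det₂_add_right, det₂_smul_right, det₂_self]; linarith
  · rw [det₂_sub_right, det₂_smul_right, det₂_self]; linarith

def NoThreeCollinear (p : V → Plane) : Prop :=
  ∀ u v w, u ≠ v → u ≠ w → v ≠ w → det₂ (p v - p u) (p w - p u) ≠ 0

/-- A drawing of a block with root `r`. -/
structure IsBlockDrawing (G : SimpleGraph V) (p : V → Plane) (r : V) : Prop where
  injective : Function.Injective p
  noThree : NoThreeCollinear p
  visible : ∀ u w, u ≠ w → ¬ G.Adj u w → Visible G p u w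
  root : ∃ c : Plane, c ≠ 0 ∧ (∀ y ≠ r, 0 < det₂ c (p y - p r)) ∧
    ∀ y ≠ r, ∃ t, FreeRay G p y t ∧ 0 < det₂ c t

theorem IsBlockDrawing.isRootedDrawing [Finite V] {r : V} (h : IsBlockDrawing G p r) :
    IsRootedDrawing G p r := by
  refine ⟨h.injective, h.visible, ?_⟩
  obtain ⟨c, hc0, hc, hy⟩ := h.root
  refine ⟨c, hc0, hc, fun y hyr => ?_⟩
  obtain ⟨t, ht, hct⟩ := hy y hyr
  exact ht.exists_freeSector hct

/-- If all neighbours of a hull vertex `u` lie strictly on one side of the line through `u` and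
`w`, then the segment between `u` and `w` can be seen from outside. -/
theorem visible_of_side [Finite V] {u w : V} {c : Plane} (hc : ∀ y ≠ u, det₂ c (p y - p u) < 0)
    (hwu : w ≠ u) {σ : ℝ} (hσ : σ ≠ 0)
    (h : ∀ k, G.Adj u k → σ * det₂ (p w - p u) (p k - p u) < 0) : Visible G p u w := by
  set e := p w - p u with he
  have hce : det₂ c e < 0 := hc w hwu
  have hwseg : ∀ s : ℝ, 0 ≤ s → s ≤ 1 → p u + s • e ∈ segment ℝ (p u) (p w) := by
    intro s h0 h1; rw [segment_eq_image']; exact ⟨s, ⟨h0, h1⟩, rfl⟩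
  clear_value e
  -- `g` points out of the hull and to the side of the line `u w` that is free of neighbours. A
  -- scaled-down segment from `e` to `g` near `p u` leaves the hull and avoids both the edges at `u`
  -- and the rest of the drawing.
  obtain ⟨g, hcg, heg⟩ : ∃ g : Plane, 0 < det₂ c g ∧ 0 < σ * det₂ e g := by
    refine ⟨σ • c - e, ?_, ?_⟩
    · rw [det₂_sub_right, det₂_smul_right, det₂_self]; linarith
    · rw [det₂_sub_right, det₂_smul_right, det₂_self, det₂_swap e c]
      have : 0 < σ * σ := mul_self_pos.2 hσ
      nlinarith
  have hpu : p u ∉ restDrawing G p u := by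
    intro hx
    have := det₂_neg_of_mem_restDrawing hc hx
    simp at this
  obtain ⟨ρ, hρ, hball⟩ := Metric.isOpen_iff.1 (isCompact_restDrawing (G := G) (p := p) u).isClosed.isOpen_compl _ hpu
  obtain ⟨s, hs, hs1, hsρ⟩ := ((eventually_gt_nhdsGT 0).and ((eventually_mul_lt 1 one_pos).and
    (eventually_mul_lt (‖e‖ + ‖g - e‖) hρ))).exists
  have hlin : ∀ τ : ℝ, p u + s • e + τ • ((p u + s • g) - (p u + s • e)) =
      p u + s • (e + τ • (g - e)) := by intro τ; module
  refine ⟨p u + s • e, ?_, p u + s • g, ?_, ?_⟩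
  · exact hwseg s hs.le (by linarith)
  · intro hx
    have := det₂_nonpos_of_mem_convexHull hc hx
    rw [add_sub_cancel_left, det₂_smul_right] at this
    nlinarith
  · rw [disjoint_left, segment_eq_image']
    rintro _ ⟨τ, hτ, rfl⟩ hx
    simp only [hlin] at hx
    have hdet : det₂ e (e + τ • (g - e)) = τ * det₂ e g := by
      rw [det₂_add_right, det₂_smul_right, det₂_sub_right, det₂_self]; ring
    have hne : e + τ • (g - e) ≠ 0 := by
      intro h0
      rw [h0, det₂_zero_right] at hdet
      have hτ0 : τ = 0 := by
        by_contra hτ0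
        have : σ * (τ * det₂ e g) = 0 := by rw [← hdet]; ring
        have : 0 < τ := lt_of_le_of_ne hτ.1 (Ne.symm hτ0)
        nlinarith
      rw [hτ0, zero_smul, add_zero] at h0
      rw [h0, det₂_zero_right] at hce
      exact lt_irrefl _ hce
    rcases (mem_straightLineDrawing_iff_rest (y := u)).1 hx with hx | hx | ⟨k, hk, hx⟩
    · refine hball ?_ hx
      rw [Metric.mem_ball, dist_eq_norm, add_sub_cancel_left, norm_smul, Real.norm_of_nonneg hs.le]
      refine lt_of_le_of_lt ?_ hsρ
      gcongr
      refine (norm_add_le _ _).trans ?_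
      gcongr
      rw [norm_smul, Real.norm_of_nonneg hτ.1]
      exact mul_le_of_le_one_left (norm_nonneg _) hτ.2
    · rw [add_eq_left, smul_eq_zero] at hx
      exact hx.elim hs.ne' hne
    · rw [segment_eq_image'] at hx
      obtain ⟨s', hs', hx⟩ := hx
      simp only [add_right_inj] at hx
      have h1 := congrArg (fun y => σ * det₂ e y) hx
      simp only [det₂_smul_right, hdet] at h1
      have h2 := h k hk
      have h3 : 0 ≤ s * (τ * (σ * det₂ e g)) := by have := hτ.1; positivity
      have hs'0 : s' = 0 := by
        by_contra h0
        have : 0 < s' := lt_of_le_of_ne hs'.1 (Ne.symm h0)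
        nlinarith
      rw [hs'0, zero_smul] at hx
      exact (smul_ne_zero hs.ne' hne) hx.symm

/-- A drawing in convex position in which every nonedge can be seen from outside. -/
structure IsConvexDrawing (G : SimpleGraph V) (p : V → Plane) : Prop where
  injective : Function.Injective p
  noThree : NoThreeCollinear p
  extreme : ∀ x, Extreme p x
  visible : ∀ u w, u ≠ w → ¬ G.Adj u w → Visible G p u w

/-- The supporting direction at `r`, reversed, is the root functional. The free ray at `y` points
away from `r`: as `y` is extreme, it leaves the hull immediately. -/
theorem IsConvexDrawing.isBlockDrawing (h : IsConvexDrawing G p) (hV : Nontrivial V) (r : V) :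
    IsBlockDrawing G p r := by
  refine ⟨h.injective, h.noThree, h.visible, ?_⟩
  obtain ⟨c, hc⟩ := h.extreme r
  obtain ⟨y₀, hy₀⟩ := exists_ne r
  have hneg : ∀ x, det₂ (-c) x = - det₂ c x := by
    intro x; rw [← neg_one_smul ℝ c, det₂_smul_left]; ring
  refine ⟨-c, ?_, ?_, ?_⟩
  · intro h0
    have := hc y₀ hy₀
    rw [neg_eq_zero] at h0
    subst h0; simp [det₂] at this
  · intro y hy; rw [hneg]; linarith [hc y hy]
  · intro y hy
    obtain ⟨c', hc'⟩ := h.extreme y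
    refine ⟨p y - p r, Extreme.freeRay hc' ?_ (sub_ne_zero.2 (h.injective.ne hy)), ?_⟩
    · have := hc' r hy.symm
      rw [det₂_sub_right] at this ⊢; linarith
    · rw [hneg]; linarith [hc y hy]

/-- The criterion `visible_of_side` for vertices on a parabola. -/
theorem isConvexDrawing_parabola [Finite V] (G : SimpleGraph V) (π : V → ℤ)
    (hπ : Function.Injective π)
    (h : ∀ u w, u ≠ w → ¬ G.Adj u w → ∃ a b : V, (a = u ∧ b = w ∨ a = w ∧ b = u) ∧
      ((∀ k, G.Adj a k → (π b - π a) * (π k - π a) * (π k - π b) < 0) ∨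
        ∀ k, G.Adj a k → 0 < (π b - π a) * (π k - π a) * (π k - π b))) :
    ∃ p, IsConvexDrawing G p := by
  set p : V → Plane := fun v => !₂[(π v : ℝ), (π v : ℝ) ^ 2] with hp
  have hpd : ∀ a b k, det₂ (p b - p a) (p k - p a) =
      (((π b - π a) * (π k - π a) * (π k - π b) : ℤ) : ℝ) := by
    intro a b k
    simp [det₂, hp]; ring
  have hne : ∀ a b, a ≠ b → (π a - π b) ≠ 0 := fun a b hab => sub_ne_zero.2 (hπ.ne hab)
  -- The supporting direction is the reversed tangent of the parabola.
  have hext : ∀ x, ∀ y ≠ x, det₂ !₂[-1, -2 * (π x : ℝ)] (p y - p x) < 0 := by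
    intro x y hy
    have h1 : det₂ !₂[-1, -2 * (π x : ℝ)] (p y - p x) = -((π y : ℝ) - π x) ^ 2 := by
      simp [det₂, hp]; ring
    rw [h1]
    have : ((π y : ℝ) - π x) ≠ 0 := by exact_mod_cast hne y x hy
    have := sq_pos_of_ne_zero this
    linarith
  refine ⟨p, ?_, ?_, fun x => ⟨_, hext x⟩, ?_⟩
  · intro a b hab
    have := congrArg (fun x : Plane => x 0) hab
    simp [hp] at this
    exact hπ this
  · intro u v w huv huw hvw
    rw [hpd]
    exact_mod_cast mul_ne_zero (mul_ne_zero (hne _ _ huv.symm) (hne _ _ huw.symm)) (hne _ _ hvw.symm)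
  · intro u w huw hadj
    obtain ⟨a, b, hab, hs⟩ := h u w huw hadj
    have hvis : Visible G p a b := by
      have hba : b ≠ a := by rcases hab with ⟨rfl, rfl⟩ | ⟨rfl, rfl⟩ <;> tauto
      rcases hs with hs | hs
      · refine visible_of_side (hext a) hba one_ne_zero fun k hk => ?_
        rw [hpd, one_mul]; exact_mod_cast hs k hk
      · refine visible_of_side (hext a) hba (σ := -1) (by norm_num) fun k hk => ?_
        rw [hpd, neg_one_mul, neg_lt_zero]; exact_mod_cast hs k hk
    rcases hab with ⟨rfl, rfl⟩ | ⟨rfl, rfl⟩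
    · exact hvis
    · exact hvis.symm

end
-- Stability of visibility and the doubling of a hull vertex.
open Set Topology Filter

section
variable {V V' : Type*} {G : SimpleGraph V} {G' : SimpleGraph V'} {p : V → Plane} {φ : V' → V}
  {P : ℝ → V' → Plane} {l : Filter ℝ}

/-- In the limit every edge of `G'` shrinks to a vertex or becomes an edge of `G`, so nearby
drawings of `G'` stay close to the drawing of `G`. -/
theorem eventually_straightLineDrawing_subset [Finite V']
    (hφ : ∀ u w, G'.Adj u w → φ u = φ w ∨ G.Adj (φ u) (φ w))
    (hP : ∀ u, Tendsto (fun ε => P ε u) l (𝓝 (p (φ u)))) {ρ : ℝ} (hρ : 0 < ρ) :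
    ∀ᶠ ε in l, straightLineDrawing G' (P ε) ⊆ Metric.thickening ρ (straightLineDrawing G p) := by
  have h1 : ∀ᶠ ε in l, ∀ u, dist (p (φ u)) (P ε u) < ρ := by
    rw [eventually_all]
    intro u
    filter_upwards [(hP u).eventually (Metric.ball_mem_nhds _ hρ)] with ε hε
    rwa [dist_comm]
  filter_upwards [h1] with ε hε
  refine (straightLineDrawing_subset_thickening G' hε).trans (Metric.thickening_subset_of_subset _ ?_)
  intro x hx
  rcases mem_straightLineDrawing.1 hx with ⟨u, rfl⟩ | ⟨u, w, huw, hx⟩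
  · exact vertex_mem_straightLineDrawing _ _ _
  · rcases hφ u w huw with h | h
    · rw [h, segment_same] at hx
      rw [mem_singleton_iff.1 hx]; exact vertex_mem_straightLineDrawing _ _ _
    · exact mem_straightLineDrawing.2 (Or.inr ⟨_, _, h, hx⟩)

/-- The exit segment is compact and at positive distance from the limit drawing, and its end is at
positive distance from the hull; the hulls also converge. -/
theorem Visible.eventually [Finite V] [Finite V']
    (hφ : ∀ u w, G'.Adj u w → φ u = φ w ∨ G.Adj (φ u) (φ w))
    (hP : ∀ u, Tendsto (fun ε => P ε u) l (𝓝 (p (φ u)))) {u w : V'}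
    (h : Visible G p (φ u) (φ w)) : ∀ᶠ ε in l, Visible G' (P ε) u w := by
  obtain ⟨z, hz, k, hk, hd⟩ := h
  rw [segment_eq_image'] at hz
  obtain ⟨t, ht, rfl⟩ := hz
  set z := p (φ u) + t • (p (φ w) - p (φ u)) with hz
  have hcl : IsClosed (convexHull ℝ (range p)) :=
    ((finite_range p).isCompact_convexHull ℝ).isClosed
  obtain ⟨ρ, hρ, hball⟩ := Metric.isOpen_iff.1 hcl.isOpen_compl _ hk
  have hc : IsCompact (segment ℝ z k) := by
    rw [segment_eq_image']; exact isCompact_Icc.image (by fun_prop)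
  obtain ⟨δ, hδ, hdis⟩ := hd.exists_thickenings hc (isCompact_straightLineDrawing G p).isClosed
  have hz' : Tendsto (fun ε => P ε u + t • (P ε w - P ε u)) l (𝓝 z) :=
    (hP u).add (((hP w).sub (hP u)).const_smul t)
  have h1 : ∀ᶠ ε in l, ∀ u, P ε u ∈ Metric.ball (p (φ u)) ρ := by
    rw [eventually_all]
    exact fun u => (hP u).eventually (Metric.ball_mem_nhds _ hρ)
  filter_upwards [eventually_straightLineDrawing_subset hφ hP hδ, h1,
    hz'.eventually (Metric.ball_mem_nhds _ hδ)] with ε e1 e2 e3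
  refine ⟨P ε u + t • (P ε w - P ε u), ?_, k, ?_, ?_⟩
  · rw [segment_eq_image']; exact ⟨t, ht, rfl⟩
  · intro hk'
    have hsub : convexHull ℝ (range (P ε)) ⊆ Metric.thickening ρ (convexHull ℝ (range p)) :=
      convexHull_min (by
        rintro _ ⟨u, rfl⟩
        exact Metric.mem_thickening_iff.2 ⟨_, subset_convexHull _ _ (mem_range_self _), e2 u⟩)
        ((convex_convexHull ℝ _).thickening ρ)
    obtain ⟨y, hy, hyd⟩ := Metric.mem_thickening_iff.1 (hsub hk')
    exact hball (by rw [Metric.mem_ball, dist_comm]; exact hyd) hy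
  · refine disjoint_left.2 fun y hy hyD => disjoint_left.1 hdis ?_ (e1 hyD)
    rw [segment_eq_image'] at hy
    obtain ⟨s, hs, rfl⟩ := hy
    refine Metric.mem_thickening_iff.2 ⟨z + s • (k - z), ?_, ?_⟩
    · rw [segment_eq_image']; exact ⟨s, hs, rfl⟩
    · exact dist_segment_lt e3 (by rwa [dist_self]) hs

/-- As only `y` is sent to `φ y`, removing `y` from `G'` corresponds to removing `φ y` from `G`;
otherwise a twin of `y` would remain close to the apex of the ray. -/
theorem FreeRay.eventually [Finite V] [Finite V']
    (hφ : ∀ u w, G'.Adj u w → φ u = φ w ∨ G.Adj (φ u) (φ w))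
    (hP : ∀ u, Tendsto (fun ε => P ε u) l (𝓝 (p (φ u)))) {y : V'} {t : Plane}
    (hy : ∀ u, φ u = φ y → u = y) (h : FreeRay G p (φ y) t) : ∀ᶠ ε in l, FreeRay G' (P ε) y t := by
  obtain ⟨ht, hray⟩ := h
  have hdis : Disjoint (restDrawing G p (φ y)) ((fun s : ℝ => p (φ y) + s • t) '' Ici 0) := by
    rw [disjoint_right]; rintro _ ⟨s, hs, rfl⟩; exact hray s hs
  obtain ⟨ρ, hρ, hd⟩ := hdis.exists_thickenings (isCompact_restDrawing _) (isClosed_ray _ ht)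
  have h1 := eventually_straightLineDrawing_subset (G' := G'.induce {k | k ≠ y})
    (G := G.induce {k | k ≠ φ y}) (φ := fun k => ⟨φ k, fun h => k.2 (hy _ h)⟩)
    (p := fun k => p k) (P := fun ε k => P ε k) (l := l) (by
      intro u w huw
      rcases hφ u w huw with h | h
      · exact Or.inl (Subtype.ext h)
      · exact Or.inr h) (fun u => hP u) hρ
  filter_upwards [h1, (hP y).eventually (Metric.ball_mem_nhds _ hρ)] with ε e1 e2
  refine ⟨ht, fun s hs hx => disjoint_left.1 hd (e1 hx) (Metric.mem_thickening_iff.2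
    ⟨_, ⟨s, hs, rfl⟩, ?_⟩)⟩
  simp only [dist_add_right]; exact e2

theorem tendsto_det₂ {f g : ℝ → Plane} {a b : Plane} (hf : Tendsto f l (𝓝 a))
    (hg : Tendsto g l (𝓝 b)) : Tendsto (fun ε => det₂ (f ε) (g ε)) l (𝓝 (det₂ a b)) := by
  have hc : Continuous (fun x : Plane × Plane => det₂ x.1 x.2) := by fun_prop
  exact (hc.tendsto (a, b)).comp (hf.prodMk_nhds hg)

theorem eventually_det₂_sub_neg [Finite V']
    (hP : ∀ u, Tendsto (fun ε => P ε u) l (𝓝 (p (φ u)))) {y : V'} {c : Plane}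
    (h : ∀ k ≠ φ y, det₂ c (p k - p (φ y)) < 0) :
    ∀ᶠ ε in l, ∀ u, φ u ≠ φ y → det₂ c (P ε u - P ε y) < 0 := by
  rw [eventually_all]
  intro u
  by_cases hu : φ u = φ y
  · simp [hu]
  · filter_upwards [(tendsto_det₂ tendsto_const_nhds ((hP u).sub (hP y))).eventually_lt_const
      (h _ hu)] with ε hε _
    exact hε

theorem exists_tilt [Finite V] {x : V} {c m : Plane} (h : ∀ k ≠ x, det₂ c (p k - p x) < 0) :
    ∃ μ : ℝ, 0 < μ ∧ ∀ k ≠ x, det₂ (c + μ • m) (p k - p x) < 0 := by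
  have : ∀ᶠ μ : ℝ in 𝓝[>] 0, ∀ k ≠ x, det₂ (c + μ • m) (p k - p x) < 0 := by
    simp only [eventually_all]
    intro k hk
    have hc : Continuous (fun μ : ℝ => det₂ (c + μ • m) (p k - p x)) := by fun_prop
    have := (hc.tendsto 0).mono_left (nhdsWithin_le_nhds (s := Ioi 0))
    simp only [zero_smul, add_zero] at this
    exact this.eventually_lt_const (h k hk)
  exact ((eventually_gt_nhdsGT 0).and this).exists

theorem exists_det₂_eq {c : Plane} (hc : c ≠ 0) (s : ℝ) : ∃ m, det₂ c m = s := by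
  have h0 : 0 < c 0 ^ 2 + c 1 ^ 2 := by
    by_contra h
    apply hc
    have h1 : c 0 = 0 := by nlinarith [sq_nonneg (c 0), sq_nonneg (c 1)]
    have h2 : c 1 = 0 := by nlinarith [sq_nonneg (c 0), sq_nonneg (c 1)]
    exact Plane.ext' (by simpa using h1) (by simpa using h2)
  refine ⟨(s / (c 0 ^ 2 + c 1 ^ 2)) • !₂[-c 1, c 0], ?_⟩
  rw [det₂_smul_right]
  have : det₂ c !₂[-c 1, c 0] = c 0 ^ 2 + c 1 ^ 2 := by simp [det₂]; ring
  rw [this, div_mul_cancel₀ _ h0.ne']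

/-- A strict supporting direction may be turned slightly in either sense; the sign of `s` selects
the sense. This makes both ends of a short segment in direction `c` extreme. -/
theorem exists_tilt_sign [Finite V] {x : V} {c : Plane} (hc : c ≠ 0)
    (h : ∀ k ≠ x, det₂ c (p k - p x) < 0) {s : ℝ} (hs : s ≠ 0) :
    ∃ c', (∀ k ≠ x, det₂ c' (p k - p x) < 0) ∧ s * det₂ c' c < 0 := by
  obtain ⟨m, hm⟩ := exists_det₂_eq hc s
  obtain ⟨μ, hμ, h'⟩ := exists_tilt (m := m) h
  refine ⟨c + μ • m, h', ?_⟩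
  rw [det₂_add_left, det₂_self, det₂_smul_left, det₂_swap m c, hm]
  have : 0 < μ * (s * s) := by have := mul_self_pos.2 hs; positivity
  nlinarith

theorem det₂_cycle (a b c : Plane) : det₂ (b - a) (c - a) = det₂ (c - b) (a - b) := by
  simp [det₂]; ring

variable [Finite V] [Finite V'] {x v r : V'} {c c₀ : Plane} {σ : ℝ}

/-- Replacing a hull vertex of a block drawing by two nearby vertices. -/
theorem IsBlockDrawing.eventually_insert (h : IsBlockDrawing G p (φ r))
    (hxv : x ≠ v) (hφxv : φ x = φ v)
    (hinj : ∀ u w, φ u = φ w → u = w ∨ (u = x ∧ w = v) ∨ (u = v ∧ w = x))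
    (hφ : ∀ u w, G'.Adj u w → φ u = φ w ∨ G.Adj (φ u) (φ w))
    (hc0 : c ≠ 0) (hc : ∀ k ≠ φ x, det₂ c (p k - p (φ x)) < 0) (hσ : σ ≠ 0)
    (hPv : ∀ ε, P ε v = p (φ v) + ε • σ • c) (hPu : ∀ ε u, u ≠ v → P ε u = p (φ u))
    (hroot : c₀ ≠ 0 ∧ (∀ y ≠ φ r, 0 < det₂ c₀ (p y - p (φ r))) ∧
      ∀ y ≠ φ r, ∃ t, FreeRay G p y t ∧ 0 < det₂ c₀ t)
    (hrx : r = x → 0 < σ * det₂ c₀ c) (hrv : r = v → σ * det₂ c₀ c < 0)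
    (hside : ∀ u w, u ≠ w → ¬ G'.Adj u w → (φ u = φ w ∨ G.Adj (φ u) (φ w)) →
      ∃ u' w', (u' = u ∧ w' = w ∨ u' = w ∧ w' = u) ∧ (u' = x ∨ u' = v) ∧ ∃ τ : ℝ, τ ≠ 0 ∧
        ∀ k, G'.Adj u' k → ∀ᶠ ε in 𝓝[>] 0, τ * det₂ (P ε w' - P ε u') (P ε k - P ε u') < 0) :
    ∀ᶠ ε in 𝓝[>] 0, IsBlockDrawing G' (P ε) r ∧ Extreme (P ε) x ∧ Extreme (P ε) v ∧
      ∀ y, y ≠ x → y ≠ v → Extreme p (φ y) → Extreme (P ε) y := by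
  have hP : ∀ u, Tendsto (fun ε => P ε u) (𝓝[>] 0) (𝓝 (p (φ u))) := by
    intro u
    by_cases hu : u = v
    · subst hu
      simp only [hPv]
      have hcont : Continuous (fun ε : ℝ => p (φ u) + ε • σ • c) := by fun_prop
      have := (hcont.tendsto 0).mono_left (nhdsWithin_le_nhds (s := Ioi 0))
      simpa only [zero_smul, add_zero] using this
    · simp only [hPu _ u hu]; exact tendsto_const_nhds
  have hPx : ∀ ε, P ε x = p (φ x) := fun ε => hPu ε x hxv
  have hvx : ∀ ε, P ε v - P ε x = (ε * σ) • c := by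
    intro ε; rw [hPv, hPx, hφxv]; module
  have hfib : ∀ y, y ≠ x → y ≠ v → ∀ u, φ u = φ y → u = y := by
    intro y hyx hyv u hu
    rcases hinj u y hu with h | h | h
    · exact h
    · exact absurd h.2 hyv
    · exact absurd h.2 hyx
  have hinj' : ∀ᶠ ε in 𝓝[>] 0, Function.Injective (P ε) := by
    have : ∀ᶠ ε in 𝓝[>] 0, ∀ u w, φ u ≠ φ w → P ε u ≠ P ε w := by
      simp only [eventually_all]
      intro u w huw
      filter_upwards [((hP u).sub (hP w)).eventually_ne (sub_ne_zero.2 (h.injective.ne huw))]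
        with ε hε
      exact sub_ne_zero.1 hε
    filter_upwards [this, eventually_gt_nhdsGT 0] with ε h1 h2 u w huw
    have hne : P ε v ≠ P ε x := by
      rw [← sub_ne_zero, hvx]; exact smul_ne_zero (mul_ne_zero h2.ne' hσ) hc0
    by_contra hne'
    have : φ u = φ w := by_contra fun h => h1 u w h huw
    rcases hinj u w this with h | ⟨rfl, rfl⟩ | ⟨rfl, rfl⟩
    · exact hne' h
    · exact hne huw.symm
    · exact hne huw
  -- The supporting direction is tilted so that `v`, which is displaced by `(ε * σ) • c`, also falls
  -- on the inner side; the remaining vertices stay there for small `ε`. For `v` the tilt is in the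
  -- opposite sense.
  have hextx : ∀ᶠ ε in 𝓝[>] 0, ∃ c', ∀ y ≠ x, det₂ c' (P ε y - P ε x) < 0 := by
    obtain ⟨c', h1, h2⟩ := exists_tilt_sign hc0 hc hσ
    filter_upwards [eventually_det₂_sub_neg hP h1, eventually_gt_nhdsGT 0] with ε e1 e2
    refine ⟨c', fun y hy => ?_⟩
    by_cases hyv : y = v
    · rw [hyv, hvx, det₂_smul_right, mul_assoc]
      exact mul_neg_of_pos_of_neg e2 h2
    · refine e1 y fun h => ?_
      rcases hinj y x h with h | h | h
      · exact hy h
      · exact hxv h.2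
      · exact hyv h.1
  have hextv : ∀ᶠ ε in 𝓝[>] 0, ∃ c', ∀ y ≠ v, det₂ c' (P ε y - P ε v) < 0 := by
    obtain ⟨c', h1, h2⟩ := exists_tilt_sign hc0 hc (neg_ne_zero.2 hσ)
    rw [hφxv] at h1
    filter_upwards [eventually_det₂_sub_neg hP h1, eventually_gt_nhdsGT 0] with ε e1 e2
    refine ⟨c', fun y hy => ?_⟩
    by_cases hyx : y = x
    · rw [hyx, ← neg_sub, hvx, ← neg_smul, det₂_smul_right]
      have : -(ε * σ) * det₂ c' c = ε * (-σ * det₂ c' c) := by ring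
      rw [this]
      exact mul_neg_of_pos_of_neg e2 h2
    · refine e1 y fun h => ?_
      rcases hinj y v h with h | h | h
      · exact hy h
      · exact hyx h.1
      · exact hxv h.2.symm
  have hexty : ∀ᶠ ε in 𝓝[>] 0, ∀ y, y ≠ x → y ≠ v → Extreme p (φ y) → Extreme (P ε) y := by
    simp only [eventually_all]
    rintro y hyx hyv ⟨c', hc'⟩
    filter_upwards [eventually_det₂_sub_neg hP hc'] with ε e1
    exact ⟨c', fun u hu => e1 u fun h => hu (hfib y hyx hyv u h)⟩
  have hno : ∀ᶠ ε in 𝓝[>] 0, NoThreeCollinear (P ε) := by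
    have h1 : ∀ᶠ ε in 𝓝[>] 0, ∀ u w k, φ u ≠ φ w → φ u ≠ φ k → φ w ≠ φ k →
        det₂ (P ε w - P ε u) (P ε k - P ε u) ≠ 0 := by
      simp only [eventually_all]
      intro u w k h1 h2 h3
      exact (tendsto_det₂ ((hP w).sub (hP u)) ((hP k).sub (hP u))).eventually_ne (h.noThree _ _ _ h1 h2 h3)
    filter_upwards [h1, eventually_gt_nhdsGT 0] with ε h1 h2
    have h3 : ∀ k, k ≠ x → k ≠ v → det₂ (P ε v - P ε x) (P ε k - P ε x) ≠ 0 := by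
      intro k hkx hkv
      rw [hvx, det₂_smul_left, hPx, hPu _ k hkv]
      exact mul_ne_zero (mul_ne_zero h2.ne' hσ)
        (hc _ fun h => hkx (hfib k hkx hkv x h.symm).symm).ne
    have h4 : ∀ u w k, u ≠ w → u ≠ k → w ≠ k → φ u = φ w →
        det₂ (P ε w - P ε u) (P ε k - P ε u) ≠ 0 := by
      intro u w k huw huk hwk he
      rcases hinj u w he with h | ⟨rfl, rfl⟩ | ⟨rfl, rfl⟩
      · exact absurd h huw
      · exact h3 k huk.symm hwk.symm
      · rw [det₂_swap, det₂_cycle, neg_ne_zero, det₂_cycle]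
        exact h3 k hwk.symm huk.symm
    intro u w k huw huk hwk
    by_cases a1 : φ u = φ w
    · exact h4 u w k huw huk hwk a1
    · by_cases a2 : φ w = φ k
      · rw [det₂_cycle]; exact h4 w k u hwk huw.symm huk.symm a2
      · by_cases a3 : φ u = φ k
        · rw [det₂_cycle, det₂_cycle]; exact h4 k u w huk.symm hwk.symm huw a3.symm
        · exact h1 u w k a1 a3 a2
  -- Nonedges that stay nonedges under `φ` inherit visibility. Those that collapse or become edges
  -- have an end at `x` or `v`, by `hside`, and are handled by `visible_of_side` at this hull
  -- vertex.
  have hvis1 : ∀ᶠ ε in 𝓝[>] 0, ∀ u w, φ u ≠ φ w → ¬ G.Adj (φ u) (φ w) → Visible G' (P ε) u w := by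
    simp only [eventually_all]
    intro u w huw hadj
    exact (h.visible _ _ huw hadj).eventually hφ hP
  have hvis2 : ∀ᶠ ε in 𝓝[>] 0, ∀ u w, u ≠ w → ¬ G'.Adj u w → (φ u = φ w ∨ G.Adj (φ u) (φ w)) →
      Visible G' (P ε) u w := by
    simp only [eventually_all]
    intro u w huw hadj he
    obtain ⟨u', w', huw', hu', τ, hτ, hk⟩ := hside u w huw hadj he
    have hk' : ∀ᶠ ε in 𝓝[>] 0, ∀ k, G'.Adj u' k →
        τ * det₂ (P ε w' - P ε u') (P ε k - P ε u') < 0 := by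
      simp only [eventually_all]; exact hk
    have hne : w' ≠ u' := by rcases huw' with ⟨rfl, rfl⟩ | ⟨rfl, rfl⟩ <;> tauto
    filter_upwards [hk', hextx, hextv] with ε e1 ⟨c₁, e2⟩ ⟨c₂, e3⟩
    have : Visible G' (P ε) u' w' := by
      rcases hu' with rfl | rfl
      · exact visible_of_side e2 hne hτ e1
      · exact visible_of_side e3 hne hτ e1
    rcases huw' with ⟨rfl, rfl⟩ | ⟨rfl, rfl⟩
    · exact this
    · exact this.symm
  obtain ⟨hc₀, hpos, hray⟩ := hroot
  have hpos' : ∀ᶠ ε in 𝓝[>] 0, ∀ y ≠ r, 0 < det₂ c₀ (P ε y - P ε r) := by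
    have : ∀ᶠ ε in 𝓝[>] 0, ∀ y, φ y ≠ φ r → 0 < det₂ c₀ (P ε y - P ε r) := by
      simp only [eventually_all]
      intro y hy
      exact (tendsto_det₂ tendsto_const_nhds ((hP y).sub (hP r))).eventually_const_lt (hpos _ hy)
    filter_upwards [this, eventually_gt_nhdsGT 0] with ε e1 e2 y hy
    by_cases he : φ y = φ r
    · rcases hinj y r he with h | ⟨rfl, rfl⟩ | ⟨rfl, rfl⟩
      · exact absurd h hy
      · rw [← neg_sub, hvx, ← neg_smul, det₂_smul_right]
        have := mul_neg_of_pos_of_neg e2 (hrv rfl)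
        linarith
      · rw [hvx, det₂_smul_right, mul_assoc]
        exact mul_pos e2 (hrx rfl)
    · exact e1 y he
  have hray' : ∀ᶠ ε in 𝓝[>] 0, ∀ y, y ≠ r → y ≠ x → y ≠ v →
      ∃ t, FreeRay G' (P ε) y t ∧ 0 < det₂ c₀ t := by
    simp only [eventually_all]
    intro y hyr hyx hyv
    obtain ⟨t, ht, h0⟩ := hray (φ y) fun h => hyr (hfib y hyx hyv r h.symm).symm
    filter_upwards [ht.eventually hφ hP (hfib y hyx hyv)] with ε hε
    exact ⟨t, hε, h0⟩
  filter_upwards [hinj', hextx, hextv, hexty, hno, hvis1, hvis2, hpos', hray']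
    with ε e1 e2 e3 e4 e5 e6 e7 e8 e9
  refine ⟨⟨e1, e5, fun u w huw hadj => ?_, c₀, hc₀, e8, fun y hy => ?_⟩, e2, e3, e4⟩
  · by_cases he : φ u = φ w ∨ G.Adj (φ u) (φ w)
    · exact e7 u w huw hadj he
    · push Not at he
      exact e6 u w he.1 he.2
  -- For the two new vertices, the ray pointing away from the root is free because they are extreme.
  · have key : Extreme (P ε) y → ∃ t, FreeRay G' (P ε) y t ∧ 0 < det₂ c₀ t := by
      rintro ⟨c', hc'⟩
      refine ⟨P ε y - P ε r, Extreme.freeRay hc' ?_ (sub_ne_zero.2 (e1.ne hy)), e8 y hy⟩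
      have := hc' r hy.symm
      rw [det₂_sub_right] at this ⊢; linarith
    by_cases hyx : y = x
    · exact key (hyx ▸ e2)
    · by_cases hyv : y = v
      · exact key (hyv ▸ e3)
      · exact e9 y hy hyx hyv

/-- A functional that separates the hull vertex `x`, adapted to the root functional. -/
theorem exists_separating_root {p : V → Plane} {x r : V} (hV : Nontrivial V)
    (hr : ∀ y ≠ r, 0 < det₂ c₀ (p y - p r)) (hx : x ≠ r → Extreme p x) {s : ℝ} (hs : s ≠ 0) :
    ∃ c, c ≠ 0 ∧ (∀ k ≠ x, det₂ c (p k - p x) < 0) ∧ (x = r → 0 < s * det₂ c₀ c) := by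
  suffices H : ∃ c, (∀ k ≠ x, det₂ c (p k - p x) < 0) ∧ (x = r → 0 < s * det₂ c₀ c) by
    obtain ⟨c, h1, h2⟩ := H
    refine ⟨c, ?_, h1, h2⟩
    rintro rfl
    obtain ⟨y, hy⟩ := exists_ne x
    have := h1 y hy
    simp [det₂] at this
  by_cases hxr : x = r
  · subst hxr
    have hc₀ : c₀ ≠ 0 := by
      rintro rfl
      obtain ⟨y, hy⟩ := exists_ne x
      have := hr y hy
      simp [det₂] at this
    have hneg : ∀ y, det₂ (-c₀) y = - det₂ c₀ y := by
      intro y; rw [← neg_one_smul ℝ c₀, det₂_smul_left]; ring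
    -- At the root itself `-c₀` is already supporting, and the sense of the tilt decides the sign of
    -- `det₂ c₀ c`.
    obtain ⟨c, h1, h2⟩ := exists_tilt_sign (c := -c₀) (neg_ne_zero.2 hc₀)
      (fun k hk => by rw [hneg]; linarith [hr k hk]) (neg_ne_zero.2 hs)
    refine ⟨c, h1, fun _ => ?_⟩
    rw [det₂_swap, hneg] at h2
    linarith
  · obtain ⟨c, hc⟩ := hx hxr
    exact ⟨c, hc, fun h => absurd h hxr⟩

end
-- Drawable graphs: adding a twin and undoing a contraction.
open Set Topology Filter

section
variable {V V' : Type*} {G : SimpleGraph V} {G' : SimpleGraph V'} {φ : V' → V}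

/-- Vertices that have to be placed on the convex hull. -/
def IsTarget (G : SimpleGraph V) (x : V) : Prop :=
  (G.neighborSet x).ncard ≤ 2 ∨ ((G.neighborSet x).ncard ≤ 3 ∧
    ∃ T : Set V, T.ncard ≤ 3 ∧ G.neighborSet x ⊆ T ∧ ∀ u w, G.Adj u w → u ∈ T ∨ w ∈ T)

/-- All roots are required because a block may be attached at any of its vertices. The targets
include every vertex that is doubled in a later step, by a twin or by undoing a contraction, and
doubling works only on the convex hull. -/
def Drawable (G : SimpleGraph V) : Prop :=
  ∀ r, ∃ p, IsBlockDrawing G p r ∧ ∀ x, IsTarget G x → Extreme p x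

theorem IsTarget.map [Finite V'] (hG : ∀ u w, G.Adj u w → ∃ u' w', φ u' = u ∧ φ w' = w ∧ G'.Adj u' w')
    {y : V'} (h : IsTarget G' y) (hN : G.neighborSet (φ y) ⊆ φ '' G'.neighborSet y) :
    IsTarget G (φ y) := by
  have hcard : (G.neighborSet (φ y)).ncard ≤ (G'.neighborSet y).ncard :=
    (ncard_le_ncard hN (toFinite _)).trans (ncard_image_le (toFinite _))
  rcases h with h | ⟨h, T, hT, hNT, hcov⟩
  · exact Or.inl (hcard.trans h)
  · refine Or.inr ⟨hcard.trans h, φ '' T, (ncard_image_le (toFinite _)).trans hT,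
      hN.trans (image_mono hNT), fun u w huw => ?_⟩
    obtain ⟨u', w', rfl, rfl, h'⟩ := hG u w huw
    exact (hcov u' w' h').imp (mem_image_of_mem _) (mem_image_of_mem _)

variable {x v : V'}

/-- Contraction of `v` into `x`. -/
def contractMap [DecidableEq V'] (hxv : x ≠ v) (u : V') : {u : V' // u ≠ v} :=
  if hu : u = v then ⟨x, hxv⟩ else ⟨u, hu⟩

def contractGraph [DecidableEq V'] (G' : SimpleGraph V') (hxv : x ≠ v) :
    SimpleGraph {u : V' // u ≠ v} where
  Adj a b := a ≠ b ∧ ∃ u w, contractMap hxv u = a ∧ contractMap hxv w = b ∧ G'.Adj u w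
  symm := ⟨fun _ _ ⟨h, u, w, hu, hw, hadj⟩ => ⟨h.symm, w, u, hw, hu, hadj.symm⟩⟩
  loopless := ⟨fun _ h => h.1 rfl⟩

theorem contractMap_self [DecidableEq V'] (hxv : x ≠ v) : contractMap hxv v = ⟨x, hxv⟩ := by
  simp [contractMap]

theorem contractMap_of_ne [DecidableEq V'] (hxv : x ≠ v) {u : V'} (hu : u ≠ v) :
    contractMap hxv u = ⟨u, hu⟩ := by simp [contractMap, hu]

theorem contractMap_eq_iff [DecidableEq V'] (hxv : x ≠ v) {u w : V'}
    (h : contractMap hxv u = contractMap hxv w) : u = w ∨ (u = x ∧ w = v) ∨ (u = v ∧ w = x) := by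
  by_cases hu : u = v
  · by_cases hw : w = v
    · exact Or.inl (hu.trans hw.symm)
    · rw [hu, contractMap_self, contractMap_of_ne _ hw] at h
      exact Or.inr (Or.inr ⟨hu, (congrArg Subtype.val h).symm⟩)
  · by_cases hw : w = v
    · rw [hw, contractMap_self, contractMap_of_ne _ hu] at h
      exact Or.inr (Or.inl ⟨congrArg Subtype.val h, hw⟩)
    · rw [contractMap_of_ne _ hu, contractMap_of_ne _ hw] at h
      exact Or.inl (congrArg Subtype.val h)

variable [Finite V] [Finite V']

/-- The drawing of the smaller graph with root `φ r` is taken, and `v` is placed at a small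
displacement from `x` along a supporting direction. The two become extreme, and the image of any
other target is a target of the smaller graph, so its extremality is inherited. -/
theorem Drawable.of_merge (h : Drawable G) (hV : Nontrivial V) (hxv : x ≠ v) (hφxv : φ x = φ v)
    (hinj : ∀ u w, φ u = φ w → u = w ∨ (u = x ∧ w = v) ∨ (u = v ∧ w = x))
    (hφ : ∀ u w, G'.Adj u w → φ u = φ w ∨ G.Adj (φ u) (φ w))
    (hG : ∀ u w, G.Adj u w → ∃ u' w', φ u' = u ∧ φ w' = w ∧ G'.Adj u' w')
    (hx : IsTarget G (φ x))
    (hside : ∀ p : V → Plane, Function.Injective p → NoThreeCollinear p → ∃ σ : ℝ, σ ≠ 0 ∧ ∀ c, c ≠ 0 →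
      (∀ k ≠ φ x, det₂ c (p k - p (φ x)) < 0) → ∀ P : ℝ → V' → Plane,
      (∀ ε, P ε v = p (φ v) + ε • σ • c) → (∀ ε u, u ≠ v → P ε u = p (φ u)) →
      ∀ u w, u ≠ w → ¬ G'.Adj u w → (φ u = φ w ∨ G.Adj (φ u) (φ w)) →
      ∃ u' w', (u' = u ∧ w' = w ∨ u' = w ∧ w' = u) ∧ (u' = x ∨ u' = v) ∧ ∃ τ : ℝ, τ ≠ 0 ∧
        ∀ k, G'.Adj u' k → ∀ᶠ ε in 𝓝[>] 0, τ * det₂ (P ε w' - P ε u') (P ε k - P ε u') < 0) :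
    Drawable G' := by
  classical
  intro r
  obtain ⟨p, hp, hext⟩ := h (φ r)
  obtain ⟨σ, hσ, hs⟩ := hside p hp.injective hp.noThree
  obtain ⟨c₀, hc₀, hpos, hray⟩ := hp.root
  -- The new vertex sits at displacement `ε • σ • c` from `x`. If the root is `v`, then `x` has to
  -- be on its positive side, which reverses the sign.
  have hs' : (if r = v then -σ else σ) ≠ 0 := by split_ifs <;> simpa
  obtain ⟨c, hc0, hc, hcr⟩ := exists_separating_root (x := φ x) hV hpos (fun _ => hext _ hx) hs'
  set P : ℝ → V' → Plane := fun ε u => if u = v then p (φ v) + ε • σ • c else p (φ u) with hP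
  have hPv : ∀ ε, P ε v = p (φ v) + ε • σ • c := by intro ε; simp [hP]
  have hPu : ∀ ε u, u ≠ v → P ε u = p (φ u) := by intro ε u hu; simp [hP, hu]
  have := hp.eventually_insert hxv hφxv hinj hφ hc0 hc hσ hPv hPu ⟨hc₀, hpos, hray⟩
    (by
      rintro rfl
      have := hcr rfl
      rwa [if_neg hxv] at this)
    (by
      rintro rfl
      have := hcr hφxv
      rw [if_pos rfl] at this; linarith)
    (hs c hc0 hc P hPv hPu)
  obtain ⟨ε, h1, h2, h3, h4⟩ := this.exists
  refine ⟨P ε, h1, fun y hy => ?_⟩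
  by_cases hyx : y = x
  · exact hyx ▸ h2
  · by_cases hyv : y = v
    · exact hyv ▸ h3
    · refine h4 y hyx hyv (hext _ (hy.map hG ?_))
      intro w hw
      obtain ⟨u', w', hu, rfl, huw⟩ := hG _ _ hw
      rcases hinj u' y hu with rfl | h | h
      · exact ⟨w', huw, rfl⟩
      · exact absurd h.2 hyv
      · exact absurd h.2 hyx

/-- The displacement is along a supporting line, so all neighbours of `x` are strictly on one side
of the line `x v`, which makes this nonedge visible. All other nonedges are nonedges of the smaller
graph. -/
theorem Drawable.of_twin [DecidableEq V'] (hxv : x ≠ v) (hadj : ¬ G'.Adj x v)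
    (htwin : ∀ w, G'.Adj x w ↔ G'.Adj v w) (hx : IsTarget G' x) (hV : Nontrivial {u : V' // u ≠ v})
    (h : Drawable (G'.induce {u | u ≠ v})) : Drawable G' := by
  set φ : V' → {u : V' // u ≠ v} := fun u => if hu : u = v then ⟨x, hxv⟩ else ⟨u, hu⟩ with hφd
  have hφv : φ v = ⟨x, hxv⟩ := by simp [hφd]
  have hφu : ∀ u (hu : u ≠ v), φ u = ⟨u, hu⟩ := by intro u hu; simp [hφd, hu]
  have hadjφ : ∀ u w, G'.Adj u w → G'.Adj (φ u) (φ w) := by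
    intro u w huw
    by_cases hu : u = v
    · subst hu
      rw [hφv, hφu w huw.ne']
      exact (htwin w).2 huw
    · by_cases hw : w = v
      · subst hw
        rw [hφv, hφu u hu]
        exact ((htwin u).2 huw.symm).symm
      · rw [hφu u hu, hφu w hw]; exact huw
  have hG : ∀ u w : {u : V' // u ≠ v}, (G'.induce {u | u ≠ v}).Adj u w →
      ∃ u' w', φ u' = u ∧ φ w' = w ∧ G'.Adj u' w' := by
    intro u w huw
    exact ⟨u, w, hφu u u.2, hφu w w.2, huw⟩
  refine h.of_merge (φ := φ) hV hxv (by rw [hφv, hφu x hxv]) ?_ (fun u w huw => Or.inr (hadjφ u w huw))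
    hG ?_ ?_
  · intro u w huw
    by_cases hu : u = v
    · by_cases hw : w = v
      · exact Or.inl (hu.trans hw.symm)
      · rw [hu, hφv, hφu w hw] at huw
        exact Or.inr (Or.inr ⟨hu, (congrArg Subtype.val huw).symm⟩)
    · by_cases hw : w = v
      · rw [hw, hφv, hφu u hu] at huw
        exact Or.inr (Or.inl ⟨congrArg Subtype.val huw, hw⟩)
      · rw [hφu u hu, hφu w hw] at huw
        exact Or.inl (congrArg Subtype.val huw)
  · refine hx.map (φ := φ) hG fun w hw => ?_
    rw [hφu x hxv] at hw
    exact ⟨w, hw, hφu w w.2⟩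
  · intro p _ _
    refine ⟨1, one_ne_zero, fun c hc0 hc P hPv hPu u w huw hnadj he => ?_⟩
    have hGadj : ∀ u w, (G'.induce {u | u ≠ v}).Adj (φ u) (φ w) → G'.Adj u w := by
      intro u w huw
      have huw : G'.Adj (φ u) (φ w) := huw
      by_cases hu : u = v
      · rw [hu, hφv] at huw
        by_cases hw : w = v
        · rw [hw, hφv] at huw; exact absurd huw (G'.irrefl)
        · rw [hφu w hw] at huw; rw [hu]; exact (htwin _).1 huw
      · rw [hφu u hu] at huw
        by_cases hw : w = v
        · rw [hw, hφv] at huw; rw [hw]; exact ((htwin _).1 huw.symm).symm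
        · rwa [hφu w hw] at huw
    have he := he.resolve_right fun h => hnadj (hGadj _ _ h)
    have key : ∀ k, G'.Adj x k → ∀ᶠ ε in 𝓝[>] 0, (1 : ℝ) * det₂ (P ε v - P ε x) (P ε k - P ε x) < 0 := by
      intro k hk
      have hkv : k ≠ v := by rintro rfl; exact hadj hk
      filter_upwards [eventually_gt_nhdsGT 0] with ε hε
      have e1 : P ε v - P ε x = ε • c := by
        rw [hPv, hPu ε x hxv, hφv, hφu x hxv]; module
      rw [e1, hPu ε k hkv, hPu ε x hxv, det₂_smul_left, one_mul]
      refine mul_neg_of_pos_of_neg hε (hc _ ?_)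
      rw [hφu k hkv, hφu x hxv]
      exact fun h => hk.ne (congrArg Subtype.val h).symm
    refine ⟨x, v, ?_, Or.inl rfl, 1, one_ne_zero, key⟩
    by_cases hu : u = v
    · have hw : w ≠ v := fun h => huw (hu.trans h.symm)
      rw [hu, hφv, hφu w hw] at he
      exact Or.inr ⟨congrArg Subtype.val he, hu.symm⟩
    · by_cases hw : w = v
      · rw [hw, hφv, hφu u hu] at he
        exact Or.inl ⟨(congrArg Subtype.val he).symm, hw.symm⟩
      · rw [hφu u hu, hφu w hw] at he
        exact absurd (congrArg Subtype.val he) huw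

/-- The contracted vertex has no neighbours besides `a` and `b`, so it is a target. The possible new
nonedges are `x a` and `v b`. With the displacement taken in the direction given by the sign of `D`,
the vertices `v` and `b` lie on the same side of the line `x a`, and `x` and `a` on the same side of
the line `v b`; this is what `visible_of_side` needs. -/
theorem Drawable.of_split [DecidableEq V'] {a b : V'} (hxv : x ≠ v) (hax : a ≠ x) (hav : a ≠ v)
    (hbx : b ≠ x) (hbv : b ≠ v) (hab : a ≠ b) (hva : G'.Adj v a) (hxb : G'.Adj x b)
    (hNx : ∀ w, G'.Adj x w → w = v ∨ w = a ∨ w = b) (hNv : ∀ w, G'.Adj v w → w = x ∨ w = a ∨ w = b)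
    (h : Drawable (contractGraph G' hxv)) (hadj : G'.Adj x v) : Drawable G' := by
  set φ := contractMap hxv with hφd
  have hφv : φ v = ⟨x, hxv⟩ := contractMap_self hxv
  have hφu : ∀ u (hu : u ≠ v), φ u = ⟨u, hu⟩ := fun u hu => contractMap_of_ne hxv hu
  have hφxv : φ x = φ v := by rw [hφv, hφu x hxv]
  have hinj := fun u w => contractMap_eq_iff (u := u) (w := w) hxv
  have hfa : φ a ≠ φ x := fun h => by rcases hinj _ _ h with h | h | h <;> tauto
  have hfb : φ b ≠ φ x := fun h => by rcases hinj _ _ h with h | h | h <;> tauto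
  have hfab : φ a ≠ φ b := fun h => by rcases hinj _ _ h with h | h | h <;> tauto
  have hGx : ∀ w, (contractGraph G' hxv).Adj (φ x) w → w = φ a ∨ w = φ b := by
    rintro w ⟨hne, u', w', hu, rfl, huw⟩
    have h1 : w' ≠ x := by rintro rfl; exact hne rfl
    have h2 : w' ≠ v := by rintro rfl; exact hne hφxv
    have h3 : w' = a ∨ w' = b := by
      rcases hinj _ _ hu with rfl | h | h
      · have := hNx _ huw; tauto
      · exact absurd h.2 hxv
      · rw [h.1] at huw; have := hNv _ huw; tauto
    rcases h3 with rfl | rfl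
    · exact Or.inl rfl
    · exact Or.inr rfl
  refine h.of_merge (φ := φ) ⟨φ x, φ a, hfa.symm⟩ hxv hφxv hinj ?_ ?_ ?_ ?_
  · intro u w huw
    by_cases he : φ u = φ w
    · exact Or.inl he
    · exact Or.inr ⟨he, u, w, rfl, rfl, huw⟩
  · rintro u w ⟨-, u', w', hu, hw, h⟩
    exact ⟨u', w', hu, hw, h⟩
  · left
    refine (ncard_le_ncard (t := {φ a, φ b}) (fun w hw => ?_) (toFinite _)).trans ((ncard_insert_le _ _).trans (by rw [ncard_singleton]))
    rcases hGx w hw with rfl | rfl <;> simp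
  · intro p _ hno
    set D := det₂ (p (φ a) - p (φ x)) (p (φ b) - p (φ x)) with hD
    have hD0 : D ≠ 0 := hno _ _ _ hfa.symm hfb.symm hfab
    refine ⟨D, hD0, fun c hc0 hc P hPv hPu u w huw hnadj he => ?_⟩
    have hPx : ∀ ε, P ε x = p (φ x) := fun ε => hPu ε x hxv
    have hPa : ∀ ε, P ε a = p (φ a) := fun ε => hPu ε a hav
    have hPb : ∀ ε, P ε b = p (φ b) := fun ε => hPu ε b hbv
    have hDD : 0 < D * D := mul_self_pos.2 hD0
    have hca := hc _ hfa
    have hcb := hc _ hfb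
    have hxa : ¬ G'.Adj x a → ∀ k, G'.Adj x k → ∀ᶠ ε in 𝓝[>] 0,
        (-D) * det₂ (P ε a - P ε x) (P ε k - P ε x) < 0 := by
      intro hna k hk
      filter_upwards [eventually_gt_nhdsGT 0] with ε hε
      rcases hNx k hk with rfl | rfl | rfl
      · have e1 : P ε k - P ε x = (ε * D) • c := by rw [hPv, hPx, hφxv]; module
        rw [e1, hPa, hPx, det₂_smul_right, det₂_swap _ c]
        have : 0 < ε * (D * D) := mul_pos hε hDD
        nlinarith
      · exact absurd hk hna
      · rw [hPa, hPx, hPb, ← hD]; linarith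
    have hvb : ¬ G'.Adj v b → ∀ k, G'.Adj v k → ∀ᶠ ε in 𝓝[>] 0,
        D * det₂ (P ε b - P ε v) (P ε k - P ε v) < 0 := by
      intro hnb k hk
      have hcont : Continuous (fun ε : ℝ => p (φ v) + ε • D • c) := by fun_prop
      have hPvt : Tendsto (fun ε => P ε v) (𝓝[>] 0) (𝓝 (p (φ x))) := by
        simp only [hPv]
        have := (hcont.tendsto 0).mono_left (nhdsWithin_le_nhds (s := Ioi 0))
        simpa only [zero_smul, add_zero, hφxv] using this
      rcases hNv k hk with rfl | rfl | rfl
      · filter_upwards [eventually_gt_nhdsGT 0] with ε hε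
        have e1 : P ε k - P ε v = (-(ε * D)) • c := by rw [hPv, hPx, hφxv]; module
        have e2 : P ε b - P ε v = (P ε b - P ε k) + (-(ε * D)) • c := by rw [← e1]; abel
        rw [e2, e1, det₂_smul_right, det₂_add_left, det₂_smul_left, det₂_self, hPb, hPx,
          det₂_swap _ c]
        have : 0 < ε * (D * D) := mul_pos hε hDD
        nlinarith
      · have := tendsto_det₂ ((tendsto_const_nhds (x := p (φ b))).sub hPvt)
          ((tendsto_const_nhds (x := p (φ k))).sub hPvt)
        rw [det₂_swap, ← hD] at this
        filter_upwards [(this.const_mul D).eventually_lt_const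
          (show D * -D < 0 by linarith)] with ε hε
        rwa [hPb, hPu ε k hav]
      · exact absurd hk hnb
    have key : ∀ u w, u ≠ w → ¬ G'.Adj u w → (contractGraph G' hxv).Adj (φ u) (φ w) →
        (φ u = φ x → ∃ u' w', (u' = u ∧ w' = w ∨ u' = w ∧ w' = u) ∧ (u' = x ∨ u' = v) ∧
        ∃ τ : ℝ, τ ≠ 0 ∧
        ∀ k, G'.Adj u' k → ∀ᶠ ε in 𝓝[>] 0, τ * det₂ (P ε w' - P ε u') (P ε k - P ε u') < 0) := by
      intro u w huw hnadj he hux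
      rw [hux] at he
      have hw : w = a ∨ w = b := by
        rcases hGx _ he with h | h
        · rcases hinj _ _ h with h | h | h
          · exact Or.inl h
          · exact absurd h.2 hav
          · exact absurd h.2 hax
        · rcases hinj _ _ h with h | h | h
          · exact Or.inr h
          · exact absurd h.2 hbv
          · exact absurd h.2 hbx
      have hu : u = x ∨ u = v := by
        rcases hinj _ _ hux with h | h | h
        · exact Or.inl h
        · exact absurd h.2 hxv
        · exact Or.inr h.1
      rcases hu with rfl | rfl <;> rcases hw with rfl | rfl
      · exact ⟨_, _, Or.inl ⟨rfl, rfl⟩, Or.inl rfl, _, neg_ne_zero.2 hD0, hxa hnadj⟩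
      · exact absurd hxb hnadj
      · exact absurd hva hnadj
      · exact ⟨_, _, Or.inl ⟨rfl, rfl⟩, Or.inr rfl, _, hD0, hvb hnadj⟩
    rcases he with he | he
    · rcases hinj _ _ he with h | ⟨rfl, rfl⟩ | ⟨rfl, rfl⟩
      · exact absurd h huw
      · exact absurd hadj hnadj
      · exact absurd hadj.symm hnadj
    · obtain ⟨u', w', hu, hw, huw'⟩ := he.2
      by_cases hux : φ u = φ x
      · exact key u w huw hnadj he hux
      · by_cases hwx : φ w = φ x
        · obtain ⟨u₁, w₁, h1, h2⟩ := key w u huw.symm (fun h => hnadj h.symm) he.symm hwx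
          exact ⟨u₁, w₁, h1.symm, h2⟩
        · have fib : ∀ y z, φ y ≠ φ x → φ z = φ y → z = y := by
            intro y z hy hz
            rcases hinj _ _ hz with h | h | h
            · exact h
            · exact absurd (by rw [h.2, hφxv]) hy
            · exact absurd (by rw [h.2]) hy
          rw [fib u u' hux hu, fib w w' hwx hw] at huw'
          exact absurd huw' hnadj

end
-- Finite graphs as bit masks; convex drawings by computation.
open Set Topology Filter

section
variable {V V' : Type*} {G : SimpleGraph V} {G' : SimpleGraph V'} {p : V → Plane}

theorem straightLineDrawing_comp_iso (f : G' ≃g G) (p : V → Plane) :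
    straightLineDrawing G' (fun x => p (f x)) = straightLineDrawing G p := by
  ext x
  simp only [mem_straightLineDrawing]
  constructor
  · rintro (⟨v, rfl⟩ | ⟨u, v, huv, hx⟩)
    · exact Or.inl ⟨_, rfl⟩
    · exact Or.inr ⟨_, _, f.map_adj_iff.2 huv, hx⟩
  · rintro (⟨v, rfl⟩ | ⟨u, v, huv, hx⟩)
    · exact Or.inl ⟨f.symm v, by simp⟩
    · exact Or.inr ⟨f.symm u, f.symm v, f.symm.map_adj_iff.2 huv, by simpa using hx⟩

theorem IsBlockDrawing.comp_iso (f : G' ≃g G) {r : V'} (h : IsBlockDrawing G p (f r)) :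
    IsBlockDrawing G' (fun x => p (f x)) r := by
  have hrange : range (fun x => p (f x)) = range p := f.toEquiv.surjective.range_comp p
  refine ⟨h.injective.comp f.injective, fun u v w h1 h2 h3 => h.noThree _ _ _ (f.injective.ne h1)
    (f.injective.ne h2) (f.injective.ne h3), fun u w huw hadj => ?_, ?_⟩
  · obtain ⟨z, hz, k, hk, hd⟩ := h.visible (f u) (f w) (f.injective.ne huw)
      (fun h => hadj (f.map_adj_iff.1 h))
    refine ⟨z, hz, k, by rwa [hrange], ?_⟩
    rwa [straightLineDrawing_comp_iso f p]
  · obtain ⟨c, hc, h1, h2⟩ := h.root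
    refine ⟨c, hc, fun y hy => h1 _ (f.injective.ne hy), fun y hy => ?_⟩
    obtain ⟨t, ⟨ht, hray⟩, h3⟩ := h2 _ (f.injective.ne hy)
    refine ⟨t, ⟨ht, fun s hs hx => hray s hs ?_⟩, h3⟩
    have := straightLineDrawing_comp_iso (G' := G'.induce {k | k ≠ y}) (G := G.induce {k | k ≠ f y})
      ⟨f.toEquiv.subtypeEquiv (fun a => (f.injective.ne_iff (x := a) (y := y)).symm), f.map_adj_iff⟩
      (fun k => p k)
    unfold restDrawing at hx ⊢
    rw [← this]; exact hx

theorem Extreme.comp_injective {f : V' → V} (hf : Function.Injective f) {y : V'}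
    (h : Extreme p (f y)) : Extreme (fun x => p (f x)) y := by
  obtain ⟨c, hc⟩ := h
  exact ⟨c, fun k hk => hc _ (hf.ne hk)⟩

theorem Drawable.of_iso [Finite V'] (f : G' ≃g G) (h : Drawable G) : Drawable G' := by
  intro r
  obtain ⟨p, hp, hx⟩ := h (f r)
  refine ⟨_, hp.comp_iso f, fun y hy => (hx (f y) (hy.map (φ := f) ?_ ?_)).comp_injective f.injective⟩
  · exact fun u w huw => ⟨f.symm u, f.symm w, by simp, by simp, f.symm.map_adj_iff.2 huw⟩
  · exact fun w hw => ⟨f.symm w, f.map_adj_iff.1 (by simpa using hw), by simp⟩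

theorem IsConvexDrawing.drawable (hV : Nontrivial V) (h : IsConvexDrawing G p) : Drawable G :=
  fun r => ⟨p, h.isBlockDrawing hV r, fun x _ => h.extreme x⟩

theorem not_isTarget_of_four [Finite V] {x : V} (S : Finset V) (hS : 4 ≤ S.card)
    (h : ∀ k ∈ S, G.Adj x k) : ¬ IsTarget G x := by
  have h1 : S.card ≤ (G.neighborSet x).ncard := by
    rw [← ncard_coe_finset]; exact ncard_le_ncard (fun k hk => h k hk) (toFinite _)
  rintro (h2 | ⟨h2, -⟩) <;> omega

/-- With three neighbours the cover in `IsTarget` must be exactly the neighbourhood, and it misses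
the edge `u w`. -/
theorem not_isTarget_of_three [Finite V] {x u w : V} (S : Finset V) (hS : 3 ≤ S.card)
    (h : ∀ k ∈ S, G.Adj x k) (huw : G.Adj u w) (hu : u ∉ S) (hw : w ∉ S) : ¬ IsTarget G x := by
  have h0 : (S : Set V) ⊆ G.neighborSet x := fun k hk => h k hk
  have h1 : S.card ≤ (G.neighborSet x).ncard := by
    rw [← ncard_coe_finset]; exact ncard_le_ncard h0 (toFinite _)
  rintro (h2 | ⟨-, T, hT, hNT, hcov⟩)
  · omega
  · have : (S : Set V) = T := eq_of_subset_of_ncard_le (h0.trans hNT)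
      (by rw [ncard_coe_finset]; omega) (toFinite _)
    rcases hcov u w huw with h | h <;> rw [← this] at h
    · exact hu h
    · exact hw h

/-- The graph on `Fin n` whose adjacency matrix has the entries of the binary number `m`. -/
def maskGraph (n m : ℕ) : SimpleGraph (Fin n) where
  Adj i j := i ≠ j ∧ (m.testBit (n * i + j) || m.testBit (n * j + i)) = true
  symm := ⟨fun _ _ h => ⟨h.1.symm, by rw [Bool.or_comm]; exact h.2⟩⟩
  loopless := ⟨fun _ h => h.1 rfl⟩

instance (n m : ℕ) : DecidableRel (maskGraph n m).Adj := fun i j =>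
  inferInstanceAs (Decidable (i ≠ j ∧ (m.testBit (n * i + j) || m.testBit (n * j + i)) = true))

/-- `0 < (b - a) (k - a) (k - b)` for three different numbers. -/
def sideBit (a b k : ℕ) : Bool := (Nat.blt a b).xor ((Nat.blt a k).xor (Nat.blt b k))

theorem sideBit_iff {a b k : ℕ} (hab : a ≠ b) (hak : a ≠ k) (hbk : b ≠ k) :
    (sideBit a b k = true → 0 < ((b : ℤ) - a) * (k - a) * (k - b)) ∧
    (sideBit a b k = false → ((b : ℤ) - a) * (k - a) * (k - b) < 0) := by
  have hblt : ∀ a b : ℕ, Nat.blt a b = decide (a < b) := by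
    intro a b; rw [Bool.eq_iff_iff, Nat.blt_eq, decide_eq_true_iff]
  have hs : ∀ {a b : ℕ}, a ≠ b → (a < b ∧ (0 : ℤ) < b - a) ∨ (¬ a < b ∧ (b : ℤ) - a < 0) := by
    intro a b h; omega
  simp only [sideBit, hblt]
  rcases hs hab with ⟨h1, e1⟩ | ⟨h1, e1⟩ <;> rcases hs hak with ⟨h2, e2⟩ | ⟨h2, e2⟩ <;>
    rcases hs hbk with ⟨h3, e3⟩ | ⟨h3, e3⟩ <;> simp only [h1, h2, h3] <;>
    refine ⟨fun h => ?_, fun h => ?_⟩ <;> first | exact absurd h (by decide) | skip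
  · exact mul_pos (mul_pos e1 e2) e3
  · exact mul_neg_of_pos_of_neg (mul_pos e1 e2) e3
  · exact mul_neg_of_neg_of_pos (mul_neg_of_pos_of_neg e1 e2) e3
  · exact mul_pos_of_neg_of_neg (mul_neg_of_pos_of_neg e1 e2) e3
  · exact mul_neg_of_neg_of_pos (mul_neg_of_neg_of_pos e1 e2) e3
  · exact mul_pos_of_neg_of_neg (mul_neg_of_neg_of_pos e1 e2) e3
  · exact mul_pos (mul_pos_of_neg_of_neg e1 e2) e3
  · exact mul_neg_of_pos_of_neg (mul_pos_of_neg_of_neg e1 e2) e3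

/-- The criterion of `isConvexDrawing_parabola` for the positions given by the octal digits of
`c`. -/
def convexCheck (n m c : ℕ) : Bool :=
  (List.range n).all fun a => (List.range n).all fun b =>
    Nat.ble b a || (!(Nat.beq (c / 8 ^ a % 8) (c / 8 ^ b % 8)) &&
    (m.testBit (n * a + b) || m.testBit (n * b + a) ||
    [(a, b, true), (a, b, false), (b, a, true), (b, a, false)].any fun t =>
      (List.range n).all fun k => !(m.testBit (n * t.1 + k) || m.testBit (n * k + t.1)) ||
        sideBit (c / 8 ^ t.1 % 8) (c / 8 ^ t.2.1 % 8) (c / 8 ^ k % 8) == t.2.2))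

theorem exists_isConvexDrawing_of_check {n m c : ℕ} (h : convexCheck n m c = true) :
    ∃ p, IsConvexDrawing (maskGraph n m) p := by
  simp only [convexCheck, List.all_eq_true, List.mem_range, Bool.or_eq_true, Bool.and_eq_true,
    Nat.ble_eq, Bool.not_eq_true', List.any_eq_true, beq_iff_eq] at h
  have hinj : ∀ a b : Fin n, a < b → c / 8 ^ (a : ℕ) % 8 ≠ c / 8 ^ (b : ℕ) % 8 := by
    intro a b hab he
    rcases h a a.2 b b.2 with h | h
    · exact absurd hab (not_lt.2 h)
    · have := h.1
      rw [he] at this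
      simp at this
  have hinj' : Function.Injective (fun a : Fin n => c / 8 ^ (a : ℕ) % 8) := by
    intro a b he
    rcases lt_trichotomy a b with h | h | h
    · exact absurd he (hinj _ _ h)
    · exact h
    · exact absurd he.symm (hinj _ _ h)
  have key : ∀ u w : Fin n, u < w → ¬ (maskGraph n m).Adj u w →
      ∃ a b : Fin n, (a = u ∧ b = w ∨ a = w ∧ b = u) ∧ ∃ s : Bool, ∀ k, (maskGraph n m).Adj a k →
        sideBit (c / 8 ^ (a : ℕ) % 8) (c / 8 ^ (b : ℕ) % 8) (c / 8 ^ (k : ℕ) % 8) = s := by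
    intro u w huw hadj
    rcases h u u.2 w w.2 with h | ⟨-, h⟩
    · exact absurd huw (not_lt.2 h)
    · rcases h with h | ⟨t, ht, hk⟩
      · exact absurd ⟨huw.ne, by simpa using h⟩ hadj
      · have hk' : ∀ k : Fin n, (m.testBit (n * t.1 + k) || m.testBit (n * k + t.1)) = true →
            sideBit (c / 8 ^ t.1 % 8) (c / 8 ^ t.2.1 % 8) (c / 8 ^ (k : ℕ) % 8) = t.2.2 := by
          intro k hadj
          rcases hk k k.2 with h | h
          · rw [hadj] at h; exact absurd h (by simp)
          · exact h
        simp only [List.mem_cons, List.not_mem_nil, or_false] at ht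
        rcases ht with rfl | rfl | rfl | rfl
        · exact ⟨u, w, Or.inl ⟨rfl, rfl⟩, true, fun k hk => hk' k hk.2⟩
        · exact ⟨u, w, Or.inl ⟨rfl, rfl⟩, false, fun k hk => hk' k hk.2⟩
        · exact ⟨w, u, Or.inr ⟨rfl, rfl⟩, true, fun k hk => hk' k hk.2⟩
        · exact ⟨w, u, Or.inr ⟨rfl, rfl⟩, false, fun k hk => hk' k hk.2⟩
  refine isConvexDrawing_parabola _ (fun a : Fin n => ((c / 8 ^ (a : ℕ) % 8 : ℕ) : ℤ))
    (fun a b he => hinj' (Nat.cast_injective he)) fun u w huw hadj => ?_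
  obtain ⟨a, b, hab, s, hs⟩ : ∃ a b : Fin n, (a = u ∧ b = w ∨ a = w ∧ b = u) ∧ ∃ s : Bool,
      ∀ k, (maskGraph n m).Adj a k →
        sideBit (c / 8 ^ (a : ℕ) % 8) (c / 8 ^ (b : ℕ) % 8) (c / 8 ^ (k : ℕ) % 8) = s := by
    rcases lt_or_gt_of_ne huw with h | h
    · exact key u w h hadj
    · obtain ⟨a, b, hab, hs⟩ := key w u h (fun h => hadj h.symm)
      exact ⟨a, b, hab.symm, hs⟩
  have hab' : a ≠ b := by rcases hab with ⟨rfl, rfl⟩ | ⟨rfl, rfl⟩ <;> tauto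
  have hnadj : ¬ (maskGraph n m).Adj a b := by
    rcases hab with ⟨rfl, rfl⟩ | ⟨rfl, rfl⟩
    · exact hadj
    · exact fun h => hadj h.symm
  have hs' := fun k (hk : (maskGraph n m).Adj a k) => sideBit_iff (hinj'.ne hab') (hinj'.ne hk.ne)
    (hinj'.ne (show b ≠ k from fun h => hnadj (h ▸ hk)))
  refine ⟨a, b, hab, ?_⟩
  cases s with
  | true => exact Or.inr fun k hk => (hs' k hk).1 (hs k hk)
  | false => exact Or.inl fun k hk => (hs' k hk).2 (hs k hk)

/-! ### Drawings certified by integral coordinates. -/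

/-- Determinant of integral vectors. -/
def idet (u v : ℤ × ℤ) : ℤ := u.1 * v.2 - u.2 * v.1

def toPlane (q : ℤ × ℤ) : Plane := !₂[(q.1 : ℝ), (q.2 : ℝ)]

theorem toPlane_sub (a b : ℤ × ℤ) : toPlane a - toPlane b = toPlane (a - b) := by
  apply Plane.ext' <;> simp [toPlane]

theorem det₂_toPlane (a b : ℤ × ℤ) : det₂ (toPlane a) (toPlane b) = (idet a b : ℝ) := by
  simp [det₂, toPlane, idet]

theorem det₂_ne_zero_of_mem_segment {d z a b x : Plane}
    (h : 0 < det₂ d (a - z) * det₂ d (b - z)) (hx : x ∈ segment ℝ a b) : det₂ d (x - z) ≠ 0 := by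
  rw [segment_eq_image'] at hx
  obtain ⟨t, ht, rfl⟩ := hx
  have e : a + t • (b - a) - z = (1 - t) • (a - z) + t • (b - z) := by module
  rw [e, det₂_add_right, det₂_smul_right, det₂_smul_right]
  intro h0
  have h1 : 0 ≤ 1 - t := by linarith [ht.2]
  rcases pos_and_pos_or_neg_and_neg_of_mul_pos h with ⟨ha, hb⟩ | ⟨ha, hb⟩
  · rcases ht.1.eq_or_lt with h2 | h2
    · rw [← h2] at h0; linarith
    · nlinarith [mul_nonneg h1 ha.le, mul_pos h2 hb]
  · rcases ht.1.eq_or_lt with h2 | h2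
    · rw [← h2] at h0; linarith
    · nlinarith [mul_nonneg h1 (neg_pos.2 ha).le, mul_pos h2 (neg_pos.2 hb)]

/-- One of the segments lies strictly on one side of the line that carries the other. -/
theorem disjoint_segment_of_det₂ {z h a b : Plane}
    (hs : 0 < det₂ (h - z) (a - z) * det₂ (h - z) (b - z) ∨
      0 < det₂ (b - a) (z - a) * det₂ (b - a) (h - a)) :
    Disjoint (segment ℝ z h) (segment ℝ a b) := by
  have key : ∀ z h x : Plane, x ∈ segment ℝ z h → det₂ (h - z) (x - z) = 0 := by
    intro z h x hx
    rw [segment_eq_image'] at hx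
    obtain ⟨t, -, rfl⟩ := hx
    rw [add_sub_cancel_left, det₂_smul_right, det₂_self, mul_zero]
  rw [disjoint_left]
  intro x hx hx'
  rcases hs with hs | hs
  · exact det₂_ne_zero_of_mem_segment hs hx' (key _ _ _ hx)
  · exact det₂_ne_zero_of_mem_segment hs hx (key _ _ _ hx')

variable {n m : ℕ}

/-- Integral data for a drawing of `maskGraph n m` in which all vertices but `x₀` are extreme. -/
structure DrawingData (n m : ℕ) (x₀ : Fin n) where
  pts : Fin n → ℤ × ℤ
  ext : Fin n → ℤ × ℤ
  -- An entry `(u, w, s, z, h, c)` records the point `z` at parameter `s / 8` of the segment from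
  -- `u` to `w`, an exit point `h`, and a direction `c` that separates `h` from all vertices.
  vis : List (Fin n × Fin n × ℤ × (ℤ × ℤ) × (ℤ × ℤ) × (ℤ × ℤ))
  -- For each root: its functional, and the direction of a free ray at the exceptional vertex `x₀`.
  root : Fin n → (ℤ × ℤ) × (ℤ × ℤ)
  size : 3 ≤ n
  exists_adj : ∀ u, ∃ w, (maskGraph n m).Adj u w
  noThree : ∀ u v w, u ≠ v → u ≠ w → v ≠ w → idet (pts v - pts u) (pts w - pts u) ≠ 0
  ext_neg : ∀ y ≠ x₀, ∀ k ≠ y, idet (ext y) (pts k - pts y) < 0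
  vis_check : ∀ t ∈ vis, 0 ≤ t.2.2.1 ∧ t.2.2.1 ≤ 8 ∧
    (8 * (t.2.2.2.1 - pts t.1).1 = t.2.2.1 * (pts t.2.1 - pts t.1).1 ∧
      8 * (t.2.2.2.1 - pts t.1).2 = t.2.2.1 * (pts t.2.1 - pts t.1).2) ∧
    (∀ k, idet t.2.2.2.2.2 (pts k - t.2.2.2.2.1) < 0) ∧
    ∀ a b, (maskGraph n m).Adj a b →
      (0 < idet (t.2.2.2.2.1 - t.2.2.2.1) (pts a - t.2.2.2.1) *
        idet (t.2.2.2.2.1 - t.2.2.2.1) (pts b - t.2.2.2.1) ∨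
      0 < idet (pts b - pts a) (t.2.2.2.1 - pts a) * idet (pts b - pts a) (t.2.2.2.2.1 - pts a))
  vis_exists : ∀ u w, u < w → ¬ (maskGraph n m).Adj u w → ∃ t ∈ vis, t.1 = u ∧ t.2.1 = w
  root_pos : ∀ r ≠ x₀, (∀ y ≠ r, 0 < idet (root r).1 (pts y - pts r)) ∧
    0 < idet (root r).1 (root r).2 ∧ (∀ k ≠ x₀, idet (root r).2 (pts k - pts x₀) ≠ 0) ∧
    ∀ a b, (maskGraph n m).Adj a b → a ≠ x₀ → b ≠ x₀ →
      (0 < idet (root r).2 (pts a - pts x₀) * idet (root r).2 (pts b - pts x₀) ∨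
      0 < idet (pts b - pts a) (pts x₀ - pts a) * idet (pts b - pts a) (root r).2)

/-- Extreme vertices have the ray away from the root; only `x₀` needs the recorded direction. The
determinant conditions make the segments and rays in question disjoint from every edge. -/
theorem DrawingData.exists_isBlockDrawing {x₀ : Fin n} (D : DrawingData n m x₀) {r : Fin n}
    (hr : r ≠ x₀) : ∃ p, IsBlockDrawing (maskGraph n m) p r ∧ ∀ y ≠ x₀, Extreme p y := by
  set p : Fin n → Plane := fun i => toPlane (D.pts i) with hp
  have hext : ∀ y ≠ x₀, ∀ k ≠ y, det₂ (toPlane (D.ext y)) (p k - p y) < 0 := by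
    intro y hy k hk
    rw [hp, toPlane_sub, det₂_toPlane]; exact_mod_cast D.ext_neg y hy k hk
  have hno : NoThreeCollinear p := by
    intro u v w huv huw hvw
    rw [hp, toPlane_sub, toPlane_sub, det₂_toPlane]; exact_mod_cast D.noThree u v w huv huw hvw
  have hinj : Function.Injective p := by
    intro u v huv
    by_contra hne
    obtain ⟨w, hwu, hwv⟩ : ∃ w : Fin n, w ≠ u ∧ w ≠ v := by
      have : ({u, v} : Finset (Fin n)).card < (Finset.univ : Finset (Fin n)).card := by
        rw [Finset.card_univ, Fintype.card_fin]
        exact lt_of_le_of_lt Finset.card_le_two (by have := D.size; omega)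
      obtain ⟨w, -, hw⟩ := Finset.exists_mem_notMem_of_card_lt_card this
      simp at hw
      exact ⟨w, hw⟩
    apply hno u v w hne hwu.symm hwv.symm
    rw [huv]; simp
  have hvis : ∀ u w, u < w → ¬ (maskGraph n m).Adj u w → Visible (maskGraph n m) p u w := by
    intro u w huw hadj
    obtain ⟨⟨u', w', s, z, h, c⟩, ht, rfl, rfl⟩ := D.vis_exists u w huw hadj
    obtain ⟨h0, h8, ⟨hz1, hz2⟩, hc, he⟩ := D.vis_check _ ht
    simp only at h0 h8 hz1 hz2 hc he
    refine ⟨toPlane z, ?_, toPlane h, ?_, ?_⟩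
    · rw [segment_eq_image']
      refine ⟨(s : ℝ) / 8, ⟨by have : (0 : ℝ) ≤ s := by exact_mod_cast h0
                               positivity, by
        rw [div_le_one (by norm_num)]; exact_mod_cast h8⟩, ?_⟩
      have h1 : (8 : ℝ) * (z.1 - (D.pts u').1) = s * ((D.pts w').1 - (D.pts u').1) := by
        exact_mod_cast hz1
      have h2 : (8 : ℝ) * (z.2 - (D.pts u').2) = s * ((D.pts w').2 - (D.pts u').2) := by
        exact_mod_cast hz2
      apply Plane.ext'
      · simp [hp, toPlane]; linarith
      · simp [hp, toPlane]; linarith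
    · intro hh
      have hsub : convexHull ℝ (range p) ⊆ {x : Plane | 0 < det₂ (-toPlane c) (x - toPlane h)} := by
        refine convexHull_min ?_ (convex_halfplane _ _ _)
        rintro _ ⟨k, rfl⟩
        have : det₂ (toPlane c) (p k - toPlane h) < 0 := by
          rw [hp, toPlane_sub, det₂_toPlane]; exact_mod_cast hc k
        simp only [mem_ofPred_eq, ← neg_one_smul ℝ (toPlane c), det₂_smul_left]
        linarith
      have := hsub hh
      simp at this
    · have hseg : ∀ a b, (maskGraph n m).Adj a b →
          Disjoint (segment ℝ (toPlane z) (toPlane h)) (segment ℝ (p a) (p b)) := by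
        intro a b hab
        apply disjoint_segment_of_det₂
        simp only [hp, toPlane_sub, det₂_toPlane]
        exact_mod_cast he a b hab
      rw [disjoint_left]
      intro x hx hxD
      rcases mem_straightLineDrawing.1 hxD with ⟨v, rfl⟩ | ⟨a, b, hab, hxs⟩
      · obtain ⟨b, hb⟩ := D.exists_adj v
        exact disjoint_left.1 (hseg v b hb) hx (left_mem_segment _ _ _)
      · exact disjoint_left.1 (hseg a b hab) hx hxs
  obtain ⟨hr1, hr2, hr3, hr4⟩ := D.root_pos r hr
  have hpos : ∀ y ≠ r, 0 < det₂ (toPlane (D.root r).1) (p y - p r) := by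
    intro y hy
    rw [hp, toPlane_sub, det₂_toPlane]; exact_mod_cast hr1 y hy
  have hct : 0 < det₂ (toPlane (D.root r).1) (toPlane (D.root r).2) := by
    rw [det₂_toPlane]; exact_mod_cast hr2
  refine ⟨p, ⟨hinj, hno, ?_, toPlane (D.root r).1, ?_, hpos, ?_⟩, fun y hy => ⟨_, hext y hy⟩⟩
  · intro u w huw hadj
    rcases lt_or_gt_of_ne huw with h | h
    · exact hvis u w h hadj
    · exact (hvis w u h (fun h => hadj h.symm)).symm
  · intro h0; rw [h0] at hct; simp at hct
  · intro y hy
    by_cases hyx : y = x₀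
    · subst hyx
      refine ⟨toPlane (D.root r).2, ⟨?_, fun s hs hx => ?_⟩, hct⟩
      · intro h0; rw [h0] at hct; simp at hct
      · rcases mem_straightLineDrawing.1 hx with ⟨⟨k, hk⟩, he⟩ | ⟨⟨a, ha⟩, ⟨b, hb⟩, hab, hxs⟩
        · simp only at he
          have h1 : det₂ (toPlane (D.root r).2) (p k - p y) ≠ 0 := by
            rw [hp, toPlane_sub, det₂_toPlane]; exact_mod_cast hr3 k hk
          apply h1
          rw [he, add_sub_cancel_left, det₂_smul_right, det₂_self, mul_zero]
        · simp only at hxs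
          rcases hr4 a b hab ha hb with h1 | h1
          · have h2 : 0 < det₂ (toPlane (D.root r).2) (p a - p y) *
                det₂ (toPlane (D.root r).2) (p b - p y) := by
              simp only [hp, toPlane_sub, det₂_toPlane]; exact_mod_cast h1
            apply det₂_ne_zero_of_mem_segment h2 hxs
            rw [add_sub_cancel_left, det₂_smul_right, det₂_self, mul_zero]
          -- The ray starts strictly on one side of the line `a b` and moves away from it.
          · have h2 : 0 < det₂ (p b - p a) (p y - p a) *
                det₂ (p b - p a) (toPlane (D.root r).2) := by
              simp only [hp, toPlane_sub, det₂_toPlane]; exact_mod_cast h1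
            rw [segment_eq_image'] at hxs
            obtain ⟨τ, -, hτ⟩ := hxs
            have h3 : det₂ (p b - p a) (p y - p a) + s * det₂ (p b - p a) (toPlane (D.root r).2) = 0 := by
              rw [← det₂_smul_right, ← det₂_add_right]
              have : p y - p a + s • toPlane (D.root r).2 = τ • (p b - p a) := by
                rw [← add_sub_right_comm, ← hτ, add_sub_cancel_left]
              rw [this, det₂_smul_right, det₂_self, mul_zero]
            rcases pos_and_pos_or_neg_and_neg_of_mul_pos h2 with ⟨ha', hb'⟩ | ⟨ha', hb'⟩
            · nlinarith [mul_nonneg hs hb'.le]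
            · nlinarith [mul_nonneg hs (neg_pos.2 hb').le]
    · refine ⟨p y - p r, Extreme.freeRay (hext y hyx) ?_ (sub_ne_zero.2 (hinj.ne hy)), hpos y hy⟩
      have := hext y hyx r hy.symm
      rw [det₂_sub_right] at this ⊢; linarith

end
-- The exceptional graphs and the Hamiltonian case.
open Set Topology Filter

/-- The wheel with hub `0` and rim `1, 4, 3, 2, 5`. All rim vertices are extreme; this serves every
root on the rim. -/
def dataW5a : DrawingData 6 7706418302 0 where
  pts := ![(448, 128), (640, 56), (744, 504), (128, 168), (64, 496), (632, 848)]
  ext := ![(0, 0), (-19, 4), (-4, -19), (-4, 20), (17, 11), (20, 0)]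
  vis := [(1, 2, 4, (692, 280), (20692, 280), (-20, -1)),
    (1, 3, 4, (384, 112), (-19179, 4270), (20, 0)),
    (2, 4, 4, (404, 500), (11297, 17273), (20, 0)),
    (3, 5, 4, (380, 508), (12136, 16688), (20, 0)),
    (4, 5, 4, (348, 672), (17309, 11270), (20, 0))]
  root := ![((0, 0), (0, 0)), ((100, 0), (-99, 12)), ((22, 97), (-99, 12)), ((20, -98), (21, -98)), ((-85, -53), (-84, -54)), ((-31, 95), (-99, 12))]
  size := by decide
  exists_adj := by decide +kernel
  noThree := by decide +kernel
  ext_neg := by decide +kernel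
  vis_check := by decide +kernel
  vis_exists := by decide +kernel
  root_pos := by decide +kernel

/-- The same wheel with the rim vertex `1` as the exceptional one. Here the hub is extreme, which
serves the root `0`. -/
def dataW5b : DrawingData 6 7706418302 1 where
  pts := ![(176, -488), (792, 472), (-184, 24), (376, -440), (-88, 920), (992, 504)]
  ext := ![(-12, 16), (0, 0), (2, 20), (-19, -5), (20, 0), (-11, -17)]
  vis := [(1, 2, 7, (-62, 80), (-760, 20068), (20, 0)),
    (1, 3, 5, (532, -98), (20532, -98), (-20, -1)),
    (2, 4, 4, (-136, 472), (1955, 20362), (20, 0)),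
    (3, 5, 4, (684, 32), (20684, 32), (-20, -1)),
    (4, 5, 4, (452, 712), (20452, 712), (-20, -2))]
  root := ![((100, 0), (99, 16)), ((0, 0), (0, 0)), ((-10, -99), (99, 16)), ((97, 24), (97, 26)), ((-99, -17), (99, 16)), ((54, 84), (53, 85))]
  size := by decide
  exists_adj := by decide +kernel
  noThree := by decide +kernel
  ext_neg := by decide +kernel
  vis_check := by decide +kernel
  vis_exists := by decide +kernel
  root_pos := by decide +kernel

def dataM1 : DrawingData 7 22197212733150 0 where
  pts := ![(1512, 640), (-424, -112), (688, -528), (208, 912), (1616, 728), (2392, 192), (-288, 320)]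
  ext := ![(0, 0), (5, 19), (-19, 7), (20, 0), (16, -11), (-18, -8), (13, 16)]
  vis := [(0, 5, 4, (1952, 416), (21952, 416), (-20, -1)),
    (1, 6, 4, (-356, 104), (5491, 19230), (20, 0)),
    (2, 4, 4, (1152, 100), (21076, 1843), (20, 0)),
    (3, 4, 4, (912, 820), (20912, 820), (-20, -2)),
    (3, 5, 5, (1573, 462), (21573, 462), (-20, -1)),
    (3, 6, 4, (-40, 616), (12546, 16159), (20, 0)),
    (4, 5, 4, (2004, 460), (22004, 460), (-20, -1)),
    (4, 6, 1, (1378, 677), (20865, 5176), (20, 0)),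
    (5, 6, 3, (1387, 240), (21387, 240), (-20, -1))]
  root := ![((0, 0), (0, 0)), ((-29, -96), (100, 0)), ((94, -35), (100, 0)), ((-100, -1), (100, 0)), ((-90, 44), (89, -45)), ((92, 39), (91, 41)), ((-64, -77), (100, 0))]
  size := by decide
  exists_adj := by decide +kernel
  noThree := by decide +kernel
  ext_neg := by decide +kernel
  vis_check := by decide +kernel
  vis_exists := by decide +kernel
  root_pos := by decide +kernel

def dataM4 : DrawingData 7 53122822231710 0 where
  pts := ![(312, -152), (592, 1672), (-104, -544), (-560, 2168), (1040, 32), (-376, -560), (1088, 936)]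
  ext := ![(0, 0), (11, -16), (-20, -2), (20, 0), (-18, -10), (-2, 20), (-1, -20)]
  vis := [(0, 5, 6, (-204, -458), (-17347, -10759), (16, 13)),
    (0, 6, 5, (797, 528), (20797, 528), (-20, -2)),
    (1, 4, 5, (872, 647), (20872, 647), (-20, -2)),
    (1, 6, 4, (840, 1304), (20840, 1304), (-20, -2)),
    (2, 4, 4, (468, -256), (20468, -256), (-20, -1)),
    (2, 5, 4, (-240, -552), (19760, -552), (-20, -1)),
    (4, 5, 4, (332, -264), (20332, -264), (-20, -1)),
    (4, 6, 4, (1064, 484), (21064, 484), (-20, -1)),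
    (5, 6, 1, (-193, -373), (-14086, -14760), (12, 16))]
  root := ![((0, 0), (0, 0)), ((-56, 83), (-72, -69)), ((100, 6), (100, 7)), ((-100, -1), (100, 0)), ((71, 70), (-72, -69)), ((7, -100), (100, 0)), ((5, 100), (-72, -69))]
  size := by decide
  exists_adj := by decide +kernel
  noThree := by decide +kernel
  ext_neg := by decide +kernel
  vis_check := by decide +kernel
  vis_exists := by decide +kernel
  root_pos := by decide +kernel

-- The recorded drawings do not treat their exceptional vertex as a root; that case needs an
-- automorphism or a second drawing.
section
variable {V : Type*} [Finite V] {G : SimpleGraph V} {n m m' : ℕ}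

theorem Drawable.of_fin_embedding (f : Fin n → Fin n) (hf : Function.Injective f)
    (h : ∀ i j, (maskGraph n m').Adj (f i) (f j) ↔ (maskGraph n m).Adj i j)
    (hd : Drawable (maskGraph n m')) : Drawable (maskGraph n m) :=
  hd.of_iso ⟨Equiv.ofBijective f (Finite.injective_iff_bijective.1 hf), h _ _⟩

/-- The root `x₀` is replaced by its image under an automorphism that moves it. Leaving `x₀` in the
interior of the hull is harmless, as it is not a target. -/
theorem DrawingData.drawable {x₀ : Fin n} (D : DrawingData n m x₀) (hx₀ : ¬ IsTarget (maskGraph n m) x₀)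
    (f : Fin n → Fin n) (hf : Function.Injective f)
    (h : ∀ i j, (maskGraph n m).Adj (f i) (f j) ↔ (maskGraph n m).Adj i j) (hfx : f x₀ ≠ x₀) :
    Drawable (maskGraph n m) := by
  intro r
  by_cases hr : r = x₀
  · set F : maskGraph n m ≃g maskGraph n m :=
      ⟨Equiv.ofBijective f (Finite.injective_iff_bijective.1 hf), h _ _⟩ with hF
    have hFr : F r ≠ x₀ := by rw [hr]; exact hfx
    obtain ⟨p, hp, hext⟩ := D.exists_isBlockDrawing hFr
    refine ⟨_, hp.comp_iso F, fun y hy => (hext (F y) fun hy0 => ?_).comp_injective F.injective⟩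
    apply hx₀
    rw [← hy0]
    exact hy.map (φ := F) (fun u w huw => ⟨F.symm u, F.symm w, by simp, by simp,
      F.symm.map_adj_iff.2 huw⟩) fun w hw => ⟨F.symm w, F.map_adj_iff.1 (by simpa using hw), by simp⟩
  · obtain ⟨p, hp, hext⟩ := D.exists_isBlockDrawing hr
    exact ⟨p, hp, fun y hy => hext y (by rintro rfl; exact hx₀ hy)⟩

/-- The hub is fixed by every automorphism, so two drawings are needed. Their exceptional vertices
are no targets: the hub has too many neighbours, and the neighbourhood of the rim vertex `1` misses
the edge between `2` and `3`. -/
theorem drawable_wheel : Drawable (maskGraph 6 7706418302) := by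
  have h0 : ¬ IsTarget (maskGraph 6 7706418302) 0 :=
    not_isTarget_of_four {1, 2, 3, 4} (by decide) (by decide +kernel)
  have h1 : ¬ IsTarget (maskGraph 6 7706418302) 1 :=
    not_isTarget_of_three (u := 2) (w := 3) {0, 4, 5} (by decide) (by decide +kernel)
      (by decide +kernel) (by decide) (by decide)
  intro r
  by_cases hr : r = 0
  · obtain ⟨p, hp, hext⟩ := dataW5b.exists_isBlockDrawing (r := r) (by rw [hr]; decide)
    exact ⟨p, hp, fun y hy => hext y (by rintro rfl; exact h1 hy)⟩
  · obtain ⟨p, hp, hext⟩ := dataW5a.exists_isBlockDrawing hr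
    exact ⟨p, hp, fun y hy => hext y (by rintro rfl; exact h0 hy)⟩

theorem drawable_mask_M1 : Drawable (maskGraph 7 22197212733150) :=
  dataM1.drawable (not_isTarget_of_four {1, 2, 3, 4} (by decide) (by decide +kernel))
    ![1, 0, 2, 3, 4, 6, 5] (by decide) (by decide +kernel) (by decide)

theorem drawable_mask_M4 : Drawable (maskGraph 7 53122822231710) :=
  dataM4.drawable (not_isTarget_of_four {1, 2, 3, 4} (by decide) (by decide +kernel))
    ![1, 0, 2, 3, 5, 4, 6] (by decide) (by decide +kernel) (by decide)

theorem drawable_of_convexCheck {c : ℕ} (hn : 2 ≤ n) (h : convexCheck n m c = true) :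
    Drawable (maskGraph n m) := by
  obtain ⟨p, hp⟩ := exists_isConvexDrawing_of_check h
  exact hp.drawable (Fin.nontrivial_iff_two_le.2 hn)

theorem Drawable.of_mask (e : Fin n ≃ V) (hd : Drawable (maskGraph n m))
    (h : ∀ i j, i < j → (G.Adj (e i) (e j) ↔ (maskGraph n m).Adj i j)) : Drawable G := by
  have h' : ∀ i j, G.Adj (e i) (e j) ↔ (maskGraph n m).Adj i j := by
    intro i j
    rcases lt_trichotomy i j with hij | rfl | hij
    · exact h i j hij
    · simp
    · rw [G.adj_comm, (maskGraph n m).adj_comm]; exact h j i hij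
  exact hd.of_iso ((⟨e, h' _ _⟩ : maskGraph n m ≃g G).symm)

def edgeBits (n i j : ℕ) (b : Bool) : ℕ := cond b (2 ^ (n * i + j)) 0

/-- The mask of a graph with a Hamiltonian cycle `0 1 2 3 4 5` and the given chords. -/
def mask6 (b02 b03 b04 b13 b14 b15 b24 b25 b35 : Bool) : ℕ :=
  2 ^ 1 + 2 ^ 8 + 2 ^ 15 + 2 ^ 22 + 2 ^ 29 + 2 ^ 5 + edgeBits 6 0 2 b02 + edgeBits 6 0 3 b03 +
  edgeBits 6 0 4 b04 + edgeBits 6 1 3 b13 + edgeBits 6 1 4 b14 + edgeBits 6 1 5 b15 +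
  edgeBits 6 2 4 b24 + edgeBits 6 2 5 b25 + edgeBits 6 3 5 b35

theorem mask6_spec : ∀ b02 b03 b04 b13 b14 b15 b24 b25 b35 : Bool, ∀ i j : Fin 6, i < j →
    ((maskGraph 6 (mask6 b02 b03 b04 b13 b14 b15 b24 b25 b35)).Adj i j ↔
      ![![false, true, b02, b03, b04, true], ![false, false, true, b13, b14, b15],
        ![false, false, false, true, b24, b25], ![false, false, false, false, true, b35],
        ![false, false, false, false, false, true], ![false, false, false, false, false, false]]
        i j = true) := by decide +kernel

/-- Of the `512` sets of chords, those not drawn by one of seven orders on the parabola are the six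
wheels, one for each choice of the hub on the Hamiltonian cycle. -/
theorem mask6_check : ∀ b02 b03 b04 b13 b14 b15 b24 b25 b35 : Bool,
    (∃ c ∈ [120072, 119904, 172824, 109152, 174168, 109320, 120912],
      convexCheck 6 (mask6 b02 b03 b04 b13 b14 b15 b24 b25 b35) c = true) ∨
    mask6 b02 b03 b04 b13 b14 b15 b24 b25 b35 ∈ [mask6 true true true false false true false false false,
      mask6 true false false true true true false false false,
      mask6 true false false true false false true true false,
      mask6 false true false true false false true false true,
      mask6 false false true false true false true false true,
      mask6 false false true false false true false true true] := by decide +kernel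

theorem drawable_mask6 (b02 b03 b04 b13 b14 b15 b24 b25 b35 : Bool) :
    Drawable (maskGraph 6 (mask6 b02 b03 b04 b13 b14 b15 b24 b25 b35)) := by
  rcases mask6_check b02 b03 b04 b13 b14 b15 b24 b25 b35 with ⟨c, -, h⟩ | h
  · exact drawable_of_convexCheck (by norm_num) h
  · simp only [List.mem_cons, List.not_mem_nil, or_false] at h
    rcases h with h | h | h | h | h | h <;> rw [h]
    · exact drawable_wheel.of_fin_embedding ![0, 1, 4, 3, 2, 5] (by decide) (by decide +kernel)
    · exact drawable_wheel.of_fin_embedding ![5, 0, 1, 4, 3, 2] (by decide) (by decide +kernel)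
    · exact drawable_wheel.of_fin_embedding ![2, 5, 0, 1, 4, 3] (by decide) (by decide +kernel)
    · exact drawable_wheel.of_fin_embedding ![3, 2, 5, 0, 1, 4] (by decide) (by decide +kernel)
    · exact drawable_wheel.of_fin_embedding ![4, 3, 2, 5, 0, 1] (by decide) (by decide +kernel)
    · exact drawable_wheel.of_fin_embedding ![1, 4, 3, 2, 5, 0] (by decide) (by decide +kernel)

def mask5 (b02 b03 b13 b14 b24 : Bool) : ℕ :=
  2 ^ 1 + 2 ^ 7 + 2 ^ 13 + 2 ^ 19 + 2 ^ 4 + edgeBits 5 0 2 b02 + edgeBits 5 0 3 b03 +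
  edgeBits 5 1 3 b13 + edgeBits 5 1 4 b14 + edgeBits 5 2 4 b24

/-- The octal digits of `10328` give the order `0, 2, 4, 1, 3` on the parabola. The pentagon becomes
a pentagram, and every potential nonedge is a side of the convex hull. -/
theorem mask5_spec : ∀ b02 b03 b13 b14 b24 : Bool,
    convexCheck 5 (mask5 b02 b03 b13 b14 b24) 10328 = true ∧ ∀ i j : Fin 5, i < j →
    ((maskGraph 5 (mask5 b02 b03 b13 b14 b24)).Adj i j ↔
      ![![false, true, b02, b03, true], ![false, false, true, b13, b14],
        ![false, false, false, true, b24], ![false, false, false, false, true],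
        ![false, false, false, false, false]] i j = true) := by decide +kernel

def mask4 (b02 b13 : Bool) : ℕ :=
  2 ^ 1 + 2 ^ 6 + 2 ^ 11 + 2 ^ 3 + edgeBits 4 0 2 b02 + edgeBits 4 1 3 b13

/-- The order `0, 1, 3, 2` makes both diagonals sides of the convex hull. -/
theorem mask4_spec : ∀ b02 b13 : Bool,
    convexCheck 4 (mask4 b02 b13) 1224 = true ∧ ∀ i j : Fin 4, i < j →
    ((maskGraph 4 (mask4 b02 b13)).Adj i j ↔
      ![![false, true, b02, true], ![false, false, true, b13],
        ![false, false, false, true], ![false, false, false, false]] i j = true) := by decide +kernel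

theorem drawable_of_hamiltonian {k : ℕ} (hk : 2 ≤ k) (hk6 : k ≤ 6) (e : Fin k ≃ V)
    (h : ∀ i, G.Adj (e i) (e (finRotate k i))) : Drawable G := by
  classical
  interval_cases k
  · refine Drawable.of_mask (m := 2) e (drawable_of_convexCheck (c := 8) le_rfl (by decide +kernel)) ?_
    intro i j hij
    have h0 : G.Adj (e 0) (e 1) := h 0
    fin_cases i <;> fin_cases j <;> first
      | exact absurd hij (by decide)
      | exact iff_of_true h0 (by decide)
  · refine Drawable.of_mask (m := 2 ^ 1 + 2 ^ 2 + 2 ^ 5) e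
      (drawable_of_convexCheck (c := 136) (by norm_num) (by decide +kernel)) ?_
    intro i j hij
    have h0 : G.Adj (e 0) (e 1) := h 0
    have h1 : G.Adj (e 1) (e 2) := h 1
    have h2 : G.Adj (e 0) (e 2) := (h 2).symm
    fin_cases i <;> fin_cases j <;> first
      | exact absurd hij (by decide)
      | exact iff_of_true h0 (by decide)
      | exact iff_of_true h1 (by decide)
      | exact iff_of_true h2 (by decide)
  · have hs := mask4_spec (decide (G.Adj (e 0) (e 2))) (decide (G.Adj (e 1) (e 3)))
    refine Drawable.of_mask e (drawable_of_convexCheck (by norm_num) hs.1) fun i j hij => ?_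
    rw [hs.2 i j hij]
    have h0 : G.Adj (e 0) (e 1) := h 0
    have h1 : G.Adj (e 1) (e 2) := h 1
    have h2 : G.Adj (e 2) (e 3) := h 2
    have h3 : G.Adj (e 0) (e 3) := (h 3).symm
    fin_cases i <;> fin_cases j <;> first
      | exact absurd hij (by decide)
      | simp [h0, h1, h2, h3]
  · have hs := mask5_spec (decide (G.Adj (e 0) (e 2))) (decide (G.Adj (e 0) (e 3)))
      (decide (G.Adj (e 1) (e 3))) (decide (G.Adj (e 1) (e 4))) (decide (G.Adj (e 2) (e 4)))
    refine Drawable.of_mask e (drawable_of_convexCheck (by norm_num) hs.1) fun i j hij => ?_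
    rw [hs.2 i j hij]
    have h0 : G.Adj (e 0) (e 1) := h 0
    have h1 : G.Adj (e 1) (e 2) := h 1
    have h2 : G.Adj (e 2) (e 3) := h 2
    have h3 : G.Adj (e 3) (e 4) := h 3
    have h4 : G.Adj (e 0) (e 4) := (h 4).symm
    fin_cases i <;> fin_cases j <;> first
      | exact absurd hij (by decide)
      | simp [h0, h1, h2, h3, h4]
  · refine Drawable.of_mask e (drawable_mask6 (decide (G.Adj (e 0) (e 2))) (decide (G.Adj (e 0) (e 3)))
      (decide (G.Adj (e 0) (e 4))) (decide (G.Adj (e 1) (e 3))) (decide (G.Adj (e 1) (e 4)))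
      (decide (G.Adj (e 1) (e 5))) (decide (G.Adj (e 2) (e 4))) (decide (G.Adj (e 2) (e 5)))
      (decide (G.Adj (e 3) (e 5)))) fun i j hij => ?_
    rw [mask6_spec _ _ _ _ _ _ _ _ _ i j hij]
    have h0 : G.Adj (e 0) (e 1) := h 0
    have h1 : G.Adj (e 1) (e 2) := h 1
    have h2 : G.Adj (e 2) (e 3) := h 2
    have h3 : G.Adj (e 3) (e 4) := h 3
    have h4 : G.Adj (e 4) (e 5) := h 4
    have h5 : G.Adj (e 0) (e 5) := (h 5).symm
    fin_cases i <;> fin_cases j <;> first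
      | exact absurd hij (by decide)
      | simp [h0, h1, h2, h3, h4, h5]

/-- Three hubs `0, 1, 2`, one vertex joined to all of them and one joined to each pair. -/
def maskM1 (b01 b02 b12 : Bool) : ℕ :=
  2 ^ 3 + 2 ^ 10 + 2 ^ 17 + 2 ^ 4 + 2 ^ 11 + 2 ^ 12 + 2 ^ 19 + 2 ^ 6 + 2 ^ 20 + edgeBits 7 0 1 b01 +
    edgeBits 7 0 2 b02 + edgeBits 7 1 2 b12

theorem maskM1_spec : ∀ b01 b02 b12 : Bool,
    ((∃ c ∈ [1754760, 1005704, 1226120], convexCheck 7 (maskM1 b01 b02 b12) c = true) ∨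
      b01 = true ∧ b02 = true ∧ b12 = true) ∧ ∀ i j : Fin 7, i < j →
    ((maskGraph 7 (maskM1 b01 b02 b12)).Adj i j ↔
      ![![false, b01, b02, true, true, false, true], ![false, false, b12, true, true, true, false],
        ![false, false, false, true, false, true, true], ![false, false, false, false, false, false, false],
        ![false, false, false, false, false, false, false],
        ![false, false, false, false, false, false, false],
        ![false, false, false, false, false, false, false]] i j = true) := by decide +kernel

/-- The edges among the three hubs are left open. If one of them is missing, a convex drawing
exists; otherwise the integral drawing is used. -/
theorem drawable_M1 (e : Fin 7 ≃ V)
    (h : ∀ i j, i < j → 3 ≤ j → (G.Adj (e i) (e j) ↔ (maskGraph 7 (maskM1 false false false)).Adj i j)) :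
    Drawable G := by
  classical
  have hs := maskM1_spec (decide (G.Adj (e 0) (e 1))) (decide (G.Adj (e 0) (e 2)))
    (decide (G.Adj (e 1) (e 2)))
  refine Drawable.of_mask e (m := maskM1 (decide (G.Adj (e 0) (e 1))) (decide (G.Adj (e 0) (e 2)))
    (decide (G.Adj (e 1) (e 2)))) ?_ fun i j hij => ?_
  · rcases hs.1 with ⟨c, -, hc⟩ | ⟨h1, h2, h3⟩
    · exact drawable_of_convexCheck (by norm_num) hc
    · rw [h1, h2, h3]
      exact drawable_mask_M1.of_fin_embedding id Function.injective_id (by decide +kernel)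
  · rw [hs.2 i j hij]
    by_cases hj : 3 ≤ j
    · rw [h i j hij hj, (maskM1_spec _ _ _).2 i j hij]
      fin_cases i <;> fin_cases j <;> first
        | exact absurd hij (by decide)
        | exact absurd hj (by decide)
        | simp
    · fin_cases i <;> fin_cases j <;> first
        | exact absurd hij (by decide)
        | exact absurd (by decide) hj
        | simp

/-- A triangle `0, 1, 2`, an apex `3`, and three vertices joined to the apex and one corner. -/
def maskM4 (b03 b13 b23 : Bool) : ℕ :=
  2 ^ 1 + 2 ^ 2 + 2 ^ 9 + 2 ^ 4 + 2 ^ 25 + 2 ^ 12 + 2 ^ 26 + 2 ^ 20 + 2 ^ 27 + edgeBits 7 0 3 b03 +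
    edgeBits 7 1 3 b13 + edgeBits 7 2 3 b23

theorem maskM4_spec : ∀ b03 b13 b23 : Bool,
    ((∃ c ∈ [1750280, 961800, 1750112], convexCheck 7 (maskM4 b03 b13 b23) c = true) ∨
      b03 = true ∧ b13 = true ∧ b23 = true) ∧ ∀ i j : Fin 7, i < j →
    ((maskGraph 7 (maskM4 b03 b13 b23)).Adj i j ↔
      ![![false, true, true, b03, true, false, false], ![false, false, true, b13, false, true, false],
        ![false, false, false, b23, false, false, true], ![false, false, false, false, true, true, true],
        ![false, false, false, false, false, false, false],
        ![false, false, false, false, false, false, false],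
        ![false, false, false, false, false, false, false]] i j = true) := by decide +kernel

/-- The edges between the triangle and the apex are left open; only when all of them are present is
the integral drawing needed. -/
theorem drawable_M4 (e : Fin 7 ≃ V)
    (h : ∀ i j, i < j → j ≠ 3 → (G.Adj (e i) (e j) ↔ (maskGraph 7 (maskM4 false false false)).Adj i j)) :
    Drawable G := by
  classical
  have hs := maskM4_spec (decide (G.Adj (e 0) (e 3))) (decide (G.Adj (e 1) (e 3)))
    (decide (G.Adj (e 2) (e 3)))
  refine Drawable.of_mask e (m := maskM4 (decide (G.Adj (e 0) (e 3))) (decide (G.Adj (e 1) (e 3)))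
    (decide (G.Adj (e 2) (e 3)))) ?_ fun i j hij => ?_
  · rcases hs.1 with ⟨c, -, hc⟩ | ⟨h1, h2, h3⟩
    · exact drawable_of_convexCheck (by norm_num) hc
    · rw [h1, h2, h3]
      exact drawable_mask_M4.of_fin_embedding id Function.injective_id (by decide +kernel)
  · rw [hs.2 i j hij]
    by_cases hj : j = 3
    · subst hj
      fin_cases i <;> first
        | exact absurd hij (by decide)
        | simp
    · rw [h i j hij hj, (maskM4_spec _ _ _).2 i j hij]
      fin_cases i <;> fin_cases j <;> first
        | exact absurd hij (by decide)
        | exact absurd rfl hj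
        | simp

end

/-! ### Cycles as lists, ears, and biconnectivity under reductions. -/

section
open Set
variable {V : Type*} {G : SimpleGraph V}

/-- The list `l`, read cyclically, is a closed walk of `G` without repeated vertices. -/
def IsCycleList (G : SimpleGraph V) (l : List V) : Prop :=
  l.Nodup ∧ (l : Cycle V).Chain G.Adj

/-- No cyclic list of `G` has more than `k` vertices. -/
def CycleListLE (G : SimpleGraph V) (k : ℕ) : Prop :=
  ∀ l : List V, IsCycleList G l → l.length ≤ k

/-- `G` is connected and has no cut vertex, in terms of adjacency-closed sets of vertices. -/
structure IsBiconnected (G : SimpleGraph V) : Prop where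
  connected : ∀ A : Set V, A.Nonempty → (∀ x ∈ A, ∀ y, G.Adj x y → y ∈ A) → ∀ y, y ∈ A
  cut : ∀ (v : V) (A : Set V), A.Nonempty → v ∉ A →
    (∀ x ∈ A, ∀ y, G.Adj x y → y ≠ v → y ∈ A) → ∀ y, y ≠ v → y ∈ A

theorem IsCycleList.of_isRotated {l l' : List V} (h : IsCycleList G l) (hr : l ~r l') :
    IsCycleList G l' :=
  ⟨hr.nodup_iff.1 h.1, by rw [← Cycle.coe_eq_coe.2 hr]; exact h.2⟩

theorem isCycleList_cons {a : V} {l : List V} :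
    IsCycleList G (a :: l) ↔ (a :: l).Nodup ∧ (a :: (l ++ [a])).IsChain G.Adj := by
  rw [IsCycleList, Cycle.chain_coe_cons]

theorem IsCycleList.exists_split {c : List V} (hc : IsCycleList G c) {a b : V} (ha : a ∈ c)
    (hb : b ∈ c) (hab : a ≠ b) : ∃ l₁ l₂, IsCycleList G (a :: (l₁ ++ b :: l₂)) ∧
      (a :: (l₁ ++ b :: l₂)).Perm c := by
  obtain ⟨s, t, rfl⟩ := List.append_of_mem ha
  have hr : (s ++ a :: t) ~r (a :: (t ++ s)) := by
    have := List.isRotated_append (l := s) (l' := a :: t)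
    simpa using this
  have hb' : b ∈ t ++ s := by
    have := hr.mem_iff.1 hb
    simpa [hab.symm] using this
  obtain ⟨l₁, l₂, hl⟩ := List.append_of_mem hb'
  rw [hl] at hr
  exact ⟨l₁, l₂, hc.of_isRotated hr, hr.perm.symm⟩

theorem isChain_adj_reverse {l : List V} (h : l.IsChain G.Adj) : l.reverse.IsChain G.Adj := by
  rw [List.isChain_reverse]
  exact h.imp fun _ _ h => h.symm

/-- Replacing either arc between `a` and `b` by the ear gives a cycle again, so in a longest cycle
neither arc has fewer inner vertices than the ear. -/
theorem CycleListLE.ear {k : ℕ} (hmax : CycleListLE G k) {c : List V} (hc : IsCycleList G c)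
    (hck : c.length = k) {a b : V} (ha : a ∈ c) (hb : b ∈ c) (hab : a ≠ b) {Q : List V}
    (hQ : Q.Nodup) (hQc : ∀ y ∈ Q, y ∉ c) (hch : (a :: (Q ++ [b])).IsChain G.Adj) :
    ∃ l₁ l₂, IsCycleList G (a :: (l₁ ++ b :: l₂)) ∧ (a :: (l₁ ++ b :: l₂)).Perm c ∧
      Q.length ≤ l₁.length ∧ Q.length ≤ l₂.length := by
  obtain ⟨l₁, l₂, hc', hp⟩ := hc.exists_split ha hb hab
  have hlen := hp.length_eq
  have hmem : ∀ z, z ∈ c ↔ z = a ∨ z ∈ l₁ ∨ z = b ∨ z ∈ l₂ := by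
    intro z; rw [← hp.mem_iff]; simp
  obtain ⟨hnd, hch'⟩ := isCycleList_cons.1 hc'
  simp only [List.append_assoc, List.cons_append] at hch'
  rw [← List.cons_append, List.isChain_split] at hch'
  have h₁ : IsCycleList G (a :: (Q ++ b :: l₂)) := by
    rw [isCycleList_cons]
    refine ⟨?_, ?_⟩
    · simp only [List.nodup_cons, List.nodup_append, List.mem_append, List.mem_cons] at hnd ⊢
      grind
    · simp only [List.append_assoc, List.cons_append]
      rw [← List.cons_append, List.isChain_split]
      exact ⟨by simpa using hch, hch'.2⟩
  have h₂ : IsCycleList G (a :: (l₁ ++ b :: Q.reverse)) := by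
    rw [isCycleList_cons]
    refine ⟨?_, ?_⟩
    · simp only [List.nodup_cons, List.nodup_append, List.mem_append, List.mem_cons,
        List.nodup_reverse, List.mem_reverse] at hnd ⊢
      grind
    · simp only [List.append_assoc, List.cons_append]
      rw [← List.cons_append, List.isChain_split]
      exact ⟨hch'.1, by simpa using isChain_adj_reverse hch⟩
  have e₁ := hmax _ h₁
  have e₂ := hmax _ h₂
  simp only [List.length_cons, List.length_append, List.length_reverse] at hlen e₁ e₂
  exact ⟨l₁, l₂, hc', hp, by omega, by omega⟩

/-- Otherwise the vertices joined to `x` by paths that avoid `S` and `a` form a set closed under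
adjacency outside `a`. Since `a` is no cut vertex, this set would contain a vertex of `S`. -/
theorem IsBiconnected.exists_path (h : IsBiconnected G) {S : Set V} {x a : V} (hx : x ∉ S)
    (hxa : x ≠ a) (hS : ∃ b ∈ S, b ≠ a) : ∃ b Q, b ∈ S ∧ b ≠ a ∧ (∀ y ∈ Q, y ∉ S ∧ y ≠ a) ∧
      (Q ++ [x]).Nodup ∧ (b :: (Q ++ [x])).IsChain G.Adj := by
  by_contra hcon
  set A : Set V := {y | ∃ Q : List V, Q.head? = some y ∧ Q.getLast? = some x ∧ Q.Nodup ∧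
    Q.IsChain G.Adj ∧ ∀ z ∈ Q, z ∉ S ∧ z ≠ a} with hA
  have hxA : x ∈ A := ⟨[x], by simp, by simp, by simp, by simp, by simpa using ⟨hx, hxa⟩⟩
  have haA : a ∉ A := by
    rintro ⟨Q, h1, -, -, -, h2⟩
    exact (h2 a (List.mem_of_mem_head? h1)).2 rfl
  obtain ⟨b, hbS, hba⟩ := hS
  obtain ⟨Q, h1, -, -, -, h2⟩ := h.cut a A ⟨x, hxA⟩ haA (by
    rintro y ⟨Q, h1, h2, h3, h4, h5⟩ z hyz hza
    by_cases hzS : z ∈ S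
    · exfalso
      apply hcon
      obtain ⟨Q', rfl⟩ := List.getLast?_eq_some_iff.1 h2
      refine ⟨z, Q', hzS, hza, fun w hw => h5 w (by simp [hw]), h3, ?_⟩
      rw [List.isChain_cons]
      refine ⟨fun w hw => ?_, h4⟩
      rw [h1, Option.mem_some_iff] at hw
      exact hw ▸ hyz.symm
    -- A vertex that is already on the path is reached by cutting the path off there.
    · by_cases hzQ : z ∈ Q
      · obtain ⟨l₁, l₂, rfl⟩ := List.append_of_mem hzQ
        refine ⟨z :: l₂, by simp, ?_, (List.nodup_append.1 h3).2.1, (List.isChain_append.1 h4).2.1,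
          fun w hw => h5 w (by simp only [List.mem_append]; exact Or.inr hw)⟩
        rw [← h2, List.getLast?_append]
        simp [List.getLast?_cons]
      · refine ⟨z :: Q, by simp, ?_, by simp [hzQ, h3], ?_, ?_⟩
        · rw [List.getLast?_cons, h2]; simp
        · rw [List.isChain_cons]
          refine ⟨fun w hw => ?_, h4⟩
          rw [h1, Option.mem_some_iff] at hw
          exact hw ▸ hyz.symm
        · intro w hw
          rcases List.mem_cons.1 hw with rfl | hw
          · exact ⟨hzS, hza⟩
          · exact h5 w hw) b hba
  exact (h2 b (List.mem_of_mem_head? h1)).1 hbS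

theorem IsCycleList.map {V' : Type*} {G' : SimpleGraph V'} {f : V' → V} (hf : Function.Injective f)
    (hadj : ∀ a b, G'.Adj a b → G.Adj (f a) (f b)) {l : List V'} (h : IsCycleList G' l) :
    IsCycleList G (l.map f) := by
  refine ⟨h.1.map hf, ?_⟩
  have := (Cycle.chain_map (r := G.Adj) f (s := (l : Cycle V'))).2 (Cycle.Chain.imp hadj h.2)
  simpa using this

theorem CycleListLE.of_injective {V' : Type*} {G' : SimpleGraph V'} {f : V' → V}
    (hf : Function.Injective f) (hadj : ∀ a b, G'.Adj a b → G.Adj (f a) (f b)) {k : ℕ}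
    (h : CycleListLE G k) : CycleListLE G' k := fun l hl => by
  simpa using h _ (hl.map hf hadj)

/-- A closed set that touches a neighbour of `v` can be enlarged by `v`, because the remaining twin
`x` has the same neighbours. If the deleted cut vertex is `x` itself, this argument is not
available, and `hlink` keeps the neighbours of the twins together. -/
theorem IsBiconnected.induce_twin (h : IsBiconnected G) {x v : V} (hxv : x ≠ v)
    (hadj : ¬ G.Adj x v) (htwin : ∀ w, G.Adj x w ↔ G.Adj v w)
    (hlink : ∀ A : Set V, x ∉ A → v ∉ A →
      (∀ y ∈ A, ∀ z, G.Adj y z → z ≠ x → z ≠ v → z ∈ A) →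
      ∀ y z, G.Adj x y → G.Adj x z → y ∈ A → z ∈ A) :
    IsBiconnected (G.induce {u | u ≠ v}) where
  connected A hne hcl := by
    set B : Set V := Subtype.val '' A with hB
    have hcl' : ∀ y ∈ B, ∀ z, G.Adj y z → z ≠ v → z ∈ B := by
      rintro _ ⟨y, hy, rfl⟩ z hyz hz
      exact ⟨⟨z, hz⟩, hcl y hy ⟨z, hz⟩ hyz, rfl⟩
    rintro ⟨y, hy⟩
    obtain ⟨y', hy', he⟩ := h.cut v B (hne.image _) (by rintro ⟨y, -, hy⟩; exact y.2 hy) hcl' y hy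
    rwa [← show y' = ⟨y, hy⟩ from Subtype.ext he]
  cut u A hne huA hcl := by
    set B : Set V := Subtype.val '' A with hB
    have hvB : v ∉ B := by rintro ⟨y, -, hy⟩; exact y.2 hy
    have huB : u.1 ∉ B := by
      rintro ⟨y, hyA, hy⟩
      exact huA (by rwa [← Subtype.ext hy])
    have hcl' : ∀ y ∈ B, ∀ z, G.Adj y z → z ≠ u → z ≠ v → z ∈ B := by
      rintro _ ⟨y, hy, rfl⟩ z hyz hzu hz
      exact ⟨⟨z, hz⟩, hcl y hy ⟨z, hz⟩ hyz (fun h => hzu (congrArg Subtype.val h)), rfl⟩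
    have huv : u.1 ≠ v := u.2
    suffices H : ∀ y, y ≠ u.1 → y ≠ v → y ∈ B by
      intro y hyu
      obtain ⟨y', hy', he⟩ := H y (fun h => hyu (Subtype.ext h)) y.2
      rwa [← show y' = y from Subtype.ext he]
    by_cases hv : ∃ y ∈ B, G.Adj y v
    · obtain ⟨y₀, hy₀, hyv⟩ := hv
      have hyx : G.Adj y₀ x := ((htwin _).2 hyv.symm).symm
      have key : ∀ z, G.Adj v z → z ≠ u.1 → z ∈ B := by
        intro z hz hzu
        by_cases hux : u.1 = x
        · exact hlink B (hux ▸ huB) hvB (by rw [← hux]; exact hcl') y₀ z hyx.symm ((htwin z).2 hz) hy₀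
        · have hxB : x ∈ B := hcl' y₀ hy₀ x hyx (Ne.symm hux) hxv
          exact hcl' x hxB z ((htwin z).2 hz) hzu hz.ne'
      have := h.cut u.1 (insert v B) ⟨v, by simp⟩ (by simp [huv, huB]) (by
        rintro y hy z hyz hzu
        rcases hy with rfl | hy
        · exact Or.inr (key z hyz hzu)
        · by_cases hzv : z = v
          · exact Or.inl hzv
          · exact Or.inr (hcl' y hy z hyz hzu hzv))
      intro y hyu hyv
      exact (this y hyu).resolve_left hyv
    · push Not at hv
      have := h.cut u.1 B (hne.image _) huB (fun y hy z hyz hzu =>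
        hcl' y hy z hyz hzu (fun hzv => hv y hy (hzv ▸ hyz)))
      intro y hyu _
      exact this y hyu

/-- Only the merged vertex could become a cut vertex. Deleting it amounts to deleting `x` and `v`,
whose other neighbours are among `a` and `b`, and `hlink` says that these are not separated. -/
theorem IsBiconnected.contract [DecidableEq V] (h : IsBiconnected G) {x v a b : V} (hxv : x ≠ v)
    (hadj : G.Adj x v)
    (hNx : ∀ w, G.Adj x w → w = v ∨ w = a ∨ w = b) (hNv : ∀ w, G.Adj v w → w = x ∨ w = a ∨ w = b)
    (hlink : ∀ A : Set V, x ∉ A → v ∉ A →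
      (∀ y ∈ A, ∀ z, G.Adj y z → z ≠ x → z ≠ v → z ∈ A) → (a ∈ A ↔ b ∈ A)) :
    IsBiconnected (contractGraph G hxv) := by
  have hval : ∀ y : {u : V // u ≠ v}, contractMap hxv y.1 = y := fun y => contractMap_of_ne hxv y.2
  constructor
  · intro A hne hcl y
    have := h.connected (contractMap hxv ⁻¹' A) (by
      obtain ⟨y, hy⟩ := hne
      exact ⟨y.1, by rwa [mem_preimage, hval]⟩) (by
      intro y hy z hyz
      by_cases he : contractMap hxv y = contractMap hxv z
      · rwa [mem_preimage, ← he]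
      · exact hcl _ hy _ ⟨he, y, z, rfl, rfl, hyz⟩) y.1
    rwa [mem_preimage, hval] at this
  · intro u A hne huA hcl y hyu
    by_cases hux : u.1 = x
    · set B : Set V := contractMap hxv ⁻¹' A with hB
      have hux' : u = contractMap hxv x := by
        rw [contractMap_of_ne hxv hxv]; exact Subtype.ext hux
      have hxB : x ∉ B := by rwa [hB, mem_preimage, ← hux']
      have hvB : v ∉ B := by
        rw [hB, mem_preimage, contractMap_self, ← contractMap_of_ne hxv hxv, ← hux']; exact huA
      have hclB : ∀ y ∈ B, ∀ z, G.Adj y z → z ≠ x → z ≠ v → z ∈ B := by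
        intro y hy z hyz hzx hzv
        by_cases he : contractMap hxv y = contractMap hxv z
        · rwa [hB, mem_preimage, ← he]
        · refine hcl _ hy _ ⟨he, y, z, rfl, rfl, hyz⟩ ?_
          rw [contractMap_of_ne hxv hzv]
          exact fun h => hzx ((congrArg Subtype.val h).trans hux)
      have hneB : B.Nonempty := by
        obtain ⟨y, hy⟩ := hne
        exact ⟨y.1, by rwa [hB, mem_preimage, hval]⟩
      have hab := hlink B hxB hvB hclB
      have hyx : y.1 ≠ x := fun h => hyu (Subtype.ext (h.trans hux.symm))
      by_cases haB : a ∈ B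
      · have := h.connected (insert x (insert v B)) ⟨x, by simp⟩ (by
          rintro y (rfl | rfl | hy) z hyz
          · rcases hNx z hyz with rfl | rfl | rfl
            · simp
            · simp [haB]
            · simp [hab.1 haB]
          · rcases hNv z hyz with rfl | rfl | rfl
            · simp
            · simp [haB]
            · simp [hab.1 haB]
          · by_cases hzx : z = x
            · simp [hzx]
            by_cases hzv : z = v
            · simp [hzv]
            exact Or.inr (Or.inr (hclB y hy z hyz hzx hzv))) y.1
        have := (this.resolve_left hyx).resolve_left y.2
        rwa [hB, mem_preimage, hval] at this
      · have hbB : b ∉ B := fun hb => haB (hab.2 hb)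
        exact absurd (h.connected B hneB (by
          intro w hw z hwz
          refine hclB w hw z hwz ?_ ?_
          · intro hzx
            rcases hNx w (hzx ▸ hwz.symm) with h | h | h <;> rw [h] at hw
            exacts [hvB hw, haB hw, hbB hw]
          · intro hzv
            rcases hNv w (hzv ▸ hwz.symm) with h | h | h <;> rw [h] at hw
            exacts [hxB hw, haB hw, hbB hw]) x) hxB
    · have := h.cut u.1 (contractMap hxv ⁻¹' A) (by
        obtain ⟨y, hy⟩ := hne
        exact ⟨y.1, by rwa [mem_preimage, hval]⟩) (by rwa [mem_preimage, hval]) (by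
        intro y hy z hyz hzu
        by_cases he : contractMap hxv y = contractMap hxv z
        · rwa [mem_preimage, ← he]
        · refine hcl _ hy _ ⟨he, y, z, rfl, rfl, hyz⟩ ?_
          intro h
          by_cases hzv : z = v
          · rw [hzv, contractMap_self] at h
            exact hux (congrArg Subtype.val h).symm
          · rw [contractMap_of_ne hxv hzv] at h
            exact hzu (congrArg Subtype.val h)) y.1 (fun h => hyu (Subtype.ext h))
      rwa [mem_preimage, hval] at this

/-- A cycle of length at least three through the merged vertex has `a` and `b` as neighbours there.
It lifts to a cycle with one more vertex, which passes through the edges `v a`, `x v` and `x b`. -/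
theorem CycleListLE.contract [DecidableEq V] {k : ℕ} (hk : 2 ≤ k) (h : CycleListLE G k)
    {x v a b : V} (hxv : x ≠ v) (hax : a ≠ x) (hav : a ≠ v) (hbx : b ≠ x) (hbv : b ≠ v)
    (hadj : G.Adj x v) (hva : G.Adj v a) (hxb : G.Adj x b)
    (hNx : ∀ w, G.Adj x w → w = v ∨ w = a ∨ w = b)
    (hNv : ∀ w, G.Adj v w → w = x ∨ w = a ∨ w = b) : CycleListLE (contractGraph G hxv) k := by
  have hadj₁ : ∀ y z : {u : V // u ≠ v}, (contractGraph G hxv).Adj y z → y.1 ≠ x → z.1 ≠ x →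
      G.Adj y.1 z.1 := by
    rintro y z ⟨-, u, w, hu, hw, huw⟩ hy hz
    have huv : u ≠ v := by
      rintro rfl
      rw [contractMap_self] at hu
      exact hy (congrArg Subtype.val hu).symm
    have hwv : w ≠ v := by
      rintro rfl
      rw [contractMap_self] at hw
      exact hz (congrArg Subtype.val hw).symm
    rw [contractMap_of_ne hxv huv] at hu
    rw [contractMap_of_ne hxv hwv] at hw
    rwa [← hu, ← hw]
  have hadj₂ : ∀ z : {u : V // u ≠ v}, (contractGraph G hxv).Adj ⟨x, hxv⟩ z →
      z.1 = a ∨ z.1 = b := by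
    rintro z ⟨hne, u, w, hu, hw, huw⟩
    have hu' : u = x ∨ u = v := by
      by_cases huv : u = v
      · exact Or.inr huv
      · rw [contractMap_of_ne hxv huv] at hu
        exact Or.inl (congrArg Subtype.val hu)
    by_cases hwv : w = v
    · rw [hwv, contractMap_self] at hw
      exact absurd hw hne
    rw [contractMap_of_ne hxv hwv] at hw
    have hwx : w ≠ x := fun h => hne (by rw [← hw]; exact Subtype.ext h.symm)
    rw [← hw]
    rcases hu' with rfl | rfl
    · exact (hNx w huw).resolve_left hwv
    · exact (hNv w huw).resolve_left hwx
  intro l hl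
  by_cases hx : (⟨x, hxv⟩ : {u : V // u ≠ v}) ∈ l
  · obtain ⟨s, t, rfl⟩ := List.append_of_mem hx
    have hr : (s ++ (⟨x, hxv⟩ : {u : V // u ≠ v}) :: t) ~r (⟨x, hxv⟩ :: (t ++ s)) := by
      simpa using List.isRotated_append (l := s) (l' := (⟨x, hxv⟩ : {u : V // u ≠ v}) :: t)
    rw [hr.perm.length_eq]
    replace hl := hl.of_isRotated hr
    clear hr hx
    generalize t ++ s = m at hl ⊢
    obtain ⟨hnd, hch⟩ := isCycleList_cons.1 hl
    rcases List.eq_nil_or_concat m with rfl | ⟨m', z, rfl⟩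
    · simp; omega
    rcases m' with _ | ⟨y, m'⟩
    · simpa using hk
    simp only [List.concat_eq_append, List.cons_append, List.append_assoc, List.nil_append,
      List.isChain_cons_cons] at hch hnd ⊢
    rw [← List.cons_append, List.isChain_split] at hch
    have hy := hadj₂ y hch.1
    have hz := hadj₂ z (by simpa using hch.2.2 : (contractGraph G hxv).Adj z _).symm
    have hyz : y.1 ≠ z.1 := by
      intro he
      have := Subtype.ext he
      subst this
      simp at hnd
    have hnx : ∀ w ∈ y :: (m' ++ [z]), w.1 ≠ x := by
      intro w hw he
      have : w = ⟨x, hxv⟩ := Subtype.ext he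
      subst this
      exact (List.nodup_cons.1 hnd).1 hw
    set L : List V := (y :: (m' ++ [z])).map Subtype.val with hL
    have hLn : L.Nodup := (List.nodup_cons.1 hnd).2.map Subtype.val_injective
    have hxL : x ∉ L := by
      rw [hL, List.mem_map]
      rintro ⟨w, hw, he⟩
      exact hnx w hw he
    have hvL : v ∉ L := by
      rw [hL, List.mem_map]
      rintro ⟨w, hw, he⟩
      exact w.2 he
    have hLc : L.IsChain G.Adj := by
      rw [hL, List.isChain_map]
      have h1 : (y :: (m' ++ [z])).IsChain (contractGraph G hxv).Adj := by simpa using hch.2.1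
      rw [List.isChain_iff_getElem] at h1 ⊢
      intro i hi
      exact hadj₁ _ _ (h1 i hi) (hnx _ (List.getElem_mem _)) (hnx _ (List.getElem_mem _))
    have hLe : L = y.1 :: (m'.map Subtype.val ++ [z.1]) := by simp [hL]
    have key : ∀ p q, (p = x ∧ q = v ∨ p = v ∧ q = x) → G.Adj q y.1 → G.Adj z.1 p →
        IsCycleList G (p :: q :: L) := by
      intro p q hpq hqy hzp
      rw [isCycleList_cons]
      constructor
      · rcases hpq with ⟨rfl, rfl⟩ | ⟨rfl, rfl⟩
        · simp [hxL, hvL, hLn, hxv]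
        · simp [hxL, hvL, hLn, hxv.symm]
      · rw [List.cons_append, List.isChain_cons_cons]
        refine ⟨by rcases hpq with ⟨rfl, rfl⟩ | ⟨rfl, rfl⟩; exacts [hadj, hadj.symm], ?_⟩
        rw [hLe] at hLc ⊢
        rw [List.cons_append, List.isChain_cons_cons]
        refine ⟨hqy, ?_⟩
        rw [List.append_assoc, ← List.cons_append, List.singleton_append, List.isChain_split]
        exact ⟨by simpa using hLc, by simpa using hzp⟩
    have hlen : L.length = m'.length + 2 := by simp [hLe]
    have hcyc : ∃ p q, IsCycleList G (p :: q :: L) := by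
      rcases hy with hy | hy <;> rcases hz with hz | hz
      · exact absurd (hy.trans hz.symm) hyz
      · exact ⟨x, v, key x v (Or.inl ⟨rfl, rfl⟩) (hy ▸ hva) (hz ▸ hxb.symm)⟩
      · exact ⟨v, x, key v x (Or.inr ⟨rfl, rfl⟩) (hy ▸ hxb) (hz ▸ hva.symm)⟩
      · exact absurd (hy.trans hz.symm) hyz
    obtain ⟨p, q, hpq⟩ := hcyc
    have := h _ hpq
    simp only [List.length_cons, List.length_append, List.length_nil] at this ⊢
    omega
  · have hnx : ∀ w ∈ l, w.1 ≠ x := fun w hw he => hx (by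
      rwa [← show w = ⟨x, hxv⟩ from Subtype.ext he])
    have : IsCycleList G (l.map Subtype.val) := by
      refine ⟨hl.1.map Subtype.val_injective, ?_⟩
      rcases l with _ | ⟨w, l⟩
      · simp
      · have h2 := (isCycleList_cons.1 hl).2
        rw [List.map_cons, Cycle.chain_coe_cons]
        have h3 : ((w :: (l ++ [w])).map Subtype.val).IsChain G.Adj := by
          rw [List.isChain_map]
          rw [List.isChain_iff_getElem] at h2 ⊢
          intro i hi
          have hm : ∀ u ∈ w :: (l ++ [w]), u.1 ≠ x := fun u hu => hnx u (by
            simp only [List.mem_cons, List.mem_append] at hu ⊢; tauto)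
          exact hadj₁ _ _ (h2 i hi) (hm _ (List.getElem_mem _)) (hm _ (List.getElem_mem _))
        simpa using h3
    simpa using h _ this

end

/-! ### Reducible configurations; longest cycles of length at most five. -/

section
open Set
variable {V : Type*} {G : SimpleGraph V}

/-- Two false twins, one of which may be removed. -/
def HasTwin (G : SimpleGraph V) : Prop :=
  ∃ x v : V, x ≠ v ∧ ¬ G.Adj x v ∧ (∀ w, G.Adj x w ↔ G.Adj v w) ∧ IsTarget G x ∧
    ∀ A : Set V, x ∉ A → v ∉ A → (∀ y ∈ A, ∀ z, G.Adj y z → z ≠ x → z ≠ v → z ∈ A) →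
      ∀ y z, G.Adj x y → G.Adj x z → y ∈ A → z ∈ A

/-- An edge that may be contracted. -/
def HasSplit (G : SimpleGraph V) : Prop :=
  ∃ x v a b : V, [x, v, a, b].Nodup ∧ G.Adj x v ∧ G.Adj v a ∧ G.Adj x b ∧
    (∀ w, G.Adj x w → w = v ∨ w = a ∨ w = b) ∧ (∀ w, G.Adj v w → w = x ∨ w = a ∨ w = b) ∧
    ∀ A : Set V, x ∉ A → v ∉ A → (∀ y ∈ A, ∀ z, G.Adj y z → z ≠ x → z ≠ v → z ∈ A) →
      (a ∈ A ↔ b ∈ A)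

theorem mem_of_isChain {A : Set V} {x v : V}
    (hcl : ∀ y ∈ A, ∀ z, G.Adj y z → z ≠ x → z ≠ v → z ∈ A) :
    ∀ (L : List V) (a : V), a ∈ A → (a :: L).IsChain G.Adj → (∀ z ∈ L, z ≠ x ∧ z ≠ v) →
      ∀ z ∈ L, z ∈ A
  | [], _, _, _, _, _, hz => by simp at hz
  | b :: L, a, ha, hch, hne, z, hz => by
    rw [List.isChain_cons_cons] at hch
    have hb : b ∈ A := hcl a ha b hch.1 (hne b (by simp)).1 (hne b (by simp)).2
    rcases List.mem_cons.1 hz with rfl | hz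
    · exact hb
    · exact mem_of_isChain hcl L b hb hch.2 (fun w hw => hne w (by simp [hw])) z hz

/-- A path from `a` to `b` that avoids `x` and `v`; this is how the link conditions in `HasTwin` and
`HasSplit` are verified. -/
theorem link_iff {x v a b : V} (L : List V) (hch : (a :: (L ++ [b])).IsChain G.Adj)
    (hne : ∀ z ∈ a :: (L ++ [b]), z ≠ x ∧ z ≠ v) (A : Set V)
    (hcl : ∀ y ∈ A, ∀ z, G.Adj y z → z ≠ x → z ≠ v → z ∈ A) : a ∈ A ↔ b ∈ A := by
  refine ⟨fun ha => mem_of_isChain hcl _ a ha hch (fun z hz => hne z (by simp [hz])) b (by simp),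
    fun hb => ?_⟩
  have := isChain_adj_reverse hch
  simp only [List.reverse_cons, List.reverse_append, List.reverse_nil, List.nil_append,
    List.cons_append] at this
  exact mem_of_isChain hcl _ b hb this (fun z hz => hne z (by
    simp only [List.mem_append, List.mem_reverse, List.mem_cons] at hz ⊢; tauto)) a (by simp)

theorem HasTwin.of_pair {x v a b : V} (hxv : x ≠ v) (hx : ∀ w, G.Adj x w ↔ w = a ∨ w = b)
    (hv : ∀ w, G.Adj v w ↔ w = a ∨ w = b) (L : List V) (hch : (a :: (L ++ [b])).IsChain G.Adj)
    (hL : ∀ z ∈ L, z ≠ x ∧ z ≠ v) : HasTwin G := by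
  have ha := ((hx a).2 (Or.inl rfl)).ne'
  have hb := ((hx b).2 (Or.inr rfl)).ne'
  have ha' := ((hv a).2 (Or.inl rfl)).ne'
  have hb' := ((hv b).2 (Or.inr rfl)).ne'
  refine ⟨x, v, hxv, ?_, fun w => (hx w).trans (hv w).symm, Or.inl ?_, ?_⟩
  · rw [hx]
    rintro (h | h)
    exacts [ha' h.symm, hb' h.symm]
  · have : G.neighborSet x = {a, b} := by ext w; simp [hx]
    rw [this]
    exact (ncard_insert_le _ _).trans (by simp)
  · intro A _ _ hcl y z hy hz hyA
    have := link_iff L hch (x := x) (v := v) (by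
      intro z hz
      simp only [List.mem_cons, List.mem_append, List.not_mem_nil, or_false] at hz
      rcases hz with rfl | hz | rfl
      exacts [⟨ha, ha'⟩, hL z hz, ⟨hb, hb'⟩]) A hcl
    rcases (hx y).1 hy with rfl | rfl <;> rcases (hx z).1 hz with rfl | rfl <;> tauto

theorem CycleListLE.false_of_cons {k : ℕ} (hmax : CycleListLE G k) (a : V) (l : List V)
    (hn : (a :: l).Nodup) (hch : (a :: (l ++ [a])).IsChain G.Adj) (hlen : k < (a :: l).length) :
    False :=
  absurd (hmax _ (isCycleList_cons.2 ⟨hn, hch⟩)) (by omega)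

/-- The edge may be chosen with one end `s` adjacent to the cycle. A path from the cycle to `s` that
avoids this neighbour gives an ear, which is long enough unless `s` is its only inner vertex; the
case of a single inner vertex is repaired through `t`. -/
theorem IsBiconnected.exists_long_ear (h : IsBiconnected G) {c : List V} (hc : c.Nodup)
    (hc2 : 2 ≤ c.length) {s t : V} (hs : s ∉ c) (ht : t ∉ c) (hst : G.Adj s t) :
    ∃ a ∈ c, ∃ b ∈ c, a ≠ b ∧ ∃ Q : List V, Q.Nodup ∧ (∀ y ∈ Q, y ∉ c) ∧
      (a :: (Q ++ [b])).IsChain G.Adj ∧ 2 ≤ Q.length := by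
  have hex : ∀ a, ∃ b ∈ {z | z ∈ c}, b ≠ a := by
    intro a
    rcases c with _ | ⟨p, _ | ⟨q, c⟩⟩
    · simp at hc2
    · simp at hc2
    · by_cases hp : p = a
      · refine ⟨q, by simp, ?_⟩
        rintro rfl
        simp [hp] at hc
      · exact ⟨p, by simp, hp⟩
  obtain ⟨a, s, t, ha, hs, ht, has, hst⟩ : ∃ a s t, a ∈ c ∧ s ∉ c ∧ t ∉ c ∧ G.Adj a s ∧
      G.Adj s t := by
    obtain ⟨b, Q, hb, hbt, hQ, hn, hch⟩ := h.exists_path (S := {z | z ∈ c}) hs hst.ne (hex t)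
    rcases Q with _ | ⟨q, _ | ⟨q', Q⟩⟩
    · exact ⟨b, s, t, hb, hs, ht, by simpa using hch, hst⟩
    · exact ⟨b, q, s, hb, (hQ q (by simp)).1, hs, by simp at hch; exact hch.1, by
        simp at hch; exact hch.2⟩
    · simp only [List.cons_append, List.isChain_cons_cons] at hch
      exact ⟨b, q, q', hb, (hQ q (by simp)).1, (hQ q' (by simp)).1, hch.1, hch.2.1⟩
  have hsa : s ≠ a := fun h => hs (h ▸ ha)
  obtain ⟨b, Q, hb, hba, hQ, hn, hch⟩ := h.exists_path (S := {z | z ∈ c}) hs hsa (hex a)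
  by_cases hQ0 : Q = []
  · subst hQ0
    have hbs : G.Adj b s := by simpa using hch
    -- Now `s` has two neighbours on the cycle. A path from the cycle to `t` that avoids `s` starts
    -- at some `d`, and one of these neighbours differs from `d`.
    obtain ⟨d, Q', hd, hds, hQ', hn', hch'⟩ := h.exists_path (S := {z | z ∈ c}) ht hst.ne' (hex s)
    obtain ⟨e, he, hed, hes⟩ : ∃ e ∈ c, e ≠ d ∧ G.Adj s e := by
      by_cases had : a = d
      · exact ⟨b, hb, had ▸ hba, hbs.symm⟩
      · exact ⟨a, ha, had, has.symm⟩
    refine ⟨d, hd, e, he, hed.symm, Q' ++ [t] ++ [s], ?_, ?_, ?_, by simp⟩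
    · rw [List.nodup_append]
      refine ⟨hn', by simp, ?_⟩
      intro y hy z hz
      simp only [List.mem_append, List.mem_singleton] at hy hz
      subst hz
      rcases hy with hy | rfl
      · exact (hQ' y hy).2
      · exact hst.ne'
    · intro y hy
      simp only [List.mem_append, List.mem_singleton] at hy
      rcases hy with (hy | rfl) | rfl
      exacts [(hQ' y hy).1, ht, hs]
    · have : (d :: ((Q' ++ [t] ++ [s]) ++ [e])) = (d :: Q') ++ t :: [s, e] := by simp
      rw [this, List.isChain_split]
      exact ⟨by simpa using hch', by simp [hst.symm, hes]⟩
  · refine ⟨b, hb, a, ha, hba, Q ++ [s], hn, ?_, ?_, ?_⟩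
    · intro y hy
      simp only [List.mem_append, List.mem_singleton] at hy
      rcases hy with hy | rfl
      exacts [(hQ y hy).1, hs]
    · have : (b :: ((Q ++ [s]) ++ [a])) = (b :: Q) ++ s :: [a] := by simp
      rw [this, List.isChain_split]
      exact ⟨by simpa using hch, by simp [has.symm]⟩
    · have := List.length_pos_iff.2 hQ0
      simp; omega

theorem IsBiconnected.exists_two_adj (h : IsBiconnected G) {c : List V} (hc : c.Nodup)
    (hc2 : 2 ≤ c.length) {x : V} (hx : x ∉ c) (hout : ∀ y, G.Adj x y → y ∈ c) :
    ∃ a ∈ c, ∃ b ∈ c, a ≠ b ∧ G.Adj x a ∧ G.Adj x b := by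
  have hex : ∀ a, ∃ b ∈ {z | z ∈ c}, b ≠ a := by
    intro a
    rcases c with _ | ⟨p, _ | ⟨q, c⟩⟩
    · simp at hc2
    · simp at hc2
    · by_cases hp : p = a
      · refine ⟨q, by simp, ?_⟩
        rintro rfl
        simp [hp] at hc
      · exact ⟨p, by simp, hp⟩
  have key : ∀ a ∈ c, ∃ b ∈ c, b ≠ a ∧ G.Adj x b := by
    intro a ha
    obtain ⟨b, Q, hb, hba, hQ, hn, hch⟩ := h.exists_path (S := {z | z ∈ c}) hx
      (fun h => hx (h ▸ ha)) (hex a)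
    rcases List.eq_nil_or_concat Q with rfl | ⟨Q', q, rfl⟩
    · exact ⟨b, hb, hba, (by simpa using hch : G.Adj b x).symm⟩
    · have : (b :: (Q'.concat q ++ [x])) = (b :: Q') ++ q :: [x] := by simp
      rw [this, List.isChain_split] at hch
      have hqx : G.Adj q x := by simpa using hch.2
      exact absurd (hout q hqx.symm) (hQ q (by simp)).1
  obtain ⟨a₀, ha₀, -⟩ := hex x
  obtain ⟨a, ha, -, hxa⟩ := key a₀ ha₀
  obtain ⟨b, hb, hba, hxb⟩ := key a ha
  exact ⟨a, ha, b, hb, hba.symm, hxa, hxb⟩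

/-- A further neighbour of `x` on the cycle would allow a longer cycle through `x`. -/
theorem CycleListLE.adj_iff_of_short {k : ℕ} (hmax : CycleListLE G k) {a y b x : V} {l : List V}
    (hc : IsCycleList G (a :: y :: b :: l)) (hk : (a :: y :: b :: l).length = k)
    (hl : l.length = 1 ∨ l.length = 2) (hx : x ∉ a :: y :: b :: l) (hxa : G.Adj x a)
    (hxb : G.Adj x b) (hout : ∀ w, G.Adj x w → w ∈ a :: y :: b :: l) :
    ∀ w, G.Adj x w ↔ w = a ∨ w = b := by
  obtain ⟨hn, hch⟩ := isCycleList_cons.1 hc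
  intro w
  refine ⟨fun hw => ?_, by rintro (rfl | rfl) <;> assumption⟩
  have hy : ¬ G.Adj x y := fun hxy => hmax.false_of_cons a (x :: y :: b :: l) (by
    simp at hn hx ⊢; grind) (by simp [hxy, hxa.symm] at hch ⊢; tauto) (by simp at hk ⊢; omega)
  have hw' := hout w hw
  rcases l with _ | ⟨d, _ | ⟨e, _ | _⟩⟩
  · simp at hl
  · have hd : ¬ G.Adj x d := fun hxd => hmax.false_of_cons a [y, b, x, d] (by
      simp at hn hx ⊢; grind) (by simp [hxd, hxb.symm] at hch ⊢; tauto) (by simp at hk ⊢; omega)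
    simp at hw'
    grind
  · have hd : ¬ G.Adj x d := fun hxd => hmax.false_of_cons a [y, b, x, d, e] (by
      simp at hn hx ⊢; grind) (by simp [hxd, hxb.symm] at hch ⊢; tauto) (by simp at hk ⊢; omega)
    have he : ¬ G.Adj x e := fun hxe => hmax.false_of_cons a [y, b, d, e, x] (by
      simp at hn hx ⊢; grind) (by simp [hxa, hxe.symm] at hch ⊢; tauto) (by simp at hk ⊢; omega)
    simp at hw'
    grind
  · simp at hl

/-- If a longest cycle has at most five vertices and misses a vertex, there are removable twins. -/
theorem IsBiconnected.hasTwin_of_short (h : IsBiconnected G) {k : ℕ} (hk2 : 2 ≤ k) (hk : k ≤ 5)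
    (hmax : CycleListLE G k) {c : List V} (hc : IsCycleList G c) (hck : c.length = k) {x : V}
    (hx : x ∉ c) : HasTwin G := by
  -- An ear with two inner vertices forces two inner vertices on both arcs, hence at least six
  -- vertices on the cycle.
  have hout : ∀ c : List V, IsCycleList G c → c.length = k → ∀ x ∉ c, ∀ y, G.Adj x y → y ∈ c := by
    intro c hc hck x hx y hxy
    by_contra hy
    obtain ⟨a, ha, b, hb, hab, Q, hQ, hQc, hch, hQ2⟩ :=
      h.exists_long_ear hc.1 (hck.symm ▸ hk2) hx hy hxy
    obtain ⟨l₁, l₂, -, hp, h₁, h₂⟩ := hmax.ear hc hck ha hb hab hQ hQc hch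
    have := hp.length_eq
    simp at this
    omega
  obtain ⟨a, ha, b, hb, hab, hxa, hxb⟩ :=
    h.exists_two_adj hc.1 (hck.symm ▸ hk2) hx (hout c hc hck x hx)
  obtain ⟨l₁, l₂, hc', hp, h₁, h₂⟩ := hmax.ear hc hck ha hb hab (Q := [x]) (by simp)
    (by simpa using hx) (by simp [hxa.symm, hxb])
  -- The two arcs have at most three inner vertices together, so one of them has a single inner
  -- vertex `y`; this is the twin of `x`.
  obtain ⟨a, y, b, l, hc', hp, hl, hxa, hxb⟩ : ∃ a y b l, IsCycleList G (a :: y :: b :: l) ∧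
      (a :: y :: b :: l).Perm c ∧ (l.length = 1 ∨ l.length = 2) ∧ G.Adj x a ∧ G.Adj x b := by
    have hlen := hp.length_eq
    simp at hlen h₁ h₂
    by_cases h1 : l₁.length = 1
    · obtain ⟨y, rfl⟩ := List.length_eq_one_iff.1 h1
      exact ⟨a, y, b, l₂, hc', hp, by omega, hxa, hxb⟩
    · obtain ⟨y, rfl⟩ := List.length_eq_one_iff.1 (show l₂.length = 1 by omega)
      have hr : (a :: (l₁ ++ b :: [y])) ~r (b :: y :: a :: l₁) := by
        simpa using List.isRotated_append (l := a :: l₁) (l' := [b, y])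
      exact ⟨b, y, a, l₁, hc'.of_isRotated hr, hr.perm.symm.trans hp, by omega, hxb, hxa⟩
  clear h₁ h₂
  have hlen : (a :: y :: b :: l).length = k := hp.length_eq.trans hck
  have hx' : x ∉ a :: y :: b :: l := by rwa [hp.mem_iff]
  obtain ⟨hn, hch⟩ := isCycleList_cons.1 hc'
  have hcx : IsCycleList G (a :: x :: b :: l) := by
    refine isCycleList_cons.2 ⟨by simp at hn hx' ⊢; grind, ?_⟩
    simp only [List.cons_append, List.isChain_cons_cons] at hch ⊢
    exact ⟨hxa.symm, hxb, hch.2.2⟩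
  have hy : y ∉ a :: x :: b :: l := by simp at hn hx' ⊢; grind
  have hya : G.Adj y a := by simp at hch; exact hch.1.symm
  have hyb : G.Adj y b := by simp at hch; exact hch.2.1
  refine HasTwin.of_pair (x := x) (v := y) (a := b) (b := a) (by simp at hx'; tauto)
    (fun w => (hmax.adj_iff_of_short hc' hlen hl hx' hxa hxb (hout _ hc' hlen x hx') w).trans or_comm)
    (fun w => (hmax.adj_iff_of_short hcx (by simpa using hlen) hl hy hya hyb
      (hout _ hcx (by simpa using hlen) y hy) w).trans or_comm) l ?_ ?_
  · simp only [List.cons_append, List.isChain_cons_cons] at hch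
    exact hch.2.2
  · intro z hz
    simp at hn hx'
    grind

end

/-! ### Hexagons with a handle. -/

section
open Set
variable {V : Type*} {G : SimpleGraph V}

/-- A hexagon of `G`. -/
structure IsHexagon (G : SimpleGraph V) (v₀ v₁ v₂ v₃ v₄ v₅ : V) : Prop where
  nodup : [v₀, v₁, v₂, v₃, v₄, v₅].Nodup
  h₀₁ : G.Adj v₀ v₁
  h₁₂ : G.Adj v₁ v₂
  h₂₃ : G.Adj v₂ v₃
  h₃₄ : G.Adj v₃ v₄
  h₄₅ : G.Adj v₄ v₅
  h₅₀ : G.Adj v₅ v₀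

theorem IsHexagon.isCycleList {v₀ v₁ v₂ v₃ v₄ v₅ : V} (h : IsHexagon G v₀ v₁ v₂ v₃ v₄ v₅) :
    IsCycleList G [v₀, v₁, v₂, v₃, v₄, v₅] := by
  rw [isCycleList_cons]
  refine ⟨h.nodup, ?_⟩
  simp [h.h₀₁, h.h₁₂, h.h₂₃, h.h₃₄, h.h₄₅, h.h₅₀]

theorem IsCycleList.isHexagon {v₀ v₁ v₂ v₃ v₄ v₅ : V}
    (h : IsCycleList G [v₀, v₁, v₂, v₃, v₄, v₅]) : IsHexagon G v₀ v₁ v₂ v₃ v₄ v₅ := by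
  obtain ⟨hn, hch⟩ := isCycleList_cons.1 h
  simp only [List.cons_append, List.nil_append, List.isChain_cons_cons] at hch
  obtain ⟨h0, h1, h2, h3, h4, h5, -⟩ := hch
  exact ⟨hn, h0, h1, h2, h3, h4, h5⟩

theorem IsHexagon.rotate {v₀ v₁ v₂ v₃ v₄ v₅ : V} (h : IsHexagon G v₀ v₁ v₂ v₃ v₄ v₅) :
    IsHexagon G v₁ v₂ v₃ v₄ v₅ v₀ :=
  ⟨by have := h.nodup; simp at this ⊢; grind, h.h₁₂, h.h₂₃, h.h₃₄, h.h₄₅, h.h₅₀, h.h₀₁⟩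

theorem IsHexagon.reflect {v₀ v₁ v₂ v₃ v₄ v₅ : V} (h : IsHexagon G v₀ v₁ v₂ v₃ v₄ v₅) :
    IsHexagon G v₀ v₅ v₄ v₃ v₂ v₁ :=
  ⟨by have := h.nodup; simp at this ⊢; grind, h.h₅₀.symm, h.h₄₅.symm, h.h₃₄.symm, h.h₂₃.symm,
    h.h₁₂.symm, h.h₀₁.symm⟩

theorem IsHexagon.exchange {v₀ v₁ v₂ v₃ v₄ v₅ x : V} (h : IsHexagon G v₀ v₁ v₂ v₃ v₄ v₅)
    (hx : x ∉ [v₀, v₁, v₂, v₃, v₄, v₅]) (hx0 : G.Adj x v₀) (hx2 : G.Adj x v₂) :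
    IsHexagon G v₀ x v₂ v₃ v₄ v₅ :=
  ⟨by have := h.nodup; simp at this hx ⊢; grind, hx0.symm, hx2, h.h₂₃, h.h₃₄, h.h₄₅, h.h₅₀⟩

/-- A path `v₀ s t v₃` between opposite vertices of a hexagon. -/
structure IsHandle (G : SimpleGraph V) (v₀ v₁ v₂ v₃ v₄ v₅ s t : V) : Prop where
  hex : IsHexagon G v₀ v₁ v₂ v₃ v₄ v₅
  nodup : [v₀, v₁, v₂, v₃, v₄, v₅, s, t].Nodup
  h₀s : G.Adj v₀ s
  hst : G.Adj s t
  ht₃ : G.Adj t v₃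

theorem IsHandle.reverse {v₀ v₁ v₂ v₃ v₄ v₅ s t : V} (h : IsHandle G v₀ v₁ v₂ v₃ v₄ v₅ s t) :
    IsHandle G v₃ v₂ v₁ v₀ v₅ v₄ t s :=
  ⟨h.hex.rotate.rotate.rotate.reflect, by have := h.nodup; simp at this ⊢; grind, h.ht₃.symm,
    h.hst.symm, h.h₀s.symm⟩

/-- Another neighbour of `s` on the hexagon gives a cycle that is too long. An outside neighbour `u`
is continued, avoiding `s`, to the hexagon or to `t`; every continuation closes a cycle with at
least seven vertices, unless `u` is adjacent to `v₃`. -/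
theorem IsHandle.adj_left {v₀ v₁ v₂ v₃ v₄ v₅ s t u : V} (h : IsHandle G v₀ v₁ v₂ v₃ v₄ v₅ s t)
    (hG : IsBiconnected G) (hmax : CycleListLE G 6) (hu : G.Adj s u) :
    u = v₀ ∨ u = v₃ ∨ u = t ∨ IsHandle G v₀ v₁ v₂ v₃ v₄ v₅ s u := by
  obtain ⟨⟨hn6, h01, h12, h23, h34, h45, h50⟩, hn, h0s, hst, ht3⟩ := h
  by_contra! hcon
  obtain ⟨hu0, hu3, hut, hcon⟩ := hcon
  have hus := hu.ne'
  by_cases hu1 : u = v₁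
  · subst hu1
    exact hmax.false_of_cons v₀ [s, u, v₂, v₃, v₄, v₅] (by simp at hn ⊢; grind)
      (by simp [*]) (by simp)
  by_cases hu2 : u = v₂
  · subst hu2
    exact hmax.false_of_cons v₀ [v₁, u, s, t, v₃, v₄, v₅] (by simp at hn ⊢; grind)
      (by simp [*, hu.symm]) (by simp)
  by_cases hu4 : u = v₄
  · subst hu4
    exact hmax.false_of_cons v₀ [v₁, v₂, v₃, t, s, u, v₅] (by simp at hn ⊢; grind)
      (by simp [*, ht3.symm, hst.symm]) (by simp)
  by_cases hu5 : u = v₅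
  · subst hu5
    exact hmax.false_of_cons v₀ [v₁, v₂, v₃, v₄, u, s] (by simp at hn ⊢; grind)
      (by simp [*, hu.symm, h0s.symm]) (by simp)
  obtain ⟨b, Q, hb, hbs, hQ, hnQ, hchQ⟩ := hG.exists_path
    (S := {z | z ∈ [v₀, v₁, v₂, v₃, v₄, v₅, t]}) (x := u) (a := s) (by simp; tauto) hus
    ⟨t, by simp, hst.ne'⟩
  have hsQ : s ∉ Q := fun hs => (hQ s hs).2 rfl
  have h0Q : v₀ ∉ Q := fun hs => (hQ _ hs).1 (by simp)
  have h1Q : v₁ ∉ Q := fun hs => (hQ _ hs).1 (by simp)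
  have h2Q : v₂ ∉ Q := fun hs => (hQ _ hs).1 (by simp)
  have h3Q : v₃ ∉ Q := fun hs => (hQ _ hs).1 (by simp)
  have h4Q : v₄ ∉ Q := fun hs => (hQ _ hs).1 (by simp)
  have h5Q : v₅ ∉ Q := fun hs => (hQ _ hs).1 (by simp)
  have htQ : t ∉ Q := fun hs => (hQ _ hs).1 (by simp)
  have huQ : u ∉ Q := fun h => by rw [List.nodup_append] at hnQ; exact hnQ.2.2 u h u (by simp) rfl
  have hQn : Q.Nodup := (List.nodup_append.1 hnQ).1
  have hrev := isChain_adj_reverse hchQ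
  simp only [List.reverse_cons, List.reverse_append, List.reverse_nil, List.nil_append,
    List.cons_append] at hrev
  clear hQ hnQ
  simp only [List.mem_cons, List.not_mem_nil, or_false, mem_ofPred_eq] at hb
  -- The cycle consists of `u`, the path `Q` backwards, its end `b`, and a path `l` that returns to
  -- `u`; it has `Q.length + l.length + 2` vertices.
  have close : ∀ l : List V, (b :: (l ++ [u])).IsChain G.Adj → (b :: l).Nodup →
      (∀ z ∈ b :: l, z ≠ u ∧ z ∉ Q) → 5 ≤ Q.length + l.length → False := by
    intro l hl hnl hd hlen
    refine hmax.false_of_cons u (Q.reverse ++ b :: l) ?_ ?_ (by simp; omega)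
    · rw [List.nodup_cons, List.nodup_append, List.mem_append, List.mem_reverse]
      refine ⟨?_, by simpa using hQn, hnl, ?_⟩
      · rintro (h | h)
        exacts [huQ h, (hd u h).1 rfl]
      · intro z hz w hw hzw
        exact (hd w hw).2 (by simpa [hzw] using hz)
    · rw [List.append_assoc, List.cons_append, ← List.cons_append, List.isChain_split]
      exact ⟨by simpa using hrev, hl⟩
  simp only [List.nodup_cons, List.mem_cons, List.not_mem_nil, or_false, not_or,
    List.nodup_nil, and_true, not_false_eq_true] at hn
  rcases hb with rfl | rfl | rfl | rfl | rfl | rfl | rfl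
  · exact close [v₁, v₂, v₃, t, s] (by simp [*, ht3.symm, hst.symm]) (by simp; grind)
      (by simp; grind) (by simp)
  · exact close [v₂, v₃, v₄, v₅, v₀, s] (by simp [*]) (by simp; grind) (by simp; grind) (by simp)
  · exact close [v₃, v₄, v₅, v₀, s] (by simp [*]) (by simp; grind) (by simp; grind) (by simp)
  · rcases Q with _ | ⟨q, Q⟩
    · have hbu : G.Adj b u := by simpa using hchQ
      exact hcon ⟨⟨hn6, h01, h12, h23, h34, h45, h50⟩, by simp; grind, h0s, hu, hbu.symm⟩
    · exact close [v₄, v₅, v₀, s] (by simp [*]) (by simp; grind) (by simp; grind) (by simp)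
  · exact close [v₃, v₂, v₁, v₀, s] (by simp [*, h34.symm, h23.symm, h12.symm, h01.symm])
      (by simp; grind) (by simp; grind) (by simp)
  · exact close [v₄, v₃, v₂, v₁, v₀, s] (by simp [*, h45.symm, h34.symm, h23.symm, h12.symm,
      h01.symm]) (by simp; grind) (by simp; grind) (by simp)
  · exact close [v₃, v₄, v₅, v₀, s] (by simp [*]) (by simp; grind) (by simp; grind) (by simp)

/-- A third neighbour of `t`, together with the second handle through `u`, closes a cycle with more
than six vertices. -/
theorem IsHandle.adj_right_iff {v₀ v₁ v₂ v₃ v₄ v₅ s t u : V}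
    (h : IsHandle G v₀ v₁ v₂ v₃ v₄ v₅ s t) (hG : IsBiconnected G) (hmax : CycleListLE G 6)
    (hu : IsHandle G v₀ v₁ v₂ v₃ v₄ v₅ s u) (htu : t ≠ u) (w : V) :
    G.Adj t w ↔ w = s ∨ w = v₃ := by
  refine ⟨fun hw => ?_, by rintro (rfl | rfl); exacts [h.hst.symm, h.ht₃]⟩
  have hu3 := hu.ht₃
  have hsu := hu.hst
  have hnu := hu.nodup
  have hrev := h.reverse.adj_left hG hmax hw
  obtain ⟨⟨hn6, h01, h12, h23, h34, h45, h50⟩, hn, h0s, hst, ht3⟩ := h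
  rcases hrev with rfl | rfl | rfl | hh
  · exact Or.inr rfl
  · refine (hmax.false_of_cons w [t, s, u, v₃, v₄, v₅] (by simp at hn hnu ⊢; grind)
      (by simp [*, hw.symm, hst.symm]) (by simp)).elim
  · exact Or.inl rfl
  · have hw0 := hh.ht₃
    have hnw := hh.nodup
    by_cases hwu : w = u
    · subst hwu
      exact (hmax.false_of_cons v₀ [w, s, t, v₃, v₄, v₅] (by simp at hn hnu ⊢; grind)
        (by simp [*, hw0.symm, hsu.symm]) (by simp)).elim
    · by_cases hws : w = s
      · exact Or.inl hws
      exact (hmax.false_of_cons v₀ [w, t, s, u, v₃, v₄, v₅] (by simp at hn hnu hnw ⊢; grind)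
        (by simp [*, hw0.symm, hw.symm, hst.symm]) (by simp)).elim

theorem IsHandle.hasTwin {v₀ v₁ v₂ v₃ v₄ v₅ s t u : V}
    (h : IsHandle G v₀ v₁ v₂ v₃ v₄ v₅ s t) (hG : IsBiconnected G) (hmax : CycleListLE G 6)
    (hu : IsHandle G v₀ v₁ v₂ v₃ v₄ v₅ s u) (htu : t ≠ u) : HasTwin G := by
  refine HasTwin.of_pair htu (h.adj_right_iff hG hmax hu htu) (hu.adj_right_iff hG hmax h htu.symm)
    [v₀, v₅, v₄] ?_ ?_
  · simp [h.h₀s.symm, h.hex.h₅₀.symm, h.hex.h₄₅.symm, h.hex.h₃₄.symm]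
  · have hn := h.nodup
    have hnu := hu.nodup
    simp at hn hnu ⊢
    grind

/-- A handle on a hexagon can be reduced. -/
theorem IsHandle.hasTwin_or_hasSplit {v₀ v₁ v₂ v₃ v₄ v₅ s t : V}
    (h : IsHandle G v₀ v₁ v₂ v₃ v₄ v₅ s t) (hG : IsBiconnected G) (hmax : CycleListLE G 6) :
    HasTwin G ∨ HasSplit G := by
  -- If neither `s` nor `t` has further neighbours, the edge `s t` is contracted. Otherwise there
  -- are two handles with a common first vertex, and their second vertices are twins.
  by_cases hs : ∀ u, G.Adj s u → u = v₀ ∨ u = v₃ ∨ u = t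
  · by_cases ht : ∀ u, G.Adj t u → u = v₃ ∨ u = v₀ ∨ u = s
    · right
      refine ⟨s, t, v₃, v₀, by have := h.nodup; simp at this ⊢; grind, h.hst, h.ht₃, h.h₀s.symm,
        fun w hw => by have := hs w hw; tauto, fun w hw => by have := ht w hw; tauto, ?_⟩
      intro A _ _ hcl
      refine link_iff [v₄, v₅] (by simp [h.hex.h₃₄, h.hex.h₄₅, h.hex.h₅₀]) ?_ A hcl
      have := h.nodup
      simp at this ⊢
      grind
    · left
      push Not at ht
      obtain ⟨u, hu, h3, h0, hus⟩ := ht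
      have hu' := ((h.reverse.adj_left hG hmax hu).resolve_left h3).resolve_left h0
      exact h.reverse.hasTwin hG hmax (hu'.resolve_left hus) (Ne.symm hus)
  · left
    push Not at hs
    obtain ⟨u, hu, h3, h0, hus⟩ := hs
    have hu' := ((h.adj_left hG hmax hu).resolve_left h3).resolve_left h0
    exact h.hasTwin hG hmax (hu'.resolve_left hus) (Ne.symm hus)

end

/-! ### Outside vertices with neighbours at distance two on a hexagon. -/

section
open Set
variable {V : Type*} {G : SimpleGraph V}

/-- Every neighbor of a vertex outside a hexagon lies on the hexagon. -/
def HexagonsAbsorb (G : SimpleGraph V) : Prop :=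
  ∀ v₀ v₁ v₂ v₃ v₄ v₅, IsHexagon G v₀ v₁ v₂ v₃ v₄ v₅ → ∀ x ∉ [v₀, v₁, v₂, v₃, v₄, v₅],
    ∀ y, G.Adj x y → y ∈ [v₀, v₁, v₂, v₃, v₄, v₅]

/-- An edge outside a hexagon gives an ear with at least two inner vertices. As the arcs of a
longest cycle are not shorter, the ear joins opposite vertices and has exactly two inner vertices:
it is a handle, and handles are reducible. -/
theorem IsBiconnected.hexagonsAbsorb (hG : IsBiconnected G) (hmax : CycleListLE G 6)
    (hr : ¬ (HasTwin G ∨ HasSplit G)) : HexagonsAbsorb G := by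
  intro v₀ v₁ v₂ v₃ v₄ v₅ h x hx y hxy
  by_contra hy
  obtain ⟨a, ha, b, hb, hab, Q, hQ, hQc, hch, hQ2⟩ :=
    hG.exists_long_ear h.nodup (by simp) hx hy hxy
  obtain ⟨l₁, l₂, hc, hp, h₁, h₂⟩ := hmax.ear h.isCycleList (by simp) ha hb hab hQ hQc hch
  have hlen := hp.length_eq
  simp only [List.length_cons, List.length_append, List.length_nil] at hlen
  obtain ⟨p, q, rfl⟩ := List.length_eq_two.1 (show l₁.length = 2 by omega)
  obtain ⟨r, w, rfl⟩ := List.length_eq_two.1 (show l₂.length = 2 by omega)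
  obtain ⟨s, t, rfl⟩ := List.length_eq_two.1 (show Q.length = 2 by omega)
  have hs := hQc s (by simp)
  have ht := hQc t (by simp)
  rw [← hp.mem_iff] at hs ht
  simp at hch
  refine hr (IsHandle.hasTwin_or_hasSplit (v₀ := a) (v₁ := p) (v₂ := q) (v₃ := b) (v₄ := r)
    (v₅ := w) (s := s) (t := t) ⟨hc.isHexagon, ?_, hch.1, hch.2.1, hch.2.2⟩ hG hmax)
  have := hc.1
  simp at this hs ht hQ ⊢
  grind

theorem IsHexagon.not_adj_succ {v₀ v₁ v₂ v₃ v₄ v₅ x : V} (h : IsHexagon G v₀ v₁ v₂ v₃ v₄ v₅)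
    (hmax : CycleListLE G 6) (hx : x ∉ [v₀, v₁, v₂, v₃, v₄, v₅]) (hx0 : G.Adj x v₀) :
    ¬ G.Adj x v₁ := fun hx1 => by
  obtain ⟨hn, h01, h12, h23, h34, h45, h50⟩ := h
  exact hmax.false_of_cons v₀ [x, v₁, v₂, v₃, v₄, v₅] (by simp at hn hx ⊢; grind)
    (by simp [*, hx0.symm]) (by simp)

theorem IsHexagon.adj_iff_of_two {v₀ v₁ v₂ v₃ v₄ v₅ x : V} (h : IsHexagon G v₀ v₁ v₂ v₃ v₄ v₅)
    (hmax : CycleListLE G 6) (ha : HexagonsAbsorb G) (hx : x ∉ [v₀, v₁, v₂, v₃, v₄, v₅])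
    (hx0 : G.Adj x v₀) (hx2 : G.Adj x v₂) (w : V) :
    G.Adj x w ↔ w = v₀ ∨ w = v₂ ∨ (w = v₄ ∧ G.Adj x v₄) := by
  refine ⟨fun hw => ?_, by rintro (rfl | rfl | ⟨rfl, h⟩) <;> assumption⟩
  have hx1 := h.not_adj_succ hmax hx hx0
  have hx3 := h.rotate.rotate.not_adj_succ hmax (by simp at hx ⊢; tauto) hx2
  have hx5 := h.reflect.not_adj_succ hmax (by simp at hx ⊢; tauto) hx0
  have := ha _ _ _ _ _ _ h x hx w hw
  simp only [List.mem_cons, List.not_mem_nil, or_false] at this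
  rcases this with rfl | rfl | rfl | rfl | rfl | rfl <;> tauto

/-- The vertex `v₁` of a hexagon and an outside neighbor `x` of `v₀` and `v₂` exchange roles. -/
theorem IsHexagon.notMem_exchange {v₀ v₁ v₂ v₃ v₄ v₅ x : V} (h : IsHexagon G v₀ v₁ v₂ v₃ v₄ v₅)
    (hx : x ∉ [v₀, v₁, v₂, v₃, v₄, v₅]) : v₁ ∉ [v₀, x, v₂, v₃, v₄, v₅] := by
  have := h.nodup
  simp at this hx ⊢
  grind

/-- The common neighbourhood covers all edges, so the twins are targets. The paths through `p` and
`q` keep it linked when both twins are removed. -/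
theorem HasTwin.of_triple {x v a b c : V} (hxv : x ≠ v)
    (hx : ∀ w, G.Adj x w ↔ w = a ∨ w = b ∨ w = c) (hv : ∀ w, G.Adj v w ↔ w = a ∨ w = b ∨ w = c)
    (hT : ∀ u w, G.Adj u w → u ∈ ({a, b, c} : Set V) ∨ w ∈ ({a, b, c} : Set V)) (p q : V)
    (hp : p ≠ x ∧ p ≠ v) (hq : q ≠ x ∧ q ≠ v) (hap : G.Adj a p) (hpb : G.Adj p b)
    (hbq : G.Adj b q) (hqc : G.Adj q c) : HasTwin G := by
  have hne : ∀ w, w = a ∨ w = b ∨ w = c → w ≠ x ∧ w ≠ v := fun w hw =>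
    ⟨((hx w).2 hw).ne', ((hv w).2 hw).ne'⟩
  have hcard : ({a, b, c} : Set V).ncard ≤ 3 :=
    (ncard_insert_le _ _).trans (by have := ncard_insert_le b {c}; simp at this; omega)
  have hN : G.neighborSet x = {a, b, c} := by ext w; simp [hx]
  refine ⟨x, v, hxv, fun h => (hne v ((hx v).1 h)).2 rfl, fun w => (hx w).trans (hv w).symm,
    Or.inr ⟨by rw [hN]; exact hcard, _, hcard, hN.le, hT⟩, ?_⟩
  intro A _ _ hcl y z hy hz hyA
  have h1 := link_iff (x := x) (v := v) [p] (a := a) (b := b) (by simp [hap, hpb]) (by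
    simp only [List.cons_append, List.nil_append, List.mem_cons, List.not_mem_nil, or_false]
    rintro z (rfl | rfl | rfl)
    exacts [hne _ (by tauto), hp, hne _ (by tauto)]) A hcl
  have h2 := link_iff (x := x) (v := v) [q] (a := b) (b := c) (by simp [hbq, hqc]) (by
    simp only [List.cons_append, List.nil_append, List.mem_cons, List.not_mem_nil, or_false]
    rintro z (rfl | rfl | rfl)
    exacts [hne _ (by tauto), hq, hne _ (by tauto)]) A hcl
  rcases (hx y).1 hy with rfl | rfl | rfl <;> rcases (hx z).1 hz with rfl | rfl | rfl <;> tauto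

theorem exists_equiv_of_list {l : List V} (hn : l.Nodup) (hall : ∀ y, y ∈ l) :
    ∃ e : Fin l.length ≃ V, ∀ i, e i = l.get i := by
  classical
  exact ⟨hn.getEquivOfForallMemList l hall, fun i => rfl⟩

/-- An outside vertex adjacent to every other vertex of a hexagon. -/
structure IsStar (G : SimpleGraph V) (v₀ v₁ v₂ v₃ v₄ v₅ x : V) : Prop where
  hex : IsHexagon G v₀ v₁ v₂ v₃ v₄ v₅
  notMem : x ∉ [v₀, v₁, v₂, v₃, v₄, v₅]
  hx₀ : G.Adj x v₀
  hx₂ : G.Adj x v₂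
  hx₄ : G.Adj x v₄

theorem IsStar.rotate {v₀ v₁ v₂ v₃ v₄ v₅ x : V} (h : IsStar G v₀ v₁ v₂ v₃ v₄ v₅ x) :
    IsStar G v₂ v₃ v₄ v₅ v₀ v₁ x :=
  ⟨h.hex.rotate.rotate, by have := h.notMem; simp at this ⊢; tauto, h.hx₂, h.hx₄, h.hx₀⟩

theorem IsStar.adj_iff {v₀ v₁ v₂ v₃ v₄ v₅ x : V} (h : IsStar G v₀ v₁ v₂ v₃ v₄ v₅ x)
    (hmax : CycleListLE G 6) (ha : HexagonsAbsorb G) (w : V) :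
    G.Adj x w ↔ w = v₀ ∨ w = v₂ ∨ w = v₄ := by
  rw [h.hex.adj_iff_of_two hmax ha h.notMem h.hx₀ h.hx₂]
  simp [h.hx₄]

theorem IsStar.adj_one_iff {v₀ v₁ v₂ v₃ v₄ v₅ x : V} (h : IsStar G v₀ v₁ v₂ v₃ v₄ v₅ x)
    (hmax : CycleListLE G 6) (ha : HexagonsAbsorb G) (w : V) :
    G.Adj v₁ w ↔ w = v₀ ∨ w = v₂ ∨ (w = v₄ ∧ G.Adj v₁ v₄) :=
  (h.hex.exchange h.notMem h.hx₀ h.hx₂).adj_iff_of_two hmax ha (h.hex.notMem_exchange h.notMem)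
    h.hex.h₀₁.symm h.hex.h₁₂ w

/-- Each of `v₁`, `v₃`, `v₅` can change places with `x` on the hexagon, so its neighbours are also
among `v₀`, `v₂`, `v₄`. Vertices off the hexagon only see the hexagon. Hence these three vertices
cover all edges. -/
theorem IsStar.adj_cover {v₀ v₁ v₂ v₃ v₄ v₅ x : V} (h : IsStar G v₀ v₁ v₂ v₃ v₄ v₅ x)
    (hmax : CycleListLE G 6) (ha : HexagonsAbsorb G) {u w : V} (hu : u ≠ v₀ ∧ u ≠ v₂ ∧ u ≠ v₄)
    (huw : G.Adj u w) : w = v₀ ∨ w = v₂ ∨ w = v₄ := by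
  have h1 := h.adj_one_iff hmax ha
  have h3 := h.rotate.adj_one_iff hmax ha
  have h5 := h.rotate.rotate.adj_one_iff hmax ha
  by_cases hu1 : u = v₁
  · subst hu1; have := (h1 w).1 huw; tauto
  by_cases hu3 : u = v₃
  · subst hu3; have := (h3 w).1 huw; tauto
  by_cases hu5 : u = v₅
  · subst hu5; have := (h5 w).1 huw; tauto
  have := ha _ _ _ _ _ _ h.hex u (by simp; tauto) w huw
  simp only [List.mem_cons, List.not_mem_nil, or_false] at this
  rcases this with rfl | rfl | rfl | rfl | rfl | rfl
  · tauto
  · have := (h1 u).1 huw.symm; tauto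
  · tauto
  · have := (h3 u).1 huw.symm; tauto
  · tauto
  · have := (h5 u).1 huw.symm; tauto

theorem IsStar.hasTwin_of_adj {v₀ v₁ v₂ v₃ v₄ v₅ x : V} (h : IsStar G v₀ v₁ v₂ v₃ v₄ v₅ x)
    (hmax : CycleListLE G 6) (ha : HexagonsAbsorb G) (h14 : G.Adj v₁ v₄) : HasTwin G := by
  have hn := h.hex.nodup
  have hx := h.notMem
  refine HasTwin.of_triple (x := x) (v := v₁) (a := v₀) (b := v₄) (c := v₂) (by simp at hx; tauto)
    (fun w => (h.adj_iff hmax ha w).trans (by tauto))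
    (fun w => (h.adj_one_iff hmax ha w).trans (by tauto)) ?_ v₅ v₃ ?_ ?_ h.hex.h₅₀.symm
    h.hex.h₄₅.symm h.hex.h₃₄.symm h.hex.h₂₃.symm
  · intro u w huw
    by_cases hu : u ≠ v₀ ∧ u ≠ v₂ ∧ u ≠ v₄
    · have := h.adj_cover hmax ha hu huw
      right; simp; tauto
    · left; simp; tauto
  · simp at hn hx ⊢; grind
  · simp at hn hx ⊢; grind

theorem IsStar.hasTwin_of_three {v₀ v₁ v₂ v₃ v₄ v₅ x y : V} (h : IsStar G v₀ v₁ v₂ v₃ v₄ v₅ x)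
    (h' : IsStar G v₀ v₁ v₂ v₃ v₄ v₅ y) (hxy : x ≠ y)
    (hmax : CycleListLE G 6) (ha : HexagonsAbsorb G) : HasTwin G := by
  have hx := h.notMem
  have hy := h'.notMem
  refine HasTwin.of_triple hxy (h.adj_iff hmax ha) (h'.adj_iff hmax ha) ?_ v₁ v₃ ?_ ?_ h.hex.h₀₁
    h.hex.h₁₂ h.hex.h₂₃ h.hex.h₃₄
  · intro u w huw
    by_cases hu : u ≠ v₀ ∧ u ≠ v₂ ∧ u ≠ v₄
    · have := h.adj_cover hmax ha hu huw
      right; simp; tauto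
    · left; simp; tauto
  · simp at hx hy ⊢; grind
  · simp at hx hy ⊢; grind

theorem IsHexagon.hasTwin_of_two {v₀ v₁ v₂ v₃ v₄ v₅ y : V} (h : IsHexagon G v₀ v₁ v₂ v₃ v₄ v₅)
    (hmax : CycleListLE G 6) (ha : HexagonsAbsorb G) (h14 : ¬ G.Adj v₁ v₄)
    (hy : y ∉ [v₀, v₁, v₂, v₃, v₄, v₅]) (h0 : G.Adj y v₀) (h2 : G.Adj y v₂) (h4 : ¬ G.Adj y v₄) :
    HasTwin G := by
  have hn := h.nodup
  have h1 := (h.exchange hy h0 h2).adj_iff_of_two hmax ha (h.notMem_exchange hy) h.h₀₁.symm h.h₁₂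
  have h2 := h.adj_iff_of_two hmax ha hy h0 h2
  refine HasTwin.of_pair (x := y) (v := v₁) (a := v₂) (b := v₀) (by simp at hy; tauto)
    (fun w => (h2 w).trans (by tauto)) (fun w => (h1 w).trans (by tauto)) [v₃, v₄, v₅]
    (by simp [h.h₂₃, h.h₃₄, h.h₄₅, h.h₅₀]) ?_
  simp at hn hy ⊢
  grind

/-- Every vertex outside the cover `v₀, v₂, v₄` is joined to two or three of its elements, and two
vertices with the same neighbours are twins. Without twins there are exactly one vertex for the
triple and one for each pair, which is the family of `drawable_M1`. -/
theorem IsStar.hasTwin_or_drawable [Finite V] {v₀ v₁ v₂ v₃ v₄ v₅ x : V}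
    (h : IsStar G v₀ v₁ v₂ v₃ v₄ v₅ x)
    (hG : IsBiconnected G) (hmax : CycleListLE G 6) (ha : HexagonsAbsorb G) :
    HasTwin G ∨ Drawable G := by
  classical
  by_cases h14 : G.Adj v₁ v₄
  · exact Or.inl (h.hasTwin_of_adj hmax ha h14)
  by_cases h30 : G.Adj v₃ v₀
  · exact Or.inl (h.rotate.hasTwin_of_adj hmax ha h30)
  by_cases h52 : G.Adj v₅ v₂
  · exact Or.inl (h.rotate.rotate.hasTwin_of_adj hmax ha h52)
  have hn := h.hex.nodup
  have hx := h.notMem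
  by_cases hy : ∃ y, y ≠ x ∧ y ∉ [v₀, v₁, v₂, v₃, v₄, v₅]
  · left
    obtain ⟨y, hyx, hy⟩ := hy
    obtain ⟨a, hac, b, hbc, hab, hya, hyb⟩ := hG.exists_two_adj hn (by simp) hy
      (ha _ _ _ _ _ _ h.hex y hy)
    have hy' : y ≠ v₀ ∧ y ≠ v₂ ∧ y ≠ v₄ := by simp at hy; tauto
    have haT := h.adj_cover hmax ha hy' hya
    have hbT := h.adj_cover hmax ha hy' hyb
    have hr := h.rotate
    have hrr := h.rotate.rotate
    have hyr : y ∉ [v₂, v₃, v₄, v₅, v₀, v₁] := by simp at hy ⊢; tauto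
    have hyrr : y ∉ [v₄, v₅, v₀, v₁, v₂, v₃] := by simp at hy ⊢; tauto
    by_cases h0 : G.Adj y v₀ <;> by_cases h2 : G.Adj y v₂ <;> by_cases h4 : G.Adj y v₄
    · exact h.hasTwin_of_three ⟨h.hex, hy, h0, h2, h4⟩ hyx.symm hmax ha
    · exact h.hex.hasTwin_of_two hmax ha h14 hy h0 h2 h4
    · exact hrr.hex.hasTwin_of_two hmax ha h52 hyrr h4 h0 h2
    · exfalso; grind
    · exact hr.hex.hasTwin_of_two hmax ha h30 hyr h2 h4 h0
    all_goals exfalso; grind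
  · right
    push Not at hy
    have hn7 : [v₀, v₂, v₄, x, v₁, v₃, v₅].Nodup := by simp at hn hx ⊢; grind
    have hall : ∀ y, y ∈ [v₀, v₂, v₄, x, v₁, v₃, v₅] := by
      intro y
      by_cases hyx : y = x
      · simp [hyx]
      · have := hy y hyx
        simp at this ⊢
        tauto
    have h1 := h.adj_one_iff hmax ha
    have h3 := h.rotate.adj_one_iff hmax ha
    have h5 := h.rotate.rotate.adj_one_iff hmax ha
    have h7 := h.adj_iff hmax ha
    simp only [h14, h30, h52, and_false, or_false] at h1 h3 h5
    obtain ⟨e, he⟩ := exists_equiv_of_list hn7 hall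
    refine drawable_M1 e ?_
    have e0 : e 0 = v₀ := he 0
    have e1 : e 1 = v₂ := he 1
    have e2 : e 2 = v₄ := he 2
    have e3 : e 3 = x := he 3
    have e4 : e 4 = v₁ := he 4
    have e5 : e 5 = v₃ := he 5
    have e6 : e 6 = v₅ := he 6
    clear he
    have hm := (maskM1_spec false false false).2
    simp only [List.nodup_cons, List.mem_cons, List.not_mem_nil, or_false, not_or,
      List.nodup_nil, and_true, not_false_eq_true] at hn7
    intro i j hij hj
    rw [hm i j hij, G.adj_comm]
    fin_cases i <;> fin_cases j <;> first
      | exact absurd hij (by decide)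
      | exact absurd hj (by decide)
      | (simp [h1, h3, h5, h7, e0, e1, e2, e3, e4, e5, e6, hn7]; done)
      | (simp [h1, h3, h5, h7, e1, e2, e3, e4, e5, e6, hn7]; grind)

end

/-! ### Outside vertices joined to opposite vertices of a hexagon. -/

section
open Set
variable {V : Type*} {G : SimpleGraph V}

/-- The vertices `x` and `v₁` are interchangeable. If one of them is adjacent to `v₄`, there is a
star; otherwise both have only the neighbours `v₀` and `v₂` and are twins. -/
theorem IsHexagon.reduces_of_two [Finite V] {v₀ v₁ v₂ v₃ v₄ v₅ x : V}
    (h : IsHexagon G v₀ v₁ v₂ v₃ v₄ v₅) (hx : x ∉ [v₀, v₁, v₂, v₃, v₄, v₅]) (hx0 : G.Adj x v₀)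
    (hx2 : G.Adj x v₂) (hG : IsBiconnected G) (hmax : CycleListLE G 6) (ha : HexagonsAbsorb G) :
    HasTwin G ∨ Drawable G := by
  by_cases hx4 : G.Adj x v₄
  · exact IsStar.hasTwin_or_drawable ⟨h, hx, hx0, hx2, hx4⟩ hG hmax ha
  by_cases h14 : G.Adj v₁ v₄
  · exact IsStar.hasTwin_or_drawable ⟨h.exchange hx hx0 hx2, h.notMem_exchange hx, h.h₀₁.symm,
      h.h₁₂, h14⟩ hG hmax ha
  exact Or.inl (h.hasTwin_of_two hmax ha h14 hx hx0 hx2 hx4)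

/-- No vertex outside a hexagon has neighbors at distance two on the hexagon. -/
def OnlyOpposite (G : SimpleGraph V) : Prop :=
  ∀ v₀ v₁ v₂ v₃ v₄ v₅, IsHexagon G v₀ v₁ v₂ v₃ v₄ v₅ → ∀ x ∉ [v₀, v₁, v₂, v₃, v₄, v₅],
    G.Adj x v₀ → ¬ G.Adj x v₂

/-- A vertex `x` joined to opposite vertices of a hexagon. -/
structure IsTheta (G : SimpleGraph V) (v₀ v₁ v₂ v₃ v₄ v₅ x : V) : Prop where
  hex : IsHexagon G v₀ v₁ v₂ v₃ v₄ v₅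
  notMem : x ∉ [v₀, v₁, v₂, v₃, v₄, v₅]
  hx₀ : G.Adj x v₀
  hx₃ : G.Adj x v₃

theorem IsTheta.reflect {v₀ v₁ v₂ v₃ v₄ v₅ x : V} (h : IsTheta G v₀ v₁ v₂ v₃ v₄ v₅ x) :
    IsTheta G v₀ v₅ v₄ v₃ v₂ v₁ x :=
  ⟨h.hex.reflect, by have := h.notMem; simp at this ⊢; tauto, h.hx₀, h.hx₃⟩

theorem IsTheta.swap {v₀ v₁ v₂ v₃ v₄ v₅ x : V} (h : IsTheta G v₀ v₁ v₂ v₃ v₄ v₅ x) :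
    IsTheta G v₃ v₄ v₅ v₀ v₁ v₂ x :=
  ⟨h.hex.rotate.rotate.rotate, by have := h.notMem; simp at this ⊢; tauto, h.hx₃, h.hx₀⟩

/-- In the absence of neighbors at distance two, a second outside vertex is not joined to `v₁`. -/
theorem IsTheta.not_adj_one {v₀ v₁ v₂ v₃ v₄ v₅ x y : V} (h : IsTheta G v₀ v₁ v₂ v₃ v₄ v₅ x)
    (hmax : CycleListLE G 6) (hG : IsBiconnected G) (ha : HexagonsAbsorb G)
    (ho : OnlyOpposite G) (hy : y ∉ [v₀, v₁, v₂, v₃, v₄, v₅]) (hyx : y ≠ x) : ¬ G.Adj y v₁ := by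
  intro h1
  have hx := h.notMem
  obtain ⟨a, hac, b, hbc, hab, hya, hyb⟩ := hG.exists_two_adj h.hex.nodup (by simp) hy
    (ha _ _ _ _ _ _ h.hex y hy)
  have h0 : ¬ G.Adj y v₀ := fun h0 => h.hex.not_adj_succ hmax hy h0 h1
  have h2 : ¬ G.Adj y v₂ := h.hex.rotate.not_adj_succ hmax (by simp at hy ⊢; tauto) h1
  have h3 : ¬ G.Adj y v₃ := ho _ _ _ _ _ _ h.hex.rotate y (by simp at hy ⊢; tauto) h1
  have h5 : ¬ G.Adj y v₅ := ho _ _ _ _ _ _ h.hex.rotate.reflect y (by simp at hy ⊢; tauto) h1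
  have h4 : ¬ G.Adj y v₄ := fun h4 => by
    obtain ⟨⟨hn, h01, h12, h23, h34, h45, h50⟩, hx', hx0, hx3⟩ := h
    exact hmax.false_of_cons v₀ [x, v₃, v₂, v₁, y, v₄, v₅] (by simp at hn hx hy ⊢; grind)
      (by simp [*, h1.symm, hx0.symm, h23.symm, h12.symm]) (by simp)
  simp only [List.mem_cons, List.not_mem_nil, or_false] at hac hbc
  grind

theorem IsTheta.adj_iff {v₀ v₁ v₂ v₃ v₄ v₅ x : V} (h : IsTheta G v₀ v₁ v₂ v₃ v₄ v₅ x)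
    (hmax : CycleListLE G 6) (ha : HexagonsAbsorb G) (w : V) : G.Adj x w ↔ w = v₃ ∨ w = v₀ := by
  refine ⟨fun hw => ?_, by rintro (rfl | rfl); exacts [h.hx₃, h.hx₀]⟩
  have h1 : ¬ G.Adj x v₁ := h.hex.not_adj_succ hmax h.notMem h.hx₀
  have h5 : ¬ G.Adj x v₅ := h.reflect.hex.not_adj_succ hmax h.reflect.notMem h.hx₀
  have h4 : ¬ G.Adj x v₄ := h.swap.hex.not_adj_succ hmax h.swap.notMem h.hx₃
  have h2 : ¬ G.Adj x v₂ := h.swap.reflect.hex.not_adj_succ hmax h.swap.reflect.notMem h.hx₃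
  have := ha _ _ _ _ _ _ h.hex x h.notMem w hw
  simp only [List.mem_cons, List.not_mem_nil, or_false] at this
  rcases this with rfl | rfl | rfl | rfl | rfl | rfl <;> tauto

theorem IsTheta.hasTwin {v₀ v₁ v₂ v₃ v₄ v₅ x y : V} (h : IsTheta G v₀ v₁ v₂ v₃ v₄ v₅ x)
    (hmax : CycleListLE G 6) (hG : IsBiconnected G) (ha : HexagonsAbsorb G)
    (ho : OnlyOpposite G) (hy : y ∉ [v₀, v₁, v₂, v₃, v₄, v₅]) (hyx : y ≠ x) : HasTwin G := by
  obtain ⟨a, hac, b, hbc, hab, hya, hyb⟩ := hG.exists_two_adj h.hex.nodup (by simp) hy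
    (ha _ _ _ _ _ _ h.hex y hy)
  have h1 := h.not_adj_one hmax hG ha ho hy hyx
  have h5 := h.reflect.not_adj_one hmax hG ha ho (y := y) (by simp at hy ⊢; tauto) hyx
  have h4 := h.swap.not_adj_one hmax hG ha ho (y := y) (by simp at hy ⊢; tauto) hyx
  have h2 := h.swap.reflect.not_adj_one hmax hG ha ho (y := y) (by simp at hy ⊢; tauto) hyx
  simp only [List.mem_cons, List.not_mem_nil, or_false] at hac hbc
  have hy0 : G.Adj y v₀ := by grind
  have hy3 : G.Adj y v₃ := by grind
  have h' : IsTheta G v₀ v₁ v₂ v₃ v₄ v₅ y := ⟨h.hex, hy, hy0, hy3⟩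
  have hx := h.notMem
  refine HasTwin.of_pair hyx.symm (h.adj_iff hmax ha) (h'.adj_iff hmax ha) [v₄, v₅]
    (by simp [h.hex.h₃₄, h.hex.h₄₅, h.hex.h₅₀]) ?_
  simp at hx hy ⊢
  grind

theorem IsTheta.not_adj_one_four {v₀ v₁ v₂ v₃ v₄ v₅ x : V} (h : IsTheta G v₀ v₁ v₂ v₃ v₄ v₅ x)
    (hmax : CycleListLE G 6) : ¬ G.Adj v₁ v₄ := fun h14 => by
  obtain ⟨⟨hn, h01, h12, h23, h34, h45, h50⟩, hx, hx0, hx3⟩ := h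
  exact hmax.false_of_cons v₀ [x, v₃, v₂, v₁, v₄, v₅] (by simp at hn hx ⊢; grind)
    (by simp [*, hx0.symm, h23.symm, h12.symm]) (by simp)

theorem IsTheta.not_adj_of_adj {v₀ v₁ v₂ v₃ v₄ v₅ x : V} (h : IsTheta G v₀ v₁ v₂ v₃ v₄ v₅ x)
    (hmax : CycleListLE G 6) (h15 : G.Adj v₁ v₅) : ¬ G.Adj v₀ v₂ ∧ ¬ G.Adj v₂ v₄ := by
  obtain ⟨⟨hn, h01, h12, h23, h34, h45, h50⟩, hx, hx0, hx3⟩ := h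
  constructor
  · intro h02
    exact hmax.false_of_cons v₀ [v₂, v₁, v₅, v₄, v₃, x] (by simp at hn hx ⊢; grind)
      (by simp [*, hx3.symm, h45.symm, h34.symm, h12.symm]) (by simp)
  · intro h24
    exact hmax.false_of_cons v₀ [v₁, v₅, v₄, v₂, v₃, x] (by simp at hn hx ⊢; grind)
      (by simp [*, hx3.symm, h45.symm, h24.symm]) (by simp)

/-- The triangle is `v₀, v₁, v₅`, the apex is `v₃`, and each of `x`, `v₂`, `v₄` is joined to the
apex and one corner. Other adjacencies, apart from those between triangle and apex, would close a
cycle of length seven. -/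
theorem IsTheta.drawable [Finite V] {v₀ v₁ v₂ v₃ v₄ v₅ x : V}
    (h : IsTheta G v₀ v₁ v₂ v₃ v₄ v₅ x) (hmax : CycleListLE G 6) (ha : HexagonsAbsorb G)
    (hall : ∀ y, y ∉ [v₀, v₁, v₂, v₃, v₄, v₅] → y = x) (h15 : G.Adj v₁ v₅) : Drawable G := by
  have hn := h.hex.nodup
  have hx := h.notMem
  have hn7 : [v₀, v₁, v₅, v₃, x, v₂, v₄].Nodup := by simp at hn hx ⊢; grind
  obtain ⟨e, he⟩ := exists_equiv_of_list hn7 (fun y => by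
    have := hall y
    simp at this ⊢
    tauto)
  have hxx := h.adj_iff hmax ha
  have h14 := h.not_adj_one_four hmax
  have h52 := h.reflect.not_adj_one_four hmax
  have h02 := h.not_adj_of_adj hmax h15
  have h04 := h.reflect.not_adj_of_adj hmax h15.symm
  refine drawable_M4 e ?_
  have e0 : e 0 = v₀ := he 0
  have e1 : e 1 = v₁ := he 1
  have e2 : e 2 = v₅ := he 2
  have e3 : e 3 = v₃ := he 3
  have e4 : e 4 = x := he 4
  have e5 : e 5 = v₂ := he 5
  have e6 : e 6 = v₄ := he 6
  have hm := (maskM4_spec false false false).2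
  obtain ⟨-, h01, h12, h23, h34, h45, h50⟩ := h.hex
  have hx1 : ∀ w, G.Adj w x ↔ w = v₃ ∨ w = v₀ := fun w => by rw [G.adj_comm, hxx]
  simp only [List.nodup_cons, List.mem_cons, List.not_mem_nil, or_false, not_or,
    List.nodup_nil, and_true, not_false_eq_true] at hn7
  clear he
  intro i j hij hj
  rw [hm i j hij]
  fin_cases i <;> fin_cases j <;> first
    | exact absurd hij (by decide)
    | exact absurd rfl hj
    | (simp [hxx, hx1, e0, e1, e2, e3, e4, e5, e6, h01, h12, h23.symm, h34, h45.symm, h50.symm, h15,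
        h14, h52, h02, h04, hn7]; done)
    | (simp [hxx, hx1, e1, e2, e4, e5, e6, hn7]; grind)

/-- A second outside vertex is a twin of `x`. If there is none, a chord `v₁ v₅` or `v₂ v₄` leads to
the family of `drawable_M4`; without both chords the edge `v₁ v₂` has no neighbours besides `v₀` and
`v₃` and can be contracted. -/
theorem IsTheta.reduces [Finite V] {v₀ v₁ v₂ v₃ v₄ v₅ x : V}
    (h : IsTheta G v₀ v₁ v₂ v₃ v₄ v₅ x) (hmax : CycleListLE G 6) (hG : IsBiconnected G)
    (ha : HexagonsAbsorb G) (ho : OnlyOpposite G) : HasTwin G ∨ HasSplit G ∨ Drawable G := by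
  by_cases hy : ∃ y, y ∉ [v₀, v₁, v₂, v₃, v₄, v₅] ∧ y ≠ x
  · obtain ⟨y, hy, hyx⟩ := hy
    exact Or.inl (h.hasTwin hmax hG ha ho hy hyx)
  push Not at hy
  by_cases h15 : G.Adj v₁ v₅
  · exact Or.inr (Or.inr (h.drawable hmax ha hy h15))
  by_cases h42 : G.Adj v₄ v₂
  · exact Or.inr (Or.inr (h.swap.drawable hmax ha
      (fun y hy' => hy y (by simp at hy' ⊢; tauto)) h42))
  right
  left
  have h14 := h.not_adj_one_four hmax
  have h52 := h.reflect.not_adj_one_four hmax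
  have hx := h.adj_iff hmax ha
  have hn := h.hex.nodup
  have hxn := h.notMem
  have hcase : ∀ y, y = x ∨ y = v₀ ∨ y = v₁ ∨ y = v₂ ∨ y = v₃ ∨ y = v₄ ∨ y = v₅ := by
    intro y
    have := hy y
    simp at this
    tauto
  have hx1 : ∀ w, G.Adj w x ↔ w = v₃ ∨ w = v₀ := fun w => by rw [G.adj_comm, hx]
  refine ⟨v₁, v₂, v₃, v₀, by simp at hn ⊢; grind, h.hex.h₁₂, h.hex.h₂₃, h.hex.h₀₁.symm, ?_, ?_, ?_⟩
  · intro w hw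
    rcases hcase w with rfl | rfl | rfl | rfl | rfl | rfl | rfl
    · simp at hn; have := (hx1 v₁).1 hw; grind
    · tauto
    · exact absurd hw (G.loopless.irrefl _)
    all_goals tauto
  · intro w hw
    rcases hcase w with rfl | rfl | rfl | rfl | rfl | rfl | rfl
    · simp at hn; have := (hx1 v₂).1 hw; grind
    · tauto
    · tauto
    · exact absurd hw (G.loopless.irrefl _)
    · tauto
    · exact absurd hw.symm h42
    · exact absurd hw.symm h52
  · intro A _ _ hcl
    refine link_iff [v₄, v₅] (by simp [h.hex.h₃₄, h.hex.h₄₅, h.hex.h₅₀]) ?_ A hcl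
    simp at hn ⊢
    grind

/-- A biconnected graph with a longest cycle of length six that misses a vertex. -/
theorem IsBiconnected.reduces_of_six [Finite V] (hG : IsBiconnected G) (hmax : CycleListLE G 6)
    {c : List V} (hc : IsCycleList G c) (hck : c.length = 6) {x : V} (hx : x ∉ c) :
    HasTwin G ∨ HasSplit G ∨ Drawable G := by
  by_cases hr : HasTwin G ∨ HasSplit G
  · tauto
  have ha := hG.hexagonsAbsorb hmax hr
  by_cases ho : OnlyOpposite G
  · have hout : ∀ y, G.Adj x y → y ∈ c := by
      obtain ⟨v₀, c, rfl⟩ := List.exists_of_length_succ _ hck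
      obtain ⟨v₁, c, rfl⟩ := List.exists_of_length_succ c (by simpa using hck)
      obtain ⟨v₂, c, rfl⟩ := List.exists_of_length_succ c (by simpa using hck)
      obtain ⟨v₃, c, rfl⟩ := List.exists_of_length_succ c (by simpa using hck)
      obtain ⟨v₄, c, rfl⟩ := List.exists_of_length_succ c (by simpa using hck)
      obtain ⟨v₅, c, rfl⟩ := List.exists_of_length_succ c (by simpa using hck)
      obtain rfl : c = [] := by simpa using hck
      exact ha _ _ _ _ _ _ hc.isHexagon x hx
    obtain ⟨a, hac, b, hbc, hab, hxa, hxb⟩ := hG.exists_two_adj hc.1 (by omega) hx hout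
    obtain ⟨l₁, l₂, hc', hp, h₁, h₂⟩ := hmax.ear hc hck hac hbc hab (Q := [x]) (by simp)
      (by simpa using hx) (by simp [hxa.symm, hxb])
    have hlen := hp.length_eq
    simp only [List.length_cons, List.length_append, List.length_nil] at hlen h₁ h₂
    rw [← hp.mem_iff] at hx
    by_cases e1 : l₁.length = 1
    · obtain ⟨p, rfl⟩ := List.length_eq_one_iff.1 e1
      obtain ⟨q, r, s, rfl⟩ := List.length_eq_three.1 (show l₂.length = 3 by omega)
      exact absurd hxb (ho _ _ _ _ _ _ hc'.isHexagon x hx hxa)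
    by_cases e2 : l₁.length = 2
    · obtain ⟨p, q, rfl⟩ := List.length_eq_two.1 e2
      obtain ⟨r, s, rfl⟩ := List.length_eq_two.1 (show l₂.length = 2 by omega)
      exact IsTheta.reduces ⟨hc'.isHexagon, hx, hxa, hxb⟩ hmax hG ha ho
    · obtain ⟨p, q, r, rfl⟩ := List.length_eq_three.1 (show l₁.length = 3 by omega)
      obtain ⟨s, rfl⟩ := List.length_eq_one_iff.1 (show l₂.length = 1 by omega)
      exact absurd hxb (ho _ _ _ _ _ _ hc'.isHexagon.reflect x
        (by simp at hx ⊢; tauto) hxa)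
  · unfold OnlyOpposite at ho
    push Not at ho
    obtain ⟨v₀, v₁, v₂, v₃, v₄, v₅, h, y, hy, h0, h2⟩ := ho
    have := h.reduces_of_two hy h0 h2 hG hmax ha
    tauto

theorem drawable_of_isCycleList [Finite V] {c : List V} (hc : IsCycleList G c)
    (hc2 : 2 ≤ c.length) (hc6 : c.length ≤ 6) (hall : ∀ x, x ∈ c) : Drawable G := by
  obtain ⟨e, he⟩ := exists_equiv_of_list hc.1 hall
  refine drawable_of_hamiltonian hc2 hc6 e ?_
  intro i
  rw [he, he]
  obtain ⟨a, l, rfl⟩ : ∃ a l, c = a :: l := by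
    rcases c with _ | ⟨a, l⟩
    · simp at hc2
    · exact ⟨a, l, rfl⟩
  have hch := (isCycleList_cons.1 hc).2
  rw [List.isChain_iff_getElem] at hch
  have := hch i.1 (by have := i.2; simp only [List.length_cons, List.length_append] at this ⊢; simpa using this)
  have hi := i.2
  have h1 : (finRotate (a :: l).length i).1 = if i.1 = l.length then 0 else i.1 + 1 := by
    by_cases h : i.1 = l.length
    · have : i = Fin.last l.length := Fin.ext h
      subst this
      simp [List.length_cons]
    · have := coe_finRotate_of_ne_last (n := l.length) (i := i) (fun h' => h (by rw [h']; rfl))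
      simpa [h] using this
  simp only [List.get_eq_getElem, h1]
  have e1 : (a :: l)[i.1] = (a :: (l ++ [a]))[i.1]'(by simp at hi ⊢) := by
    have : a :: (l ++ [a]) = (a :: l) ++ [a] := rfl
    simp only [this, List.getElem_append_left hi]
  rw [e1]
  convert this using 1
  by_cases h : i.1 = l.length
  · simp [h]
  · simp only [h, if_false, List.getElem_cons_succ]
    rw [List.getElem_append_left]

/-! ### The induction for blocks. -/

/-- Every biconnected graph without a cycle of length more than six has good block drawings. -/
theorem IsBiconnected.drawable : ∀ (n : ℕ) {V : Type*} [Finite V] (G : SimpleGraph V),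
    Nat.card V = n → Nontrivial V → IsBiconnected G → CycleListLE G 6 → Drawable G := by
  intro n
  induction n using Nat.strong_induction_on with
  | _ n ih =>
  intro V _ G hn hV hG h6
  classical
  by_cases hr : HasTwin G ∨ HasSplit G
  · have hsub : ∀ v : V, Nat.card {u : V // u ≠ v} < n := fun v => by
      rw [← hn]
      exact Finite.card_subtype_lt (p := fun u => u ≠ v) (x := v) (by simp)
    rcases hr with ⟨x, v, hxv, hadj, htwin, hT, hlink⟩ |
      ⟨x, v, a, b, hnd, hadj, hva, hxb, hNx, hNv, hlink⟩
    · have hnt : Nontrivial {u : V // u ≠ v} := by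
        have : ∃ w, G.Adj x w := by
          by_contra! hcon
          have := hG.connected {x} ⟨x, rfl⟩ (by
            rintro y rfl z hyz
            exact absurd hyz (hcon z)) v
          exact hxv this.symm
        obtain ⟨w, hw⟩ := this
        exact ⟨⟨x, hxv⟩, ⟨w, ((htwin w).1 hw).ne'⟩, fun h => hw.ne (congrArg Subtype.val h)⟩
      refine Drawable.of_twin hxv hadj htwin hT hnt (ih _ (hsub v) _ rfl hnt
        (hG.induce_twin hxv hadj htwin hlink) ?_)
      exact h6.of_injective Subtype.val_injective fun a b h => h
    · simp only [List.nodup_cons, List.mem_cons, List.not_mem_nil, or_false, not_or,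
        List.nodup_nil, and_true, not_false_eq_true] at hnd
      obtain ⟨⟨hxv, hxa, hxb'⟩, ⟨hva', hvb⟩, hab⟩ := hnd
      refine Drawable.of_split hxv (Ne.symm hxa) (Ne.symm hva') (Ne.symm hxb') (Ne.symm hvb) hab hva
        hxb hNx hNv (ih _ (hsub v) _ rfl
          ⟨⟨x, hxv⟩, ⟨a, Ne.symm hva'⟩, fun h => hxa (congrArg Subtype.val h)⟩
          (hG.contract hxv hadj hNx hNv hlink) ?_) hadj
      exact h6.contract (by norm_num) hxv (Ne.symm hxa) (Ne.symm hva') (Ne.symm hxb')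
        (Ne.symm hvb) hadj hva hxb hNx hNv
  · obtain ⟨u, w, huw⟩ : ∃ u w, G.Adj u w := by
      by_contra! hcon
      obtain ⟨x, y, hxy⟩ := hV
      exact hxy.symm (hG.connected {x} ⟨x, rfl⟩ (fun _ _ z hz => absurd hz (hcon _ z)) y)
    -- An edge counts as a cyclic list of length two, so a longest list exists and a block with a
    -- single edge is covered by the Hamiltonian case.
    have hex : ∃ k, 2 ≤ k ∧ ∃ c : List V, IsCycleList G c ∧ c.length = k :=
      ⟨2, le_rfl, [u, w], isCycleList_cons.2 ⟨by simp [huw.ne], by simp [huw, huw.symm]⟩, rfl⟩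
    obtain ⟨k, ⟨hk2, c, hc, hck⟩, hkmax⟩ : ∃ k, (2 ≤ k ∧ ∃ c : List V, IsCycleList G c ∧ c.length = k) ∧
        ∀ m, (2 ≤ m ∧ ∃ c : List V, IsCycleList G c ∧ c.length = m) → m ≤ k := by
      refine ⟨Nat.findGreatest (fun k => 2 ≤ k ∧ ∃ c : List V, IsCycleList G c ∧ c.length = k) 6,
        ?_, ?_⟩
      · obtain ⟨k, hk⟩ := hex
        obtain ⟨-, c, hc, rfl⟩ := id hk
        exact Nat.findGreatest_spec
          (P := fun k => 2 ≤ k ∧ ∃ c : List V, IsCycleList G c ∧ c.length = k) (h6 c hc) hk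
      · rintro m ⟨hm, c, hc, rfl⟩
        exact Nat.le_findGreatest (h6 c hc) ⟨hm, c, hc, rfl⟩
    have hk6 : k ≤ 6 := hck ▸ h6 c hc
    have hmax : CycleListLE G k := by
      intro l hl
      by_cases h2 : 2 ≤ l.length
      · exact hkmax _ ⟨h2, l, hl, rfl⟩
      · omega
    by_cases hall : ∀ x, x ∈ c
    · exact drawable_of_isCycleList hc (hck ▸ hk2) (hck ▸ hk6) hall
    · push Not at hall
      obtain ⟨x, hx⟩ := hall
      by_cases hk5 : k ≤ 5
      · exact absurd (Or.inl (hG.hasTwin_of_short hk2 hk5 hmax hc hck hx)) hr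
      · obtain rfl : k = 6 := by omega
        have := hG.reduces_of_six hmax hc hck hx
        tauto

end

/-! ### From blocks to arbitrary graphs. -/

section
open Set
variable {V V' : Type*} {G : SimpleGraph V} {G' : SimpleGraph V'}

/-- Passing to an induced subgraph keeps the nonedges among the remaining vertices and only removes
parts of the drawing. -/
theorem IsEscapeDrawing.comp_embedding {p : V → Plane} (h : IsEscapeDrawing G p) (i : G' ↪g G) :
    IsEscapeDrawing G' (p ∘ i) := by
  have hsub : straightLineDrawing G' (p ∘ i) ⊆ straightLineDrawing G p := by
    intro x hx
    rcases mem_straightLineDrawing.1 hx with ⟨v, rfl⟩ | ⟨u, v, huv, hx⟩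
    · exact mem_straightLineDrawing.2 (Or.inl ⟨i v, rfl⟩)
    · exact mem_straightLineDrawing.2 (Or.inr ⟨i u, i v, i.map_rel_iff.2 huv, hx⟩)
  refine ⟨h.injective.comp i.injective, fun u w huw hadj => ?_, fun v => ?_⟩
  · obtain ⟨z, hz, E, h1, h2, h3, h4, h5⟩ := h.escapes (i u) (i w) (i.injective.ne huw)
      (fun h => hadj (i.map_rel_iff.1 h))
    exact ⟨z, hz, E, h1, h2, h3, h4, h5.mono_right hsub⟩
  · obtain ⟨n₁, n₂, h0, hn⟩ := h.sector (i v)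
    exact ⟨n₁, n₂, h0, fun α β hα hβ hαβ hmem => hn α β hα hβ hαβ (hsub hmem)⟩

theorem isEscapeDrawing_of_subsingleton [Subsingleton V] :
    IsEscapeDrawing G (fun _ => (0 : Plane)) := by
  refine ⟨Function.injective_of_subsingleton _, fun u w huw => absurd (Subsingleton.elim u w) huw,
    fun v => ⟨!₂[1, 0], !₂[0, 1], by simp [det₂], fun α β hα hβ hαβ hmem => ?_⟩⟩
  have h0 : (0 : Plane) + α • !₂[(1 : ℝ), 0] + β • !₂[(0 : ℝ), 1] = 0 := by
    rcases mem_straightLineDrawing.1 hmem with ⟨v, hv⟩ | ⟨u, v, huv, hx⟩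
    · exact hv.symm
    · exact absurd (Subsingleton.elim u v) huv.ne
  have h1 := congrArg (fun z : Plane => z 0) h0
  have h2 := congrArg (fun z : Plane => z 1) h0
  simp at h1 h2
  linarith

/-- `K` is a nonempty union of components of `G` without `v`. -/
def IsLobe (G : SimpleGraph V) (v : V) (K : Set V) : Prop :=
  K.Nonempty ∧ v ∉ K ∧ ∀ x ∈ K, ∀ y, G.Adj x y → y ≠ v → y ∈ K

/-- A lobe of least size, over all vertices, belongs to an end block. A separation of it at `v`
would give a smaller lobe at `v`. At a vertex `u` of `K`, the part of a separation that misses `v`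
is a lobe at `u` inside `K` without `u`, which is smaller again. -/
theorem IsLobe.isBiconnected [Finite V] {v : V} {K : Set V} (h : IsLobe G v K)
    (hmin : ∀ u L, IsLobe G u L → K.ncard ≤ L.ncard)
    (hG : ∀ A : Set V, A.Nonempty → (∀ x ∈ A, ∀ y, G.Adj x y → y ∈ A) → ∀ y, y ∈ A) :
    IsBiconnected (G.induce (insert v K)) := by
  obtain ⟨hne, hv, hcl⟩ := h
  have hadjK : ∀ x ∈ K, ∀ y, G.Adj x y → y ∈ insert v K := by
    intro x hx y hxy
    by_cases hy : y = v
    · exact Or.inl hy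
    · exact Or.inr (hcl x hx y hxy hy)
  have hsmall : ∀ u L, IsLobe G u L → L ⊆ K → u ∉ K := by
    intro u L hL hLK huK
    have := ncard_lt_ncard (⟨hLK, fun h => hL.2.1 (h huK)⟩ : L ⊂ K)
    exact absurd (hmin u L hL) (by omega)
  constructor
  · intro A hA hAcl
    have hclB : ∀ x ∈ Subtype.val '' A, ∀ y ∈ insert v K, G.Adj x y → y ∈ Subtype.val '' A := by
      rintro _ ⟨x, hx, rfl⟩ y hy hxy
      exact ⟨⟨y, hy⟩, hAcl x hx ⟨y, hy⟩ hxy, rfl⟩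
    have hBK : Subtype.val '' A ⊆ insert v K := by rintro _ ⟨x, -, rfl⟩; exact x.2
    have hBn := hA.image Subtype.val
    suffices H : ∀ y ∈ insert v K, y ∈ Subtype.val '' A by
      intro y
      obtain ⟨y', hy', he⟩ := H y y.2
      rwa [← show y' = y from Subtype.ext he]
    generalize Subtype.val '' A = B at hclB hBK hBn
    by_cases hvB : v ∈ B
    · intro y hy
      by_contra hyB
      have hK : ∀ x, x ∈ insert v K \ B → x ∈ K := fun x hx => by
        rcases hx.1 with rfl | h
        exacts [absurd hvB hx.2, h]
      have := hG (insert v K \ B) ⟨y, hy, hyB⟩ (by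
        intro x hx z hxz
        refine ⟨hadjK x (hK x hx) z hxz, fun hz => hx.2 (hclB z hz x hx.1 hxz.symm)⟩) v
      exact this.2 hvB
    · refine absurd (hG B hBn ?_ v) hvB
      intro x hx z hxz
      have hxK : x ∈ K := by
        rcases hBK hx with rfl | h
        exacts [absurd hx hvB, h]
      exact hclB x hx z (hadjK x hxK z hxz) hxz
  · intro u A hA huA hAcl
    have hclB : ∀ x ∈ Subtype.val '' A, ∀ y ∈ insert v K, G.Adj x y → y ≠ u.1 →
        y ∈ Subtype.val '' A := by
      rintro _ ⟨x, hx, rfl⟩ y hy hxy hyu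
      exact ⟨⟨y, hy⟩, hAcl x hx ⟨y, hy⟩ hxy (fun h => hyu (congrArg Subtype.val h)), rfl⟩
    have hBK : Subtype.val '' A ⊆ insert v K := by rintro _ ⟨x, -, rfl⟩; exact x.2
    have hBn := hA.image Subtype.val
    have huB : u.1 ∉ Subtype.val '' A := by
      rintro ⟨x, hx, he⟩
      exact huA (by rwa [← show x = u from Subtype.ext he])
    suffices H : ∀ y ∈ insert v K, y ≠ u.1 → y ∈ Subtype.val '' A by
      intro y hyu
      obtain ⟨y', hy', he⟩ := H y y.2 (fun h => hyu (Subtype.ext h))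
      rwa [← show y' = y from Subtype.ext he]
    obtain ⟨u, huK⟩ := u
    simp only at hclB huB ⊢
    generalize Subtype.val '' A = B at hclB hBK hBn huB
    rcases huK with rfl | huK
    · have hBK' : B ⊆ K := fun x hx => (hBK hx).resolve_left (fun h => huB (h ▸ hx))
      have hB : IsLobe G u B := ⟨hBn, huB, fun x hx y hxy hyu =>
        hclB x hx y (hadjK x (hBK' hx) y hxy) hxy hyu⟩
      have := eq_of_subset_of_ncard_le hBK' (hmin u B hB)
      intro y hy hyu
      rw [this]
      exact hy.resolve_left hyu
    · by_cases hvB : v ∈ B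
      · intro y hy hyu
        by_contra hyB
        have hK : ∀ x, x ∈ insert v K \ B → x ∈ K := fun x hx => by
          rcases hx.1 with rfl | h
          exacts [absurd hvB hx.2, h]
        refine hsmall u {x | x ∈ insert v K \ B ∧ x ≠ u} ⟨⟨y, ⟨hy, hyB⟩, hyu⟩, fun h => h.2 rfl, ?_⟩
          (fun x hx => hK x hx.1) huK
        rintro x ⟨hx, hxu⟩ z hxz hzu
        exact ⟨⟨hadjK x (hK x hx) z hxz, fun hz => hx.2 (hclB z hz x hx.1 hxz.symm hxu)⟩, hzu⟩
      · have hBK' : B ⊆ K := fun x hx => (hBK hx).resolve_left (fun h => hvB (h ▸ hx))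
        exact absurd huK (hsmall u B ⟨hBn, huB, fun x hx y hxy hyu =>
          hclB x hx y (hadjK x (hBK' hx) y hxy) hxy hyu⟩ hBK')

/-- Connected graphs without a cycle of length more than six have escape drawings. -/
theorem exists_isEscapeDrawing_of_connected : ∀ (n : ℕ) {V : Type*} [Finite V] (G : SimpleGraph V),
    Nat.card V = n →
    (∀ A : Set V, A.Nonempty → (∀ x ∈ A, ∀ y, G.Adj x y → y ∈ A) → ∀ y, y ∈ A) →
    CycleListLE G 6 → ∃ p, IsEscapeDrawing G p := by
  intro n
  induction n using Nat.strong_induction_on with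
  | _ n ih =>
  intro V _ G hn hG h6
  rcases subsingleton_or_nontrivial V with hV | hV
  · exact ⟨_, isEscapeDrawing_of_subsingleton⟩
  obtain ⟨a, b, hab⟩ := hV
  -- The complement of any vertex is a lobe, so a smallest one exists.
  have hex : ∃ k, ∃ v K, IsLobe G v K ∧ K.ncard = k :=
    ⟨_, a, {a}ᶜ, ⟨⟨b, hab.symm⟩, by simp, fun x _ y _ hy => hy⟩, rfl⟩
  classical
  obtain ⟨v, K, hK, hcard⟩ := Nat.find_spec hex
  have hmin : ∀ u L, IsLobe G u L → K.ncard ≤ L.ncard := fun u L hL => by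
    rw [hcard]
    exact Nat.find_min' hex ⟨u, L, hL, rfl⟩
  have hbi := hK.isBiconnected hmin hG
  obtain ⟨⟨w, hw⟩, hv, hcl⟩ := hK
  have hd : Drawable (G.induce (insert v K)) := IsBiconnected.drawable _ _ rfl
    ⟨⟨v, Or.inl rfl⟩, ⟨w, Or.inr hw⟩, fun h => hv ((show v = w from congrArg Subtype.val h) ▸ hw)⟩ hbi
    (h6.of_injective Subtype.val_injective fun _ _ h => h)
  obtain ⟨p₂, hp₂, -⟩ := hd ⟨v, Or.inl rfl⟩
  have hlt : Nat.card (Kᶜ : Set V) < n := by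
    rw [← hn]
    exact Finite.card_subtype_lt (p := fun u => u ∈ Kᶜ) (x := w) (by simpa using hw)
  obtain ⟨p₁, hp₁⟩ := ih _ hlt (G.induce Kᶜ) rfl (by
    intro A hA hAcl
    have hclB : ∀ x ∈ Subtype.val '' A, ∀ y, y ∉ K → G.Adj x y → y ∈ Subtype.val '' A := by
      rintro _ ⟨x, hx, rfl⟩ y hy hxy
      exact ⟨⟨y, hy⟩, hAcl x hx ⟨y, hy⟩ hxy, rfl⟩
    have hBK : ∀ x ∈ Subtype.val '' A, x ∉ K := by rintro _ ⟨x, -, rfl⟩; exact x.2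
    have hBn := hA.image Subtype.val
    suffices H : ∀ y, y ∉ K → y ∈ Subtype.val '' A by
      intro y
      obtain ⟨y', hy', he⟩ := H y y.2
      rwa [← show y' = y from Subtype.ext he]
    generalize Subtype.val '' A = B at hclB hBK hBn
    by_cases hvB : v ∈ B
    · intro y hy
      refine (hG (B ∪ K) (hBn.mono subset_union_left) ?_ y).resolve_right hy
      rintro x (hx | hx) z hxz
      · by_cases hz : z ∈ K
        · exact Or.inr hz
        · exact Or.inl (hclB x hx z hz hxz)
      · by_cases hz : z = v
        · exact Or.inl (hz ▸ hvB)
        · exact Or.inr (hcl x hx z hxz hz)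
    · refine absurd (hG B hBn ?_ v) hvB
      intro x hx z hxz
      refine hclB x hx z (fun hz => ?_) hxz
      exact hBK x hx (hcl z hz x hxz.symm (fun h => hvB (h ▸ hx))))
    (h6.of_injective Subtype.val_injective fun _ _ h => h)
  -- The graph without `K` and the block on `insert v K` share only `v`, and no edge joins their
  -- other vertices.
  refine hp₁.exists_glue (v := ⟨v, hv⟩) hp₂.isRootedDrawing (SimpleGraph.Embedding.induce _)
    (SimpleGraph.Embedding.induce _) rfl ?_ ?_ ?_
  · intro x y hxy
    have hxy' : x.1 = y.1 := hxy
    rcases y.2 with h | h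
    · exact Subtype.ext h
    · exact absurd (hxy' ▸ h) x.2
  · intro x
    by_cases hx : x ∈ K
    · exact Or.inr ⟨⟨x, Or.inr hx⟩, rfl⟩
    · exact Or.inl ⟨⟨x, hx⟩, rfl⟩
  · intro x y hx hy hxy
    have hxy' : G.Adj x.1 y.1 := hxy
    have hyK : y.1 ∈ K := y.2.resolve_left (fun h => hy (Subtype.ext h))
    exact x.2 (hcl y.1 hyK x.1 hxy'.symm (fun h => hx (Subtype.ext h)))

/-- Add a new vertex, joined to one vertex of each component. -/
def joinComponents (G : SimpleGraph V) : SimpleGraph (Option V) where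
  Adj
    | some u, some v => G.Adj u v
    | none, some v => (G.connectedComponentMk v).out = v
    | some v, none => (G.connectedComponentMk v).out = v
    | none, none => False
  symm := ⟨fun a b => by cases a <;> cases b <;> simp [G.adj_comm]⟩
  loopless := ⟨fun a => by cases a <;> simp⟩

theorem connectedComponentMk_out (c : G.ConnectedComponent) : G.connectedComponentMk c.out = c :=
  Quot.out_eq c

theorem joinComponents_connected (A : Set (Option V)) (hA : A.Nonempty)
    (hcl : ∀ x ∈ A, ∀ y, (joinComponents G).Adj x y → y ∈ A) (y : Option V) : y ∈ A := by
  have hreach : ∀ u v : V, G.Reachable u v → some u ∈ A → some v ∈ A := by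
    rintro u v ⟨w⟩ hu
    induction w with
    | nil => exact hu
    | cons h _ ih => exact ih (hcl _ hu _ h)
  have hout : ∀ v : V, G.Reachable v (G.connectedComponentMk v).out := fun v =>
    SimpleGraph.ConnectedComponent.exact (connectedComponentMk_out _).symm
  have hidem : ∀ v : V, (G.connectedComponentMk (G.connectedComponentMk v).out).out =
      (G.connectedComponentMk v).out := fun v => by rw [connectedComponentMk_out]
  have hnone : none ∈ A := by
    obtain ⟨_ | v, hx⟩ := hA
    · exact hx
    · exact hcl _ (hreach _ _ (hout v) hx) none (hidem v)
  cases y with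
  | none => exact hnone
  | some v => exact hreach _ _ (hout v).symm (hcl _ hnone _ (hidem v))

theorem reachable_of_isChain : ∀ (l : List V) (a : V), (a :: l).IsChain G.Adj →
    ∀ z ∈ a :: l, G.Reachable a z
  | [], a, _, z, hz => by simp at hz; rw [hz]
  | b :: l, a, h, z, hz => by
    rw [List.isChain_cons_cons] at h
    rcases List.mem_cons.1 hz with rfl | hz
    · exact SimpleGraph.Reachable.refl _
    · exact h.1.reachable.trans (reachable_of_isChain l b h.2 z hz)

theorem exists_map_some : ∀ l : List (Option V), none ∉ l → ∃ m : List V, l = m.map some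
  | [], _ => ⟨[], rfl⟩
  | none :: l, h => absurd (by simp) h
  | some a :: l, h => by
    obtain ⟨m, rfl⟩ := exists_map_some l (fun h' => h (by simp [h']))
    exact ⟨a :: m, rfl⟩

/-- A cycle of length at least three through the new vertex would connect two different neighbours
of it within `G`, but every component contains only one. -/
theorem CycleListLE.joinComponents {k : ℕ} (hk : 2 ≤ k) (h : CycleListLE G k) :
    CycleListLE (joinComponents G) k := by
  intro l hl
  by_cases hn : none ∈ l
  · obtain ⟨s, t, rfl⟩ := List.append_of_mem hn
    have hr : (s ++ none :: t) ~r (none :: (t ++ s)) := by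
      simpa using List.isRotated_append (l := s) (l' := none :: t)
    rw [hr.perm.length_eq]
    replace hl := hl.of_isRotated hr
    clear hr hn
    generalize t ++ s = m at hl ⊢
    obtain ⟨hnd, hch⟩ := isCycleList_cons.1 hl
    obtain ⟨m, rfl⟩ := exists_map_some m (List.nodup_cons.1 hnd).1
    have hnm : m.Nodup := (List.nodup_cons.1 hnd).2.of_map _
    rcases List.eq_nil_or_concat m with rfl | ⟨m', z, rfl⟩
    · simp; omega
    rcases m' with _ | ⟨a, m'⟩
    · simpa using hk
    exfalso
    simp only [List.concat_eq_append, List.cons_append, List.map_cons, List.map_append,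
      List.map_nil, List.isChain_cons_cons, List.append_assoc, List.nil_append] at hch hnm
    rw [← List.cons_append, List.isChain_split] at hch
    obtain ⟨h1, h2, h3⟩ := hch
    have h2' : (a :: (m' ++ [z])).IsChain G.Adj := by
      have : ((a :: (m' ++ [z])).map some).IsChain (_root_.joinComponents G).Adj := by simpa using h2
      rw [List.isChain_map] at this
      exact this
    have hr := reachable_of_isChain _ a h2' z (by simp)
    have h3' : (G.connectedComponentMk z).out = z := by
      simp only [List.isChain_cons_cons] at h3
      exact h3.1
    have h1' : (G.connectedComponentMk a).out = a := h1
    rw [← SimpleGraph.ConnectedComponent.eq.2 hr, h1'] at h3'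
    subst h3'
    simp at hnm
  · obtain ⟨m, rfl⟩ := exists_map_some l hn
    have : IsCycleList G m := by
      refine ⟨hl.1.of_map _, ?_⟩
      have h2 := hl.2
      rw [← Cycle.map_coe, Cycle.chain_map] at h2
      exact h2
    simpa using h m this

/-- A cyclic list with at least three vertices is traversed by a cycle of the same length; shorter
lists are covered by `2 ≤ k`. -/
theorem CycleListLE.of_circumference_le {k : ℕ} (hk : 2 ≤ k) (h : G.circumference ≤ k) :
    CycleListLE G k := by
  intro l hl
  by_contra hlen
  obtain ⟨a, b, c, l, rfl⟩ : ∃ a b c l', l = a :: b :: c :: l' := by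
    rcases l with _ | ⟨a, _ | ⟨b, _ | ⟨c, l⟩⟩⟩
    · simp at hlen
    · simp at hlen; omega
    · simp at hlen; omega
    · exact ⟨a, b, c, l, rfl⟩
  obtain ⟨hnd, hch⟩ := isCycleList_cons.1 hl
  obtain ⟨m, z, hm⟩ : ∃ m z, c :: l = m ++ [z] :=
    ⟨_, _, (List.dropLast_append_getLast (List.cons_ne_nil c l)).symm⟩
  rw [hm] at hl hch hnd hlen
  simp only [List.cons_append, List.append_assoc, List.nil_append] at hch
  have hsplit : (a :: b :: (m ++ z :: [a])) = (a :: b :: m) ++ z :: [a] := by simp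
  rw [hsplit, List.isChain_split] at hch
  obtain ⟨hch1, hza⟩ := hch
  simp only [List.cons_append, List.isChain_cons_cons] at hch1
  have hza : G.Adj z a := by simpa using hza
  obtain ⟨q, hq⟩ : ∃ q : G.Walk b z, q.support = b :: (m ++ [z]) := by
    have hne : b :: (m ++ [z]) ≠ [] := by simp
    have hlast : (b :: (m ++ [z])).getLast hne = z := by simp
    refine ⟨(SimpleGraph.Walk.ofSupport _ hne hch1.2).copy (List.head_cons (h := hne)) hlast, ?_⟩
    rw [SimpleGraph.Walk.support_copy, SimpleGraph.Walk.support_ofSupport]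
  have hcyc : (SimpleGraph.Walk.cons hza (SimpleGraph.Walk.cons hch1.1 q)).IsCycle := by
    rw [SimpleGraph.Walk.cons_isCycle_iff, SimpleGraph.Walk.isPath_def,
      SimpleGraph.Walk.support_cons, hq, SimpleGraph.Walk.edges_cons]
    refine ⟨hnd, ?_⟩
    rw [List.mem_cons, not_or]
    simp only [List.nodup_cons, List.mem_cons, List.mem_append, List.not_mem_nil, not_or] at hnd
    constructor
    · intro h
      rw [Sym2.eq_iff] at h
      rcases h with h | h
      · exact hza.ne h.1
      · tauto
    · intro h
      have := q.snd_mem_support_of_mem_edges h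
      rw [hq] at this
      simp only [List.mem_cons, List.mem_append, List.not_mem_nil] at this
      tauto
  have hle : ((SimpleGraph.Walk.cons hza (SimpleGraph.Walk.cons hch1.1 q)).length : ℕ∞) ≤ k :=
    (le_iSup_of_le (f := fun a => ⨆ (w : G.Walk a a) (_ : w.IsCycle), (w.length : ℕ∞)) z
      (le_iSup_of_le (f := fun w : G.Walk z z => ⨆ _ : w.IsCycle, (w.length : ℕ∞)) _
        (le_iSup_of_le hcyc le_rfl))).trans h
  have hql : q.length + 1 = (b :: (m ++ [z])).length := by
    rw [← hq, SimpleGraph.Walk.length_support]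
  have hle' := Nat.cast_le.1 hle
  simp only [SimpleGraph.Walk.length_cons, List.length_cons] at hle' hql hlen
  omega

/-- Graphs of circumference at most six have escape drawings. -/
theorem exists_isEscapeDrawing [Finite V] (hG : G.circumference ≤ 6) :
    ∃ p, IsEscapeDrawing G p := by
  -- The components are joined by a new vertex without new cycles, and the drawing is restricted to
  -- the old vertices.
  obtain ⟨p, hp⟩ := exists_isEscapeDrawing_of_connected _ (joinComponents G) rfl
    joinComponents_connected
    ((CycleListLE.of_circumference_le (k := 6) (by norm_num) hG).joinComponents (by norm_num))
  exact ⟨_, hp.comp_embedding ⟨⟨some, Option.some_injective V⟩, Iff.rfl⟩⟩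

end

theorem mainTheorem1 {V : Type*} [Finite V] (G : SimpleGraph V) (hG : G.circumference ≤ 6) :
    HasOutsideObstacleRepresentation G := by
  obtain ⟨p, hp⟩ := exists_isEscapeDrawing hG
  exact hp.hasOutsideObstacleRepresentation
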